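/- **Setting.** Let $G\subset \mathrm{GL}_N(\mathbb C)$ be a connected complex reductive group with Lie algebra $\mathfrak g$, embedded (as is always possible) as a Zariski closed subgroup stable under $g\mapsto g^*=\bar g^{t}$, let $K=G\cap U(N)$ be its maximal compact subgroup and $T\subset G$ a maximal torus stable under $g\mapsto g^*$. Let $X$ be a connected smooth projective curve over $\mathbb C$, viewed as a compact Riemann surface, $\boldsymbol D\subset X$ a finite set, $X_{\boldsymbol D}=X\setminus\boldsymbol D$; for $x\in\boldsymbol D$ let $z$ be a local coordinate at $x$, $\theta_x\in\mathrm{Hom}(\mathbb G_m,T)\otimes\mathbb R$ a weight (i.e. $r(\theta_x)\le 1$ for all roots $r$), and $n_x\ge 1$ an integer. Parabolic subgroups $P$ (with Lie algebra $\mathfrak p$) are those containing $T$, i.e. those given by subsets of the roots. A character $\chi$ of $P$ is anti-dominant if $\langle r^\vee,\chi\rangle\le 0$ for every root $r$ of $P$. **Algebraic side.** Sections of the parahoric group scheme $\mathcal G_{\boldsymbol\theta}$ over an open $U\subset X$ are the holomorphic maps $g:U\setminus\boldsymbol D\to G$ such that $z^{\theta_x}gz^{-\theta_x}$ stays in a compact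 subset of $G$ near each $x\in U\cap\boldsymbol D$ (that is, $g\in G_{\theta_x}(\mathbb C(\!(z)\!))$); those of $\mathcal P_{\boldsymbol\theta}$ are the $P$-valued ones. A merohoric $\mathcal G_{\boldsymbol\theta}$-Higgs torsor (resp. connection) is a $\mathcal G_{\boldsymbol\theta}$-torsor $\mathcal E$ on $X$ with a Higgs field (resp. connection) over $X_{\boldsymbol D}$ which, in local sections of $\mathcal E$ at $x\in \boldsymbol D$, is a $\mathfrak g$-valued form $\varphi$ (resp. is $d+A$ with $\varphi:=A$) such that the coefficient of $z^{\theta_x}(z^{n_x}\varphi)z^{-\theta_x}$ is bounded. Given a section $\varsigma$ of $\mathcal E/\mathcal P_{\boldsymbol\theta}$ and a character $\kappa:\mathcal P_{\boldsymbol\theta}\to\mathbb G_m$ with corresponding character $\chi$ of $P$, put $parh\deg\mathcal E(\varsigma,\kappa)=\deg \kappa_*(\mathcal E_\varsigma)+\sum_{x\in \boldsymbol D}\langle\theta_x,\chi\rangle$. The object is $R$-stable (resp. $R$-semistable) if $parh\deg\mathcal E(\varsigma,\kappa)>0$ (resp. $\ge 0$) for all proper parabolics $P$, all $\varsigma$ compatible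 with the Higgs field (resp. connection), i.e. such that it restricts to one on $\mathcal E_\varsigma$ with values in $\mathfrak p$, and all nontrivial anti-dominant $\kappa$ that are trivial on the centre of $\mathcal P_{\boldsymbol\theta}$. **Analytic side.** A metrized $G$-bundle on $X_{\boldsymbol D}$ is a holomorphic principal $G$-bundle $E$ on $X_{\boldsymbol D}$ with a smooth hermitian metric $h$ (a reduction to $K$) that is $\boldsymbol\theta$-adapted: near each $x\in\boldsymbol D$ there is a holomorphic trivialization $e_x$ of $E$ in which $h=|z|^{2\theta_x}e^{c}$ with $c$ valued in $\mathfrak g$ and $\mathrm{Ad}(|z|^{\theta_x})c=o(\ln|z|)$, and the curvature of its Chern connection is in $L^1$ (for the norm $|\cdot|_h$). Fix such $e_x$. A metrized $(\boldsymbol\theta,\boldsymbol n)$-adapted $G$-Higgs bundle (resp. $G$-connection) is such an $(E,h)$ with a Higgs field $\phi$ (resp. holomorphic connection $d+A$, $\phi:=A$) over $X_{\boldsymbol D}$ for which the coefficient of $z^{\theta_x}(z^{n_x}\phi)z^{-\theta_x}$ in the trivialization $e_x$ is bounded near each $x\in\boldsymbol D$. A holomorphic section $\sigma$ of $E/P$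 is $\boldsymbol\theta$-adapted if near each $x\in\boldsymbol D$ it is represented in $e_x$ by a holomorphic $G$-valued map $g$ with $z^{\theta_x}gz^{-\theta_x}$ in a compact subset of $G$. For such $\sigma$ and a character $\chi$ of $P$ put $\deg^{\rm an}E(h,\sigma,\chi)=\frac{\sqrt{-1}}{2\pi}\int_{X_{\boldsymbol D}}\chi_*F_{h_\sigma}$, where $\chi_*F_{h_\sigma}$ is the curvature of the line bundle $\chi_*E_\sigma$ with the metric induced by $h$. The object is $R_h$-stable (resp. $R_h$-semistable) if $\deg^{\rm an}E(h,\sigma,\chi)>0$ (resp. $\ge0$) for all proper parabolics $P$, all compatible $\boldsymbol\theta$-adapted holomorphic reductions $\sigma$, and all nontrivial anti-dominant algebraic characters $\chi$ of $P$ that are trivial on the centre of $P$. **Extension.** $\Xi(E,h)$ is the $\mathcal G_{\boldsymbol\theta}$-torsor obtained by gluing $E$ to the trivial $\mathcal G_{\theta_x}$-torsors on discs around the $x\in\boldsymbol D$ by means of the trivializations $e_x$; the Higgs field (resp. connection) extends to a meromorphic one on it, giving $\Xi_{\rm Higgs}$ (resp. $\Xi_{\rm Conn}$). **Proposition.** A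 metrized $(\boldsymbol\theta,\boldsymbol n)$-adapted $G$-Higgs bundle is $R_h$-stable (resp. $R_h$-semistable) if and only if the corresponding merohoric $\mathcal G_{\boldsymbol\theta}$-Higgs torsor is $R$-stable (resp. $R$-semistable). Similarly, a metrized $(\boldsymbol\theta,\boldsymbol n)$-adapted $G$-connection is $R_h$-stable (resp. $R_h$-semistable) if and only if the corresponding merohoric $\mathcal G_{\boldsymbol\theta}$-connection is $R$-stable (resp. $R$-semistable). -/

import Mathlib

open scoped Manifold ContDiff Topology Matrix
open TopologicalSpace (Opens)

universe u

noncomputable section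

namespace Merohoric

/-! ### Complex reductive groups, tori, weights, parabolic subgroups, characters -/

/-- Complex `n × n` matrices. -/
abbrev Mat (n : ℕ) : Type := Matrix (Fin n) (Fin n) ℂ

/-- Subgroups of `GL_n(ℂ)`. -/
abbrev MatGroup (n : ℕ) : Type := Subgroup (GL (Fin n) ℂ)

section Groups

variable {n : ℕ}

/-- Zariski closed in `GL_n(ℂ)`: cut out by polynomials in the matrix entries. -/
def IsZariskiClosed (H : MatGroup n) : Prop :=
  ∃ I : Set (MvPolynomial (Fin n × Fin n) ℂ), ∀ g : GL (Fin n) ℂ,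
    g ∈ H ↔ ∀ f ∈ I, MvPolynomial.eval (fun ij => (g : Mat n) ij.1 ij.2) f = 0

/-- Stable under conjugate transposition. -/
def IsSelfAdjointGroup (H : MatGroup n) : Prop :=
  ∀ g ∈ H, ∃ g' ∈ H, (g' : Mat n) = (g : Mat n)ᴴ

/-- An algebraic torus: a Zariski closed, connected, (simultaneously) diagonalizable subgroup. -/
def IsTorus (T : MatGroup n) : Prop :=
  IsZariskiClosed T ∧ IsConnected (T : Set (GL (Fin n) ℂ)) ∧
    ∃ S : GL (Fin n) ℂ, ∀ t ∈ T, ((S * t * S⁻¹ : GL (Fin n) ℂ) : Mat n).IsDiag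

/-- A maximal torus of `G`. -/
def IsMaximalTorus (G T : MatGroup n) : Prop :=
  T ≤ G ∧ IsTorus T ∧ ∀ T' : MatGroup n, T' ≤ G → IsTorus T' → T ≤ T' → T' = T

/-- A connected complex reductive group `G` with a maximal torus `T`, realised as the
complexification of its maximal compact subgroup `K = G ∩ U(n)`: `G` is a connected Zariski closed
subgroup of `GL_n(ℂ)` stable under `g ↦ gᴴ`, and so is `T`.  Every connected complex reductive group
with a maximal torus admits such a realisation, and every such group is reductive. -/
structure ReductiveGroup (n : ℕ) where
  G : MatGroup n
  T : MatGroup n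
  zariskiClosed : IsZariskiClosed G
  connected : IsConnected (G : Set (GL (Fin n) ℂ))
  selfAdjoint : IsSelfAdjointGroup G
  maximalTorus : IsMaximalTorus G T
  torus_selfAdjoint : IsSelfAdjointGroup T

/-- The Lie algebra of a complex Lie subgroup `H` of `GL_n(ℂ)`. -/
def lieAlg (H : MatGroup n) : Set (Mat n) :=
  {A | ∀ s : ℂ, ∃ g ∈ H, (g : Mat n) = NormedSpace.exp (s • A)}

/-- The cocharacter lattice `Hom(𝔾_m, T)`; the cocharacter `t ↦ t ^ A = exp (A log t)` is recorded
by its derivative `A` at `1`. -/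
def cochar (T : MatGroup n) : Set (Mat n) :=
  {A | A ∈ lieAlg T ∧ NormedSpace.exp ((2 * Real.pi * Complex.I : ℂ) • A) = 1}

/-- The value of a homomorphism `χ : H → ℂˣ` at a matrix (`0` if the matrix is not in `H`). -/
def charEval {H : MatGroup n} (χ : H →* ℂˣ) (M : Mat n) : ℂ :=
  open Classical in
  if h : ∃ p : H, ((p : GL (Fin n) ℂ) : Mat n) = M then ((χ h.choose : ℂˣ) : ℂ) else 0

/-- The pairing `⟨θ, χ⟩` of a real cocharacter with a character: the derivative of
`s ↦ χ (exp (s θ))` at `0`. -/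
def pairing {H : MatGroup n} (θ : Mat n) (χ : H →* ℂˣ) : ℝ :=
  (deriv (fun s : ℂ => charEval χ (NormedSpace.exp (s • θ))) 0).re

/-- `A` lies in the weight space of the Lie algebra of `G` for the character `r` of `T`. -/
def IsWeightVector (G T : MatGroup n) (r : T →* ℂˣ) (A : Mat n) : Prop :=
  A ∈ lieAlg G ∧ ∀ t : T, ((t : GL (Fin n) ℂ) : Mat n) * A * ((t⁻¹ : T) : GL (Fin n) ℂ)
    = ((r t : ℂˣ) : ℂ) • A

/-- The roots of `G` with respect to `T`. -/
def IsRoot (G T : MatGroup n) (r : T →* ℂˣ) : Prop :=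
  r ≠ 1 ∧ ∃ A, A ≠ 0 ∧ IsWeightVector G T r A

/-- `B` is the coroot of the root `r`: `B = [A, A']` with `A`, `A'` root vectors for `r`, `r⁻¹`
and `r(B) = 2`. -/
def IsCoroot (G T : MatGroup n) (r : T →* ℂˣ) (B : Mat n) : Prop :=
  ∃ A A' : Mat n, A ≠ 0 ∧ IsWeightVector G T r A ∧ IsWeightVector G T r⁻¹ A' ∧
    B = A * A' - A' * A ∧ B * A - A * B = (2 : ℂ) • A

/-- A (real) weight: an element `θ` of `Hom(𝔾_m, T) ⊗ ℝ`, viewed in the Lie algebra of `T`, with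
`r(θ) ≤ 1` for all roots `r`. -/
def IsWeight (R : ReductiveGroup n) (θ : Mat n) : Prop :=
  θ ∈ Submodule.span ℝ (cochar R.T) ∧ ∀ r : R.T →* ℂˣ, IsRoot R.G R.T r → pairing θ r ≤ 1

/-- The parabolic subgroups `P ⊇ T` of `G`: those of the form
`P(l) = {g ∈ G | lim_{t → 0} l(t) g l(t)⁻¹ exists}` for a cocharacter `l(t) = t ^ A` of `T`, i.e.
those generated by `T` and the root groups of all roots `r` with `⟨r, l⟩ ≥ 0`. -/
def IsParabolic (R : ReductiveGroup n) (P : MatGroup n) : Prop :=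
  ∃ A ∈ cochar R.T, ∀ g : GL (Fin n) ℂ, g ∈ P ↔ g ∈ R.G ∧ ∃ M : Mat n,
    Filter.Tendsto (fun t : ℂ => NormedSpace.exp (Complex.log t • A) * (g : Mat n) *
      NormedSpace.exp (-(Complex.log t • A))) (𝓝[≠] 0) (𝓝 M)

/-- Algebraic characters `P → ℂˣ`. -/
def IsAlgChar {P : MatGroup n} (χ : P →* ℂˣ) : Prop :=
  ∃ (f : MvPolynomial (Fin n × Fin n) ℂ) (k : ℕ), ∀ p : P,
    ((χ p : ℂˣ) : ℂ) * ((p : GL (Fin n) ℂ) : Mat n).det ^ k =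
      MvPolynomial.eval (fun ij => ((p : GL (Fin n) ℂ) : Mat n) ij.1 ij.2) f

/-- A character `χ` of `P ⊇ T` is anti-dominant if `⟨r^∨, χ⟩ ≤ 0` for all roots `r` of `P`. -/
def IsAntidominant (R : ReductiveGroup n) {P : MatGroup n} (χ : P →* ℂˣ) : Prop :=
  ∀ (r : R.T →* ℂˣ) (B : Mat n), IsRoot R.G R.T r →
    (∀ A, IsWeightVector R.G R.T r A → A ∈ lieAlg P) → IsCoroot R.G R.T r B → pairing B χ ≤ 0

end Groups

/-! ### Local coordinates, boundedness, forms and integration on a compact Riemann surface -/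

section Surface

variable {X : Type u} [TopologicalSpace X] [ChartedSpace ℂ X] {n : ℕ}

/-- A local coordinate vanishing at `x`. -/
def coord (x y : X) : ℂ := chartAt ℂ x y - chartAt ℂ x x

/-- `z ^ θ = exp (θ log z)`. -/
def zpow (z : ℂ) (θ : Mat n) : Mat n := NormedSpace.exp (Complex.log z • θ)

/-- `z ^ (-θ)`. -/
def zpowNeg (z : ℂ) (θ : Mat n) : Mat n := NormedSpace.exp (-(Complex.log z • θ))

/-- `z ^ θ · M · z ^ (-θ)` near `x`, where `z` is the local coordinate at `x`. -/
def conjZ (x : X) (θ : Mat n) (M : X → Mat n) (y : X) : Mat n :=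
  zpow (coord x y) θ * M y * zpowNeg (coord x y) θ

/-- `M` is bounded on some punctured neighbourhood of `x`. -/
def BddNear (x : X) (M : X → Mat n) : Prop :=
  ∃ C : ℝ, ∀ᶠ y in 𝓝[≠] x, ∀ i j, ‖M y i j‖ ≤ C

/-- The matrix of a group element. -/
def toMat {G : MatGroup n} (g : G) : Mat n := ((g : GL (Fin n) ℂ) : Mat n)

/-- Holomorphy of a `G`-valued map on an open set. -/
def HolOn {G : MatGroup n} (U : Set X) (g : X → G) : Prop :=
  ∀ i j, MDifferentiableOn 𝓘(ℂ) 𝓘(ℂ) (fun y => toMat (g y) i j) U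

/-- `z ^ θ g z ^ (-θ)` is bounded in `G` (i.e. together with its inverse) near the puncture `x`.
For holomorphic `g` this says that `g` is meromorphic at `x` and lies in `G_θ(K)`. -/
def IsParahoricAt {G : MatGroup n} (x : X) (θ : Mat n) (g : X → G) : Prop :=
  BddNear x (conjZ x θ fun y => toMat (g y)) ∧ BddNear x (conjZ x θ fun y => toMat (g y)⁻¹)

/-- Matrix-valued forms of type `(1,0)`. -/
abbrev Form10 (X : Type u) [TopologicalSpace X] [ChartedSpace ℂ X] (n : ℕ) : Type u :=
  ∀ y : X, TangentSpace 𝓘(ℂ) y →ₗ[ℂ] Mat n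

/-- The coefficient `f` of a form `f dz` at `y`, where `z` is the chart at `a`. -/
def Form10.coeff (w : Form10 X n) (a y : X) : Mat n :=
  w y (mfderiv 𝓘(ℂ) 𝓘(ℂ) (chartAt ℂ a).symm (chartAt ℂ a y) (1 : ℂ) : ℂ)

/-- Holomorphy of a matrix-valued `1`-form on an open set. -/
def Form10.HolOn (U : Set X) (w : Form10 X n) : Prop :=
  ∀ (a : X) (i j), MDifferentiableOn 𝓘(ℂ) 𝓘(ℂ) (fun y => w.coeff a y i j)
    (U ∩ (chartAt ℂ a).source)

/-- `z ^ θ (z ^ k w) z ^ (-θ)` is bounded near `x`, i.e. `w ∈ 𝔤_θ(K) dz / z ^ k`. -/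
def Form10.HasPoleAt (x : X) (θ : Mat n) (k : ℕ) (w : Form10 X n) : Prop :=
  BddNear x (conjZ x θ fun y => coord x y ^ k • w.coeff x y)

/-- `g⁻¹ dg`. -/
def logDiff {G : MatGroup n} (g : X → G) (y : X) (v : TangentSpace 𝓘(ℂ) y) : Mat n :=
  toMat (g y)⁻¹ * Matrix.of fun i j =>
    (mfderiv 𝓘(ℂ) 𝓘(ℂ) (fun w => toMat (g w) i j) y v : ℂ)

/-- The Wirtinger derivative `∂f/∂z`. -/
def dZ (f : ℂ → ℂ) (z : ℂ) : ℂ := (fderiv ℝ f z 1 - Complex.I * fderiv ℝ f z Complex.I) / 2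

/-- The Wirtinger derivative `∂f/∂z̄`. -/
def dZbar (f : ℂ → ℂ) (z : ℂ) : ℂ := (fderiv ℝ f z 1 + Complex.I * fderiv ℝ f z Complex.I) / 2

theorem exists_finite_atlas (X : Type u) [TopologicalSpace X] [ChartedSpace ℂ X] [CompactSpace X]
    [Nonempty X] : ∃ (N : ℕ) (a : ℕ → X), ∀ y : X, ∃ k < N, y ∈ (chartAt ℂ (a k)).source := by
  obtain ⟨t, ht⟩ := isCompact_univ.elim_finite_subcover
    (fun x : X => (chartAt ℂ x).source) (fun x => (chartAt ℂ x).open_source)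
    (fun x _ => Set.mem_iUnion.2 ⟨x, mem_chart_source ℂ x⟩)
  refine ⟨t.toList.length, fun k => t.toList.getD k (Classical.arbitrary X), fun y => ?_⟩
  obtain ⟨x, hx, hy⟩ := Set.mem_iUnion₂.1 (ht (Set.mem_univ y))
  obtain ⟨k, hk, rfl⟩ := List.mem_iff_getElem.1 (Finset.mem_toList.2 hx)
  refine ⟨k, hk, ?_⟩
  show y ∈ (chartAt ℂ (t.toList.getD k (Classical.arbitrary X))).source
  rwa [List.getD_eq_getElem _ _ hk]

variable (X) in
/-- The number of charts of a finite atlas. -/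
def atlasSize [CompactSpace X] [Nonempty X] : ℕ := (exists_finite_atlas X).choose

variable (X) in
/-- The centres of the charts of a finite atlas. -/
def atlasPt [CompactSpace X] [Nonempty X] : ℕ → X := (exists_finite_atlas X).choose_spec.choose

variable (X) in
/-- The `k`-th chart domain minus the previous ones, in the `k`-th coordinate; for
`k < atlasSize X` these pieces form a partition of `X`. -/
def piece [CompactSpace X] [Nonempty X] (k : ℕ) : Set ℂ :=
  {z | z ∈ (chartAt ℂ (atlasPt X k)).target ∧
    ∀ l < k, (chartAt ℂ (atlasPt X k)).symm z ∉ (chartAt ℂ (atlasPt X l)).source}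

/-- The integral over `X` of a `(1,1)`-form, given by its coefficients `f a y` with respect to
`dz̄ ∧ dz = 2i dx ∧ dy`, where `z` is the chart at `a`. -/
def integral11 [CompactSpace X] [Nonempty X] (f : X → X → ℂ) : ℂ :=
  ∑ k ∈ Finset.range (atlasSize X),
    ∫ z in piece X k, 2 * Complex.I * f (atlasPt X k) ((chartAt ℂ (atlasPt X k)).symm z)

/-- Integrability over `X` of a density, given by its coefficients `f a y` with respect to
`dx dy`, where `z = x + iy` is the chart at `a`. -/
def DensityIntegrable [CompactSpace X] [Nonempty X] (f : X → X → ℝ) : Prop :=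
  ∀ k < atlasSize X, MeasureTheory.IntegrableOn
    (fun z => f (atlasPt X k) ((chartAt ℂ (atlasPt X k)).symm z)) (piece X k)

/-! ### Line bundles and their degree -/

/-- The curvature `∂̄∂ log m` of the hermitian line bundle whose frames over `U i` have squared
norms `m i`, as a coefficient of `dz̄ ∧ dz`; it is `0` off the union of the `U i`. -/
def chernCoeff {ι : Type u} (U : ι → Opens X) (m : ι → X → ℝ) (a y : X) : ℂ :=
  open Classical in
  if h : ∃ i, y ∈ U i then
    dZbar (dZ fun w => (Real.log (m h.choose ((chartAt ℂ a).symm w)) : ℂ)) (chartAt ℂ a y)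
  else 0

/-- `(i / 2π) ∫ F`, for the curvature form `F` of a hermitian line bundle as in `chernCoeff`. -/
def chernDegree [CompactSpace X] [Nonempty X] {ι : Type u} (U : ι → Opens X) (m : ι → X → ℝ) : ℝ :=
  (Complex.I / (2 * Real.pi) * integral11 (chernCoeff U m)).re

/-- Holomorphic line bundles on `X`, given by transition functions: `e_j = e_i g_ij` for frames
`e_i` over `U i`. -/
structure LineBundle (X : Type u) [TopologicalSpace X] [ChartedSpace ℂ X] where
  ι : Type u
  U : ι → Opens X
  cover : ∀ y, ∃ i, y ∈ U i
  g : ι → ι → X → ℂ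
  hol : ∀ i j, MDifferentiableOn 𝓘(ℂ) 𝓘(ℂ) (g i j) (U i ∩ U j : Set X)
  ne_zero : ∀ i j, ∀ y, y ∈ U i → y ∈ U j → g i j y ≠ 0
  cocycle : ∀ i j k, ∀ y, y ∈ U i → y ∈ U j → y ∈ U k → g i j y * g j k y = g i k y

/-- Smooth hermitian metrics on a line bundle; `m i` is the squared norm of the frame over `U i`. -/
def LineBundle.IsSmoothMetric (L : LineBundle X) (m : L.ι → X → ℝ) : Prop :=
  (∀ i, ContMDiffOn 𝓘(ℝ, ℂ) 𝓘(ℝ) ∞ (m i) (L.U i)) ∧ (∀ i, ∀ y ∈ L.U i, 0 < m i y) ∧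
    ∀ i j, ∀ y, y ∈ L.U i → y ∈ L.U j → m j y = ‖L.g i j y‖ ^ 2 * m i y

/-- The degree of a holomorphic line bundle on a compact Riemann surface: `(i / 2π) ∫_X F` for the
curvature `F` of any smooth hermitian metric. -/
def LineBundle.deg [CompactSpace X] [Nonempty X] (L : LineBundle X) : ℝ :=
  open Classical in
  if h : ∃ m, L.IsSmoothMetric m then chernDegree L.U h.choose else 0

end Surface

/-! ### Elementary facts on boundedness -/

section Bounded

set_option linter.unusedSectionVars false

variable {X : Type u} [TopologicalSpace X] [ChartedSpace ℂ X] {n : ℕ}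

theorem BddNear.mul {x : X} {M N : X → Mat n} (hM : BddNear x M) (hN : BddNear x N) :
    BddNear x fun y => M y * N y := by
  obtain ⟨C, hC⟩ := hM
  obtain ⟨C', hC'⟩ := hN
  refine ⟨∑ _k : Fin n, |C| * |C'|, ?_⟩
  filter_upwards [hC, hC'] with y h1 h2 i j
  rw [Matrix.mul_apply]
  refine (norm_sum_le _ _).trans (Finset.sum_le_sum fun k _ => ?_)
  rw [norm_mul]
  exact mul_le_mul ((h1 i k).trans (le_abs_self C)) ((h2 k j).trans (le_abs_self C'))
    (norm_nonneg _) (abs_nonneg _)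

theorem BddNear.congr {x : X} {M N : X → Mat n} (hM : BddNear x M)
    (h : ∀ᶠ y in 𝓝[≠] x, M y = N y) : BddNear x N := by
  obtain ⟨C, hC⟩ := hM
  refine ⟨C, ?_⟩
  filter_upwards [hC, h] with y h1 h2
  rwa [← h2]

theorem zpowNeg_mul_zpow (z : ℂ) (θ : Mat n) : zpowNeg z θ * zpow z θ = 1 := by
  unfold zpowNeg zpow
  rw [Matrix.exp_neg]
  exact Matrix.nonsing_inv_mul _ ((Matrix.isUnit_iff_isUnit_det _).1 (Matrix.isUnit_exp _))

theorem zpow_mul_zpowNeg (z : ℂ) (θ : Mat n) : zpow z θ * zpowNeg z θ = 1 :=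
  mul_eq_one_comm.1 (zpowNeg_mul_zpow z θ)

theorem conjZ_mul (x : X) (θ : Mat n) (M N : X → Mat n) :
    (conjZ x θ fun y => M y * N y) = fun y => conjZ x θ M y * conjZ x θ N y := by
  funext y
  unfold conjZ
  calc _ = zpow (coord x y) θ * M y * 1 * N y * zpowNeg (coord x y) θ := by
        simp only [mul_one, mul_assoc]
    _ = _ := by rw [← zpowNeg_mul_zpow (coord x y) θ]; simp only [mul_assoc]

theorem IsParahoricAt.mul {G : MatGroup n} {x : X} {θ : Mat n} {g g' : X → G}
    (hg : IsParahoricAt x θ g) (hg' : IsParahoricAt x θ g') :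
    IsParahoricAt x θ fun y => g y * g' y := by
  constructor
  · have h := hg.1.mul hg'.1
    rw [← conjZ_mul] at h
    exact h
  · have h := hg'.2.mul hg.2
    rw [← conjZ_mul] at h
    refine h.congr (Filter.Eventually.of_forall fun y => ?_)
    simp [conjZ, toMat]

theorem IsParahoricAt.inv {G : MatGroup n} {x : X} {θ : Mat n} {g : X → G}
    (hg : IsParahoricAt x θ g) : IsParahoricAt x θ fun y => (g y)⁻¹ := by
  refine ⟨hg.2, hg.1.congr (Filter.Eventually.of_forall fun y => ?_)⟩
  simp [conjZ]

theorem IsParahoricAt.one {G : MatGroup n} (x : X) (θ : Mat n) :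
    IsParahoricAt x θ fun _ => (1 : G) := by
  have h : BddNear x fun _ : X => (1 : Mat n) :=
    ⟨1, Filter.Eventually.of_forall fun y i j => by
      show ‖(1 : Mat n) i j‖ ≤ 1
      rw [Matrix.one_apply]; split_ifs <;> simp⟩
  constructor <;>
  · refine h.congr (Filter.Eventually.of_forall fun y => ?_)
    simp [conjZ, toMat, zpow_mul_zpowNeg]

theorem IsParahoricAt.congr {G : MatGroup n} {x : X} {θ : Mat n} {g g' : X → G}
    (hg : IsParahoricAt x θ g) (h : ∀ᶠ y in 𝓝[≠] x, g y = g' y) : IsParahoricAt x θ g' := by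
  constructor
  · refine hg.1.congr ?_
    filter_upwards [h] with y hy
    simp [conjZ, hy]
  · refine hg.2.congr ?_
    filter_upwards [h] with y hy
    simp [conjZ, hy]

end Bounded

/-! ### The initial data, torsors and reductions -/

section Torsors

set_option linter.unusedSectionVars false

variable {X : Type u} [TopologicalSpace X] [ChartedSpace ℂ X] {n : ℕ}

variable (X n) in
/-- A connected complex reductive group `G ⊇ T`, a finite set `D` of punctures, and at each puncture
a weight `θ` and a positive integer `ord`. -/
structure Setup where
  R : ReductiveGroup n
  D : Finset X
  θ : X → Mat n
  isWeight : ∀ x ∈ D, IsWeight R (θ x)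
  ord : X → ℕ
  ord_pos : ∀ x ∈ D, 0 < ord x

/-- The group `G`. -/
abbrev Setup.G (S : Setup X n) : MatGroup n := S.R.G

/-- The punctured surface `X_D = X \ D`. -/
def Setup.punctured [T2Space X] (S : Setup X n) : Opens X :=
  ⟨(S.D : Set X)ᶜ, S.D.finite_toSet.isClosed.isOpen_compl⟩

/-- The sheaf of holomorphic `G`-valued maps on `X_D`. -/
def Setup.holSheaf (S : Setup X n) (U : Opens X) : Set (X → S.G) := {g | HolOn (U : Set X) g}

/-- The sheaf of sections of the parahoric group scheme `𝒢_θ`: holomorphic `G`-valued maps off `D`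
that lie in `G_θ(K)` at the points of `D`. (Values at points of `D` are immaterial.) -/
def Setup.parahoricSheaf (S : Setup X n) (U : Opens X) : Set (X → S.G) :=
  {g | HolOn ((U : Set X) \ S.D) g ∧ ∀ x ∈ S.D, x ∈ U → IsParahoricAt x (S.θ x) g}

/-- Torsors over the open set `W` under a sheaf `𝒢` of groups of `G`-valued maps: a right `G`-torsor
`Fib y` for each point, with a sheaf of sections, which exist locally on `W` and any two of which
differ by a section of `𝒢`.  (`ratio e e'` is the unique `g` with `e g = e'`.) -/
structure GTorsor (G : MatGroup n) (W : Opens X) (𝒢 : Opens X → Set (X → G)) where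
  Fib : X → Type u
  act : ∀ {y : X}, Fib y → G → Fib y
  ratio : ∀ {y : X}, Fib y → Fib y → G
  act_one : ∀ {y : X} (e : Fib y), act e 1 = e
  act_act : ∀ {y : X} (e : Fib y) (g g' : G), act (act e g) g' = act e (g * g')
  act_ratio : ∀ {y : X} (e e' : Fib y), act e (ratio e e') = e'
  ratio_act : ∀ {y : X} (e : Fib y) (g : G), ratio e (act e g) = g
  IsSection : Opens X → (∀ y, Fib y) → Prop
  le : ∀ {U s}, IsSection U s → U ≤ W
  mono : ∀ {U V s}, IsSection U s → V ≤ U → IsSection V s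
  glue : ∀ {U s}, (∀ y ∈ U, ∃ V, y ∈ V ∧ IsSection V s) → IsSection U s
  change : ∀ {U s}, IsSection U s →
    ∀ t, IsSection U t ↔ (fun y => ratio (s y) (t y)) ∈ 𝒢 U
  exists_section : ∀ y ∈ W, ∃ U s, y ∈ U ∧ IsSection U s

variable {G : MatGroup n} {W : Opens X} {𝒢 : Opens X → Set (X → G)}

theorem GTorsor.ratio_mul_ratio (E : GTorsor G W 𝒢) {y : X} (e e' e'' : E.Fib y) :
    E.ratio e e' * E.ratio e' e'' = E.ratio e e'' := by
  rw [← E.ratio_act e (E.ratio e e' * E.ratio e' e''), ← E.act_act, E.act_ratio, E.act_ratio]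

theorem GTorsor.ratio_self (E : GTorsor G W 𝒢) {y : X} (e : E.Fib y) : E.ratio e e = 1 := by
  have h := E.ratio_mul_ratio e e e
  simpa using h

theorem GTorsor.ratio_inv (E : GTorsor G W 𝒢) {y : X} (e e' : E.Fib y) :
    (E.ratio e e')⁻¹ = E.ratio e' e := by
  rw [inv_eq_iff_mul_eq_one, E.ratio_mul_ratio, E.ratio_self]

/-- Holomorphic principal `G`-bundles on `X_D`. -/
abbrev HolBundle [T2Space X] (S : Setup X n) : Type (u + 1) :=
  GTorsor S.G S.punctured S.holSheaf

/-- Parahoric `𝒢_θ`-torsors on `X`. -/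
abbrev ParahoricTorsor (S : Setup X n) : Type (u + 1) :=
  GTorsor S.G ⊤ S.parahoricSheaf

/-- A reduction of structure group of a torsor over `W`, i.e. a holomorphic section of `E / P`:
a `P`-orbit in each fibre (off the finite set `D`) that locally on `W` contains sections of the
torsor.  For a bundle on `X_D` this is a holomorphic section of `E / P` over `X_D`; for a
`𝒢_θ`-torsor it is a section over `X` of its quotient by `𝒫_θ`. -/
structure Reduction (E : GTorsor G W 𝒢) (D : Finset X) (P : MatGroup n) where
  carrier : ∀ y, Set (E.Fib y)
  orbit : ∀ y, y ∉ D → ∀ e ∈ carrier y, ∀ e',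
    e' ∈ carrier y ↔ (E.ratio e e' : GL (Fin n) ℂ) ∈ P
  exists_section : ∀ y ∈ W, ∃ U s, y ∈ U ∧ E.IsSection U s ∧ ∀ v ∈ U, v ∉ D → s v ∈ carrier v

/-- The local sections of the reduced `P`-bundle (resp. `𝒫_θ`-torsor). -/
def Reduction.Sec {E : GTorsor G W 𝒢} {D : Finset X} {P : MatGroup n} (σ : Reduction E D P) :
    Type u :=
  {us : Opens X × (∀ y, E.Fib y) //
    E.IsSection us.1 us.2 ∧ ∀ v ∈ us.1, v ∉ D → us.2 v ∈ σ.carrier v}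

/-! ### Higgs fields and connections -/

/-- A holomorphic section of `E(𝔤) ⊗ K` over `W \ D`, as an equivariant function on `E`. -/
structure HiggsField (E : GTorsor G W 𝒢) (D : Finset X) where
  val : ∀ y, E.Fib y → (TangentSpace 𝓘(ℂ) y →ₗ[ℂ] Mat n)
  mem_lieAlg : ∀ y, y ∉ D → ∀ e v, val y e v ∈ lieAlg G
  equivariant : ∀ y, y ∉ D → ∀ e (g : G) v,
    val y (E.act e g) v = toMat g⁻¹ * val y e v * toMat g
  hol : ∀ U s, E.IsSection U s → Form10.HolOn ((U : Set X) \ D) fun y => val y (s y)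

/-- A reduction `σ` to `P` is compatible with a Higgs field `φ` if `φ` induces a section of
`E_σ(𝔭) ⊗ K`. -/
def HiggsField.Compatible {E : GTorsor G W 𝒢} {D : Finset X} (φ : HiggsField E D) {P : MatGroup n}
    (σ : Reduction E D P) : Prop :=
  ∀ y, y ∉ D → ∀ e ∈ σ.carrier y, ∀ v, φ.val y e v ∈ lieAlg P

/-- A holomorphic connection over `W \ D`: `form s` is the connection form `A_s` of the
connection `d + A_s` in the local trivialization given by the section `s`. -/
structure Connection (E : GTorsor G W 𝒢) (D : Finset X) where
  form : (∀ y, E.Fib y) → Form10 X n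
  mem_lieAlg : ∀ U s, E.IsSection U s → ∀ y ∈ U, y ∉ D → ∀ v, form s y v ∈ lieAlg G
  hol : ∀ U s, E.IsSection U s → Form10.HolOn ((U : Set X) \ D) (form s)
  gauge : ∀ U s (g : X → G), E.IsSection U s → E.IsSection U (fun y => E.act (s y) (g y)) →
    ∀ y ∈ U, y ∉ D → ∀ v, form (fun y => E.act (s y) (g y)) y v =
      toMat (g y)⁻¹ * form s y v * toMat (g y) + logDiff g y v

/-- A reduction `σ` to `P` is compatible with a connection if the connection restricts to a
connection on `E_σ`. -/
def Connection.Compatible {E : GTorsor G W 𝒢} {D : Finset X} (A : Connection E D) {P : MatGroup n}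
    (σ : Reduction E D P) : Prop :=
  ∀ us : σ.Sec, ∀ y ∈ us.1.1, y ∉ D → ∀ v, A.form us.1.2 y v ∈ lieAlg P

end Torsors

/-! ### The algebraic side -/

section Algebraic

set_option linter.unusedSectionVars false

variable {X : Type u} [TopologicalSpace X] [ChartedSpace ℂ X] {n : ℕ}

/-- The sheaf of sections of `𝒫_θ`: the `P`-valued sections of `𝒢_θ`. -/
def Setup.parabolicSheaf (S : Setup X n) (P : MatGroup n) (U : Opens X) : Set (X → P) :=
  {p | ∃ g ∈ S.parahoricSheaf U, ∀ y ∈ U, y ∉ S.D → (g y : GL (Fin n) ℂ) = p y}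

/-- A character `κ : 𝒫_θ → 𝔾_m`, a morphism of group schemes over `X`: algebraic characters of the
fibres `P` of `𝒫_θ` over `X_D` that map each section of `𝒫_θ` over `U` to a nowhere vanishing
holomorphic function on `U`. -/
structure ParahoricChar (S : Setup X n) (P : MatGroup n) where
  val : X → (P →* ℂˣ)
  algebraic : ∀ y, y ∉ S.D → IsAlgChar (val y)
  regular : ∀ (U : Opens X) (p : X → P), p ∈ S.parabolicSheaf P U →
    ∃ f : X → ℂ, MDifferentiableOn 𝓘(ℂ) 𝓘(ℂ) f U ∧ (∀ y ∈ U, f y ≠ 0) ∧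
      ∀ y ∈ U, y ∉ S.D → f y = ((val y (p y) : ℂˣ) : ℂ)

/-- `χ` is the character of `P` corresponding to `κ`. -/
def ParahoricChar.Corresponds {S : Setup X n} {P : MatGroup n} (κ : ParahoricChar S P)
    (χ : P →* ℂˣ) : Prop :=
  ∀ y, y ∉ S.D → κ.val y = χ

/-- The `P`-valued transition function between two sections of a reduction. -/
def Reduction.transition {G : MatGroup n} {W : Opens X} {𝒢 : Opens X → Set (X → G)}
    {E : GTorsor G W 𝒢} {D : Finset X} {P : MatGroup n} (σ : Reduction E D P)
    (s t : σ.Sec) (y : X) : P :=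
  open Classical in
  if h : (E.ratio (s.1.2 y) (t.1.2 y) : GL (Fin n) ℂ) ∈ P then ⟨_, h⟩ else 1

theorem Reduction.transition_coe {G : MatGroup n} {W : Opens X} {𝒢 : Opens X → Set (X → G)}
    {E : GTorsor G W 𝒢} {D : Finset X} {P : MatGroup n} (σ : Reduction E D P)
    (s t : σ.Sec) {y : X} (hs : y ∈ s.1.1) (ht : y ∈ t.1.1) (hy : y ∉ D) :
    (σ.transition s t y : GL (Fin n) ℂ) = E.ratio (s.1.2 y) (t.1.2 y) := by
  have h := (σ.orbit y hy _ (s.2.2 y hs hy) _).1 (t.2.2 y ht hy)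
  simp [Reduction.transition, h]

theorem Reduction.transition_mem {S : Setup X n} {E : ParahoricTorsor S} {P : MatGroup n}
    (σ : Reduction E S.D P) (s t : σ.Sec) :
    σ.transition s t ∈ S.parabolicSheaf P (s.1.1 ⊓ t.1.1) := by
  refine ⟨_, (E.change (E.mono s.2.1 inf_le_left) t.1.2).1 (E.mono t.2.1 inf_le_right), ?_⟩
  intro y hy hD
  exact (σ.transition_coe s t hy.1 hy.2 hD).symm

/-- Points of `X` are not isolated, even after removal of a finite set. -/
theorem neBot_compl_finset [T2Space X] (D : Finset X) (x : X) :
    (𝓝[((D : Set X)ᶜ)] x).NeBot := by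
  have key : ∀ y : X, (𝓝[≠] y).NeBot := by
    intro y
    by_contra hy
    rw [Filter.not_neBot, ← isOpen_singleton_iff_punctured_nhds] at hy
    have h := (chartAt ℂ y).isOpen_image_of_subset_source hy
      (Set.singleton_subset_iff.2 (mem_chart_source ℂ y))
    rw [Set.image_singleton, isOpen_singleton_iff_punctured_nhds] at h
    exact (inferInstance : (𝓝[≠] (chartAt ℂ y y)).NeBot).ne h
  have hd : Dense ((D : Set X)ᶜ) := by
    have h := (dense_univ (X := X)).sdiff_finset D
    rwa [← Set.compl_eq_univ_sdiff] at h
  exact mem_closure_iff_nhdsWithin_neBot.1 (hd x)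

/-- The transition functions of `L(ς, κ)`. -/
def ParahoricChar.transition {S : Setup X n} {P : MatGroup n} (κ : ParahoricChar S P)
    {E : ParahoricTorsor S} (σ : Reduction E S.D P) (s t : σ.Sec) : X → ℂ :=
  (κ.regular _ _ (σ.transition_mem s t)).choose

/-- The line bundle `L(ς, κ) = κ_* (E_ς)` on `X`. -/
def ParahoricChar.lineBundle [T2Space X] {S : Setup X n} {P : MatGroup n} (κ : ParahoricChar S P)
    {E : ParahoricTorsor S} (σ : Reduction E S.D P) : LineBundle X where
  ι := σ.Sec
  U s := s.1.1
  cover y := by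
    obtain ⟨U, s, hy, hs, h⟩ := σ.exists_section y trivial
    exact ⟨⟨(U, s), hs, h⟩, hy⟩
  g := κ.transition σ
  hol s t := (κ.regular _ _ (σ.transition_mem s t)).choose_spec.1
  ne_zero s t y hs ht := (κ.regular _ _ (σ.transition_mem s t)).choose_spec.2.1 y ⟨hs, ht⟩
  cocycle r s t y hr hs ht := by
    have hcont : ∀ a b : σ.Sec, y ∈ a.1.1 → y ∈ b.1.1 → Filter.Tendsto (κ.transition σ a b)
        (𝓝[((S.D : Set X)ᶜ)] y) (𝓝 (κ.transition σ a b y)) := fun a b ha hb =>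
      ((((κ.regular _ _ (σ.transition_mem a b)).choose_spec.1).continuousOn.continuousAt
        ((a.1.1 ⊓ b.1.1).isOpen.mem_nhds ⟨ha, hb⟩)).tendsto).mono_left nhdsWithin_le_nhds
    have hval : ∀ a b : σ.Sec, ∀ v, v ∈ a.1.1 → v ∈ b.1.1 → v ∉ S.D →
        κ.transition σ a b v = ((κ.val v (σ.transition a b v) : ℂˣ) : ℂ) := fun a b v ha hb hv =>
      (κ.regular _ _ (σ.transition_mem a b)).choose_spec.2.2 v ⟨ha, hb⟩ hv
    have := neBot_compl_finset S.D y
    refine tendsto_nhds_unique_of_eventuallyEq ((hcont r s hr hs).mul (hcont s t hs ht))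
      (hcont r t hr ht) ?_
    have hO : ((r.1.1 ⊓ s.1.1 ⊓ t.1.1 : Opens X) : Set X) ∈ 𝓝[((S.D : Set X)ᶜ)] y :=
      nhdsWithin_le_nhds ((r.1.1 ⊓ s.1.1 ⊓ t.1.1).isOpen.mem_nhds ⟨⟨hr, hs⟩, ht⟩)
    filter_upwards [hO, self_mem_nhdsWithin] with v hv hvD
    obtain ⟨⟨h1, h2⟩, h3⟩ := hv
    have hvD' : v ∉ S.D := hvD
    rw [hval r s v h1 h2 hvD', hval s t v h2 h3 hvD', hval r t v h1 h3 hvD', ← Units.val_mul,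
      ← map_mul]
    congr 3
    apply Subtype.ext
    rw [Subgroup.coe_mul, σ.transition_coe r s h1 h2 hvD', σ.transition_coe s t h2 h3 hvD',
      σ.transition_coe r t h1 h3 hvD', ← Subgroup.coe_mul, E.ratio_mul_ratio]

/-- The parahoric degree `deg L(ς, κ) + ⟨θ, κ⟩`, where `⟨θ, κ⟩ = ⟨θ, χ⟩` for the character `χ` of
`P` corresponding to `κ`. -/
def parhDeg [T2Space X] [CompactSpace X] [Nonempty X] {S : Setup X n} {P : MatGroup n}
    {E : ParahoricTorsor S} (σ : Reduction E S.D P) (κ : ParahoricChar S P) (χ : P →* ℂˣ) : ℝ :=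
  (κ.lineBundle σ).deg + ∑ x ∈ S.D, pairing (S.θ x) χ

/-- Merohoric `𝒢_θ`-Higgs torsors: the Higgs field is a section of `E(𝔤) ⊗ K(ord D)`, i.e. in
local sections of the torsor at `x ∈ D` it lies in `𝔤_θ(K) dz / z ^ ord`. -/
structure MerohoricHiggs (S : Setup X n) where
  E : ParahoricTorsor S
  φ : HiggsField E S.D
  pole : ∀ U s, E.IsSection U s → ∀ x ∈ S.D, x ∈ U →
    Form10.HasPoleAt x (S.θ x) (S.ord x) fun y => φ.val y (s y)

/-- Merohoric `𝒢_θ`-connections: at each `x ∈ D` the connection is `d + A` with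
`A ∈ 𝔤_θ(K) dz / z ^ ord` in some (equivalently, since `ord ≥ 1`, in every) local section of the
torsor. -/
structure MerohoricConnection (S : Setup X n) where
  V : ParahoricTorsor S
  A : Connection V S.D
  pole : ∀ x ∈ S.D, ∃ U s, x ∈ U ∧ V.IsSection U s ∧
    Form10.HasPoleAt x (S.θ x) (S.ord x) (A.form s)

variable [T2Space X] [CompactSpace X] [Nonempty X]

/-- The stability inequality `rel (parhdeg E(ς, κ))` for all proper parabolic `P`, all reductions
`ς` satisfying `compat`, and all nontrivial anti-dominant characters `κ` of `𝒫_θ` that are trivial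
on the centre of `𝒫_θ`; here `χ` is the character of `P` corresponding to `κ`. -/
def AlgStability {S : Setup X n} (E : ParahoricTorsor S)
    (compat : ∀ P : MatGroup n, Reduction E S.D P → Prop) (rel : ℝ → Prop) : Prop :=
  ∀ P : MatGroup n, IsParabolic S.R P → P ≠ S.G →
    ∀ σ : Reduction E S.D P, compat P σ →
      ∀ (κ : ParahoricChar S P) (χ : P →* ℂˣ), κ.Corresponds χ →
        (∃ y, y ∉ S.D ∧ κ.val y ≠ 1) → IsAntidominant S.R χ →
          (∀ y, y ∉ S.D → ∀ c ∈ Subgroup.center P, κ.val y c = 1) → rel (parhDeg σ κ χ)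

/-- `R`-stability of a merohoric Higgs torsor. -/
def MerohoricHiggs.RStable {S : Setup X n} (F : MerohoricHiggs S) : Prop :=
  AlgStability F.E (fun _ σ => F.φ.Compatible σ) fun d => 0 < d

/-- `R`-semistability of a merohoric Higgs torsor. -/
def MerohoricHiggs.RSemistable {S : Setup X n} (F : MerohoricHiggs S) : Prop :=
  AlgStability F.E (fun _ σ => F.φ.Compatible σ) fun d => 0 ≤ d

/-- `R`-stability of a merohoric connection. -/
def MerohoricConnection.RStable {S : Setup X n} (F : MerohoricConnection S) : Prop :=
  AlgStability F.V (fun _ σ => F.A.Compatible σ) fun d => 0 < d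

/-- `R`-semistability of a merohoric connection. -/
def MerohoricConnection.RSemistable {S : Setup X n} (F : MerohoricConnection S) : Prop :=
  AlgStability F.V (fun _ σ => F.A.Compatible σ) fun d => 0 ≤ d

end Algebraic

/-! ### The analytic side -/

section Analytic

set_option linter.unusedSectionVars false

variable {X : Type u} [TopologicalSpace X] [ChartedSpace ℂ X] {n : ℕ}

/-- The curvature `∂̄ (H⁻¹ ∂H)` of the Chern connection of a hermitian metric `H` (in a holomorphic
frame), as a coefficient of `dz̄ ∧ dz`. -/
def curvature (H : ℂ → Mat n) (z : ℂ) : Mat n :=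
  Matrix.of fun i j => dZbar
    (fun w => ((H w)⁻¹ * Matrix.of fun k l => dZ (fun v => H v k l) w) i j) z

/-- The pointwise norm `|F|_h = (tr F F^*)^(1/2)` of the curvature coefficient in the chart at `a`,
where `F^* = H⁻¹ Fᴴ H` is the adjoint with respect to the metric. It is computed in any local
holomorphic section at `y`. -/
def curvNorm {G : MatGroup n} {W : Opens X} {𝒢 : Opens X → Set (X → G)} (E : GTorsor G W 𝒢)
    (h : ∀ y, E.Fib y → Mat n) (a y : X) : ℝ :=
  open Classical in
  if hs : ∃ us : Opens X × (∀ y, E.Fib y), y ∈ us.1 ∧ E.IsSection us.1 us.2 then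
    let H : ℂ → Mat n := fun w => h _ (hs.choose.2 ((chartAt ℂ a).symm w))
    let z := chartAt ℂ a y
    let F := curvature H z
    Real.sqrt (F * ((H z)⁻¹ * Fᴴ * H z)).trace.re
  else 0

variable [T2Space X] [CompactSpace X] [Nonempty X]

/-- A metrized `G`-bundle on `X_D` with a `θ`-adapted metric. The metric is a smooth reduction of
structure group to `K = G ∩ U(n)`; it is recorded by the hermitian matrices `h e` of the elements
`e` of `E` (so the reduction is `{e | h e = 1}`). `frame x` is the local holomorphic trivialization
near the puncture `x` in which the metric takes the form `|z| ^ (2θ) e ^ c`. -/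
structure MetrizedBundle (S : Setup X n) where
  E : HolBundle S
  h : ∀ y, E.Fib y → Mat n
  h_act : ∀ y, y ∉ S.D → ∀ e (g : S.G), h y (E.act e g) = (toMat g)ᴴ * h y e * toMat g
  h_reduction : ∀ y, y ∉ S.D → ∀ e, ∃ k : S.G, h y e = (toMat k)ᴴ * toMat k
  h_smooth : ∀ U s, E.IsSection U s → ∀ i j,
    ContMDiffOn 𝓘(ℝ, ℂ) 𝓘(ℝ, ℂ) ∞ (fun y => h y (s y) i j) U
  nbhd : X → Opens X
  frame : X → ∀ y, E.Fib y
  mem_nbhd : ∀ x ∈ S.D, x ∈ nbhd x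
  nbhd_inter : ∀ x ∈ S.D, ∀ y ∈ nbhd x, y ∈ S.D → y = x
  frame_isSection : ∀ x ∈ S.D, E.IsSection (nbhd x ⊓ S.punctured) (frame x)
  adapted : ∀ x ∈ S.D, ∃ c : X → Mat n,
    (∀ᶠ y in 𝓝[≠] x, c y ∈ lieAlg S.G ∧ h y (frame x y) =
      NormedSpace.exp ((2 * Real.log ‖coord x y‖) • S.θ x) * NormedSpace.exp (c y)) ∧
    ∀ i j, (fun y => (NormedSpace.exp (Real.log ‖coord x y‖ • S.θ x) * c y *
      NormedSpace.exp (-(Real.log ‖coord x y‖ • S.θ x))) i j) =o[𝓝[≠] x]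
        fun y => Real.log ‖coord x y‖
  curvature_L1 : DensityIntegrable (curvNorm E h)

/-- The metric induced on the line bundle `χ_* E_σ` by `h`: if `e ∈ E_σ` and `h e = pᴴ p` with
`p ∈ P` (so that `e p⁻¹` lies in `E_σ` and in the reduction to `K`), the squared norm of the
induced frame of `χ_* E_σ` is `|χ p|²`. -/
def charMetric {P : MatGroup n} (χ : P →* ℂˣ) (H : Mat n) : ℝ :=
  open Classical in
  if hp : ∃ p : P, H = (toMat p)ᴴ * toMat p then ‖((χ hp.choose : ℂˣ) : ℂ)‖ ^ 2 else 1

variable {S : Setup X n}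

/-- The analytic degree `(i / 2π) ∫_{X_D} χ_* F_{h_σ}`. -/
def MetrizedBundle.degAn (B : MetrizedBundle S) {P : MatGroup n} (σ : Reduction B.E S.D P)
    (χ : P →* ℂˣ) : ℝ :=
  chernDegree (fun s : σ.Sec => s.1.1) fun s y => charMetric χ (B.h y (s.1.2 y))

/-- A reduction `σ` is `θ`-adapted: near each puncture `x` it has, in the trivialization
`frame x`, a holomorphic `G`-valued lift `g` with `z ^ θ g z ^ (-θ)` bounded in `G`. -/
def MetrizedBundle.IsAdaptedReduction (B : MetrizedBundle S) {P : MatGroup n}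
    (σ : Reduction B.E S.D P) : Prop :=
  ∀ x ∈ S.D, ∃ (U : Opens X) (g : X → S.G), x ∈ U ∧ HolOn ((U : Set X) \ S.D) g ∧
    IsParahoricAt x (S.θ x) g ∧ ∀ y ∈ U, y ∉ S.D → B.E.act (B.frame x y) (g y) ∈ σ.carrier y

variable (S) in
/-- Metrized `(θ, ord)`-adapted `G`-Higgs bundles on `X_D`. -/
structure MetrizedHiggs where
  B : MetrizedBundle S
  φ : HiggsField B.E S.D
  adapted : ∀ x ∈ S.D, Form10.HasPoleAt x (S.θ x) (S.ord x) fun y => φ.val y (B.frame x y)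

variable (S) in
/-- Metrized `(θ, ord)`-adapted `G`-connections `(V, d', h)` on `X_D`. -/
structure MetrizedConnection where
  B : MetrizedBundle S
  A : Connection B.E S.D
  adapted : ∀ x ∈ S.D, Form10.HasPoleAt x (S.θ x) (S.ord x) (A.form (B.frame x))

/-- The stability inequality `rel (deg^an E(h, σ, χ))` for all proper parabolic `P`, all `θ`-adapted
reductions `σ` satisfying `compat`, and all nontrivial anti-dominant algebraic characters `χ` of `P`
that are trivial on the centre of `P`. -/
def AnStability (B : MetrizedBundle S)
    (compat : ∀ P : MatGroup n, Reduction B.E S.D P → Prop) (rel : ℝ → Prop) : Prop :=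
  ∀ P : MatGroup n, IsParabolic S.R P → P ≠ S.G →
    ∀ σ : Reduction B.E S.D P, B.IsAdaptedReduction σ → compat P σ →
      ∀ χ : P →* ℂˣ, IsAlgChar χ → χ ≠ 1 → IsAntidominant S.R χ →
        (∀ c ∈ Subgroup.center P, χ c = 1) → rel (B.degAn σ χ)

/-- `R_h`-stability of a metrized Higgs bundle. -/
def MetrizedHiggs.RhStable (F : MetrizedHiggs S) : Prop :=
  AnStability F.B (fun _ σ => F.φ.Compatible σ) fun d => 0 < d

/-- `R_h`-semistability of a metrized Higgs bundle. -/
def MetrizedHiggs.RhSemistable (F : MetrizedHiggs S) : Prop :=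
  AnStability F.B (fun _ σ => F.φ.Compatible σ) fun d => 0 ≤ d

/-- `R_h`-stability of a metrized connection. -/
def MetrizedConnection.RhStable (F : MetrizedConnection S) : Prop :=
  AnStability F.B (fun _ σ => F.A.Compatible σ) fun d => 0 < d

/-- `R_h`-semistability of a metrized connection. -/
def MetrizedConnection.RhSemistable (F : MetrizedConnection S) : Prop :=
  AnStability F.B (fun _ σ => F.A.Compatible σ) fun d => 0 ≤ d

/-! ### The extension functor -/

/-- Points near (but different from) `x` lie off `D`. -/
theorem eventually_not_mem (D : Finset X) (x : X) : ∀ᶠ y in 𝓝[≠] x, y ∉ D := by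
  have h : ((D : Set X) \ {x})ᶜ ∈ 𝓝 x :=
    ((D.finite_toSet.subset Set.sdiff_subset).isClosed.isOpen_compl).mem_nhds (by simp)
  filter_upwards [nhdsWithin_le_nhds h, self_mem_nhdsWithin] with y h1 h2 h3
  exact h1 ⟨h3, h2⟩

/-- The parahoric `𝒢_θ`-torsor `Ξ(E, h)`: the extension of `E` over the punctures obtained by gluing
`E` on `X_D` to the trivial `𝒢_θ`-torsor on a disc around each `x ∈ D` via `frame x`. Its sections
are the holomorphic sections of `E` off `D` that differ from `frame x` by an element of `G_θ(K)` at
each `x ∈ D`. -/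
def MetrizedBundle.Xi (B : MetrizedBundle S) : ParahoricTorsor S where
  Fib := B.E.Fib
  act := B.E.act
  ratio := B.E.ratio
  act_one := B.E.act_one
  act_act := B.E.act_act
  act_ratio := B.E.act_ratio
  ratio_act := B.E.ratio_act
  IsSection U s := B.E.IsSection (U ⊓ S.punctured) s ∧
    ∀ x ∈ S.D, x ∈ U → IsParahoricAt x (S.θ x) fun y => B.E.ratio (B.frame x y) (s y)
  le _ := le_top
  mono h hV := ⟨B.E.mono h.1 (inf_le_inf_right _ hV), fun x hx hxV => h.2 x hx (hV hxV)⟩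
  glue {U s} h := by
    constructor
    · refine B.E.glue fun y hy => ?_
      obtain ⟨V, hyV, hV, -⟩ := h y hy.1
      exact ⟨V ⊓ S.punctured, ⟨hyV, hy.2⟩, hV⟩
    · intro x hx hxU
      obtain ⟨V, hxV, -, hV⟩ := h x hxU
      exact hV x hx hxV
  change {U s} hs t := by
    constructor
    · rintro ⟨h1, h2⟩
      refine ⟨(B.E.change hs.1 t).1 h1, fun x hx hxU => ?_⟩
      refine ((hs.2 x hx hxU).inv.mul (h2 x hx hxU)).congr (Filter.Eventually.of_forall fun y => ?_)
      simp only [B.E.ratio_inv, B.E.ratio_mul_ratio]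
    · rintro ⟨h1, h2⟩
      refine ⟨(B.E.change hs.1 t).2 h1, fun x hx hxU => ?_⟩
      refine ((hs.2 x hx hxU).mul (h2 x hx hxU)).congr (Filter.Eventually.of_forall fun y => ?_)
      simp only [B.E.ratio_mul_ratio]
  exists_section y _ := by
    by_cases hy : y ∈ S.D
    · refine ⟨B.nbhd y, B.frame y, B.mem_nbhd y hy, B.frame_isSection y hy, fun x hx hxU => ?_⟩
      obtain rfl := B.nbhd_inter y hy x hxU hx
      refine (IsParahoricAt.one x (S.θ x)).congr (Filter.Eventually.of_forall fun y => ?_)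
      rw [B.E.ratio_self]
    · obtain ⟨U, s, hyU, hs⟩ := B.E.exists_section y hy
      exact ⟨U, s, hyU, B.E.mono hs inf_le_left, fun x hx hxU => absurd hx (B.E.le hs hxU)⟩

/-- The extension functor `Ξ_Higgs` on objects. -/
def MetrizedHiggs.Xi (F : MetrizedHiggs S) : MerohoricHiggs S where
  E := F.B.Xi
  φ :=
    { val := F.φ.val
      mem_lieAlg := F.φ.mem_lieAlg
      equivariant := F.φ.equivariant
      hol := fun U s hs => by
        have h := F.φ.hol _ s hs.1
        have hset : ((U ⊓ S.punctured : Opens X) : Set X) \ S.D = (U : Set X) \ S.D := by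
          ext y
          exact ⟨fun hy => ⟨hy.1.1, hy.2⟩, fun hy => ⟨⟨hy.1, hy.2⟩, hy.2⟩⟩
        rwa [hset] at h }
  pole U s hs x hx hxU := by
    have hg := hs.2 x hx hxU
    have h1 := hg.2.mul (F.adapted x hx)
    rw [← conjZ_mul] at h1
    have h := h1.mul hg.1
    rw [← conjZ_mul] at h
    refine h.congr ?_
    filter_upwards [eventually_not_mem S.D x] with y hy
    have he : ∀ v, F.φ.val y (s y) v = toMat (F.B.E.ratio (F.B.frame x y) (s y))⁻¹ *
        F.φ.val y (F.B.frame x y) v * toMat (F.B.E.ratio (F.B.frame x y) (s y)) := fun v =>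
      (congrArg (fun e => F.φ.val y e v) (F.B.E.act_ratio (F.B.frame x y) (s y)).symm).trans
        (F.φ.equivariant y hy _ _ v)
    simp only [conjZ, Form10.coeff, Matrix.mul_smul, Matrix.smul_mul]
    exact congrArg (fun M => coord x y ^ S.ord x • (zpow (coord x y) (S.θ x) * M *
      zpowNeg (coord x y) (S.θ x))) (he _).symm

/-- The extension functor `Ξ_Conn` on objects. -/
def MetrizedConnection.Xi (F : MetrizedConnection S) : MerohoricConnection S where
  V := F.B.Xi
  A :=
    { form := F.A.form
      mem_lieAlg := fun U s hs y hy hyD => F.A.mem_lieAlg _ s hs.1 y ⟨hy, hyD⟩ hyD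
      hol := fun U s hs => by
        have h := F.A.hol _ s hs.1
        have hset : ((U ⊓ S.punctured : Opens X) : Set X) \ S.D = (U : Set X) \ S.D := by
          ext y
          exact ⟨fun hy => ⟨hy.1.1, hy.2⟩, fun hy => ⟨⟨hy.1, hy.2⟩, hy.2⟩⟩
        rwa [hset] at h
      gauge := fun U s g hs hsg y hy hyD => F.A.gauge _ s g hs.1 hsg.1 y ⟨hy, hyD⟩ hyD }
  pole x hx := by
    refine ⟨F.B.nbhd x, F.B.frame x, F.B.mem_nbhd x hx, ⟨F.B.frame_isSection x hx, ?_⟩,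
      F.adapted x hx⟩
    intro x' hx' hxU
    obtain rfl := F.B.nbhd_inter x hx x' hxU hx'
    refine (IsParahoricAt.one x' (S.θ x')).congr (Filter.Eventually.of_forall fun y => ?_)
    rw [F.B.E.ratio_self]

end Analytic

end Merohoric

end

/-! The proposition follows from matching the test data of the two stability conditions and then
comparing the two degrees.

Off the punctures the extension $\Xi(E,h)$ has the same fibres as $E$, and near a puncture its
sections are the sections of $E$ that differ from the fixed frame by an element of $G_\theta$. Hence
$\theta$-adapted reductions of $E$ and reductions of $\Xi(E,h)$ are the same families of $P$-orbits
(`MetrizedBundle.exists_reduction_xi`, `MetrizedBundle.exists_reduction`), and compatibility, which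
is tested off the punctures, is the same condition. An anti-dominant algebraic character $\chi$ of
$P$ defines a character of $\mathcal P_\theta$: since $z^\theta\in T\subset P$, conjugation by
$z^\theta$ does not change $\chi$, so $\chi(p)$ and its inverse stay bounded along a section of
$\mathcal P_\theta$ and $\chi(p)$ extends over the puncture without zeros
(`FlagData.exists_regular`). What remains is the equality $\deg^{\rm an}=parh\deg$,
`SameReduction.degAn_eq`.

Let $u$ be the logarithm of the quotient of the metric induced by $h$ on $\chi_*E_\sigma$ by a
smooth metric on the extended line bundle. Adaptedness gives
$u=2\langle\theta,\chi\rangle\log|z|+o(\log|z|)$ (`MetrizedBundle.logMetric_isLittleO`). A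
singularity $\alpha\log|z|$ contributes $-\frac{\pi}{2}\alpha$ to the integral of $\partial_{\bar
z}\partial_z u$, hence $\alpha/2=\langle\theta,\chi\rangle$ to the degree (`surfInt_lapDens`,
`chernDegree_eq_add`).

Two points make this delicate. The error $o(\log|z|)$ is not controlled together with its
derivatives; this is met by cut-off functions of $\log|z|/n$, whose Laplacian, multiplied by
$|\log|z||$, has bounded integral, so that the error disappears in the limit. Moreover the curvature
of the line bundle is not known to be integrable. It is enough to have a one-sided bound by an
integrable function: Fatou's lemma then gives integrability (`integral_mul_lapl_puncture`).

The one-sided bound is where anti-dominance enters. On the Levi algebra $d\chi$ equals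
$\mathrm{tr}(Z\,\cdot)$ for a hermitian $Z$ that is central there (`exists_dualElement`), and
anti-dominance says that $\mathrm{ad}\,Z$ has no positive eigenvalue on the nilradical
(`DualElement.loc_eq_zero`). So $P$ preserves the spectral subspaces $\{Z\le\tau\}$, and $|\chi|$ is
a product of powers with exponents $\le 0$ of the determinants of $P$ on these subspaces, up to a
power of either sign of the full determinant (`exists_flagData`). For the determinant of a subbundle
the second fundamental form has a definite sign, and the remaining term is bounded by the norm of
the curvature (`lapl_log_det_compress`).

The facts needed about reductive groups are obtained by variational arguments with matrices. The
Iwasawa decomposition $G=KP$ comes from minimising $|k|^2+|k^{-1}|^2$ on a coset $gP$, and coroots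
come from maximising $|[\alpha,\alpha^*]|$ on the unit sphere of a weight space. -/

noncomputable section

namespace Merohoric

attribute [local instance] Matrix.linftyOpNormedRing Matrix.linftyOpNormedAlgebra

/-! ### Lie algebras of Zariski closed matrix groups. -/

section LieAlgebra

variable {n : ℕ}

/-- The exponential of a matrix as an invertible matrix. -/
def expGL (Y : Mat n) : GL (Fin n) ℂ where
  val := NormedSpace.exp Y
  inv := NormedSpace.exp (-Y)
  val_inv := by
    rw [← Matrix.exp_add_of_commute _ _ (Commute.neg_right (Commute.refl Y))]; simp
  inv_val := by
    rw [← Matrix.exp_add_of_commute _ _ (Commute.neg_left (Commute.refl Y))]; simp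

@[simp] theorem expGL_coe (Y : Mat n) : ((expGL Y : GL (Fin n) ℂ) : Mat n) = NormedSpace.exp Y := rfl

@[simp] theorem expGL_zero : expGL (0 : Mat n) = 1 := by ext1; simp

@[simp] theorem expGL_neg (Y : Mat n) : expGL (-Y) = (expGL Y)⁻¹ := by
  rw [eq_inv_iff_mul_eq_one]
  ext1
  exact (expGL Y).inv_val

theorem expGL_add {Y Z : Mat n} (h : Commute Y Z) : expGL (Y + Z) = expGL Y * expGL Z := by
  ext1; simpa using Matrix.exp_add_of_commute _ _ h

theorem expGL_conj (g : GL (Fin n) ℂ) (Y : Mat n) :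
    expGL ((g : Mat n) * Y * ((g⁻¹ : GL (Fin n) ℂ) : Mat n)) = g * expGL Y * g⁻¹ := by
  ext1; simpa using Matrix.exp_units_conj g Y

theorem mem_lieAlg_iff {H : MatGroup n} {Y : Mat n} :
    Y ∈ lieAlg H ↔ ∀ s : ℂ, expGL (s • Y) ∈ H := by
  refine forall_congr' fun s => ⟨?_, fun h => ⟨_, h, rfl⟩⟩
  rintro ⟨g, hg, he⟩
  have : g = expGL (s • Y) := by ext1; exact he
  rwa [← this]

theorem smul_mem_lieAlg {H : MatGroup n} {Y : Mat n} (hY : Y ∈ lieAlg H) (c : ℂ) :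
    c • Y ∈ lieAlg H := by
  rw [mem_lieAlg_iff] at *
  intro s; rw [smul_smul]; exact hY _

theorem zero_mem_lieAlg {H : MatGroup n} : (0 : Mat n) ∈ lieAlg H := by
  rw [mem_lieAlg_iff]; intro s; simp

theorem conj_mem_lieAlg {H : MatGroup n} {Y : Mat n} (hY : Y ∈ lieAlg H) {g : GL (Fin n) ℂ}
    (hg : g ∈ H) : (g : Mat n) * Y * ((g⁻¹ : GL (Fin n) ℂ) : Mat n) ∈ lieAlg H := by
  rw [mem_lieAlg_iff] at *
  intro s
  have := expGL_conj g (s • Y)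
  rw [Matrix.mul_smul, Matrix.smul_mul] at this
  rw [this]
  exact H.mul_mem (H.mul_mem hg (hY s)) (H.inv_mem hg)

theorem lieAlg_mono {H H' : MatGroup n} (h : H ≤ H') : lieAlg H ⊆ lieAlg H' := by
  intro Y hY
  rw [mem_lieAlg_iff] at *
  exact fun s => h (hY s)

theorem differentiable_mvPolynomial_eval {E : Type*} [NormedAddCommGroup E] [NormedSpace ℂ E]
    {σ : Type*} (f : MvPolynomial σ ℂ) {c : E → σ → ℂ} {U : Set E}
    (hc : ∀ i, DifferentiableOn ℂ (fun x => c x i) U) :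
    DifferentiableOn ℂ (fun x => MvPolynomial.eval (c x) f) U := by
  induction f using MvPolynomial.induction_on with
  | C a => simp
  | add p q hp hq => simpa using hp.fun_add hq
  | mul_X p i hp => simpa using hp.fun_mul (hc i)

theorem continuous_mvPolynomial_eval_mat (f : MvPolynomial (Fin n × Fin n) ℂ) :
    Continuous fun M : Mat n => MvPolynomial.eval (fun ij => M ij.1 ij.2) f :=
  (MvPolynomial.continuous_eval f).comp (continuous_pi fun ij => continuous_id.matrix_elem ij.1 ij.2)

/-- A Zariski closed group is closed. -/
theorem IsZariskiClosed.mem_of_tendsto {H : MatGroup n} (hH : IsZariskiClosed H) {ι : Type*}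
    {l : Filter ι} [l.NeBot] {γ : ι → GL (Fin n) ℂ} {g : GL (Fin n) ℂ}
    (hγ : ∀ᶠ i in l, γ i ∈ H) (h : Filter.Tendsto (fun i => (γ i : Mat n)) l (𝓝 (g : Mat n))) :
    g ∈ H := by
  obtain ⟨I, hI⟩ := hH
  rw [hI]
  intro f hf
  refine tendsto_nhds_unique (((continuous_mvPolynomial_eval_mat f).tendsto _).comp h) ?_
  refine tendsto_const_nhds.congr' ?_
  filter_upwards [hγ] with i hi
  exact ((hI _).1 hi f hf).symm

theorem hasDerivAt_exp_smul (Y : Mat n) (s : ℂ) :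
    HasDerivAt (fun s : ℂ => NormedSpace.exp (s • Y)) (NormedSpace.exp (s • Y) * Y) s :=
  hasDerivAt_exp_smul_const Y s

theorem differentiable_exp_smul_apply (Y : Mat n) (i j : Fin n) :
    Differentiable ℂ fun s : ℂ => NormedSpace.exp (s • Y) i j := fun s =>
  (HasDerivAt.differentiableAt (hasDerivAt_pi.1 (hasDerivAt_pi.1 (hasDerivAt_exp_smul Y s) i) j))

/-- If the exponentials of the real multiples of `Y` lie in a Zariski closed group, so do those of
the complex multiples. -/
theorem IsZariskiClosed.mem_lieAlg_of_real {H : MatGroup n} (hH : IsZariskiClosed H) {Y : Mat n}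
    (h : ∀ s : ℝ, expGL ((s : ℂ) • Y) ∈ H) : Y ∈ lieAlg H := by
  rw [mem_lieAlg_iff]
  obtain ⟨I, hI⟩ := hH
  intro s
  rw [hI]
  intro f hf
  set F : ℂ → ℂ := fun s => MvPolynomial.eval (fun ij => (expGL (s • Y) : Mat n) ij.1 ij.2) f
  have hF : Differentiable ℂ F := by
    rw [← differentiableOn_univ]
    exact differentiable_mvPolynomial_eval f fun ij =>
      (differentiable_exp_smul_apply Y ij.1 ij.2).differentiableOn
  have han : AnalyticOnNhd ℂ F Set.univ := hF.differentiableOn.analyticOnNhd isOpen_univ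
  have h0 : AnalyticOnNhd ℂ (fun _ : ℂ => (0 : ℂ)) Set.univ := analyticOnNhd_const
  -- The entire function $f(e^{sY})$ vanishes at the real points $1/(k+1)$, which accumulate at $0$;
  -- the identity theorem gives all complex $s$.
  have key : ∃ᶠ z in 𝓝[≠] (0 : ℂ), F z = 0 := by
    have ht : Filter.Tendsto (fun k : ℕ => (((1 / ((k : ℝ) + 1) : ℝ)) : ℂ)) Filter.atTop
        (𝓝[≠] (0 : ℂ)) := by
      refine tendsto_nhdsWithin_iff.2 ⟨?_, Filter.Eventually.of_forall fun k => ?_⟩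
      · have := tendsto_one_div_add_atTop_nhds_zero_nat (𝕜 := ℝ)
        simpa [Function.comp_def] using (Complex.continuous_ofReal.tendsto 0).comp this
      · have : ((k : ℝ) + 1) ≠ 0 := by positivity
        simp only [Set.mem_compl_iff, Set.mem_singleton_iff, Complex.ofReal_eq_zero]
        exact one_div_ne_zero this
    refine ht.frequently (Filter.Frequently.of_forall fun k => ?_)
    exact (hI _).1 (h _) f hf
  have := han.eq_of_frequently_eq h0 key
  exact congrFun this s

/-- Telescoping estimate behind the product formula $\gamma(s/m)^m\to e^{sY}$. -/
theorem norm_pow_sub_pow_le {R : Type*} [NormedRing R] [NormOneClass R] (x y : R) {K : ℝ}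
    (hx : ‖x‖ ≤ K) (hy : ‖y‖ ≤ K) (h1 : 1 ≤ K) (m : ℕ) :
    ‖x ^ m - y ^ m‖ ≤ m * K ^ m * ‖x - y‖ := by
  induction m with
  | zero => simp
  | succ m ih =>
    have e : x ^ (m + 1) - y ^ (m + 1) = x ^ m * (x - y) + (x ^ m - y ^ m) * y := by
      rw [pow_succ, pow_succ]; noncomm_ring
    have hK : 0 ≤ K := by linarith
    have hxm : ‖x ^ m‖ ≤ K ^ m := (norm_pow_le _ _).trans (pow_le_pow_left₀ (norm_nonneg _) hx m)
    have hkm : K ^ m ≤ K ^ (m + 1) := pow_le_pow_right₀ h1 (Nat.le_succ m)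
    rw [e]
    calc _ ≤ ‖x ^ m‖ * ‖x - y‖ + ‖x ^ m - y ^ m‖ * ‖y‖ :=
          (norm_add_le _ _).trans (add_le_add (norm_mul_le _ _) (norm_mul_le _ _))
      _ ≤ K ^ (m + 1) * ‖x - y‖ + (m * K ^ m * ‖x - y‖) * K := by
          gcongr
          exact hxm.trans hkm
      _ = _ := by push_cast; ring

/-- The velocity at `1` of a curve in a Zariski closed group lies in its Lie algebra. -/
theorem IsZariskiClosed.mem_lieAlg_of_hasDerivAt {H : MatGroup n} (hH : IsZariskiClosed H)
    {Y : Mat n} {γ : ℝ → GL (Fin n) ℂ} (hγ : ∀ᶠ s in 𝓝 0, γ s ∈ H) (h0 : γ 0 = 1)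
    (hd : HasDerivAt (fun s => (γ s : Mat n)) Y 0) : Y ∈ lieAlg H := by
  refine hH.mem_lieAlg_of_real fun s => ?_
  -- For $n=0$ the unit matrix has norm $0$, so the norm estimates below, which use $\|1\|=1$, need
  -- $n>0$.
  rcases Nat.eq_zero_or_pos n with rfl | hn
  · have : expGL ((s : ℂ) • Y) = 1 := by ext i; exact i.elim0
    rw [this]; exact H.one_mem
  have : Nonempty (Fin n) := ⟨⟨0, hn⟩⟩
  have hlim : Filter.Tendsto (fun m : ℕ => s / (m + 1 : ℝ)) Filter.atTop (𝓝 0) := by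
    have := (tendsto_one_div_add_atTop_nhds_zero_nat (𝕜 := ℝ)).const_mul s
    simpa [div_eq_mul_inv] using this
  -- Product formula: $\gamma(s/m)^m$ lies in the group and converges to $e^{sY}$, because
  -- $\gamma(t)$ and $e^{tY}$ agree to first order and both have norm at most $e^{(\|Y\|+1)|t|}$,
  -- which keeps the $m$-th powers bounded.
  refine hH.mem_of_tendsto (l := Filter.atTop) (γ := fun m : ℕ => γ (s / (m + 1 : ℝ)) ^ (m + 1)) ?_ ?_
  · filter_upwards [hlim.eventually hγ] with m hm using H.pow_mem hm _
  -- both curves agree to first order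
  set e : ℝ → Mat n := fun t => NormedSpace.exp ((t : ℂ) • Y)
  have he : HasDerivAt e Y 0 := by
    have h1 := (hasDerivAt_exp_smul Y (0 : ℂ))
    have h2 := HasDerivAt.scomp_of_eq (0 : ℝ) (g₁ := fun s : ℂ => NormedSpace.exp (s • Y))
      (h := fun t : ℝ => (t : ℂ)) (y := 0) h1 (Complex.ofRealCLM.hasDerivAt) (by simp)
    simpa [e, Function.comp_def] using! h2
  have hdiff : HasDerivAt (fun t => (γ t : Mat n) - e t) 0 0 := by
    have := hd.fun_sub he
    rwa [sub_self] at this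
  have hlo : (fun t : ℝ => (γ t : Mat n) - e t) =o[𝓝 0] fun t => t := by
    have := hdiff.isLittleO
    simpa [h0, e] using this
  -- a bound for the norms
  have hbd : ∀ {c : ℝ → Mat n}, HasDerivAt c Y 0 → c 0 = 1 →
      ∀ᶠ t in 𝓝 (0 : ℝ), ‖c t‖ ≤ Real.exp ((‖Y‖ + 1) * |t|) := by
    intro c hc hc0
    have := hc.isLittleO.def (c := 1) one_pos
    filter_upwards [this] with t ht
    have h1 : ‖c t‖ ≤ ‖c t - c 0 - (t - 0) • Y‖ + (1 + |t| * ‖Y‖) := by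
      have e1 : c t = (c t - c 0 - (t - 0) • Y) + (c 0 + (t - 0) • Y) := by abel
      calc ‖c t‖ = ‖(c t - c 0 - (t - 0) • Y) + (c 0 + (t - 0) • Y)‖ := by rw [← e1]
        _ ≤ _ := (norm_add_le _ _).trans (add_le_add le_rfl ?_)
      refine (norm_add_le _ _).trans ?_
      rw [hc0, norm_smul, norm_one]
      simp
    have h2 : ‖c t - c 0 - (t - 0) • Y‖ ≤ |t| := by simpa using ht
    calc _ ≤ (‖Y‖ + 1) * |t| + 1 := by linarith
      _ ≤ _ := Real.add_one_le_exp _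
  have e0 : e 0 = 1 := by simp [e]
  have hg0 : (γ 0 : Mat n) = 1 := by simp [h0]
  have htar : ∀ m : ℕ, e (s / (m + 1 : ℝ)) ^ (m + 1) = NormedSpace.exp ((s : ℂ) • Y) := by
    intro m
    have hm : ((m : ℂ) + 1) ≠ 0 := by exact_mod_cast Nat.succ_ne_zero m
    simp only [e]
    rw [← Matrix.exp_nsmul]
    congr 1
    rw [← Nat.cast_smul_eq_nsmul ℂ, smul_smul]
    congr 1
    push_cast
    field_simp
  refine (tendsto_iff_norm_sub_tendsto_zero (E := Mat n)).2 ?_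
  have hb1 := hlim.eventually (hbd hd hg0)
  have hb2 := hlim.eventually (hbd he e0)
  have hlo' : Filter.Tendsto (fun m : ℕ => (m + 1 : ℝ) *
      ‖(γ (s / (m + 1 : ℝ)) : Mat n) - e (s / (m + 1 : ℝ))‖) Filter.atTop (𝓝 0) := by
    have h3 := (hlo.comp_tendsto hlim)
    have h4 : (fun m : ℕ => s / (m + 1 : ℝ)) =O[Filter.atTop] fun m : ℕ => 1 / (m + 1 : ℝ) := by
      simpa [div_eq_mul_inv] using (Asymptotics.isBigO_refl (fun m : ℕ => 1 / (m + 1 : ℝ))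
        Filter.atTop).const_mul_left s
    have h5 := (h3.trans_isBigO h4).norm_left
    rw [Asymptotics.isLittleO_iff_tendsto'] at h5
    · refine h5.congr fun m => ?_
      have : ((m : ℝ) + 1) ≠ 0 := by positivity
      simp only [Function.comp]
      field_simp
    · refine Filter.Eventually.of_forall fun m hm => ?_
      have : ((m : ℝ) + 1) ≠ 0 := by positivity
      exact absurd hm (one_div_ne_zero this)
  have hup := hlo'.const_mul (Real.exp ((‖Y‖ + 1) * |s|))
  rw [mul_zero] at hup
  refine squeeze_zero' (Filter.Eventually.of_forall fun m => norm_nonneg _) ?_ hup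
  filter_upwards [hb1, hb2] with m h1 h2
  have hs : |s / (m + 1 : ℝ)| = |s| / (m + 1 : ℝ) := by
    rw [abs_div, abs_of_pos (by positivity : (0:ℝ) < m + 1)]
  have := norm_pow_sub_pow_le _ _ h1 h2 (Real.one_le_exp (by positivity)) (m + 1)
  rw [htar] at this
  simp only [Units.val_pow_eq_pow_val, expGL_coe]
  refine this.trans (le_of_eq ?_)
  rw [← Real.exp_nat_mul, hs]
  have : ((m : ℝ) + 1) ≠ 0 := by positivity
  have e2 : ((m + 1 : ℕ) : ℝ) * ((‖Y‖ + 1) * (|s| / (m + 1 : ℝ))) = (‖Y‖ + 1) * |s| := by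
    push_cast; field_simp
  rw [e2]; push_cast; ring

/-- The Lie algebra of a Zariski closed group as a complex subspace. -/
theorem IsZariskiClosed.add_mem_lieAlg {H : MatGroup n} (hH : IsZariskiClosed H) {Y Z : Mat n}
    (hY : Y ∈ lieAlg H) (hZ : Z ∈ lieAlg H) : Y + Z ∈ lieAlg H := by
  have he : ∀ Y : Mat n, HasDerivAt (fun t : ℝ => NormedSpace.exp ((t : ℂ) • Y)) Y 0 := by
    intro Y
    have h2 := HasDerivAt.scomp_of_eq (0 : ℝ) (g₁ := fun s : ℂ => NormedSpace.exp (s • Y))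
      (h := fun t : ℝ => (t : ℂ)) (y := 0) (hasDerivAt_exp_smul Y (0 : ℂ))
      (Complex.ofRealCLM.hasDerivAt) (by simp)
    simpa [Function.comp_def] using! h2
  refine hH.mem_lieAlg_of_hasDerivAt (γ := fun s : ℝ => expGL ((s : ℂ) • Y) * expGL ((s : ℂ) • Z))
    (Filter.Eventually.of_forall fun s =>
      H.mul_mem (mem_lieAlg_iff.1 hY _) (mem_lieAlg_iff.1 hZ _)) (by simp) ?_
  have := (he Y).fun_mul (he Z)
  simp only [Complex.ofReal_zero, zero_smul, NormedSpace.exp_zero, mul_one, one_mul] at this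
  exact this

/-- The Lie algebra of a Zariski closed group, as a subspace. -/
def IsZariskiClosed.lieSubspace {H : MatGroup n} (hH : IsZariskiClosed H) : Submodule ℂ (Mat n) where
  carrier := lieAlg H
  add_mem' := hH.add_mem_lieAlg
  zero_mem' := zero_mem_lieAlg
  smul_mem' c _ h := smul_mem_lieAlg h c

/-- The bracket is the derivative at $0$ of $e^{sY}Ze^{-sY}$. Its difference quotients lie in the
Lie algebra, a finite-dimensional and hence closed subspace. -/
theorem IsZariskiClosed.bracket_mem_lieAlg {H : MatGroup n} (hH : IsZariskiClosed H) {Y Z : Mat n}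
    (hY : Y ∈ lieAlg H) (hZ : Z ∈ lieAlg H) : Y * Z - Z * Y ∈ lieAlg H := by
  have hder : HasDerivAt (fun s : ℂ => NormedSpace.exp (s • Y) * Z * NormedSpace.exp (s • (-Y)))
      (Y * Z - Z * Y) 0 := by
    have := ((hasDerivAt_exp_smul Y 0).mul_const Z).mul (hasDerivAt_exp_smul (-Y) 0)
    simpa [sub_eq_add_neg] using! this
  have hcl : IsClosed (hH.lieSubspace : Set (Mat n)) := Submodule.closed_of_finiteDimensional _
  replace hder := (hasDerivAt_iff_tendsto_slope (F := Mat n)).1 hder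
  refine hcl.mem_of_tendsto hder (Filter.Eventually.of_forall fun s => ?_)
  rw [slope_def_module]
  refine hH.lieSubspace.smul_mem _ (hH.lieSubspace.sub_mem ?_ ?_)
  · have := conj_mem_lieAlg hZ (mem_lieAlg_iff.1 hY s)
    rw [← expGL_neg, ← smul_neg] at this
    exact this
  · have hZ' : Z ∈ hH.lieSubspace := hZ
    simpa using hZ'

end LieAlgebra

/-! ### Unitary diagonalization, functional calculus and the grading by $\mathrm{ad}\,A$. -/

section Hermitian

variable {n : ℕ}

/-- A unitary diagonalization of a hermitian matrix. -/
structure UDiag (A : Mat n) where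
  V : Mat n
  ev : Fin n → ℝ
  left : Vᴴ * V = 1
  right : V * Vᴴ = 1
  eq : A = V * Matrix.diagonal (fun i => (ev i : ℂ)) * Vᴴ

theorem exists_uDiag {A : Mat n} (hA : Aᴴ = A) : Nonempty (UDiag A) := by
  have h : A.IsHermitian := hA
  refine ⟨⟨(h.eigenvectorUnitary : Mat n), h.eigenvalues, ?_, ?_, ?_⟩⟩
  · exact Unitary.coe_star_mul_self h.eigenvectorUnitary
  · exact Unitary.coe_mul_star_self h.eigenvectorUnitary
  · have := h.spectral_theorem
    simpa [Unitary.conjStarAlgAut_apply, Function.comp_def, Matrix.star_eq_conjTranspose] using this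

namespace UDiag

variable {A : Mat n} (d : UDiag A)

/-- The matrix of `Y` in the eigenbasis. -/
def loc (Y : Mat n) : Mat n := d.Vᴴ * Y * d.V

/-- The matrix with the given matrix in the eigenbasis. -/
def glob (Y : Mat n) : Mat n := d.V * Y * d.Vᴴ

@[simp] theorem loc_glob (Y : Mat n) : d.loc (d.glob Y) = Y := by
  calc _ = (d.Vᴴ * d.V) * Y * (d.Vᴴ * d.V) := by simp only [loc, glob, mul_assoc]
    _ = Y := by simp [d.left]

@[simp] theorem glob_loc (Y : Mat n) : d.glob (d.loc Y) = Y := by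
  calc _ = (d.V * d.Vᴴ) * Y * (d.V * d.Vᴴ) := by simp only [loc, glob, mul_assoc]
    _ = Y := by simp [d.right]

theorem loc_mul (Y Z : Mat n) : d.loc (Y * Z) = d.loc Y * d.loc Z := by
  calc _ = d.Vᴴ * Y * 1 * Z * d.V := by simp only [loc, mul_one, mul_assoc]
    _ = _ := by rw [← d.right]; simp only [loc, mul_assoc]

theorem glob_mul (Y Z : Mat n) : d.glob (Y * Z) = d.glob Y * d.glob Z := by
  rw [← d.glob_loc (d.glob Y * d.glob Z), d.loc_mul]; simp

theorem loc_injective : Function.Injective d.loc := fun Y Z h => by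
  rw [← d.glob_loc Y, h, d.glob_loc]

@[simp] theorem loc_one : d.loc 1 = 1 := by simp [loc, d.left]
@[simp] theorem glob_one : d.glob 1 = 1 := by simp [glob, d.right]

theorem loc_add (Y Z : Mat n) : d.loc (Y + Z) = d.loc Y + d.loc Z := by
  simp [loc, mul_add, add_mul]
theorem loc_sub (Y Z : Mat n) : d.loc (Y - Z) = d.loc Y - d.loc Z := by
  simp [loc, mul_sub, sub_mul]
theorem loc_smul (c : ℂ) (Y : Mat n) : d.loc (c • Y) = c • d.loc Y := by
  simp [loc]
theorem loc_conjTranspose (Y : Mat n) : d.loc Yᴴ = (d.loc Y)ᴴ := by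
  simp [loc, mul_assoc]
theorem glob_conjTranspose (Y : Mat n) : d.glob Yᴴ = (d.glob Y)ᴴ := by
  simp [glob, mul_assoc]

theorem continuous_loc : Continuous d.loc := by unfold loc; fun_prop
theorem continuous_glob : Continuous d.glob := by unfold glob; fun_prop

theorem trace_loc (Y : Mat n) : (d.loc Y).trace = Y.trace := by
  rw [loc, Matrix.trace_mul_cycle, d.right, one_mul]

theorem det_loc (Y : Mat n) : (d.loc Y).det = Y.det := by
  have h : d.Vᴴ.det * d.V.det = 1 := by rw [← Matrix.det_mul, d.left, Matrix.det_one]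
  rw [loc, Matrix.det_mul, Matrix.det_mul, mul_right_comm, h, one_mul]

/-- Functional calculus. -/
def fn (φ : ℝ → ℂ) : Mat n := d.glob (Matrix.diagonal fun i => φ (d.ev i))

@[simp] theorem loc_fn (φ : ℝ → ℂ) : d.loc (d.fn φ) = Matrix.diagonal fun i => φ (d.ev i) := by
  simp [fn]

theorem loc_self : d.loc A = Matrix.diagonal fun i => (d.ev i : ℂ) := by
  have h : A = d.glob (Matrix.diagonal fun i => (d.ev i : ℂ)) := d.eq
  exact (congrArg d.loc h).trans (d.loc_glob _)

theorem conjTranspose_self (d : UDiag A) : Aᴴ = A := by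
  apply d.loc_injective
  rw [d.loc_conjTranspose, d.loc_self, Matrix.diagonal_conjTranspose]
  congr 1; funext i; simp

theorem fn_mul (φ ψ : ℝ → ℂ) : d.fn φ * d.fn ψ = d.fn fun x => φ x * ψ x := by
  rw [fn, fn, ← d.glob_mul, Matrix.diagonal_mul_diagonal]; rfl

theorem fn_conjTranspose (φ : ℝ → ℂ) : (d.fn φ)ᴴ = d.fn fun x => star (φ x) := by
  rw [fn, ← d.glob_conjTranspose, Matrix.diagonal_conjTranspose]; rfl

theorem exp_smul (s : ℂ) : NormedSpace.exp (s • A) = d.fn fun x => Complex.exp (s * x) := by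
  have hu : IsUnit d.V := (Matrix.isUnit_iff_isUnit_det _).2
    (by have h := congrArg Matrix.det d.left
        rw [Matrix.det_mul, Matrix.det_one] at h
        exact IsUnit.of_mul_eq_one_right _ h)
  have hinv : d.V⁻¹ = d.Vᴴ := Matrix.inv_eq_left_inv d.left
  have h1 : s • A = d.V * (Matrix.diagonal fun i => s * (d.ev i : ℂ)) * d.V⁻¹ := by
    have h0 : (Matrix.diagonal fun i => s * (d.ev i : ℂ)) =
        s • Matrix.diagonal fun i => (d.ev i : ℂ) := by
      ext i j
      simp [Matrix.diagonal_apply]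
    rw [hinv, h0, Matrix.mul_smul, Matrix.smul_mul]
    exact congrArg (s • ·) d.eq
  rw [h1, Matrix.exp_conj _ _ hu, Matrix.exp_diagonal, hinv]
  unfold fn glob
  congr 3
  funext i
  simp [Complex.exp_eq_exp_ℂ]

/-- The operator `φ (ad A)`. -/
def gr (φ : ℝ → ℂ) (Y : Mat n) : Mat n :=
  d.glob (Matrix.of fun i j => φ (d.ev i - d.ev j) * d.loc Y i j)

@[simp] theorem loc_gr (φ : ℝ → ℂ) (Y : Mat n) (i j : Fin n) :
    d.loc (d.gr φ Y) i j = φ (d.ev i - d.ev j) * d.loc Y i j := by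
  simp [gr]

theorem gr_gr (φ ψ : ℝ → ℂ) (Y : Mat n) : d.gr φ (d.gr ψ Y) = d.gr (fun x => φ x * ψ x) Y := by
  apply d.loc_injective; ext i j; simp [mul_assoc]

theorem gr_bracket (Y : Mat n) : d.gr (fun x => (x : ℂ)) Y = A * Y - Y * A := by
  apply d.loc_injective; ext i j
  simp [d.loc_sub, d.loc_mul, d.loc_self, Matrix.diagonal_mul, Matrix.mul_diagonal]
  ring

theorem exp_conj (s : ℂ) (Y : Mat n) : NormedSpace.exp (s • A) * Y * NormedSpace.exp (-(s • A)) =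
    d.gr (fun x => Complex.exp (s * x)) Y := by
  rw [← neg_smul, d.exp_smul, d.exp_smul]
  apply d.loc_injective; ext i j
  simp only [d.loc_mul, d.loc_fn, Matrix.diagonal_mul, Matrix.mul_diagonal, d.loc_gr]
  rw [mul_right_comm, ← Complex.exp_add]
  congr 2
  push_cast; ring

/-- On the finitely many differences of eigenvalues $\varphi$ agrees with an interpolating
polynomial, so $\varphi(\mathrm{ad}\,A)$ is a polynomial in $\mathrm{ad}\,A$. In this way the weight
components of an element of $\mathfrak g$ are seen to lie in $\mathfrak g$. -/
theorem gr_mem {W : Submodule ℂ (Mat n)} (hW : ∀ Y ∈ W, A * Y - Y * A ∈ W) (φ : ℝ → ℂ) {Y : Mat n}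
    (hY : Y ∈ W) : d.gr φ Y ∈ W := by
  set S : Finset ℂ := Finset.univ.image fun ij : Fin n × Fin n => ((d.ev ij.1 - d.ev ij.2 : ℝ) : ℂ)
  set q : Polynomial ℂ := Lagrange.interpolate S id fun z => φ z.re
  have hq : ∀ i j, q.eval ((d.ev i - d.ev j : ℝ) : ℂ) = φ (d.ev i - d.ev j) := by
    intro i j
    have := Lagrange.eval_interpolate_at_node (s := S) (v := id) (fun z => φ z.re)
      (Set.injOn_id _) (i := ((d.ev i - d.ev j : ℝ) : ℂ))
      (Finset.mem_image.2 ⟨(i, j), Finset.mem_univ _, rfl⟩)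
    rwa [Complex.ofReal_re] at this
  have key : ∀ q : Polynomial ℂ, d.gr (fun x => q.eval (x : ℂ)) Y ∈ W := by
    intro q
    induction q using Polynomial.induction_on with
    | C a =>
      have : d.gr (fun x => (Polynomial.C a).eval (x : ℂ)) Y = a • Y := by
        apply d.loc_injective; ext i j; simp [d.loc_smul]
      rw [this]; exact W.smul_mem _ hY
    | add p q hp hq =>
      have : d.gr (fun x => (p + q).eval (x : ℂ)) Y = d.gr (fun x => p.eval (x : ℂ)) Y +
          d.gr (fun x => q.eval (x : ℂ)) Y := by
        apply d.loc_injective; ext i j; simp [d.loc_add, add_mul]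
      rw [this]; exact W.add_mem hp hq
    | monomial k a ih =>
      have := hW _ ih
      rw [← d.gr_bracket, d.gr_gr] at this
      convert this using 2
      funext x
      simp [pow_succ]; ring
  have : d.gr φ Y = d.gr (fun x => q.eval (x : ℂ)) Y := by
    apply d.loc_injective; ext i j
    rw [d.loc_gr, d.loc_gr, ← hq i j]
  rw [this]; exact key q

/-- The matrices with no components of negative weight. -/
def IsUpper (Y : Mat n) : Prop := ∀ i j, d.ev i < d.ev j → d.loc Y i j = 0

theorem IsUpper.mul {Y Z : Mat n} (hY : d.IsUpper Y) (hZ : d.IsUpper Z) : d.IsUpper (Y * Z) := by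
  intro i j hij
  rw [d.loc_mul, Matrix.mul_apply]
  refine Finset.sum_eq_zero fun k _ => ?_
  rcases lt_or_ge (d.ev i) (d.ev k) with h | h
  · rw [hY i k h, zero_mul]
  · rw [hZ k j (h.trans_lt hij), mul_zero]

theorem isUpper_one : d.IsUpper 1 := by
  intro i j hij
  rw [d.loc_one, Matrix.one_apply_ne]
  rintro rfl; exact lt_irrefl _ hij

/-- The matrices with no components of negative weight, as a subalgebra. -/
def upper : Subalgebra ℂ (Mat n) where
  carrier := {Y | d.IsUpper Y}
  mul_mem' := IsUpper.mul d
  add_mem' := fun {Y Z} hY hZ i j h => by rw [d.loc_add, Matrix.add_apply, hY i j h, hZ i j h, add_zero]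
  algebraMap_mem' c := by
    intro i j h
    rw [Algebra.algebraMap_eq_smul_one, d.loc_smul, Matrix.smul_apply, d.isUpper_one i j h, smul_zero]

theorem isUpper_exp {Y : Mat n} (hY : d.IsUpper Y) : d.IsUpper (NormedSpace.exp Y) := by
  have hcl : IsClosed (d.upper : Set (Mat n)) :=
    Submodule.closed_of_finiteDimensional (Subalgebra.toSubmodule d.upper)
  have h := NormedSpace.exp_series_hasSum_exp' (𝕂 := ℂ) Y
  refine hcl.mem_of_tendsto h (Filter.Eventually.of_forall fun s => ?_)
  exact d.upper.sum_mem fun k _ => d.upper.smul_mem (d.upper.pow_mem hY k) _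

end UDiag

theorem conjTranspose_mem_lieAlg {H : MatGroup n} (hs : IsSelfAdjointGroup H) {Y : Mat n}
    (hY : Y ∈ lieAlg H) : Yᴴ ∈ lieAlg H := by
  intro s
  obtain ⟨g, hg, he⟩ := hY (star s)
  obtain ⟨g', hg', he'⟩ := hs g hg
  refine ⟨g', hg', ?_⟩
  rw [he', he, ← Matrix.exp_conjTranspose]
  simp [Matrix.conjTranspose_smul]

theorem commute_of_commute_exp {Y M : Mat n}
    (h : ∀ s : ℂ, Commute (NormedSpace.exp (s • Y)) M) : Commute Y M := by
  have h1 : HasDerivAt (fun s : ℂ => NormedSpace.exp (s • Y) * M) (Y * M) 0 := by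
    have := (hasDerivAt_exp_smul Y 0).mul_const M
    simpa using! this
  have h2 : HasDerivAt (fun s : ℂ => NormedSpace.exp (s • Y) * M) (M * Y) 0 := by
    have := (hasDerivAt_exp_smul Y 0).const_mul M
    have e : (fun s : ℂ => NormedSpace.exp (s • Y) * M) = fun s => M * NormedSpace.exp (s • Y) :=
      funext fun s => h s
    rw [e]
    simpa using! this
  exact h1.unique h2

theorem IsTorus.commute {T : MatGroup n} (hT : IsTorus T) {s t : GL (Fin n) ℂ} (hs : s ∈ T)
    (ht : t ∈ T) : Commute s t := by
  obtain ⟨S, hS⟩ := hT.2.2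
  have h1 := hS s hs
  have h2 := hS t ht
  have : Commute (S * s * S⁻¹) (S * t * S⁻¹) := by
    apply Units.ext
    rw [Units.val_mul (S * s * S⁻¹), Units.val_mul (S * t * S⁻¹), ← h1.diagonal_diag,
      ← h2.diagonal_diag, Matrix.diagonal_mul_diagonal, Matrix.diagonal_mul_diagonal]
    congr 1; funext i; exact mul_comm _ _
  have h3 : S * (s * t) * S⁻¹ = S * (t * s) * S⁻¹ := by
    have := this.eq
    simpa [mul_assoc] using this
  exact mul_left_cancel (mul_right_cancel h3)

theorem IsTorus.commute_lieAlg {T : MatGroup n} (hT : IsTorus T) {Y : Mat n} (hY : Y ∈ lieAlg T)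
    {t : GL (Fin n) ℂ} (ht : t ∈ T) : Commute Y (t : Mat n) :=
  commute_of_commute_exp fun s =>
    congrArg (Units.val) (hT.commute (mem_lieAlg_iff.1 hY s) ht).eq

theorem IsTorus.commute_lieAlg_lieAlg {T : MatGroup n} (hT : IsTorus T) {Y Z : Mat n}
    (hY : Y ∈ lieAlg T) (hZ : Z ∈ lieAlg T) : Commute Y Z :=
  (commute_of_commute_exp fun s =>
    (hT.commute_lieAlg hY (mem_lieAlg_iff.1 hZ s)).symm).symm

/-- A hermitian matrix with trivial exponential vanishes. -/
theorem eq_zero_of_exp_eq_one {C : Mat n} (hC : Cᴴ = C) (h : NormedSpace.exp C = 1) : C = 0 := by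
  obtain ⟨d⟩ := exists_uDiag hC
  have h1 := d.exp_smul 1
  rw [one_smul, h] at h1
  have h2 := congrArg d.loc h1
  rw [d.loc_one, d.loc_fn] at h2
  apply d.loc_injective
  rw [d.loc_self]
  ext i j
  have h3 := congrFun (congrFun h2 i) i
  simp only [Matrix.one_apply_eq, one_mul, Matrix.diagonal_apply_eq] at h3
  have h4 : d.ev i = 0 := by
    have : Real.exp (d.ev i) = 1 := by exact_mod_cast h3.symm
    simpa using this
  by_cases hij : i = j
  · subst hij; simp [h4, UDiag.loc]
  · simp [hij, UDiag.loc]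

/-- With $c=2\pi i$, the matrix $cA-cA^*$ is hermitian and, as $A$ and $A^*$ commute in the Lie
algebra of the torus, its exponential is $e^{cA}(e^{cA})^*=1$. So it vanishes. -/
theorem cochar_isHermitian {T : MatGroup n} (hT : IsTorus T) (hs : IsSelfAdjointGroup T) {A : Mat n}
    (hA : A ∈ cochar T) : Aᴴ = A := by
  have hstar := conjTranspose_mem_lieAlg hs hA.1
  have hc : Commute A Aᴴ := hT.commute_lieAlg_lieAlg hA.1 hstar
  set c : ℂ := 2 * Real.pi * Complex.I
  have hcs : star c = -c := by
    simp [c]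
  have h1 : NormedSpace.exp (c • A - c • Aᴴ) = 1 := by
    rw [sub_eq_add_neg, Matrix.exp_add_of_commute]
    · have h2 : NormedSpace.exp (-(c • Aᴴ)) = (NormedSpace.exp (c • A))ᴴ := by
        rw [← Matrix.exp_conjTranspose, Matrix.conjTranspose_smul, hcs, neg_smul]
      rw [h2, hA.2]; simp
    · exact ((hc.smul_left c).smul_right c).neg_right
  have h3 := eq_zero_of_exp_eq_one (C := c • A - c • Aᴴ) (by
    rw [Matrix.conjTranspose_sub, Matrix.conjTranspose_smul, Matrix.conjTranspose_smul, hcs]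
    simp [sub_eq_add_neg, add_comm]) h1
  rw [← smul_sub, smul_eq_zero] at h3
  rcases h3 with h3 | h3
  · simp [c, Real.pi_ne_zero, Complex.I_ne_zero] at h3
  · exact (sub_eq_zero.1 h3).symm

theorem span_cochar {T : MatGroup n} (hT : IsTorus T) (hs : IsSelfAdjointGroup T) {θ : Mat n}
    (hθ : θ ∈ Submodule.span ℝ (cochar T)) : θᴴ = θ ∧ θ ∈ lieAlg T := by
  induction hθ using Submodule.span_induction with
  | mem A hA => exact ⟨cochar_isHermitian hT hs hA, hA.1⟩
  | zero => exact ⟨by simp, zero_mem_lieAlg⟩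
  | add x y _ _ hx hy =>
    exact ⟨by rw [Matrix.conjTranspose_add, hx.1, hy.1], hT.1.add_mem_lieAlg hx.2 hy.2⟩
  | smul a x _ hx =>
    have : a • x = (a : ℂ) • x := by ext i j; simp
    rw [this]
    refine ⟨?_, smul_mem_lieAlg hx.2 _⟩
    rw [Matrix.conjTranspose_smul, hx.1]; simp

end Hermitian

/-! ### Parabolic subgroups as groups without negative weights; logarithms of hermitian elements. -/

section Parabolic

open scoped ComplexOrder

variable {n : ℕ}

theorem norm_exp_log_mul (t : ℂ) (x : ℝ) :
    ‖Complex.exp (Complex.log t * x)‖ = Real.exp (x * Real.log ‖t‖) := by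
  rw [Complex.norm_exp]; congr 1; simp [Complex.log_re, mul_comm]

theorem tendsto_log_norm_nhdsNE : Filter.Tendsto (fun t : ℂ => Real.log ‖t‖) (𝓝[≠] 0) Filter.atBot :=
  Real.tendsto_log_nhdsGT_zero.comp (tendsto_norm_nhdsNE_zero)

namespace UDiag

variable {A : Mat n} (d : UDiag A)

/-- The component of weight zero. -/
def lev (Y : Mat n) : Mat n := d.gr (fun x => if x = 0 then 1 else 0) Y

theorem tendsto_iff_loc {ι : Type*} {l : Filter ι} {f : ι → Mat n} {M : Mat n} :
    Filter.Tendsto f l (𝓝 M) ↔ ∀ i j, Filter.Tendsto (fun t => d.loc (f t) i j) l (𝓝 (d.loc M i j)) := by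
  have h1 : Filter.Tendsto f l (𝓝 M) ↔ Filter.Tendsto (fun t => d.loc (f t)) l (𝓝 (d.loc M)) := by
    constructor
    · exact fun h => (d.continuous_loc.tendsto _).comp h
    · intro h
      have := (d.continuous_glob.tendsto _).comp h
      simpa [Function.comp_def] using this
  rw [h1]
  exact ⟨fun h i j => (((continuous_id.matrix_elem i j).tendsto _).comp h), fun h =>
    tendsto_pi_nhds.2 fun i => tendsto_pi_nhds.2 fun j => h i j⟩

/-- In the eigenbasis the $(i,j)$ entry is multiplied by a number of modulus
$\exp((\lambda_i-\lambda_j)\log|t|)$, whatever the branch of the logarithm. Entries of positive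
weight tend to $0$, those of weight zero are fixed, and those of negative weight would blow up. -/
theorem IsUpper.tendsto_lev {Y : Mat n} (hY : d.IsUpper Y) :
    Filter.Tendsto (fun t : ℂ => NormedSpace.exp (Complex.log t • A) * Y *
      NormedSpace.exp (-(Complex.log t • A))) (𝓝[≠] 0) (𝓝 (d.lev Y)) := by
  simp only [d.exp_conj]
  rw [d.tendsto_iff_loc]
  intro i j
  simp only [lev, d.loc_gr]
  rcases lt_trichotomy (d.ev i) (d.ev j) with h | h | h
  · simp [hY i j h]
  · simp [h]
  · have hne : d.ev i - d.ev j ≠ 0 := by linarith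
    rw [if_neg hne]
    refine Filter.Tendsto.mul_const _ ?_
    rw [tendsto_zero_iff_norm_tendsto_zero]
    have h1 : Filter.Tendsto (fun t : ℂ => Real.exp ((d.ev i - d.ev j) * Real.log ‖t‖)) (𝓝[≠] 0)
        (𝓝 0) :=
      Real.tendsto_exp_atBot.comp (tendsto_log_norm_nhdsNE.const_mul_atBot (by linarith))
    refine h1.congr fun t => ?_
    rw [norm_exp_log_mul]

theorem isUpper_of_tendsto {Y M : Mat n}
    (h : Filter.Tendsto (fun t : ℂ => NormedSpace.exp (Complex.log t • A) * Y *
      NormedSpace.exp (-(Complex.log t • A))) (𝓝[≠] 0) (𝓝 M)) : d.IsUpper Y := by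
  simp only [d.exp_conj] at h
  rw [d.tendsto_iff_loc] at h
  intro i j hij
  by_contra hne
  have h1 := (h i j).norm
  simp only [d.loc_gr, norm_mul, norm_exp_log_mul] at h1
  have h2 : Filter.Tendsto (fun t : ℂ => Real.exp ((d.ev i - d.ev j) * Real.log ‖t‖) *
      ‖d.loc Y i j‖) (𝓝[≠] 0) Filter.atTop :=
    (Real.tendsto_exp_atTop.comp
      (tendsto_log_norm_nhdsNE.const_mul_atBot_of_neg (by linarith))).atTop_mul_const
      (norm_pos_iff.2 hne)
  exact not_tendsto_atTop_of_tendsto_nhds h1 h2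

/-- `P = {g ∈ G | g has no components of negative weight}`. -/
def IsParabolicPair (G P : MatGroup n) : Prop := ∀ g, g ∈ P ↔ g ∈ G ∧ d.IsUpper (g : Mat n)

end UDiag

theorem IsParabolic.exists_uDiag {R : ReductiveGroup n} {P : MatGroup n} (h : IsParabolic R P) :
    ∃ A ∈ lieAlg R.T, ∃ d : UDiag A, d.IsParabolicPair R.G P := by
  obtain ⟨A, hA, hP⟩ := h
  obtain ⟨d⟩ := Merohoric.exists_uDiag
    (cochar_isHermitian R.maximalTorus.2.1 R.torus_selfAdjoint hA)
  refine ⟨A, hA.1, d, fun g => (hP g).trans (and_congr_right fun _ => ?_)⟩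
  exact ⟨fun ⟨M, hM⟩ => d.isUpper_of_tendsto hM, fun h => ⟨_, UDiag.IsUpper.tendsto_lev d h⟩⟩

/-- Expanding into monomials gives an exponential sum $\sum_m q_m e^{s\mu_m}$. Its values at natural
numbers are linear combinations of the monoid characters $k\mapsto(e^{\mu})^k$, which are
independent for distinct real $\mu$; so after collecting equal exponents all coefficients vanish. -/
theorem mvPolynomial_eval_exp_eq_zero {σ : Type*} (q : MvPolynomial σ ℂ) (ev : σ → ℝ)
    (h : ∀ k : ℕ, MvPolynomial.eval (fun l => Complex.exp (k * ev l)) q = 0) (s : ℂ) :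
    MvPolynomial.eval (fun l => Complex.exp (s * ev l)) q = 0 := by
  set μ : (σ →₀ ℕ) → ℝ := fun m => ∑ i ∈ m.support, m i * ev i
  have hev : ∀ s : ℂ, MvPolynomial.eval (fun l => Complex.exp (s * ev l)) q =
      ∑ m ∈ q.support, q.coeff m * Complex.exp (s * μ m) := by
    intro s
    rw [MvPolynomial.eval_eq]
    refine Finset.sum_congr rfl fun m _ => ?_
    congr 1
    simp only [μ, Complex.ofReal_sum, Finset.mul_sum, Complex.exp_sum]
    refine Finset.prod_congr rfl fun i _ => ?_
    rw [← Complex.exp_nat_mul]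
    congr 1; push_cast; ring
  set l : ℝ →₀ ℂ := ∑ m ∈ q.support, Finsupp.single (μ m) (q.coeff m)
  have hli : LinearIndependent ℂ (fun x : ℝ => fun k : Multiplicative ℕ =>
      powersHom ℂ (Complex.exp x) k) := by
    have h1 := linearIndependent_monoidHom (Multiplicative ℕ) ℂ
    refine h1.comp (fun x : ℝ => powersHom ℂ (Complex.exp x)) fun x y hxy => ?_
    have := (powersHom ℂ).injective hxy
    exact Real.exp_injective (by exact_mod_cast this)
  have hl : l = 0 := by
    refine linearIndependent_iff.1 hli l ?_
    simp only [l, map_sum, Finsupp.linearCombination_single]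
    funext k
    have := h k.toAdd
    rw [hev] at this
    simp only [Finset.sum_apply, Pi.smul_apply, powersHom_apply, smul_eq_mul, Pi.zero_apply]
    rw [← this]
    refine Finset.sum_congr rfl fun m _ => ?_
    rw [← Complex.exp_nat_mul]
  have h2 := congrArg (Finsupp.linearCombination ℂ fun x : ℝ => Complex.exp (s * x)) hl
  simp only [l, map_sum, Finsupp.linearCombination_single, map_zero, smul_eq_mul] at h2
  rw [hev, h2]

theorem UDiag.fn_apply {A : Mat n} (d : UDiag A) (φ : ℝ → ℂ) (i j : Fin n) :
    d.fn φ i j = ∑ l, d.V i l * φ (d.ev l) * d.Vᴴ l j := by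
  rw [UDiag.fn, UDiag.glob, Matrix.mul_apply]
  simp only [Matrix.mul_diagonal]

/-- A hermitian matrix lies in the Lie algebra of a Zariski closed group as soon as its exponential
lies in the group. -/
theorem IsZariskiClosed.mem_lieAlg_of_exp {H : MatGroup n} (hH : IsZariskiClosed H) {y : Mat n}
    (hy : yᴴ = y) (h : expGL y ∈ H) : y ∈ lieAlg H := by
  obtain ⟨d⟩ := exists_uDiag hy
  obtain ⟨I, hI⟩ := hH
  rw [mem_lieAlg_iff]
  intro s
  rw [hI]
  intro f hf
  set q : MvPolynomial (Fin n) ℂ := MvPolynomial.bind₁ (fun ij : Fin n × Fin n =>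
    ∑ l, MvPolynomial.C (d.V ij.1 l) * MvPolynomial.X l * MvPolynomial.C (d.Vᴴ l ij.2)) f
  have hq : ∀ s : ℂ, MvPolynomial.eval (fun ij => (expGL (s • y) : Mat n) ij.1 ij.2) f =
      MvPolynomial.eval (fun l => Complex.exp (s * d.ev l)) q := by
    intro s
    rw [show MvPolynomial.eval (fun l => Complex.exp (s * d.ev l)) q =
      MvPolynomial.eval (fun ij => MvPolynomial.eval (fun l => Complex.exp (s * d.ev l))
        (∑ l, MvPolynomial.C (d.V ij.1 l) * MvPolynomial.X l * MvPolynomial.C (d.Vᴴ l ij.2))) f from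
      MvPolynomial.eval₂Hom_bind₁ _ _ _ _]
    congr 2
    funext ij
    rw [expGL_coe, d.exp_smul, d.fn_apply]
    simp
  rw [hq]
  -- In the eigenbasis of $y$ an equation of the group along $e^{sy}$ is a polynomial in the
  -- $e^{s\lambda_l}$. It holds at every natural $s=k$, as $e^{ky}=(e^y)^k$ lies in the group.
  refine mvPolynomial_eval_exp_eq_zero q d.ev (fun k => ?_) s
  rw [← hq]
  refine (hI _).1 ?_ f hf
  have : expGL ((k : ℂ) • y) = expGL y ^ k := by
    ext1
    rw [Units.val_pow_eq_pow_val, expGL_coe, expGL_coe, ← Matrix.exp_nsmul, Nat.cast_smul_eq_nsmul]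
  rw [this]
  exact H.pow_mem h k

/-- The positive part `gᴴ g` of an invertible matrix is the exponential of a hermitian matrix. -/
theorem exists_exp_eq_conjTranspose_mul_self (g : GL (Fin n) ℂ) :
    ∃ y : Mat n, yᴴ = y ∧ NormedSpace.exp y = (g : Mat n)ᴴ * (g : Mat n) := by
  set H : Mat n := (g : Mat n)ᴴ * (g : Mat n)
  have hpd : H.PosDef := by
    refine Matrix.PosDef.conjTranspose_mul_self _ ?_
    exact Matrix.mulVec_injective_iff_isUnit.2 g.isUnit
  obtain ⟨d⟩ := exists_uDiag (A := H) hpd.1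
  have hpos : ∀ i, 0 < d.ev i := by
    intro i
    have hloc : (d.loc H).PosDef := by
      have hV : Function.Injective d.V.mulVec := by
        rw [Matrix.mulVec_injective_iff_isUnit, Matrix.isUnit_iff_isUnit_det]
        have h := congrArg Matrix.det d.left
        rw [Matrix.det_mul, Matrix.det_one] at h
        exact IsUnit.of_mul_eq_one_right _ h
      exact hpd.conjTranspose_mul_mul_same hV
    have := hloc.diag_pos (i := i)
    rw [d.loc_self, Matrix.diagonal_apply_eq] at this
    exact_mod_cast this
  set y : Mat n := d.glob (Matrix.diagonal fun i => (Real.log (d.ev i) : ℂ))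
  have hy : yᴴ = y := by
    simp only [y]
    rw [← d.glob_conjTranspose, Matrix.diagonal_conjTranspose]
    congr 2; funext i; simp
  refine ⟨y, hy, ?_⟩
  set d' : UDiag y := ⟨d.V, fun i => Real.log (d.ev i), d.left, d.right, rfl⟩
  have h1 := d'.exp_smul 1
  rw [one_smul] at h1
  rw [h1]
  refine Eq.trans ?_ d.eq.symm
  simp only [UDiag.fn, UDiag.glob, d', one_mul]
  congr 3
  funext i
  rw [← Complex.ofReal_exp, Real.exp_log (hpos i)]

/-- The squared Frobenius norm. -/
def frob (M : Mat n) : ℝ := ∑ i, ∑ j, ‖M i j‖ ^ 2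

theorem frob_eq_trace (M : Mat n) : ((frob M : ℝ) : ℂ) = (Mᴴ * M).trace := by
  simp only [frob, Matrix.trace, Matrix.diag_apply, Matrix.mul_apply, Matrix.conjTranspose_apply]
  rw [Finset.sum_comm]
  push_cast
  refine Finset.sum_congr rfl fun i _ => Finset.sum_congr rfl fun j _ => ?_
  rw [← Complex.conj_mul']; rfl

theorem frob_nonneg (M : Mat n) : 0 ≤ frob M := by unfold frob; positivity

theorem norm_sq_le_frob (M : Mat n) (i j : Fin n) : ‖M i j‖ ^ 2 ≤ frob M := by
  refine le_trans ?_ (Finset.single_le_sum (f := fun i => ∑ j, ‖M i j‖ ^ 2)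
    (fun i _ => by positivity) (Finset.mem_univ i))
  exact Finset.single_le_sum (f := fun j => ‖M i j‖ ^ 2) (fun j _ => by positivity)
    (Finset.mem_univ j)

theorem frob_eq_zero {M : Mat n} (h : frob M = 0) : M = 0 := by
  ext i j
  have := norm_sq_le_frob M i j
  rw [h] at this
  have h2 : ‖M i j‖ ^ 2 = 0 := le_antisymm this (by positivity)
  simpa using h2

theorem continuous_frob : Continuous (frob : Mat n → ℝ) := by
  unfold frob
  refine continuous_finsetSum _ fun i _ => continuous_finsetSum _ fun j _ => ?_
  exact ((continuous_id.matrix_elem i j).norm).pow 2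

theorem hasDerivAt_frob {γ : ℝ → Mat n} {γ' : Mat n} {s : ℝ} (h : HasDerivAt γ γ' s) :
    HasDerivAt (fun s => frob (γ s)) (2 * ((γ s)ᴴ * γ').trace.re) s := by
  have hent : ∀ i j, HasDerivAt (fun s => γ s i j) (γ' i j) s := fun i j =>
    hasDerivAt_pi.1 (hasDerivAt_pi.1 h i) j
  have h1 : HasDerivAt (fun s => frob (γ s)) (∑ i, ∑ j, 2 * inner ℝ (γ s i j) (γ' i j)) s := by
    unfold frob
    exact HasDerivAt.fun_sum fun i _ => HasDerivAt.fun_sum fun j _ => (hent i j).norm_sq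
  convert h1 using 1
  simp only [Matrix.trace, Matrix.diag_apply, Matrix.mul_apply, Matrix.conjTranspose_apply,
    Complex.re_sum, Finset.mul_sum]
  rw [Finset.sum_comm]
  refine Finset.sum_congr rfl fun i _ => Finset.sum_congr rfl fun j _ => ?_
  rw [Complex.inner]
  simp [mul_comm]

end Parabolic

/-! ### The Iwasawa decomposition by a minimum principle. -/

section Iwasawa

variable {n : ℕ}

theorem hasDerivAt_exp_real_smul (Y : Mat n) :
    HasDerivAt (fun t : ℝ => NormedSpace.exp ((t : ℂ) • Y)) Y 0 := by
  have h2 := HasDerivAt.scomp_of_eq (0 : ℝ) (g₁ := fun s : ℂ => NormedSpace.exp (s • Y))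
    (h := fun t : ℝ => (t : ℂ)) (y := 0) (hasDerivAt_exp_smul Y (0 : ℂ))
    (Complex.ofRealCLM.hasDerivAt) (by simp)
  simpa [Function.comp_def] using! h2

theorem UDiag.IsParabolicPair.mem_lieAlg {A : Mat n} {d : UDiag A} {G P : MatGroup n}
    (hP : d.IsParabolicPair G P) {Y : Mat n} (hY : Y ∈ lieAlg G) (hu : d.IsUpper Y) :
    Y ∈ lieAlg P := by
  rw [mem_lieAlg_iff] at *
  intro s
  rw [hP]
  exact ⟨hY s, d.isUpper_exp (d.upper.smul_mem hu s)⟩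

theorem UDiag.isClosed_isUpper {A : Mat n} (d : UDiag A) : IsClosed {M : Mat n | d.IsUpper M} :=
  Submodule.closed_of_finiteDimensional (Subalgebra.toSubmodule d.upper)

/-- A bound on $|k|^2+|k^{-1}|^2$ bounds both the matrix and its inverse, so this function is proper
on the closed coset $gP$ and has a minimum there. -/
theorem exists_frob_minimizer {A : Mat n} {d : UDiag A} {G P : MatGroup n}
    (hG : IsZariskiClosed G) (hP : d.IsParabolicPair G P) {g : GL (Fin n) ℂ} (hg : g ∈ G) :
    ∃ k ∈ G, k⁻¹ * g ∈ P ∧ ∀ q ∈ P,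
      frob ((k⁻¹ : GL (Fin n) ℂ) : Mat n) + frob (k : Mat n) ≤
        frob ((q : Mat n) * ((k⁻¹ : GL (Fin n) ℂ) : Mat n)) +
          frob ((k : Mat n) * ((q⁻¹ : GL (Fin n) ℂ) : Mat n)) := by
  obtain ⟨I, hI⟩ := id hG
  set φ : Mat n × Mat n → ℝ := fun x => frob x.1 + frob x.2
  have hφ : Continuous φ := (continuous_frob.comp continuous_fst).add
    (continuous_frob.comp continuous_snd)
  -- The coset $gP$, recorded by the pairs $(k^{-1},k)$. In this form it is closed in the space of
  -- pairs of matrices, without reference to invertibility.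
  set C : Set (Mat n × Mat n) := {x | x.1 * x.2 = 1 ∧ x.2 * x.1 = 1 ∧ d.IsUpper (x.1 * (g : Mat n)) ∧
    ∀ f ∈ I, MvPolynomial.eval (fun ij => (x.1 * (g : Mat n)) ij.1 ij.2) f = 0}
  have hmem : ∀ x, x ∈ C ↔ ∃ k : GL (Fin n) ℂ, k⁻¹ * g ∈ P ∧
      x = (((k⁻¹ : GL (Fin n) ℂ) : Mat n), (k : Mat n)) := by
    rintro ⟨x, y⟩
    constructor
    · rintro ⟨h1, h2, h3, h4⟩
      refine ⟨⟨y, x, h2, h1⟩, ?_, rfl⟩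
      rw [hP, hI]
      exact ⟨h4, h3⟩
    · rintro ⟨k, hk, he⟩
      obtain ⟨rfl, rfl⟩ := Prod.ext_iff.1 he
      rw [hP, hI] at hk
      exact ⟨k.inv_val, k.val_inv, hk.2, hk.1⟩
  have hCcl : IsClosed C := by
    have c1 : Continuous fun x : Mat n × Mat n => x.1 * (g : Mat n) := by fun_prop
    refine (isClosed_eq (by fun_prop) continuous_const).inter
      ((isClosed_eq (by fun_prop) continuous_const).inter
      ((d.isClosed_isUpper.preimage c1).inter ?_))
    have : IsClosed {x : Mat n × Mat n | ∀ f ∈ I,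
        MvPolynomial.eval (fun ij => (x.1 * (g : Mat n)) ij.1 ij.2) f = 0} := by
      simp only [Set.ofPred_forall]
      exact isClosed_biInter fun f _ =>
        isClosed_eq ((continuous_mvPolynomial_eval_mat f).comp c1) continuous_const
    exact this
  have hgC : (((g⁻¹ : GL (Fin n) ℂ) : Mat n), (g : Mat n)) ∈ C :=
    (hmem _).2 ⟨g, by simp, rfl⟩
  set c := φ (((g⁻¹ : GL (Fin n) ℂ) : Mat n), (g : Mat n))
  have hbd : Bornology.IsBounded {x : Mat n × Mat n | φ x ≤ c} := by
    have hb : ∀ M : Mat n, frob M ≤ c → ∀ i j, ‖M i j‖ ≤ 1 + c := by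
      intro M hM i j
      have h1 := (norm_sq_le_frob M i j).trans hM
      nlinarith [norm_nonneg (M i j), sq_nonneg (‖M i j‖ - 1)]
    have hcpt : IsCompact ({M : Mat n | ∀ i j, ‖M i j‖ ≤ 1 + c}) := by
      have : {M : Mat n | ∀ i j, ‖M i j‖ ≤ 1 + c} =
          Set.pi Set.univ fun _ : Fin n => Set.pi Set.univ fun _ : Fin n =>
            Metric.closedBall (0 : ℂ) (1 + c) := by
        ext M
        exact ⟨fun h i _ j _ => by simpa using h i j, fun h i j => by simpa using h i trivial j trivial⟩
      rw [this]
      exact isCompact_univ_pi fun _ => isCompact_univ_pi fun _ => isCompact_closedBall _ _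
    refine ((hcpt.prod hcpt).isBounded).subset fun x hx => ?_
    have hx' : frob x.1 + frob x.2 ≤ c := hx
    exact ⟨hb _ (by linarith [frob_nonneg x.2]), hb _ (by linarith [frob_nonneg x.1])⟩
  have hcompact : IsCompact (C ∩ {x | φ x ≤ c}) := by
    have : ProperSpace (Mat n) := FiniteDimensional.proper ℂ _
    exact Metric.isCompact_of_isClosed_isBounded
      (hCcl.inter (isClosed_le hφ continuous_const)) (hbd.subset Set.inter_subset_right)
  obtain ⟨x, hx, hmin⟩ := hcompact.exists_isMinOn ⟨_, hgC, le_refl c⟩ hφ.continuousOn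
  obtain ⟨k, hk, rfl⟩ := (hmem x).1 hx.1
  have hkG : k ∈ G := by
    have := ((hP _).1 hk).1
    have h2 := G.mul_mem hg (G.inv_mem this)
    rwa [mul_inv_rev, inv_inv, mul_inv_cancel_left] at h2
  refine ⟨k, hkG, hk, fun q hq => ?_⟩
  have hqC : ((q : Mat n) * ((k⁻¹ : GL (Fin n) ℂ) : Mat n),
      (k : Mat n) * ((q⁻¹ : GL (Fin n) ℂ) : Mat n)) ∈ C := by
    refine (hmem _).2 ⟨k * q⁻¹, ?_, by simp⟩
    have := P.mul_mem hq hk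
    rwa [mul_inv_rev, inv_inv, mul_assoc]
  have key : φ (((k⁻¹ : GL (Fin n) ℂ) : Mat n), (k : Mat n)) ≤
      φ ((q : Mat n) * ((k⁻¹ : GL (Fin n) ℂ) : Mat n),
        (k : Mat n) * ((q⁻¹ : GL (Fin n) ℂ) : Mat n)) := by
    generalize ((q : Mat n) * ((k⁻¹ : GL (Fin n) ℂ) : Mat n),
      (k : Mat n) * ((q⁻¹ : GL (Fin n) ℂ) : Mat n)) = x at hqC
    rcases le_total (φ x) c with h | h
    · exact isMinOn_iff.1 hmin x ⟨hqC, h⟩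
    · exact le_trans hx.2 h
  exact key

/-- The Iwasawa decomposition `G = K P`. -/
theorem exists_parabolic_conjTranspose_mul_self {A : Mat n} {d : UDiag A} {G P : MatGroup n}
    (hG : IsZariskiClosed G) (hs : IsSelfAdjointGroup G) (hA : A ∈ lieAlg G)
    (hP : d.IsParabolicPair G P) {g : GL (Fin n) ℂ} (hg : g ∈ G) :
    ∃ p ∈ P, (g : Mat n)ᴴ * (g : Mat n) = (p : Mat n)ᴴ * (p : Mat n) := by
  obtain ⟨k, hkG, hk, hmin⟩ := exists_frob_minimizer hG hP hg
  set K : Mat n := (k : Mat n) with hK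
  set K' : Mat n := ((k⁻¹ : GL (Fin n) ℂ) : Mat n) with hK'
  have hKK' : K * K' = 1 := k.val_inv
  have hK'K : K' * K = 1 := k.inv_val
  obtain ⟨y, hy, hye⟩ := exists_exp_eq_conjTranspose_mul_self k
  obtain ⟨e⟩ := exists_uDiag hy
  set E : Mat n := K' * K'ᴴ - Kᴴ * K with hE
  have hEs : Eᴴ = E := by simp [hE]
  -- the first variation
  have hvar : ∀ Y ∈ lieAlg P, (Y * E).trace.re = 0 := by
    intro Y hY
    have h1 : HasDerivAt (fun s : ℝ => NormedSpace.exp ((s : ℂ) • Y) * K') (Y * K') 0 := by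
      simpa using! (hasDerivAt_exp_real_smul Y).mul_const K'
    have h2 : HasDerivAt (fun s : ℝ => K * NormedSpace.exp ((s : ℂ) • (-Y))) (K * (-Y)) 0 := by
      simpa using! (hasDerivAt_exp_real_smul (-Y)).const_mul K
    have h3 := (hasDerivAt_frob h1).add (hasDerivAt_frob h2)
    have hmin' : IsLocalMin ((fun s : ℝ => frob (NormedSpace.exp ((s : ℂ) • Y) * K')) +
        fun s : ℝ => frob (K * NormedSpace.exp ((s : ℂ) • (-Y)))) 0 := by
      refine Filter.Eventually.of_forall fun s => ?_
      have := hmin _ (mem_lieAlg_iff.1 hY (s : ℂ))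
      rw [← expGL_neg, ← smul_neg] at this
      simp only [Pi.add_apply, Complex.ofReal_zero, zero_smul, NormedSpace.exp_zero, one_mul, mul_one]
      exact this
    have h4 := hmin'.hasDerivAt_eq_zero h3
    simp only [Complex.ofReal_zero, zero_smul, NormedSpace.exp_zero, one_mul, mul_one, mul_neg,
      Matrix.trace_neg, Complex.neg_re] at h4
    have e1 : (K'ᴴ * (Y * K')).trace = (Y * (K' * K'ᴴ)).trace := by
      rw [Matrix.trace_mul_comm, mul_assoc]
    have e2 : (Kᴴ * (K * Y)).trace = (Y * (Kᴴ * K)).trace := by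
      rw [← mul_assoc, Matrix.trace_mul_comm]
    rw [e1, e2] at h4
    rw [hE, mul_sub, Matrix.trace_sub, Complex.sub_re]
    linarith
  have hyG : y ∈ lieAlg G := by
    refine hG.mem_lieAlg_of_exp hy ?_
    obtain ⟨g', hg', he'⟩ := hs k hkG
    have : expGL y = g' * k := by ext1; rw [Units.val_mul, he', expGL_coe, hye]
    rw [this]; exact G.mul_mem hg' hkG
  have hstab : ∀ Y ∈ hG.lieSubspace, A * Y - Y * A ∈ hG.lieSubspace := fun Y hY =>
    hG.bracket_mem_lieAlg hA hY
  -- The part of $y$ of nonnegative weight lies in $\mathfrak p$, and so does the adjoint of its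
  -- part of negative weight. Since $E$ is hermitian,
  -- $\mathrm{Re}\,\mathrm{tr}(YE)=\mathrm{Re}\,\mathrm{tr}(Y^*E)$, so the first variation
  -- annihilates both parts.
  have htr : (y * E).trace.re = 0 := by
    set y1 := d.gr (fun x => if 0 ≤ x then 1 else 0) y
    set y2 := d.gr (fun x => if x < 0 then 1 else 0) y
    have h12 : y = y1 + y2 := by
      apply d.loc_injective; ext i j
      simp only [y1, y2, d.loc_add, Matrix.add_apply, d.loc_gr]
      by_cases h : 0 ≤ d.ev i - d.ev j
      · rw [if_pos h, if_neg (not_lt.2 h)]; ring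
      · rw [if_neg h, if_pos (not_le.1 h)]; ring
    have hy1 : y1 ∈ lieAlg P := by
      refine hP.mem_lieAlg (d.gr_mem hstab _ hyG) fun i j hij => ?_
      simp only [y1, d.loc_gr]
      rw [if_neg (by linarith), zero_mul]
    have hy2 : y2ᴴ ∈ lieAlg P := by
      refine hP.mem_lieAlg (conjTranspose_mem_lieAlg hs (d.gr_mem hstab _ hyG)) fun i j hij => ?_
      rw [d.loc_conjTranspose, Matrix.conjTranspose_apply]
      simp only [y2, d.loc_gr]
      rw [if_neg (by linarith), zero_mul, star_zero]
    have h2 : (y2 * E).trace.re = (y2ᴴ * E).trace.re := by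
      have : (y2ᴴ * E).trace = star (y2 * E).trace := by
        rw [← Matrix.trace_conjTranspose, Matrix.conjTranspose_mul, hEs, Matrix.trace_mul_comm]
      rw [this]; simp
    rw [h12, add_mul, Matrix.trace_add, Complex.add_re, hvar _ hy1, h2, hvar _ hy2, add_zero]
  -- `E` in the eigenbasis of `y`
  have hE1 : Kᴴ * K = e.fn fun x => Complex.exp x := by
    rw [← hye]; simpa using e.exp_smul 1
  have hE2 : K' * K'ᴴ = e.fn fun x => Complex.exp (-x) := by
    have h1 : (K' * K'ᴴ) * (Kᴴ * K) = 1 := by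
      calc _ = K' * (K * K')ᴴ * K := by rw [Matrix.conjTranspose_mul]; simp only [mul_assoc]
        _ = 1 := by rw [hKK']; simp [hK'K]
    have h2 : (Kᴴ * K) * (e.fn fun x => Complex.exp (-x)) = 1 := by
      rw [hE1, e.fn_mul]
      simp only [← Complex.exp_add, add_neg_cancel, Complex.exp_zero]
      simp [UDiag.fn]
    exact left_inv_eq_right_inv h1 h2
  -- $E$ is diagonal with entries $e^{-\lambda}-e^{\lambda}$ in the eigenbasis of $y$. Each summand
  -- $\lambda(e^{-\lambda}-e^{\lambda})$ is $\le 0$ and vanishes only for $\lambda=0$; the vanishing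
  -- of the sum makes the minimiser unitary.
  have htr2 : (y * E).trace = ((∑ i, e.ev i * (Real.exp (-(e.ev i)) - Real.exp (e.ev i)) : ℝ) : ℂ) := by
    rw [← e.trace_loc, e.loc_mul, hE, e.loc_sub, hE1, hE2, e.loc_fn, e.loc_fn, e.loc_self,
      Matrix.diagonal_sub, Matrix.diagonal_mul_diagonal, Matrix.trace_diagonal]
    push_cast
    rfl
  rw [htr2, Complex.ofReal_re] at htr
  have hterm : ∀ i, e.ev i * (Real.exp (-(e.ev i)) - Real.exp (e.ev i)) ≤ 0 := by
    intro i
    rcases le_total 0 (e.ev i) with h | h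
    · exact mul_nonpos_of_nonneg_of_nonpos h (sub_nonpos.2 (Real.exp_le_exp.2 (by linarith)))
    · exact mul_nonpos_of_nonpos_of_nonneg h (sub_nonneg.2 (Real.exp_le_exp.2 (by linarith)))
  have hev : ∀ i, e.ev i = 0 := by
    intro i
    have := (Finset.sum_eq_zero_iff_of_nonpos (fun i _ => hterm i)).1 htr i (Finset.mem_univ i)
    rcases mul_eq_zero.1 this with h | h
    · exact h
    · have := Real.exp_injective (sub_eq_zero.1 h); linarith
  have hone : Kᴴ * K = 1 := by
    rw [hE1, UDiag.fn]; simp [hev]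
  refine ⟨_, hk, ?_⟩
  have hgk : (g : Mat n) = K * ((k⁻¹ * g : GL (Fin n) ℂ) : Mat n) := by
    rw [Units.val_mul, ← mul_assoc, hKK', one_mul]
  calc (g : Mat n)ᴴ * (g : Mat n) = ((k⁻¹ * g : GL (Fin n) ℂ) : Mat n)ᴴ * (Kᴴ * K) *
        ((k⁻¹ * g : GL (Fin n) ℂ) : Mat n) := by
        conv_lhs => rw [hgk]
        rw [Matrix.conjTranspose_mul]; simp only [mul_assoc]
    _ = _ := by rw [hone, mul_one]

end Iwasawa

/-! ### Algebraic characters: differentials, and absolute value on unitary elements. -/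

section Characters

variable {n : ℕ}

/-- A matrix entry as a continuous linear form. -/
def entryCLM (i j : Fin n) : Mat n →L[ℂ] ℂ := (Matrix.entryLinearMap ℂ ℂ i j).toContinuousLinearMap

theorem contDiff_det (m : WithTop ℕ∞) : ContDiff ℂ m fun M : Mat n => M.det := by
  simp only [Matrix.det_apply']
  refine ContDiff.sum fun σ _ => contDiff_const.mul (contDiff_prod fun i _ => ?_)
  exact (entryCLM (σ i) i).contDiff

theorem charEval_coe {H : MatGroup n} (χ : H →* ℂˣ) (p : H) :
    charEval χ ((p : GL (Fin n) ℂ) : Mat n) = ((χ p : ℂˣ) : ℂ) := by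
  have h : ∃ q : H, ((q : GL (Fin n) ℂ) : Mat n) = ((p : GL (Fin n) ℂ) : Mat n) := ⟨p, rfl⟩
  unfold charEval
  rw [dif_pos h]
  have : h.choose = p := Subtype.ext (Units.ext h.choose_spec)
  rw [this]

theorem differentiable_mvPolynomial_eval_mat (f : MvPolynomial (Fin n × Fin n) ℂ) :
    Differentiable ℂ fun M : Mat n => MvPolynomial.eval (fun ij => M ij.1 ij.2) f := by
  rw [← differentiableOn_univ]
  refine differentiable_mvPolynomial_eval f fun ij => Differentiable.differentiableOn ?_
  exact (entryCLM ij.1 ij.2).differentiable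

/-- An algebraic character is the restriction of a rational function. -/
theorem IsAlgChar.exists_rational {P : MatGroup n} {χ : P →* ℂˣ} (h : IsAlgChar χ) :
    ∃ (f : MvPolynomial (Fin n × Fin n) ℂ) (k : ℕ), ∀ p : P, ((χ p : ℂˣ) : ℂ) =
      MvPolynomial.eval (fun ij => toMat p ij.1 ij.2) f / (toMat p).det ^ k := by
  obtain ⟨f, k, hf⟩ := h
  refine ⟨f, k, fun p => ?_⟩
  rw [eq_div_iff]
  · exact hf p
  · exact pow_ne_zero _ (((Matrix.isUnit_iff_isUnit_det _).1 (p : GL (Fin n) ℂ).isUnit).ne_zero)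

/-- The derivative of a character. -/
def dchar {H : MatGroup n} (χ : H →* ℂˣ) (Y : Mat n) : ℂ :=
  deriv (fun s : ℂ => charEval χ (NormedSpace.exp (s • Y))) 0

theorem pairing_eq {H : MatGroup n} (χ : H →* ℂˣ) (Y : Mat n) : pairing Y χ = (dchar χ Y).re := rfl

theorem IsAlgChar.exists_differentiableAt {P : MatGroup n} {χ : P →* ℂˣ} (h : IsAlgChar χ) :
    ∃ F : Mat n → ℂ, (∀ p : P, F (toMat p) = ((χ p : ℂˣ) : ℂ)) ∧
      ∀ M : Mat n, M.det ≠ 0 → DifferentiableAt ℂ F M := by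
  obtain ⟨f, k, hf⟩ := h.exists_rational
  refine ⟨fun M => MvPolynomial.eval (fun ij => M ij.1 ij.2) f / M.det ^ k, fun p => (hf p).symm,
    fun M hM => ?_⟩
  have h1 : DifferentiableAt ℂ (fun M : Mat n => M.det ^ k) M :=
    ((contDiff_det 1).differentiable one_ne_zero M).fun_pow k
  exact (differentiable_mvPolynomial_eval_mat f M).mul (h1.inv (pow_ne_zero _ hM))

/-- The element `exp Y` of a group, for `Y` in its Lie algebra. -/
def expIn {H : MatGroup n} {Y : Mat n} (hY : Y ∈ lieAlg H) (s : ℂ) : H :=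
  ⟨expGL (s • Y), mem_lieAlg_iff.1 hY s⟩

/-- A rational extension $F$ of $\chi$ is differentiable at $1$, and $dF_1$ is the linear form.
Along a one-parameter subgroup $\chi$ is multiplicative and differentiable, hence solves $f'=cf$ and
is an exponential. -/
theorem IsAlgChar.exists_linear {P : MatGroup n} {χ : P →* ℂˣ} (h : IsAlgChar χ) :
    ∃ ℓ : Mat n →ₗ[ℂ] ℂ, ∀ Y (hY : Y ∈ lieAlg P), dchar χ Y = ℓ Y ∧
      ∀ s : ℂ, ((χ (expIn hY s) : ℂˣ) : ℂ) = Complex.exp (s * ℓ Y) := by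
  obtain ⟨F, hF, hd⟩ := h.exists_differentiableAt
  refine ⟨(fderiv ℂ F 1 : Mat n →L[ℂ] ℂ), fun Y hY => ?_⟩
  set f : ℂ → ℂ := fun s => ((χ (expIn hY s) : ℂˣ) : ℂ) with hf
  have hfF : f = fun s => F (NormedSpace.exp (s • Y)) := by
    funext s; exact (hF (expIn hY s)).symm
  have hchar : (fun s : ℂ => charEval χ (NormedSpace.exp (s • Y))) = f := by
    funext s; exact charEval_coe χ (expIn hY s)
  have hadd : ∀ s t, f (s + t) = f s * f t := by
    intro s t
    have : expIn hY (s + t) = expIn hY s * expIn hY t := by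
      apply Subtype.ext
      show expGL ((s + t) • Y) = expGL (s • Y) * expGL (t • Y)
      rw [add_smul, expGL_add (((Commute.refl Y).smul_left s).smul_right t)]
    simp only [hf, this, map_mul, Units.val_mul]
  have h0 : HasDerivAt f (fderiv ℂ F 1 Y) 0 := by
    rw [hfF]
    have h1 : HasFDerivAt F (fderiv ℂ F 1) (NormedSpace.exp ((0 : ℂ) • Y)) := by
      rw [zero_smul, NormedSpace.exp_zero]
      exact (hd 1 (by simp)).hasFDerivAt
    have h2 := h1.comp_hasDerivAt (0 : ℂ) (hasDerivAt_exp_smul Y 0)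
    simpa using! h2
  have hderiv : ∀ s, HasDerivAt f (f s * fderiv ℂ F 1 Y) s := by
    intro s
    have h1 : HasDerivAt (fun t => f s * f (t - s)) (f s * fderiv ℂ F 1 Y) s := by
      have h2 : HasDerivAt (fun t => f (t - s)) (fderiv ℂ F 1 Y) s := by
        have := h0
        rw [← sub_self s] at this
        exact this.comp_sub_const s s
      exact h2.const_mul _
    have h3 : (fun t => f s * f (t - s)) = f := by
      funext t; rw [← hadd]; congr 1; ring
    rwa [h3] at h1
  have hf0 : f 0 = 1 := by
    have : expIn hY 0 = 1 := Subtype.ext (by show expGL ((0 : ℂ) • Y) = 1; simp)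
    simp [hf, this]
  refine ⟨?_, fun s => ?_⟩
  · rw [dchar, hchar, h0.deriv]; rfl
  · set c : ℂ := fderiv ℂ F 1 Y
    have hconst : ∀ s, HasDerivAt (fun s => f s * Complex.exp (-(s * c))) 0 s := by
      intro s
      have h1 : HasDerivAt (fun s => Complex.exp (-(s * c))) (Complex.exp (-(s * c)) * (-(1 * c))) s :=
        ((hasDerivAt_id s).mul_const c).neg.cexp
      refine ((hderiv s).fun_mul h1).congr_deriv ?_
      ring
    have h2 := is_const_of_deriv_eq_zero (f := fun s => f s * Complex.exp (-(s * c)))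
      (fun s => (hconst s).differentiableAt) (fun s => (hconst s).deriv) s 0
    simp only [hf0, zero_mul, neg_zero, Complex.exp_zero, mul_one] at h2
    show f s = Complex.exp (s * c)
    rw [Complex.exp_neg] at h2
    exact (mul_inv_eq_one₀ (Complex.exp_ne_zero _)).1 h2

theorem norm_apply_le_one_of_unitary {M : Mat n} (h : Mᴴ * M = 1) (i j : Fin n) : ‖M i j‖ ≤ 1 := by
  have h1 := congrFun (congrFun h j) j
  rw [Matrix.mul_apply, Matrix.one_apply_eq] at h1
  have h2 : ∑ k, ‖M k j‖ ^ 2 = 1 := by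
    have : ((∑ k, ‖M k j‖ ^ 2 : ℝ) : ℂ) = 1 := by
      rw [← h1]; push_cast
      refine Finset.sum_congr rfl fun k _ => ?_
      rw [← Complex.conj_mul']; rfl
    exact_mod_cast this
  have h3 : ‖M i j‖ ^ 2 ≤ 1 := by
    rw [← h2]
    exact Finset.single_le_sum (f := fun k => ‖M k j‖ ^ 2) (fun k _ => by positivity)
      (Finset.mem_univ i)
  nlinarith [norm_nonneg (M i j)]

theorem exists_bound_mvPolynomial (f : MvPolynomial (Fin n × Fin n) ℂ) (C : ℝ) :
    ∃ B, ∀ M : Mat n, (∀ i j, ‖M i j‖ ≤ C) → ‖MvPolynomial.eval (fun ij => M ij.1 ij.2) f‖ ≤ B := by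
  have hK : IsCompact (Set.pi Set.univ fun _ : Fin n × Fin n => Metric.closedBall (0 : ℂ) C) :=
    isCompact_univ_pi fun _ => isCompact_closedBall _ _
  obtain ⟨B, hB⟩ := hK.exists_bound_of_continuousOn (MvPolynomial.continuous_eval f).continuousOn
  refine ⟨B, fun M hM => hB _ fun ij _ => ?_⟩
  simpa using hM ij.1 ij.2

theorem norm_det_of_unitary {M : Mat n} (h : Mᴴ * M = 1) : ‖M.det‖ = 1 := by
  have h1 := congrArg Matrix.det h
  rw [Matrix.det_mul, Matrix.det_conjTranspose, Matrix.det_one] at h1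
  have h2 : ‖M.det‖ ^ 2 = 1 := by
    have := congrArg norm h1
    rw [norm_mul, norm_star, norm_one] at this
    rw [sq]; exact this
  nlinarith [norm_nonneg M.det]

/-- Algebraic characters have absolute value one on unitary elements. -/
theorem IsAlgChar.norm_eq_one_of_unitary {P : MatGroup n} {χ : P →* ℂˣ} (h : IsAlgChar χ) {k : P}
    (hk : (toMat k)ᴴ * toMat k = 1) : ‖((χ k : ℂˣ) : ℂ)‖ = 1 := by
  obtain ⟨f, m, hf⟩ := h.exists_rational
  obtain ⟨B, hB⟩ := exists_bound_mvPolynomial f 1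
  -- Unitary matrices have bounded entries and determinant of modulus one, so a rational expression
  -- for $\chi$ is bounded on them. Applied to all powers of $k$ this forces $|\chi(k)|\le1$; the
  -- inverse gives the other inequality.
  have key : ∀ k : P, (toMat k)ᴴ * toMat k = 1 → ‖((χ k : ℂˣ) : ℂ)‖ ≤ 1 := by
    intro k hk
    have hu : ∀ j : ℕ, (toMat (k ^ j))ᴴ * toMat (k ^ j) = 1 := by
      intro j
      induction j with
      | zero => simp [toMat]
      | succ j ih =>
        have e : toMat (k ^ (j + 1)) = toMat (k ^ j) * toMat k := by simp [toMat, pow_succ]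
        rw [e, Matrix.conjTranspose_mul, mul_assoc, ← mul_assoc (toMat (k ^ j))ᴴ, ih, one_mul, hk]
    by_contra hlt
    obtain ⟨j, hj⟩ := pow_unbounded_of_one_lt B (not_le.1 hlt)
    have h1 := hf (k ^ j)
    have h2 : ‖((χ (k ^ j) : ℂˣ) : ℂ)‖ ≤ B := by
      rw [h1, norm_div, norm_pow, norm_det_of_unitary (hu j), one_pow, div_one]
      exact hB _ (norm_apply_le_one_of_unitary (hu j))
    rw [map_pow, Units.val_pow_eq_pow_val, norm_pow] at h2
    linarith
  refine le_antisymm (key k hk) ?_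
  have hk' : (toMat k⁻¹)ᴴ * toMat k⁻¹ = 1 := by
    have e1 : toMat k * toMat k⁻¹ = 1 := by simp [toMat]
    have e2 : toMat k⁻¹ = (toMat k)ᴴ := (left_inv_eq_right_inv hk e1).symm
    rw [e2, Matrix.conjTranspose_conjTranspose, ← e2, e1]
  have h2 := key _ hk'
  rw [map_inv, Units.val_inv_eq_inv_val, norm_inv] at h2
  exact (inv_le_one₀ (by simp)).1 h2

end Characters

/-! ### Common eigenvectors of a torus, and vectors $\alpha$ with
$[[\alpha,\alpha^*],\alpha]=M\alpha$. -/

section Coroots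

variable {n : ℕ}

/-- Conjugation by an invertible matrix. -/
def conjLin (t : GL (Fin n) ℂ) : Mat n →ₗ[ℂ] Mat n :=
  LinearMap.mulLeft ℂ (t : Mat n) ∘ₗ LinearMap.mulRight ℂ ((t⁻¹ : GL (Fin n) ℂ) : Mat n)

theorem conjLin_apply (t : GL (Fin n) ℂ) (Y : Mat n) :
    conjLin t Y = (t : Mat n) * Y * ((t⁻¹ : GL (Fin n) ℂ) : Mat n) := by
  simp [conjLin, mul_assoc]

theorem conjLin_mul (s t : GL (Fin n) ℂ) (Y : Mat n) : conjLin (s * t) Y = conjLin s (conjLin t Y) := by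
  simp only [conjLin_apply, mul_inv_rev, Units.val_mul, mul_assoc]

theorem conjLin_one (Y : Mat n) : conjLin 1 Y = Y := by simp [conjLin_apply]

/-- A commutative group acting on a nonzero space of matrices by conjugation has a common
eigenvector. -/
theorem exists_common_eigenvector {T : MatGroup n} (hc : ∀ s ∈ T, ∀ t ∈ T, Commute s t) :
    ∀ (k : ℕ) (W : Submodule ℂ (Mat n)), Module.finrank ℂ W = k → W ≠ ⊥ →
      (∀ t ∈ T, ∀ Y ∈ W, conjLin t Y ∈ W) →
      ∃ (r : T →* ℂˣ) (Y : Mat n), Y ∈ W ∧ Y ≠ 0 ∧ ∀ t : T, conjLin (t : GL (Fin n) ℂ) Y = ((r t : ℂˣ) : ℂ) • Y := by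
  intro k
  induction k using Nat.strong_induction_on with
  | _ k ih =>
  intro W hk hne hW
  by_cases hscal : ∀ t : T, ∃ c : ℂ, ∀ Y ∈ W, conjLin (t : GL (Fin n) ℂ) Y = c • Y
  · choose c hcY using hscal
    obtain ⟨Y, hY, hY0⟩ := (Submodule.ne_bot_iff W).1 hne
    have hmul : ∀ s t : T, c (s * t) = c s * c t := by
      intro s t
      have h1 := hcY (s * t) Y hY
      rw [Subgroup.coe_mul, conjLin_mul, hcY t Y hY, map_smul, hcY s Y hY, smul_smul] at h1
      have := smul_left_injective ℂ hY0 h1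
      rw [← this]; ring
    have hone : c 1 = 1 := by
      have h1 := hcY 1 Y hY
      rw [Subgroup.coe_one, conjLin_one] at h1
      have h2 : (1 : ℂ) • Y = c 1 • Y := by rw [one_smul]; exact h1
      exact (smul_left_injective ℂ hY0 h2).symm
    exact ⟨MonoidHom.toHomUnits ⟨⟨c, hone⟩, hmul⟩, Y, hY, hY0, fun t => hcY t Y hY⟩
  -- If some $t$ is not a scalar on $W$, an eigenspace of $t$ in $W$ is nonzero, proper, and stable
  -- under the commutative group; induction on the dimension applies to it.
  · push Not at hscal
    obtain ⟨t, ht⟩ := hscal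
    have hWt : ∀ Y ∈ W, conjLin (t : GL (Fin n) ℂ) Y ∈ W := hW t t.2
    have : Nontrivial W := Submodule.nontrivial_iff_ne_bot.2 hne
    obtain ⟨μ, hμ⟩ := Module.End.exists_eigenvalue ((conjLin (t : GL (Fin n) ℂ)).restrict hWt)
    obtain ⟨v, hv⟩ := hμ.exists_hasEigenvector
    set W' : Submodule ℂ (Mat n) :=
      W ⊓ LinearMap.ker (conjLin (t : GL (Fin n) ℂ) - μ • LinearMap.id) with hW'
    have hmem : ∀ Y, Y ∈ W' ↔ Y ∈ W ∧ conjLin (t : GL (Fin n) ℂ) Y = μ • Y := by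
      intro Y; simp [hW', sub_eq_zero]
    have hlt : W' < W := by
      refine lt_of_le_of_ne inf_le_left fun heq => ?_
      obtain ⟨Y, hY, hne'⟩ := ht μ
      rw [← heq] at hY
      exact hne' ((hmem Y).1 hY).2
    have hne' : W' ≠ ⊥ := by
      rw [Submodule.ne_bot_iff]
      refine ⟨v, (hmem _).2 ⟨v.2, ?_⟩, fun h => hv.2 (Subtype.ext h)⟩
      have := congrArg Subtype.val hv.apply_eq_smul
      simpa using this
    obtain ⟨r, Y, hY, hY0, hr⟩ := ih _ (hk ▸ Submodule.finrank_lt_finrank_of_lt hlt) W' rfl hne' (by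
      intro s hs Y hY
      rw [hmem] at hY ⊢
      refine ⟨hW s hs Y hY.1, ?_⟩
      rw [← conjLin_mul, ← (hc s hs t t.2).eq, conjLin_mul, hY.2, map_smul])
    exact ⟨r, Y, ((hmem Y).1 hY).1, hY0, hr⟩

/-- The commutator of a matrix with its adjoint. -/
def selfComm (α : Mat n) : Mat n := α * αᴴ - αᴴ * α

theorem selfComm_conjTranspose (α : Mat n) : (selfComm α)ᴴ = selfComm α := by simp [selfComm]

theorem frob_smul (c : ℂ) (M : Mat n) : frob (c • M) = ‖c‖ ^ 2 * frob M := by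
  simp only [frob, Matrix.smul_apply, smul_eq_mul, norm_mul, mul_pow, Finset.mul_sum]

/-- A space of matrices closed under `α ↦ [[α, αᴴ], α]` and without nonzero normal elements contains
an eigenvector of this operation. -/
theorem exists_selfComm_eigenvector {V : Submodule ℂ (Mat n)} (hne : V ≠ ⊥)
    (hcl : ∀ α ∈ V, selfComm α * α - α * selfComm α ∈ V)
    (hnn : ∀ α ∈ V, selfComm α = 0 → α = 0) :
    ∃ α ∈ V, α ≠ 0 ∧ ∃ M : ℝ, 0 < M ∧ selfComm α * α - α * selfComm α = (M : ℂ) • α := by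
  have hfc : Continuous fun α : Mat n => frob (selfComm α) := by
    refine continuous_frob.comp ?_
    unfold selfComm
    fun_prop
  have hcompact : IsCompact ((V : Set (Mat n)) ∩ {α | frob α = 1}) := by
    have : ProperSpace (Mat n) := FiniteDimensional.proper ℂ _
    refine Metric.isCompact_of_isClosed_isBounded
      ((Submodule.closed_of_finiteDimensional V).inter (isClosed_eq continuous_frob continuous_const)) ?_
    have hcpt : IsCompact (Set.pi Set.univ fun _ : Fin n => Set.pi Set.univ fun _ : Fin n =>
            Metric.closedBall (0 : ℂ) 1) :=
      isCompact_univ_pi fun _ => isCompact_univ_pi fun _ => isCompact_closedBall _ _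
    refine Bornology.IsBounded.subset (t := {M : Mat n | M ∈ (Set.pi Set.univ fun _ : Fin n => Set.pi Set.univ fun _ : Fin n =>
            Metric.closedBall (0 : ℂ) 1)}) (IsCompact.isBounded hcpt) ?_
    rintro α ⟨-, hα⟩ i - j -
    have h1 := norm_sq_le_frob α i j
    have hα' : frob α = 1 := hα
    rw [hα'] at h1
    have : ‖α i j‖ ≤ 1 := by nlinarith [norm_nonneg (α i j)]
    simpa using this
  have hscale : ∀ α ∈ V, α ≠ 0 → ∃ β ∈ V, frob β = 1 ∧
      frob (selfComm α) = frob α ^ 2 * frob (selfComm β) := by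
    intro α hα h0
    have hpos : 0 < frob α := lt_of_le_of_ne (frob_nonneg α) fun h => h0 (frob_eq_zero h.symm)
    set c : ℂ := ((Real.sqrt (frob α) : ℝ) : ℂ) with hcdef
    have hsq : 0 < Real.sqrt (frob α) := Real.sqrt_pos.2 hpos
    have hc0 : c ≠ 0 := by rw [hcdef]; exact_mod_cast hsq.ne'
    have hcn : ‖c‖ ^ 2 = frob α := by
      rw [hcdef, Complex.norm_real, Real.norm_of_nonneg hsq.le, Real.sq_sqrt hpos.le]
    have hcs : star c = c := by simp [hcdef]
    refine ⟨c⁻¹ • α, V.smul_mem _ hα, ?_, ?_⟩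
    · rw [frob_smul, norm_inv, inv_pow, hcn, inv_mul_cancel₀ hpos.ne']
    · have h2 : selfComm α = (c * c) • selfComm (c⁻¹ • α) := by
        simp only [selfComm, Matrix.conjTranspose_smul, Matrix.smul_mul, Matrix.mul_smul, star_inv₀,
          hcs, smul_smul, ← smul_sub]
        rw [show c * c * (c⁻¹ * c⁻¹) = 1 by field_simp, one_smul]
      rw [h2, frob_smul, norm_mul, ← sq, hcn]
  obtain ⟨v, hv, hv0⟩ := (Submodule.ne_bot_iff V).1 hne
  obtain ⟨β, hβ, hβ1, -⟩ := hscale v hv hv0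
  obtain ⟨α, ⟨hαV, hα1⟩, hmax⟩ := hcompact.exists_isMaxOn ⟨β, hβ, hβ1⟩ hfc.continuousOn
  have hα1 : frob α = 1 := hα1
  set M : ℝ := frob (selfComm α)
  have hα0 : α ≠ 0 := by
    rintro rfl
    simp [frob] at hα1
  have hMpos : 0 < M := by
    refine lt_of_le_of_ne (frob_nonneg _) fun h => hα0 (hnn α hαV (frob_eq_zero h.symm))
  -- Both sides are homogeneous of degree four in $\beta$, so the bound on the unit sphere holds on
  -- all of $V$.
  have hineq : ∀ β ∈ V, frob (selfComm β) ≤ M * frob β ^ 2 := by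
    intro β hβ
    by_cases h0 : β = 0
    · subst h0; simp [selfComm, frob]
    obtain ⟨γ, hγ, hγ1, he⟩ := hscale β hβ h0
    rw [he, mul_comm M]
    exact mul_le_mul_of_nonneg_left (isMaxOn_iff.1 hmax γ ⟨hγ, hγ1⟩) (sq_nonneg _)
  refine ⟨α, hαV, hα0, M, hMpos, ?_⟩
  set B := selfComm α with hB
  have hBs : Bᴴ = B := selfComm_conjTranspose α
  -- The defect of the desired equation. It lies in $V$, and it is itself chosen as the direction of
  -- variation: the condition for a critical point then reads $|\delta|^2=0$.
  set δ : Mat n := B * α - α * B - (M : ℂ) • α with hδ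
  have hδV : δ ∈ V := V.sub_mem (hcl α hαV) (V.smul_mem _ hαV)
  have hd1 : HasDerivAt (fun s : ℝ => α + (s : ℂ) • δ) δ 0 := by
    exact (((Complex.ofRealCLM.hasDerivAt (x := 0)).smul_const δ).const_add α).congr_deriv
      (by simp)
  have hd2 : HasDerivAt (fun s : ℝ => αᴴ + (s : ℂ) • δᴴ) δᴴ 0 := by
    exact (((Complex.ofRealCLM.hasDerivAt (x := 0)).smul_const δᴴ).const_add αᴴ).congr_deriv
      (by simp)
  have hstar : ∀ s : ℝ, (α + (s : ℂ) • δ)ᴴ = αᴴ + (s : ℂ) • δᴴ := by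
    intro s; simp [Matrix.conjTranspose_smul]
  have hdB : HasDerivAt (fun s : ℝ => selfComm (α + (s : ℂ) • δ))
      (δ * αᴴ + α * δᴴ - (δᴴ * α + αᴴ * δ)) 0 := by
    simp only [selfComm, hstar]
    have h := (hd1.fun_mul hd2).fun_sub (hd2.fun_mul hd1)
    simpa using! h
  have hd3 := hasDerivAt_frob hd1
  have hd4 := hasDerivAt_frob hdB
  have hd5 := ((hd3.fun_pow 2).const_mul M).fun_sub hd4
  -- The homogeneous inequality replaces a Lagrange multiplier: $M|\beta|^4-|[\beta,\beta^*]|^2$ is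
  -- nonnegative on $V$ and vanishes at $\alpha$.
  have hmin : IsLocalMin (fun s : ℝ => M * frob (α + (s : ℂ) • δ) ^ 2 -
      frob (selfComm (α + (s : ℂ) • δ))) 0 := by
    refine Filter.Eventually.of_forall fun s => ?_
    have h1 := hineq _ (V.add_mem hαV (V.smul_mem (s : ℂ) hδV))
    simp only [Complex.ofReal_zero, zero_smul, add_zero, hα1]
    have h2 : frob (selfComm α) = M := rfl
    rw [h2]
    linarith
  have h0 := hmin.hasDerivAt_eq_zero hd5
  simp only [Complex.ofReal_zero, zero_smul, add_zero, hα1, ← hB, hBs] at h0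
  have e1 : (B * (α * δᴴ - δᴴ * α)).trace = (δᴴ * (B * α - α * B)).trace := by
    simp only [mul_sub, Matrix.trace_sub]
    congr 1
    · rw [← mul_assoc, Matrix.trace_mul_comm]
    · rw [← mul_assoc, Matrix.trace_mul_comm, ← mul_assoc, Matrix.trace_mul_comm]
  have e2 : (B * (δ * αᴴ - αᴴ * δ)).trace.re = (B * (α * δᴴ - δᴴ * α)).trace.re := by
    have : (B * (δ * αᴴ - αᴴ * δ)).trace = star (B * (α * δᴴ - δᴴ * α)).trace := by
      rw [← Matrix.trace_conjTranspose, Matrix.conjTranspose_mul, Matrix.trace_mul_comm, hBs]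
      simp
    rw [this]; simp
  have e3 : (B * (δ * αᴴ + α * δᴴ - (δᴴ * α + αᴴ * δ))).trace.re =
      2 * (δᴴ * (B * α - α * B)).trace.re := by
    rw [← e1]
    have : δ * αᴴ + α * δᴴ - (δᴴ * α + αᴴ * δ) = (δ * αᴴ - αᴴ * δ) + (α * δᴴ - δᴴ * α) := by abel
    rw [this, mul_add, Matrix.trace_add, Complex.add_re, e2]; ring
  have e4 : (αᴴ * δ).trace.re = (δᴴ * α).trace.re := by
    have : (αᴴ * δ).trace = star (δᴴ * α).trace := by
      rw [← Matrix.trace_conjTranspose, Matrix.conjTranspose_mul, Matrix.conjTranspose_conjTranspose]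
    rw [this]; simp
  rw [e3, e4] at h0
  have h1 : frob δ = 0 := by
    have h2 : frob δ = (δᴴ * δ).trace.re := by rw [← frob_eq_trace]; simp
    have h3 : (δᴴ * δ).trace.re = (δᴴ * (B * α - α * B)).trace.re - M * (δᴴ * α).trace.re := by
      conv_lhs => rw [hδ, mul_sub, ← hδ]
      rw [Matrix.trace_sub, Matrix.mul_smul, Matrix.trace_smul]
      simp
    rw [h2, h3]
    norm_num at h0
    linarith
  exact sub_eq_zero.1 (frob_eq_zero h1)

end Coroots

/-! ### The Levi algebra and the element dual to a character. -/

section Levi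

variable {n : ℕ}

namespace UDiag

variable {A : Mat n} (d : UDiag A)

theorem loc_eq_zero_of_commute {Y : Mat n} (h : Commute A Y) {i j : Fin n} (hij : d.ev i ≠ d.ev j) :
    d.loc Y i j = 0 := by
  have h1 : d.gr (fun x => (x : ℂ)) Y = 0 := by rw [d.gr_bracket, h.eq, sub_self]
  have h2 := d.loc_gr (fun x => (x : ℂ)) Y i j
  rw [h1] at h2
  have h3 : ((d.ev i - d.ev j : ℝ) : ℂ) * d.loc Y i j = 0 := by rw [← h2]; simp [loc]
  rcases mul_eq_zero.1 h3 with h4 | h4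
  · exact absurd (sub_eq_zero.1 (by exact_mod_cast h4)) hij
  · exact h4

theorem isUpper_of_commute {Y : Mat n} (h : Commute A Y) : d.IsUpper Y := fun _ _ hij =>
  d.loc_eq_zero_of_commute h hij.ne

theorem commute_fn_of_commute {Y : Mat n} (h : Commute A Y) (φ : ℝ → ℂ) : Commute (d.fn φ) Y := by
  apply d.loc_injective
  ext i j
  simp only [d.loc_mul, d.loc_fn, Matrix.diagonal_mul, Matrix.mul_diagonal]
  by_cases hij : d.ev i = d.ev j
  · rw [hij, mul_comm]
  · rw [d.loc_eq_zero_of_commute h hij]; simp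

theorem commute_lev (Y : Mat n) : Commute A (d.lev Y) := by
  have h : d.gr (fun x => (x : ℂ)) (d.lev Y) = 0 := by
    apply d.loc_injective; ext i j
    simp only [lev, d.gr_gr, d.loc_gr]
    have : d.loc 0 i j = 0 := by simp [loc]
    rw [this]
    split_ifs with h <;> simp [h]
  rw [d.gr_bracket] at h
  exact sub_eq_zero.1 h

/-- If the exponential of a hermitian matrix commutes with `Y`, so does the matrix. -/
theorem commute_of_commute_exp (d : UDiag A) {Y : Mat n} (h : Commute (NormedSpace.exp A) Y) : Commute A Y := by
  have h1 : NormedSpace.exp A = d.fn fun x => Complex.exp x := by simpa using d.exp_smul 1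
  rw [h1] at h
  apply d.loc_injective; ext i j
  have h2 := congrFun (congrFun (congrArg d.loc h.eq) i) j
  simp only [d.loc_mul, d.loc_fn, d.loc_self, Matrix.diagonal_mul, Matrix.mul_diagonal] at h2 ⊢
  by_cases hz : d.loc Y i j = 0
  · simp [hz]
  · rw [mul_comm (d.loc Y i j)] at h2 ⊢
    have h3 := mul_right_cancel₀ hz h2
    rw [← Complex.ofReal_exp, ← Complex.ofReal_exp] at h3
    rw [Real.exp_injective (Complex.ofReal_injective h3)]

end UDiag

variable {R : ReductiveGroup n} {P : MatGroup n} {A : Mat n} {d : UDiag A}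

/-- The Lie algebra of the Levi subgroup. -/
def leviLie (R : ReductiveGroup n) (A : Mat n) : Submodule ℂ (Mat n) where
  carrier := {Y | Y ∈ lieAlg R.G ∧ Commute A Y}
  add_mem' h h' := ⟨R.zariskiClosed.add_mem_lieAlg h.1 h'.1, h.2.add_right h'.2⟩
  zero_mem' := ⟨zero_mem_lieAlg, Commute.zero_right _⟩
  smul_mem' c _ h := ⟨smul_mem_lieAlg h.1 c, h.2.smul_right c⟩

theorem leviLie_conjTranspose (hA : Aᴴ = A) {Y : Mat n} (hY : Y ∈ leviLie R A) :
    Yᴴ ∈ leviLie R A := by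
  refine ⟨conjTranspose_mem_lieAlg R.selfAdjoint hY.1, ?_⟩
  have := congrArg Matrix.conjTranspose hY.2.eq
  rw [Matrix.conjTranspose_mul, Matrix.conjTranspose_mul, hA] at this
  exact this.symm

theorem mem_lieAlg_of_leviLie (hP : d.IsParabolicPair R.G P) {Y : Mat n} (hY : Y ∈ leviLie R A) :
    Y ∈ lieAlg P :=
  hP.mem_lieAlg hY.1 (d.isUpper_of_commute hY.2)

theorem mem_of_commute (hP : d.IsParabolicPair R.G P) {g : GL (Fin n) ℂ} (hg : g ∈ R.G)
    (hc : Commute A (g : Mat n)) : g ∈ P :=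
  (hP g).2 ⟨hg, d.isUpper_of_commute hc⟩

/-- A form on a conjugation stable space of matrices is given by the trace form. -/
theorem exists_trace_repr {V : Submodule ℂ (Mat n)} (hV : ∀ Y ∈ V, Yᴴ ∈ V) (ℓ : Mat n →ₗ[ℂ] ℂ) :
    ∃ Z ∈ V, ∀ Y ∈ V, ℓ Y = (Z * Y).trace := by
  set Φ : V →ₗ[ℂ] Module.Dual ℂ V :=
    LinearMap.mk₂ ℂ (fun Z Y : V => ((Z : Mat n) * (Y : Mat n)).trace)
      (fun _ _ _ => by simp [add_mul]) (fun _ _ _ => by simp)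
      (fun _ _ _ => by simp [mul_add]) (fun _ _ _ => by simp) with hΦ
  -- The trace form is nondegenerate on a $*$-stable space because $\mathrm{tr}(ZZ^*)=|Z|^2$.
  have hinj : Function.Injective Φ := by
    rw [← LinearMap.ker_eq_bot, LinearMap.ker_eq_bot']
    intro Z hZ
    have h1 : ((Z : Mat n) * (Z : Mat n)ᴴ).trace = 0 :=
      congrArg (fun f : Module.Dual ℂ V => f ⟨_, hV _ Z.2⟩) hZ
    rw [Matrix.trace_mul_comm, ← frob_eq_trace] at h1
    exact Subtype.ext (frob_eq_zero (by exact_mod_cast h1))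
  have hsurj := (LinearMap.injective_iff_surjective_of_finrank_eq_finrank
    (Subspace.dual_finrank_eq (K := ℂ) (V := V)).symm).1 hinj
  obtain ⟨Z, hZ⟩ := hsurj (ℓ ∘ₗ V.subtype)
  exact ⟨Z, Z.2, fun Y hY => (congrArg (fun f : Module.Dual ℂ V => f ⟨Y, hY⟩) hZ).symm⟩

theorem eq_of_trace_eq {V : Submodule ℂ (Mat n)} (hV : ∀ Y ∈ V, Yᴴ ∈ V) {Z Z' : Mat n} (hZ : Z ∈ V)
    (hZ' : Z' ∈ V) (h : ∀ Y ∈ V, (Z * Y).trace = (Z' * Y).trace) : Z = Z' := by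
  have h1 := h _ (hV _ (V.sub_mem hZ hZ'))
  rw [← sub_eq_zero, ← Matrix.trace_sub, ← sub_mul, Matrix.trace_mul_comm, ← frob_eq_trace] at h1
  exact sub_eq_zero.1 (frob_eq_zero (by exact_mod_cast h1))

theorem eq_of_re_trace_eq {V : Submodule ℂ (Mat n)} (hV : ∀ Y ∈ V, Yᴴ ∈ V) {Z Z' : Mat n}
    (hZ : Z ∈ V) (hZ' : Z' ∈ V) (h : ∀ Y ∈ V, (Z * Y).trace.re = (Z' * Y).trace.re) : Z = Z' := by
  have h1 := h _ (hV _ (V.sub_mem hZ hZ'))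
  rw [← sub_eq_zero, ← Complex.sub_re, ← Matrix.trace_sub, ← sub_mul, Matrix.trace_mul_comm,
    ← frob_eq_trace, Complex.ofReal_re] at h1
  exact sub_eq_zero.1 (frob_eq_zero h1)

/-- The element `Z` of the Levi algebra dual to a character: it is hermitian and central. -/
structure DualElement (R : ReductiveGroup n) (A : Mat n) (P : MatGroup n) (χ : P →* ℂˣ)
    (Z : Mat n) : Prop where
  mem : Z ∈ leviLie R A
  herm : Zᴴ = Z
  comm : ∀ g ∈ R.G, Commute A (g : Mat n) → Commute Z (g : Mat n)
  pair : ∀ Y ∈ leviLie R A, dchar χ Y = (Z * Y).trace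
  exp : ∀ Y ∈ leviLie R A, ∀ p : P, toMat p = NormedSpace.exp Y →
    ((χ p : ℂˣ) : ℂ) = Complex.exp (Z * Y).trace

/-- The Levi algebra is $*$-stable, so the trace form represents $d\chi$ by some $Z$ in it. Unitary
elements $e^{Y-Y^*}$ have $|\chi|=1$, which makes $Z$ hermitian; invariance of $\chi$ and of the
trace form under conjugation by the Levi subgroup makes $Z$ central. -/
theorem exists_dualElement (hP : d.IsParabolicPair R.G P) {χ : P →* ℂˣ} (hχ : IsAlgChar χ) :
    ∃ Z, DualElement R A P χ Z := by
  have hV : ∀ Y ∈ leviLie R A, Yᴴ ∈ leviLie R A := fun Y hY =>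
    leviLie_conjTranspose d.conjTranspose_self hY
  obtain ⟨ℓ, hℓ⟩ := hχ.exists_linear
  obtain ⟨Z, hZ, hZℓ⟩ := exists_trace_repr hV ℓ
  have hexp : ∀ Y ∈ leviLie R A, ∀ p : P, toMat p = NormedSpace.exp Y →
      ((χ p : ℂˣ) : ℂ) = Complex.exp (Z * Y).trace := by
    intro Y hY p hp
    have hYP := mem_lieAlg_of_leviLie hP hY
    have h1 := (hℓ Y hYP).2 1
    have h2 : p = expIn hYP 1 := by
      apply Subtype.ext; apply Units.ext
      show toMat p = NormedSpace.exp ((1 : ℂ) • Y)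
      rw [one_smul, hp]
    rw [h2, h1, one_mul, hZℓ Y hY]
  refine ⟨Z, hZ, ?_, ?_, fun Y hY => ?_, hexp⟩
  · -- hermitian
    refine eq_of_re_trace_eq hV (hV _ hZ) hZ fun Y hY => ?_
    set S : Mat n := Y - Yᴴ with hS
    have hSm : S ∈ leviLie R A := (leviLie R A).sub_mem hY (hV _ hY)
    have hSs : Sᴴ = -S := by simp [hS]
    have hSP := mem_lieAlg_of_leviLie hP hSm
    have hun : (toMat (expIn hSP 1))ᴴ * toMat (expIn hSP 1) = 1 := by
      show (NormedSpace.exp ((1 : ℂ) • S))ᴴ * NormedSpace.exp ((1 : ℂ) • S) = 1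
      rw [one_smul, ← Matrix.exp_conjTranspose, hSs]
      exact (expGL S).inv_val
    have h1 := hχ.norm_eq_one_of_unitary hun
    rw [hexp S hSm _ (by show NormedSpace.exp ((1 : ℂ) • S) = _; rw [one_smul]), Complex.norm_exp,
      Real.exp_eq_one_iff, hS, mul_sub, Matrix.trace_sub, Complex.sub_re] at h1
    have h2 : (Z * Yᴴ).trace.re = (Zᴴ * Y).trace.re := by
      have : (Zᴴ * Y).trace = star (Z * Yᴴ).trace := by
        rw [← Matrix.trace_conjTranspose, Matrix.conjTranspose_mul, Matrix.conjTranspose_conjTranspose,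
          Matrix.trace_mul_comm]
      rw [this]; simp
    rw [← h2]; linarith
  · -- central
    intro g hg hgc
    have hgi : Commute A ((g⁻¹ : GL (Fin n) ℂ) : Mat n) := hgc.units_inv_right
    have hgP := mem_of_commute hP hg hgc
    have hconj : ∀ {g : GL (Fin n) ℂ}, g ∈ R.G → Commute A (g : Mat n) →
        Commute A ((g⁻¹ : GL (Fin n) ℂ) : Mat n) → ∀ Y ∈ leviLie R A,
        (g : Mat n) * Y * ((g⁻¹ : GL (Fin n) ℂ) : Mat n) ∈ leviLie R A := fun hg hgc hgi Y hY =>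
      ⟨conj_mem_lieAlg hY.1 hg, (hgc.mul_right hY.2).mul_right hgi⟩
    have h1 : ((g⁻¹ : GL (Fin n) ℂ) : Mat n) * Z * (g : Mat n) = Z := by
      have hm := hconj (R.G.inv_mem hg) hgi (by simpa using hgc) Z hZ
      rw [inv_inv] at hm
      refine eq_of_trace_eq hV hm hZ fun Y hY => ?_
      have hY' := hconj hg hgc hgi Y hY
      have hYP := mem_lieAlg_of_leviLie hP hY
      have hYP' := mem_lieAlg_of_leviLie hP hY'
      have e1 : (((g⁻¹ : GL (Fin n) ℂ) : Mat n) * Z * (g : Mat n) * Y).trace =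
          (Z * ((g : Mat n) * Y * ((g⁻¹ : GL (Fin n) ℂ) : Mat n))).trace := by
        rw [mul_assoc, mul_assoc, Matrix.trace_mul_comm]
        simp only [mul_assoc]
      rw [e1, ← hZℓ _ hY', ← hZℓ _ hY, ← (hℓ _ hYP').1, ← (hℓ _ hYP).1, dchar, dchar]
      congr 1
      funext s
      have e2 : expIn hYP' s = ⟨g, hgP⟩ * expIn hYP s * ⟨g, hgP⟩⁻¹ := by
        apply Subtype.ext
        show expGL (s • ((g : Mat n) * Y * ((g⁻¹ : GL (Fin n) ℂ) : Mat n))) = g * expGL (s • Y) * g⁻¹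
        rw [← expGL_conj, Matrix.mul_smul, Matrix.smul_mul]
      calc _ = ((χ (expIn hYP' s) : ℂˣ) : ℂ) := charEval_coe χ (expIn hYP' s)
        _ = ((χ (expIn hYP s) : ℂˣ) : ℂ) := by
          rw [e2, map_mul, map_mul, map_inv, mul_comm (χ _), mul_assoc, mul_inv_cancel, mul_one]
        _ = _ := (charEval_coe χ (expIn hYP s)).symm
    have h2 := congrArg ((g : Mat n) * ·) h1
    simp only [← mul_assoc] at h2
    rw [← Units.val_mul, mul_inv_cancel, Units.val_one, one_mul] at h2
    exact h2
  · rw [(hℓ Y (mem_lieAlg_of_leviLie hP hY)).1, hZℓ Y hY]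

theorem DualElement.commute_leviLie {χ : P →* ℂˣ} {Z : Mat n} (h : DualElement R A P χ Z) {Y : Mat n}
    (hY : Y ∈ leviLie R A) : Commute Z Y := by
  refine (Merohoric.commute_of_commute_exp fun s => (h.comm _ (mem_lieAlg_iff.1 hY.1 s) ?_).symm).symm
  exact (hY.2.smul_right s).exp_right

end Levi

/-! ### Anti-dominance as a sign condition on the nilradical. -/

section Sign

variable {n : ℕ} {R : ReductiveGroup n} {P : MatGroup n} {A : Mat n} {d : UDiag A}

theorem UDiag.loc_exp_conj {A : Mat n} (d : UDiag A) (s : ℂ) (Y : Mat n) (i j : Fin n) :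
    d.loc (NormedSpace.exp (s • A) * Y * NormedSpace.exp (-(s • A))) i j =
      Complex.exp (s * (d.ev i - d.ev j : ℝ)) * d.loc Y i j := by
  rw [d.exp_conj, d.loc_gr]

/-- The matrices all of whose components have positive weight. -/
def UDiag.strictUpper {A : Mat n} (d : UDiag A) : Submodule ℂ (Mat n) where
  carrier := {Y | ∀ i j, d.ev i ≤ d.ev j → d.loc Y i j = 0}
  add_mem' hY hZ i j h := by rw [d.loc_add, Matrix.add_apply, hY i j h, hZ i j h, add_zero]
  zero_mem' i j _ := by simp [UDiag.loc]
  smul_mem' c Y hY i j h := by rw [d.loc_smul, Matrix.smul_apply, hY i j h, smul_zero]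

theorem UDiag.isUpper_mul_strictUpper {A : Mat n} (d : UDiag A) {Y Z : Mat n} (hY : d.IsUpper Y)
    (hZ : Z ∈ d.strictUpper) : Y * Z ∈ d.strictUpper := by
  intro i j hij
  rw [d.loc_mul, Matrix.mul_apply]
  refine Finset.sum_eq_zero fun k _ => ?_
  rcases lt_or_ge (d.ev i) (d.ev k) with h | h
  · rw [hY i k h, zero_mul]
  · rw [hZ k j (h.trans hij), mul_zero]

theorem UDiag.strictUpper_mul_isUpper {A : Mat n} (d : UDiag A) {Y Z : Mat n}
    (hZ : Z ∈ d.strictUpper) (hY : d.IsUpper Y) : Z * Y ∈ d.strictUpper := by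
  intro i j hij
  rw [d.loc_mul, Matrix.mul_apply]
  refine Finset.sum_eq_zero fun k _ => ?_
  rcases lt_or_ge (d.ev k) (d.ev j) with h | h
  · rw [hY k j h, mul_zero]
  · rw [hZ i k (hij.trans h), zero_mul]

/-- The weight of a cocharacter on a root vector of positive weight. -/
theorem exists_weight (hA : A ∈ lieAlg R.T) {α : Mat n} (hα0 : α ≠ 0) (hαu : α ∈ d.strictUpper)
    {r : R.T →* ℂˣ} (hr : ∀ t : R.T, conjLin (t : GL (Fin n) ℂ) α = ((r t : ℂˣ) : ℂ) • α) :
    ∃ c : ℝ, 0 < c ∧ (∀ s : ℂ, ((r (expIn hA s) : ℂˣ) : ℂ) = Complex.exp (s * c)) ∧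
      ∀ Y : Mat n, (∀ t : R.T, conjLin (t : GL (Fin n) ℂ) Y = ((r t : ℂˣ) : ℂ) • Y) →
        ∀ i j, d.ev i - d.ev j ≠ c → d.loc Y i j = 0 := by
  obtain ⟨i0, j0, hij0⟩ : ∃ i j, d.loc α i j ≠ 0 := by
    by_contra hcon
    push Not at hcon
    exact hα0 (d.loc_injective (by ext i j; rw [hcon]; simp [UDiag.loc]))
  set c : ℝ := d.ev i0 - d.ev j0 with hc
  have hcpos : 0 < c := by
    by_contra hle
    exact hij0 (hαu i0 j0 (by linarith))
  have hrexp : ∀ s : ℂ, ((r (expIn hA s) : ℂˣ) : ℂ) = Complex.exp (s * c) := by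
    intro s
    have h1 := hr (expIn hA s)
    rw [conjLin_apply] at h1
    have h2 : (((expIn hA s : R.T) : GL (Fin n) ℂ) : Mat n) = NormedSpace.exp (s • A) := rfl
    have h3 : ((((expIn hA s : R.T) : GL (Fin n) ℂ)⁻¹ : GL (Fin n) ℂ) : Mat n) =
        NormedSpace.exp (-(s • A)) := rfl
    rw [h2, h3] at h1
    have h4 := congrFun (congrFun (congrArg d.loc h1) i0) j0
    rw [d.loc_exp_conj, d.loc_smul, Matrix.smul_apply, smul_eq_mul] at h4
    exact (mul_right_cancel₀ hij0 h4).symm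
  have hweight : ∀ Y : Mat n, (∀ t : R.T, conjLin (t : GL (Fin n) ℂ) Y = ((r t : ℂˣ) : ℂ) • Y) →
      ∀ i j, d.ev i - d.ev j ≠ c → d.loc Y i j = 0 := by
    intro Y hY i j hij
    by_contra hne
    have h1 := hY (expIn hA 1)
    rw [conjLin_apply, hrexp] at h1
    have h4 := congrFun (congrFun (congrArg d.loc h1) i) j
    have h5 : d.loc ((((expIn hA 1 : R.T) : GL (Fin n) ℂ) : Mat n) * Y *
      ((((expIn hA 1 : R.T) : GL (Fin n) ℂ)⁻¹ : GL (Fin n) ℂ) : Mat n)) i j =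
        Complex.exp (1 * (d.ev i - d.ev j : ℝ)) * d.loc Y i j := d.loc_exp_conj 1 Y i j
    rw [h5, d.loc_smul, Matrix.smul_apply, smul_eq_mul] at h4
    have h6 := mul_right_cancel₀ hne h4
    rw [one_mul, one_mul, ← Complex.ofReal_exp, ← Complex.ofReal_exp] at h6
    exact hij (Real.exp_injective (Complex.ofReal_injective h6))
  exact ⟨c, hcpos, hrexp, hweight⟩

theorem UDiag.bracket_eq_smul {A : Mat n} (d : UDiag A) {α : Mat n} {c : ℝ}
    (h : ∀ i j, d.ev i - d.ev j ≠ c → d.loc α i j = 0) : A * α - α * A = (c : ℂ) • α := by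
  rw [← d.gr_bracket]
  apply d.loc_injective; ext i j
  rw [d.loc_gr, d.loc_smul, Matrix.smul_apply, smul_eq_mul]
  by_cases hij : d.ev i - d.ev j = c
  · rw [hij]
  · rw [h i j hij, mul_zero, mul_zero]

/-- The adjoint of a weight vector has the opposite weight. -/
theorem conjLin_conjTranspose {α : Mat n} (hα0 : α ≠ 0) {r : R.T →* ℂˣ}
    (hr : ∀ t : R.T, conjLin (t : GL (Fin n) ℂ) α = ((r t : ℂˣ) : ℂ) • α) (t : R.T) :
    conjLin (t : GL (Fin n) ℂ) αᴴ = (((r t : ℂˣ) : ℂ))⁻¹ • αᴴ := by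
  have hfpos : 0 < frob α := lt_of_le_of_ne (frob_nonneg α) fun h => hα0 (frob_eq_zero h.symm)
  -- A weight satisfies $r(t^*)=\overline{r(t)}$: take the trace of $\alpha^*$ against $t\alpha
  -- t^{-1}$, pass to adjoints, and divide by $|\alpha|^2\neq0$.
  have hconj : ∀ t : R.T, ∀ s : GL (Fin n) ℂ, (s : Mat n) = ((t : GL (Fin n) ℂ) : Mat n)ᴴ → ∀ hs : s ∈ R.T,
      star ((r ⟨s, hs⟩ : ℂˣ) : ℂ) = ((r t : ℂˣ) : ℂ) := by
    intro t s hst hs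
    have h1 := hr ⟨s, hs⟩
    have h2 := hr t
    rw [conjLin_apply] at h1 h2
    have hsi : ((s⁻¹ : GL (Fin n) ℂ) : Mat n) = (((t : GL (Fin n) ℂ)⁻¹ : GL (Fin n) ℂ) : Mat n)ᴴ := by
      have e1 : (((t : GL (Fin n) ℂ)⁻¹ : GL (Fin n) ℂ) : Mat n)ᴴ * (s : Mat n) = 1 := by
        rw [hst, ← Matrix.conjTranspose_mul, ← Units.val_mul, mul_inv_cancel]; simp
      exact (left_inv_eq_right_inv e1 s.val_inv).symm
    have h3 : (αᴴ * ((s : Mat n) * α * ((s⁻¹ : GL (Fin n) ℂ) : Mat n))).trace =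
        star (αᴴ * (((t : GL (Fin n) ℂ) : Mat n) * α *
          (((t : GL (Fin n) ℂ)⁻¹ : GL (Fin n) ℂ) : Mat n))).trace := by
      rw [← Matrix.trace_conjTranspose, hst, hsi]
      simp only [Matrix.conjTranspose_mul, Matrix.conjTranspose_conjTranspose]
      generalize (((t : GL (Fin n) ℂ)⁻¹ : GL (Fin n) ℂ) : Mat n)ᴴ = u
      rw [← mul_assoc, Matrix.trace_mul_comm]
      simp only [mul_assoc]
    have h1' : (s : Mat n) * α * ((s⁻¹ : GL (Fin n) ℂ) : Mat n) = ((r ⟨s, hs⟩ : ℂˣ) : ℂ) • α := h1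
    rw [h1', h2, Matrix.mul_smul, Matrix.mul_smul, Matrix.trace_smul, Matrix.trace_smul,
      ← frob_eq_trace, star_smul] at h3
    have h4 : star ((frob α : ℝ) : ℂ) = ((frob α : ℝ) : ℂ) := by simp
    rw [h4, smul_eq_mul, smul_eq_mul] at h3
    have h5 := mul_right_cancel₀ (by exact_mod_cast hfpos.ne') h3
    rw [h5, star_star]
  obtain ⟨s, hs, hst⟩ := R.torus_selfAdjoint _ t.2
  have h1 := hr ⟨s, hs⟩
  rw [conjLin_apply] at h1 ⊢
  have h1' : (s : Mat n) * α = ((r ⟨s, hs⟩ : ℂˣ) : ℂ) • α * (s : Mat n) := by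
    rw [← h1]
    show _ = (s : Mat n) * α * ((s⁻¹ : GL (Fin n) ℂ) : Mat n) * (s : Mat n)
    rw [mul_assoc _ ((s⁻¹ : GL (Fin n) ℂ) : Mat n), ← Units.val_mul]; simp
  have h2 := congrArg Matrix.conjTranspose h1'
  rw [Matrix.conjTranspose_mul, Matrix.conjTranspose_mul, Matrix.conjTranspose_smul,
    hconj t s hst hs, hst, Matrix.conjTranspose_conjTranspose, Matrix.mul_smul] at h2
  have h3 : ((t : GL (Fin n) ℂ) : Mat n) * αᴴ =
      (((r t : ℂˣ) : ℂ))⁻¹ • (αᴴ * ((t : GL (Fin n) ℂ) : Mat n)) := by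
    rw [h2, smul_smul, inv_mul_cancel₀ (Units.ne_zero _), one_smul]
  rw [h3, Matrix.smul_mul, mul_assoc, ← Units.val_mul, mul_inv_cancel, Units.val_one, mul_one]

/-- The coroots attached to weight vectors of positive weight. -/
theorem antidominant_apply (hA : A ∈ lieAlg R.T) (hP : d.IsParabolicPair R.G P) {χ : P →* ℂˣ}
    (hanti : IsAntidominant R χ) {Z : Mat n} (hZ : DualElement R A P χ Z) {α : Mat n}
    (hα0 : α ≠ 0) (hαG : α ∈ lieAlg R.G) (hαu : α ∈ d.strictUpper) {r : R.T →* ℂˣ}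
    (hr : ∀ t : R.T, conjLin (t : GL (Fin n) ℂ) α = ((r t : ℂˣ) : ℂ) • α) {M : ℝ} (hM : 0 < M)
    (hαM : selfComm α * α - α * selfComm α = (M : ℂ) • α) {ζ : ℝ} (hζ : Z * α - α * Z = (ζ : ℂ) • α) :
    ζ ≤ 0 := by
  have hTG : ∀ t : R.T, (t : GL (Fin n) ℂ) ∈ R.G := fun t => R.maximalTorus.1 t.2
  have hAG : A ∈ lieAlg R.G := lieAlg_mono R.maximalTorus.1 hA
  have hAh := d.conjTranspose_self
  obtain ⟨c, hcpos, hrexp, hweight⟩ := exists_weight hA hα0 hαu hr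
  have hAα : A * α - α * A = (c : ℂ) • α := d.bracket_eq_smul (hweight α hr)
  set B := selfComm α with hB
  have hBs : Bᴴ = B := selfComm_conjTranspose α
  have hαs : αᴴ ∈ lieAlg R.G := conjTranspose_mem_lieAlg R.selfAdjoint hαG
  have hBG : B ∈ lieAlg R.G := R.zariskiClosed.bracket_mem_lieAlg hαG hαs
  have hfpos : 0 < frob α := lt_of_le_of_ne (frob_nonneg α) fun h => hα0 (frob_eq_zero h.symm)
  have hAαs : A * αᴴ - αᴴ * A = -((c : ℂ) • αᴴ) := by
    have := congrArg Matrix.conjTranspose hAα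
    rw [Matrix.conjTranspose_sub, Matrix.conjTranspose_mul, Matrix.conjTranspose_mul, hAh,
      Matrix.conjTranspose_smul] at this
    rw [← neg_sub, this]
    simp
  have hAB : Commute A B := by
    have : A * B - B * A = (A * α - α * A) * αᴴ + α * (A * αᴴ - αᴴ * A) -
        ((A * αᴴ - αᴴ * A) * α + αᴴ * (A * α - α * A)) := by
      simp only [hB, selfComm]; noncomm_ring
    rw [hAα, hAαs] at this
    refine sub_eq_zero.1 (this.trans ?_)
    simp only [Matrix.smul_mul, Matrix.mul_smul, neg_mul, mul_neg]
    abel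
  have hBl : B ∈ leviLie R A := ⟨hBG, hAB⟩
  have hrs := conjLin_conjTranspose hα0 hr
  -- the coroot
  set k : ℂ := ((2 / M : ℝ) : ℂ) with hk
  have hMc : (M : ℂ) ≠ 0 := by exact_mod_cast hM.ne'
  have hkM : k * M = 2 := by rw [hk]; push_cast; field_simp
  have hroot : IsRoot R.G R.T r := by
    refine ⟨fun h1 => ?_, α, hα0, hαG, ?_⟩
    · have h2 := hrexp 1
      rw [h1, one_mul, MonoidHom.one_apply, Units.val_one, ← Complex.ofReal_exp] at h2
      have h3 : Real.exp c = 1 := by exact_mod_cast h2.symm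
      rw [Real.exp_eq_one_iff] at h3
      linarith
    · intro t; rw [← hr t, conjLin_apply]; rfl
  have hcoroot : IsCoroot R.G R.T r (k • B) := by
    refine ⟨α, k • αᴴ, hα0, ⟨hαG, fun t => ?_⟩, ⟨smul_mem_lieAlg hαs k, fun t => ?_⟩, ?_, ?_⟩
    · rw [← hr t, conjLin_apply]; rfl
    · have h1 := hrs t
      rw [conjLin_apply] at h1
      rw [Matrix.mul_smul, Matrix.smul_mul]
      have h2 : (((r⁻¹ : R.T →* ℂˣ) t : ℂˣ) : ℂ) = (((r t : ℂˣ) : ℂ))⁻¹ := by simp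
      rw [h2, smul_comm]
      exact congrArg (k • ·) h1
    · simp only [hB, selfComm, Matrix.mul_smul, Matrix.smul_mul, smul_sub]
    · rw [Matrix.smul_mul, Matrix.mul_smul, ← smul_sub, hαM, smul_smul, hkM]
  -- All weight vectors of $r$ have $A$-weight $c>0$, so $r$ is a root of $P$ and anti-dominance
  -- applies to its coroot $(2/M)[\alpha,\alpha^*]$. The pairing is
  -- $(2/M)\,\mathrm{tr}(Z[\alpha,\alpha^*])=(2/M)\,\zeta|\alpha|^2$, so $\zeta$ cannot be positive.
  have hle := hanti r (k • B) hroot (fun Y hY => hP.mem_lieAlg hY.1 fun i j hij =>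
    hweight Y (fun t => by rw [← hY.2 t, conjLin_apply]; rfl) i j (by linarith)) hcoroot
  rw [pairing_eq, hZ.pair _ ((leviLie R A).smul_mem k hBl), Matrix.mul_smul, Matrix.trace_smul] at hle
  have htr : (Z * B).trace = ((ζ * frob α : ℝ) : ℂ) := by
    have e1 : (Z * B).trace = (αᴴ * (Z * α - α * Z)).trace := by
      simp only [hB, selfComm, mul_sub, Matrix.trace_sub]
      congr 1
      · rw [← mul_assoc, Matrix.trace_mul_comm]
      · rw [Matrix.trace_mul_comm, mul_assoc]
    rw [e1, hζ, Matrix.mul_smul, Matrix.trace_smul, ← frob_eq_trace]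
    push_cast; rfl
  rw [htr, hk, smul_eq_mul, ← Complex.ofReal_mul, Complex.ofReal_re] at hle
  by_contra hlt
  have : 0 < 2 / M * (ζ * frob α) := by
    have := not_le.1 hlt
    positivity
  linarith

/-- The dual element of an antidominant character has no positive eigenvalues on the nilradical. -/
theorem DualElement.loc_eq_zero (hA : A ∈ lieAlg R.T) (hP : d.IsParabolicPair R.G P) {χ : P →* ℂˣ}
    (hanti : IsAntidominant R χ) {Z : Mat n} (hZ : DualElement R A P χ Z) (e : UDiag Z) {Y : Mat n}
    (hY : Y ∈ lieAlg R.G) (hYu : Y ∈ d.strictUpper) {i j : Fin n} (hij : e.ev j < e.ev i) :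
    e.loc Y i j = 0 := by
  by_contra hne
  have hAG : A ∈ lieAlg R.G := lieAlg_mono R.maximalTorus.1 hA
  set ζ : ℝ := e.ev i - e.ev j with hζ
  have hAZ : Commute A Z := hZ.mem.2
  set U : Submodule ℂ (Mat n) := R.zariskiClosed.lieSubspace ⊓ d.strictUpper with hU
  have hZup : d.IsUpper Z := d.isUpper_of_commute hAZ
  have hUst : ∀ Y ∈ U, Z * Y - Y * Z ∈ U := fun Y hY =>
    ⟨R.zariskiClosed.bracket_mem_lieAlg hZ.mem.1 hY.1, d.strictUpper.sub_mem
      (d.isUpper_mul_strictUpper hZup hY.2) (d.strictUpper_mul_isUpper hY.2 hZup)⟩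
  -- The component of $Y$ of weight $\zeta>0$ for $\mathrm{ad}\,Z$. It is nonzero by assumption and
  -- stays in the nilradical, because $Z$ commutes with $A$ and so $\mathrm{ad}\,Z$ preserves that
  -- space.
  set Y1 := e.gr (fun x => if x = ζ then 1 else 0) Y with hY1
  have hY1U : Y1 ∈ U := e.gr_mem hUst _ ⟨hY, hYu⟩
  have hY10 : Y1 ≠ 0 := by
    intro h
    have := e.loc_gr (fun x => if x = ζ then 1 else 0) Y i j
    rw [← hY1, h, if_pos rfl, one_mul] at this
    exact hne (by rw [← this]; simp [UDiag.loc])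
  have hadZ : ∀ Y, Y ∈ LinearMap.ker (LinearMap.mulLeft ℂ Z - LinearMap.mulRight ℂ Z -
      (ζ : ℂ) • LinearMap.id : Mat n →ₗ[ℂ] Mat n) ↔ Z * Y - Y * Z = (ζ : ℂ) • Y := by
    intro Y
    simp [sub_eq_zero]
  have hY1Z : Z * Y1 - Y1 * Z = (ζ : ℂ) • Y1 := by
    rw [← e.gr_bracket]
    apply e.loc_injective; ext a b
    simp only [hY1, e.gr_gr, e.loc_gr, e.loc_smul, Matrix.smul_apply, smul_eq_mul]
    split_ifs with h
    · rw [h]; ring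
    · ring
  -- The $\zeta$-eigenspace of $\mathrm{ad}\,Z$ in the nilradical. The torus commutes with $A$ and
  -- $Z$, hence acts on it, which produces a root vector in it.
  set W : Submodule ℂ (Mat n) := U ⊓ LinearMap.ker (LinearMap.mulLeft ℂ Z - LinearMap.mulRight ℂ Z -
      (ζ : ℂ) • LinearMap.id : Mat n →ₗ[ℂ] Mat n) with hW
  have hTA : ∀ t ∈ R.T, Commute A (t : Mat n) := fun t ht =>
    R.maximalTorus.2.1.commute_lieAlg hA ht
  have hTZ : ∀ t ∈ R.T, Commute Z (t : Mat n) := fun t ht =>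
    hZ.comm t (R.maximalTorus.1 ht) (hTA t ht)
  have hTW : ∀ t ∈ R.T, ∀ Y ∈ W, conjLin t Y ∈ W := by
    rintro t ht Y ⟨⟨hY1, hY2⟩, hY3⟩
    replace hY3 := (hadZ Y).1 hY3
    rw [conjLin_apply]
    refine ⟨⟨conj_mem_lieAlg hY1 (R.maximalTorus.1 ht), ?_⟩, ?_⟩
    · exact d.strictUpper_mul_isUpper (d.isUpper_mul_strictUpper
        (d.isUpper_of_commute (hTA t ht)) hY2)
        (d.isUpper_of_commute (hTA t⁻¹ (R.T.inv_mem ht)))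
    · refine (hadZ _).2 ?_
      rw [← Matrix.smul_mul, ← Matrix.mul_smul, ← hY3]
      have h1 := (hTZ t ht).eq
      have h2 := (hTZ t⁻¹ (R.T.inv_mem ht)).eq
      rw [mul_sub, sub_mul]
      congr 1
      · rw [← mul_assoc, ← mul_assoc, h1, mul_assoc (t : Mat n) Z Y]
      · rw [mul_assoc, ← h2]; simp only [mul_assoc]
  have hWne : W ≠ ⊥ := (Submodule.ne_bot_iff W).2 ⟨Y1, ⟨hY1U, (hadZ _).2 hY1Z⟩, hY10⟩
  obtain ⟨r, Y2, hY2W, hY20, hr⟩ := exists_common_eigenvector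
    (fun s hs t ht => R.maximalTorus.2.1.commute hs ht) _ W rfl hWne hTW
  -- the joint eigenspace
  set V : Submodule ℂ (Mat n) := W ⊓ ⨅ t : R.T, LinearMap.ker
    (conjLin (t : GL (Fin n) ℂ) - ((r t : ℂˣ) : ℂ) • LinearMap.id) with hV
  have hVmem : ∀ Y, Y ∈ V ↔ Y ∈ W ∧ ∀ t : R.T, conjLin (t : GL (Fin n) ℂ) Y = ((r t : ℂˣ) : ℂ) • Y := by
    intro Y
    simp only [hV, Submodule.mem_inf, Submodule.mem_iInf, LinearMap.mem_ker, LinearMap.sub_apply,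
      LinearMap.smul_apply, LinearMap.id_apply, sub_eq_zero]
  have hTs : ∀ t : R.T, ∀ α ∈ V, conjLin (t : GL (Fin n) ℂ) (selfComm α) = selfComm α := by
    intro t α hα
    by_cases h0 : α = 0
    · simp [h0, selfComm]
    have h1 := ((hVmem α).1 hα).2
    have h2 := conjLin_conjTranspose h0 h1 t
    have hm : ∀ Y Y' : Mat n, conjLin (t : GL (Fin n) ℂ) (Y * Y') =
        conjLin (t : GL (Fin n) ℂ) Y * conjLin (t : GL (Fin n) ℂ) Y' := by
      intro Y Y'
      simp only [conjLin_apply, mul_assoc]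
      rw [← mul_assoc (((t : GL (Fin n) ℂ)⁻¹ : GL (Fin n) ℂ) : Mat n) (t : GL (Fin n) ℂ),
        ← Units.val_mul, inv_mul_cancel, Units.val_one, one_mul]
    have hc : ((r t : ℂˣ) : ℂ) ≠ 0 := Units.ne_zero _
    simp only [selfComm, map_sub, hm, h1 t, h2, Matrix.smul_mul, Matrix.mul_smul, smul_smul]
    rw [inv_mul_cancel₀ hc, mul_inv_cancel₀ hc, one_smul, one_smul]
  have hTc : ∀ t : R.T, ∀ α ∈ V, Commute ((t : GL (Fin n) ℂ) : Mat n) (selfComm α) := by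
    intro t α hα
    have h1 := congrArg (· * ((t : GL (Fin n) ℂ) : Mat n)) (hTs t α hα)
    simp only [conjLin_apply] at h1
    rw [mul_assoc _ (((t : GL (Fin n) ℂ)⁻¹ : GL (Fin n) ℂ) : Mat n), ← Units.val_mul,
      inv_mul_cancel, Units.val_one, mul_one] at h1
    exact h1
  have hlev : ∀ α ∈ V, selfComm α ∈ leviLie R A := by
    intro α hα
    have hαG : α ∈ lieAlg R.G := ((hVmem α).1 hα).1.1.1
    exact ⟨R.zariskiClosed.bracket_mem_lieAlg hαG (conjTranspose_mem_lieAlg R.selfAdjoint hαG),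
      commute_of_commute_exp fun s => hTc (expIn hA s) α hα⟩
  -- The commutator $[\alpha,\alpha^*]$ is fixed by the torus and lies in the Levi algebra, so it
  -- commutes with $Z$. Bracketing with it therefore preserves the joint eigenspace $V$, as the
  -- maximum argument requires.
  obtain ⟨α, hαV, hα0, M, hM, hαM⟩ := exists_selfComm_eigenvector (V := V)
    ((Submodule.ne_bot_iff V).2 ⟨Y2, (hVmem _).2 ⟨hY2W, hr⟩, hY20⟩)
    (fun α hα => by
      obtain ⟨⟨⟨h1, h2⟩, h3⟩, h4⟩ := (hVmem α).1 hα
      have hB := hlev α hα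
      have hBup := d.isUpper_of_commute hB.2
      have hZB := hZ.commute_leviLie hB
      replace h3 := (hadZ α).1 h3
      refine (hVmem _).2 ⟨⟨⟨R.zariskiClosed.bracket_mem_lieAlg hB.1 h1, d.strictUpper.sub_mem
        (d.isUpper_mul_strictUpper hBup h2) (d.strictUpper_mul_isUpper h2 hBup)⟩, ?_⟩, fun t => ?_⟩
      · refine (hadZ _).2 ?_
        have e1 : Z * (selfComm α * α - α * selfComm α) - (selfComm α * α - α * selfComm α) * Z =
            selfComm α * (Z * α - α * Z) - (Z * α - α * Z) * selfComm α +
            ((Z * selfComm α - selfComm α * Z) * α - α * (Z * selfComm α - selfComm α * Z)) := by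
          noncomm_ring
        rw [e1, hZB.eq, sub_self, zero_mul, mul_zero, sub_self, add_zero, h3, Matrix.mul_smul,
          Matrix.smul_mul, smul_sub]
      · have hm : ∀ Y Y' : Mat n, conjLin (t : GL (Fin n) ℂ) (Y * Y') =
            conjLin (t : GL (Fin n) ℂ) Y * conjLin (t : GL (Fin n) ℂ) Y' := by
          intro Y Y'
          simp only [conjLin_apply, mul_assoc]
          rw [← mul_assoc (((t : GL (Fin n) ℂ)⁻¹ : GL (Fin n) ℂ) : Mat n) (t : GL (Fin n) ℂ),
            ← Units.val_mul, inv_mul_cancel, Units.val_one, one_mul]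
        rw [map_sub, hm, hm, hTs t α hα, h4 t, Matrix.mul_smul, Matrix.smul_mul, smul_sub])
    -- No nonzero element of $V$ is normal, since $\mathrm{tr}(A[\alpha,\alpha^*])=c|\alpha|^2$ with
    -- $c>0$.
    (fun α hα h0 => by
      by_contra hα0
      obtain ⟨⟨⟨h1, h2⟩, h3⟩, h4⟩ := (hVmem α).1 hα
      obtain ⟨c, hc, -, hw⟩ := exists_weight hA hα0 h2 h4
      have h5 := d.bracket_eq_smul (hw α h4)
      have h6 : (A * selfComm α).trace = (αᴴ * (A * α - α * A)).trace := by
        simp only [selfComm, mul_sub, Matrix.trace_sub]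
        congr 1
        · rw [← mul_assoc, Matrix.trace_mul_comm]
        · rw [Matrix.trace_mul_comm, mul_assoc]
      rw [h0, h5, mul_zero, Matrix.trace_zero, Matrix.mul_smul, Matrix.trace_smul, ← frob_eq_trace,
        smul_eq_mul, ← Complex.ofReal_mul] at h6
      have h7 : c * frob α = 0 := by exact_mod_cast h6.symm
      rcases mul_eq_zero.1 h7 with h8 | h8
      · exact hc.ne' h8
      · exact hα0 (frob_eq_zero h8))
  obtain ⟨⟨⟨h1, h2⟩, h3⟩, h4⟩ := (hVmem α).1 hαV
  have := antidominant_apply hA hP hanti hZ hα0 h1 h2 h4 hM hαM ((hadZ α).1 h3)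
  linarith

end Sign

/-! ### Invariant flags and the unipotent radical. -/

section Flags

variable {n : ℕ}

/-- The compression of a matrix to the range of a projection, extended by the identity. -/
def compress (Q M : Mat n) : Mat n := Q * M * Q + (1 - Q)

/-- Compression is multiplicative as soon as the right factor preserves the range of $Q$; adding
$1-Q$ keeps the full size, so that its determinant is the determinant of the compression to the
range of $Q$. -/
theorem compress_mul {Q M N : Mat n} (hQ : Q * Q = Q) (hN : N * Q = Q * N * Q) :
    compress Q (M * N) = compress Q M * compress Q N := by
  have h1 : Q * M * Q * (Q * N * Q) = Q * (M * N) * Q := by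
    calc _ = Q * M * (Q * Q * N * Q) := by simp only [mul_assoc]
      _ = Q * M * (N * Q) := by rw [hQ, ← hN]
      _ = _ := by simp only [mul_assoc]
  have h2 : Q * M * Q * (1 - Q) = 0 := by rw [mul_sub, mul_one, mul_assoc (Q * M) Q Q, hQ, sub_self]
  have h3 : (1 - Q) * (Q * N * Q) = 0 := by
    rw [sub_mul, one_mul, ← mul_assoc, ← mul_assoc, hQ, sub_self]
  have h4 : (1 - Q) * (1 - Q) = 1 - Q := by noncomm_ring [hQ]
  simp only [compress]
  rw [add_mul, mul_add, mul_add, h1, h2, h3, h4, add_zero, zero_add]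

theorem compress_one {Q : Mat n} (hQ : Q * Q = Q) : compress Q 1 = 1 := by
  simp [compress, hQ]

theorem compress_conjTranspose {Q M : Mat n} (hQ : Qᴴ = Q) : (compress Q M)ᴴ = compress Q Mᴴ := by
  simp [compress, hQ, mul_assoc]

theorem compress_conjTranspose_mul_self {Q M : Mat n} (hQs : Qᴴ = Q) (hQ : Q * Q = Q)
    (hM : M * Q = Q * M * Q) : compress Q (Mᴴ * M) = (compress Q M)ᴴ * compress Q M := by
  rw [compress_mul hQ hM, compress_conjTranspose hQs]

theorem continuous_compress (Q : Mat n) : Continuous (compress Q) := by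
  unfold compress; fun_prop

variable {R : ReductiveGroup n} {P : MatGroup n} {A : Mat n} {d : UDiag A}

/-- The spectral projection of a hermitian matrix for the eigenvalues `≤ a`. -/
def UDiag.proj {A : Mat n} (d : UDiag A) (a : ℝ) : Mat n := d.fn fun x => if x ≤ a then 1 else 0

theorem UDiag.proj_mul_self {A : Mat n} (d : UDiag A) (a : ℝ) : d.proj a * d.proj a = d.proj a := by
  rw [proj, d.fn_mul]; congr 1; funext x; split_ifs <;> simp

theorem UDiag.proj_conjTranspose {A : Mat n} (d : UDiag A) (a : ℝ) : (d.proj a)ᴴ = d.proj a := by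
  rw [proj, d.fn_conjTranspose]; congr 1; funext x; split_ifs <;> simp

theorem UDiag.mul_proj_of_loc {A : Mat n} (d : UDiag A) (a : ℝ) {Y : Mat n}
    (h : ∀ i j, d.ev j < d.ev i → d.loc Y i j = 0) : Y * d.proj a = d.proj a * Y * d.proj a := by
  apply d.loc_injective; ext i j
  simp only [proj, d.loc_mul, d.loc_fn, Matrix.mul_diagonal, Matrix.diagonal_mul]
  by_cases hi : d.ev i ≤ a
  · rw [if_pos hi, one_mul]
  · rw [if_neg hi]
    by_cases hj : d.ev j ≤ a
    · rw [h i j (by linarith)]; simp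
    · rw [if_neg hj]; simp

/-- The Levi component is the limit of $t^Apt^{-A}$ as $t\to0$. The determinant is constant along
the family, so the limit is invertible, and $G$ is Zariski closed. -/
theorem exists_levi (hA : A ∈ lieAlg R.G) (hP : d.IsParabolicPair R.G P) {p : GL (Fin n) ℂ}
    (hp : p ∈ P) : ∃ l ∈ R.G, (l : Mat n) = d.lev (p : Mat n) := by
  have hlim := UDiag.IsUpper.tendsto_lev d ((hP p).1 hp).2
  have hdet : (d.lev (p : Mat n)).det = (p : Mat n).det := by
    have h1 := ((contDiff_det 0).continuous.tendsto _).comp hlim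
    refine tendsto_nhds_unique h1 (tendsto_const_nhds.congr fun t => ?_)
    simp only [Function.comp]
    rw [Matrix.det_mul, Matrix.det_mul, mul_right_comm, ← Matrix.det_mul,
      show NormedSpace.exp (Complex.log t • A) * NormedSpace.exp (-(Complex.log t • A)) = 1 from
        (expGL _).val_inv, Matrix.det_one, one_mul]
  have hne : (d.lev (p : Mat n)).det ≠ 0 := by
    rw [hdet]; exact ((Matrix.isUnit_iff_isUnit_det _).1 p.isUnit).ne_zero
  refine ⟨Matrix.GeneralLinearGroup.mkOfDetNeZero _ hne, ?_, rfl⟩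
  refine R.zariskiClosed.mem_of_tendsto (l := 𝓝[≠] (0 : ℂ))
    (γ := fun t => expGL (Complex.log t • A) * p * (expGL (Complex.log t • A))⁻¹) ?_ hlim
  exact Filter.Eventually.of_forall fun t =>
    R.G.mul_mem (R.G.mul_mem (mem_lieAlg_iff.1 hA _) ((hP p).1 hp).1)
      (R.G.inv_mem (mem_lieAlg_iff.1 hA _))

/-- The elements of the parabolic subgroup with trivial Levi component. -/
def IsUnip (d : UDiag A) (P : MatGroup n) (u : GL (Fin n) ℂ) : Prop := u ∈ P ∧ d.lev (u : Mat n) = 1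

theorem IsUnip.tendsto (hP : d.IsParabolicPair R.G P) {u : GL (Fin n) ℂ} (hu : IsUnip d P u) :
    Filter.Tendsto (fun t : ℂ => NormedSpace.exp (Complex.log t • A) * (u : Mat n) *
      NormedSpace.exp (-(Complex.log t • A))) (𝓝[≠] 0) (𝓝 1) := by
  rw [← hu.2]
  exact UDiag.IsUpper.tendsto_lev d ((hP u).1 hu.1).2

theorem exists_levi_unip (hA : A ∈ lieAlg R.G) (hP : d.IsParabolicPair R.G P) {p : GL (Fin n) ℂ}
    (hp : p ∈ P) : ∃ l ∈ R.G, ∃ u, Commute A (l : Mat n) ∧ IsUnip d P u ∧ p = l * u := by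
  obtain ⟨l, hl, he⟩ := exists_levi hA hP hp
  have hc : Commute A (l : Mat n) := by rw [he]; exact d.commute_lev _
  have hlP := mem_of_commute hP hl hc
  have huP := P.mul_mem (P.inv_mem hlP) hp
  refine ⟨l, hl, l⁻¹ * p, hc, ⟨huP, ?_⟩, by group⟩
  have h1 := UDiag.IsUpper.tendsto_lev d ((hP _).1 huP).2
  have h2 := (UDiag.IsUpper.tendsto_lev d ((hP _).1 hp).2).const_mul ((l⁻¹ : GL (Fin n) ℂ) : Mat n)
  rw [← he, ← Units.val_mul, inv_mul_cancel, Units.val_one] at h2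
  refine tendsto_nhds_unique h1 (h2.congr fun t => ?_)
  have hci : Commute (NormedSpace.exp (Complex.log t • A)) ((l⁻¹ : GL (Fin n) ℂ) : Mat n) :=
    (hc.units_inv_right.smul_left (Complex.log t)).exp_left
  rw [Units.val_mul, ← mul_assoc (NormedSpace.exp (Complex.log t • A)), hci.eq]
  simp only [mul_assoc]

/-- Writes the identity on a finite set as its maximum minus positive jumps at thresholds; applied
to eigenvalues, it expresses a hermitian matrix through its spectral projections. The strengthened
induction keeps the constant $a$ in $S$ and the thresholds below elements of $S$, so a new maximum
$b$ meets no threshold and one jump $b-a$ at the old maximum corrects the other points. -/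
theorem exists_thresholds (S : Finset ℝ) : ∃ (m : ℕ) (τ c : Fin m → ℝ) (a : ℝ),
    (∀ k, 0 ≤ c k) ∧ ∀ x ∈ S, x = a - ∑ k, c k * (if x ≤ τ k then 1 else 0) := by
  suffices H : ∃ (m : ℕ) (τ c : Fin m → ℝ) (a : ℝ), (∀ k, 0 ≤ c k) ∧
      (∀ k, ∃ y ∈ S, τ k ≤ y) ∧ (S.Nonempty → a ∈ S) ∧
      ∀ x ∈ S, x = a - ∑ k, c k * (if x ≤ τ k then 1 else 0) by
    obtain ⟨m, τ, c, a, h1, -, -, h2⟩ := H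
    exact ⟨m, τ, c, a, h1, h2⟩
  induction S using Finset.induction_on_max with
  | empty => exact ⟨0, Fin.elim0, Fin.elim0, 0, fun k => k.elim0, fun k => k.elim0, by simp, by simp⟩
  | insert b S hb ih =>
    obtain ⟨m, τ, c, a, hc, hτ, ha, hx⟩ := ih
    rcases S.eq_empty_or_nonempty with rfl | hS
    · exact ⟨0, Fin.elim0, Fin.elim0, b, fun k => k.elim0, fun k => k.elim0, by simp, by simp⟩
    · have hab : a < b := hb a (ha hS)
      refine ⟨m + 1, Fin.cons (S.max' hS) τ, Fin.cons (b - a) c, b, ?_, ?_, by simp, ?_⟩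
      · refine Fin.cases ?_ ?_
        · simpa using hab.le
        · simpa using hc
      · refine Fin.cases ?_ ?_
        · exact ⟨S.max' hS, by simp [S.max'_mem hS], by simp⟩
        · intro k
          obtain ⟨y, hy, hle⟩ := hτ k
          exact ⟨y, by simp [hy], by simpa using hle⟩
      · intro x hxm
        rw [Fin.sum_univ_succ]
        simp only [Fin.cons_zero, Fin.cons_succ]
        rcases Finset.mem_insert.1 hxm with rfl | hxS
        · have h1 : ¬ x ≤ S.max' hS := not_le.2 (hb _ (S.max'_mem hS))
          have h2 : ∀ k, ¬ x ≤ τ k := by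
            intro k hk
            obtain ⟨y, hy, hle⟩ := hτ k
            exact absurd (hb y hy) (not_lt.2 (hk.trans hle))
          simp [h1, h2]
        · have h1 : x ≤ S.max' hS := S.le_max' x hxS
          rw [if_pos h1, mul_one]
          have := hx x hxS
          linarith

theorem UDiag.exists_eq_sum_proj {Z : Mat n} (e : UDiag Z) : ∃ (m : ℕ) (τ c : Fin m → ℝ) (a : ℝ),
    (∀ k, 0 ≤ c k) ∧ Z = (a : ℂ) • 1 - ∑ k, (c k : ℂ) • e.proj (τ k) := by
  obtain ⟨m, τ, c, a, hc, hx⟩ := exists_thresholds (Finset.univ.image e.ev)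
  refine ⟨m, τ, c, a, hc, ?_⟩
  have hsum : ∀ s : Finset (Fin m), e.loc (∑ k ∈ s, (c k : ℂ) • e.proj (τ k)) =
      ∑ k ∈ s, (c k : ℂ) • e.loc (e.proj (τ k)) := by
    intro s
    induction s using Finset.induction_on with
    | empty => simp [UDiag.loc]
    | insert k s hk ih => rw [Finset.sum_insert hk, Finset.sum_insert hk, e.loc_add, e.loc_smul, ih]
  apply e.loc_injective
  rw [e.loc_sub, e.loc_smul, e.loc_one, hsum, e.loc_self]
  ext i j
  simp only [Matrix.sub_apply, Matrix.smul_apply, Matrix.sum_apply, proj, e.loc_fn, smul_eq_mul]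
  by_cases hij : i = j
  · subst hij
    simp only [Matrix.diagonal_apply_eq, Matrix.one_apply_eq, mul_one]
    have := hx (e.ev i) (Finset.mem_image_of_mem _ (Finset.mem_univ i))
    have h2 := congrArg (fun x : ℝ => (x : ℂ)) this
    simp only [Complex.ofReal_sub, Complex.ofReal_sum, Complex.ofReal_mul] at h2
    rw [h2]
    congr 1
    refine Finset.sum_congr rfl fun k _ => ?_
    split_ifs <;> simp
  · simp [hij]

/-- The difference $u^{-1}Au-A$ lies in the nilradical, so $N=u^{-1}Au$ preserves the range of $Q$
and so does $t^N=u^{-1}t^Au$. Contracting $u$ to $1$ by $t^A$ transfers this to $u^{-1}$. -/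
theorem flag_of_unip (hA : A ∈ lieAlg R.G) (hP : d.IsParabolicPair R.G P) {Q : Mat n}
    (hQ : Q * Q = Q) (hAQ : Commute A Q)
    (hQY : ∀ Y ∈ lieAlg R.G, Y ∈ d.strictUpper → Y * Q = Q * Y * Q) {u : GL (Fin n) ℂ}
    (hu : IsUnip d P u) :
    ((u⁻¹ : GL (Fin n) ℂ) : Mat n) * Q = Q * ((u⁻¹ : GL (Fin n) ℂ) : Mat n) * Q := by
  set ui : Mat n := ((u⁻¹ : GL (Fin n) ℂ) : Mat n) with hui
  have hmul : ui * (u : Mat n) = 1 := u.inv_val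
  set N : Mat n := ui * A * (u : Mat n) with hN
  have hYmem : N - A ∈ lieAlg R.G := by
    have h1 := conj_mem_lieAlg hA (R.G.inv_mem ((hP u).1 hu.1).1)
    rw [inv_inv] at h1
    exact R.zariskiClosed.lieSubspace.sub_mem h1 hA
  have hYu : N - A ∈ d.strictUpper := by
    have h1 : N - A = ui * (A * (u : Mat n) - (u : Mat n) * A) := by
      rw [mul_sub, ← mul_assoc, ← mul_assoc, hmul, one_mul]
    rw [h1]
    refine d.isUpper_mul_strictUpper ((hP _).1 (P.inv_mem hu.1)).2 fun i j hij => ?_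
    rw [← d.gr_bracket, d.loc_gr]
    rcases hij.lt_or_eq with h | h
    · rw [((hP u).1 hu.1).2 i j h, mul_zero]
    · rw [h]; simp
  have hNQ : N * Q = Q * N * Q := by
    have h1 := hQY _ hYmem hYu
    have h2 : A * Q = Q * A * Q := by rw [← hAQ.eq, mul_assoc, hQ]
    have e : N = (N - A) + A := by abel
    rw [e, add_mul, h1, h2]
    simp only [mul_add, add_mul, mul_sub, sub_mul, mul_assoc]
  -- matrices preserving the range of `Q`
  set S : Subalgebra ℂ (Mat n) :=
    { carrier := {M | M * Q = Q * M * Q}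
      mul_mem' := by
        intro M M' hM hM'
        have hM : M * Q = Q * M * Q := hM
        have hM' : M' * Q = Q * M' * Q := hM'
        show M * M' * Q = Q * (M * M') * Q
        calc M * M' * Q = M * Q * (M' * Q) := by
              rw [mul_assoc, hM']; simp only [mul_assoc]; rw [← mul_assoc Q Q, hQ]
          _ = Q * M * (Q * M' * Q) := by
              rw [hM]; simp only [mul_assoc]
          _ = _ := by rw [← hM']; simp only [mul_assoc]
      add_mem' := by
        intro M M' hM hM'
        have hM : M * Q = Q * M * Q := hM
        have hM' : M' * Q = Q * M' * Q := hM'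
        show (M + M') * Q = Q * (M + M') * Q
        rw [add_mul, hM, hM']; simp only [mul_add, add_mul]
      algebraMap_mem' := by
        intro c
        show algebraMap ℂ (Mat n) c * Q = Q * algebraMap ℂ (Mat n) c * Q
        rw [Algebra.algebraMap_eq_smul_one]
        simp [hQ] } with hS
  have hexpS : ∀ s : ℂ, NormedSpace.exp (s • N) ∈ S := by
    intro s
    have hcl : IsClosed (S : Set (Mat n)) :=
      Submodule.closed_of_finiteDimensional (Subalgebra.toSubmodule S)
    refine hcl.mem_of_tendsto (NormedSpace.exp_series_hasSum_exp' (𝕂 := ℂ) (s • N))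
      (Filter.Eventually.of_forall fun t => ?_)
    exact S.sum_mem fun k _ => S.smul_mem (S.pow_mem (S.smul_mem hNQ s) k) _
  have hconj : ∀ s : ℂ, NormedSpace.exp (s • N) = ui * NormedSpace.exp (s • A) * (u : Mat n) := by
    intro s
    have := congrArg Units.val (expGL_conj u⁻¹ (s • A))
    rw [inv_inv, Matrix.mul_smul, Matrix.smul_mul] at this
    exact this
  have hlim := hu.tendsto hP
  -- The expression equals $(1-Q)\,t^N\,t^{-A}Q$, which is zero since $t^{-A}$ commutes with $Q$ and
  -- $t^N$ preserves its range; its limit is $(1-Q)u^{-1}Q$.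
  have h1 : Filter.Tendsto (fun t : ℂ => (1 - Q) * ui * (NormedSpace.exp (Complex.log t • A) *
      (u : Mat n) * NormedSpace.exp (-(Complex.log t • A))) * Q) (𝓝[≠] 0) (𝓝 ((1 - Q) * ui * 1 * Q)) :=
    (hlim.const_mul _).mul_const _
  have h2 : ∀ t : ℂ, (1 - Q) * ui * (NormedSpace.exp (Complex.log t • A) *
      (u : Mat n) * NormedSpace.exp (-(Complex.log t • A))) * Q = 0 := by
    intro t
    have hc : Commute (NormedSpace.exp (-(Complex.log t • A))) Q :=
      ((hAQ.smul_left _).neg_left).exp_left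
    have h3 : NormedSpace.exp (Complex.log t • N) * Q = Q * NormedSpace.exp (Complex.log t • N) * Q :=
      hexpS _
    have h4 : (1 - Q) * (NormedSpace.exp (Complex.log t • N) * Q) = 0 := by
      rw [h3, sub_mul, one_mul, ← mul_assoc, ← mul_assoc, hQ, sub_self]
    calc _ = (1 - Q) * (ui * NormedSpace.exp (Complex.log t • A) * (u : Mat n) *
          (NormedSpace.exp (-(Complex.log t • A)) * Q)) := by simp only [mul_assoc]
      _ = (1 - Q) * (NormedSpace.exp (Complex.log t • N) * Q) *
          NormedSpace.exp (-(Complex.log t • A)) := by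
          rw [hc.eq, hconj]; simp only [mul_assoc]
      _ = 0 := by rw [h4, zero_mul]
  have h3 := tendsto_nhds_unique h1 (tendsto_const_nhds.congr fun t => (h2 t).symm)
  rw [mul_one, sub_mul, one_mul, sub_mul, sub_eq_zero] at h3
  exact h3

end Flags

/-! ### The absolute value of an anti-dominant character through determinants on a flag. -/

section FlagData

variable {n : ℕ} {R : ReductiveGroup n} {P : MatGroup n} {A : Mat n} {d : UDiag A}

theorem IsUnip.inv (hP : d.IsParabolicPair R.G P) {u : GL (Fin n) ℂ} (hu : IsUnip d P u) :
    IsUnip d P u⁻¹ := by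
  refine ⟨P.inv_mem hu.1, ?_⟩
  have h1 := UDiag.IsUpper.tendsto_lev d ((hP _).1 (P.inv_mem hu.1)).2
  have h2 := h1.mul (hu.tendsto hP)
  rw [mul_one] at h2
  refine tendsto_nhds_unique h2 (tendsto_const_nhds.congr fun t => ?_)
  have h3 : NormedSpace.exp (-(Complex.log t • A)) * NormedSpace.exp (Complex.log t • A) = 1 :=
    (expGL _).inv_val
  have h4 : NormedSpace.exp (Complex.log t • A) * NormedSpace.exp (-(Complex.log t • A)) = 1 :=
    (expGL _).val_inv
  symm
  calc _ = NormedSpace.exp (Complex.log t • A) * ((u⁻¹ : GL (Fin n) ℂ) : Mat n) *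
        (NormedSpace.exp (-(Complex.log t • A)) * NormedSpace.exp (Complex.log t • A)) *
        (u : Mat n) * NormedSpace.exp (-(Complex.log t • A)) := by simp only [mul_assoc]
    _ = NormedSpace.exp (Complex.log t • A) * (((u⁻¹ : GL (Fin n) ℂ) : Mat n) *
        (u : Mat n)) * NormedSpace.exp (-(Complex.log t • A)) := by
          rw [h3]; simp only [mul_one, mul_assoc]
    _ = 1 := by rw [← Units.val_mul, inv_mul_cancel, Units.val_one, mul_one, h4]

/-- Conjugation by $t^A\in P$ does not change $\chi(u)$ but moves $u$ to $1$, where $\chi$ has a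
continuous extension. The determinant on a flag subspace is treated in the same way below. -/
theorem IsUnip.apply_eq_one (hA : A ∈ lieAlg R.G) (hP : d.IsParabolicPair R.G P) {χ : P →* ℂˣ}
    (hχ : IsAlgChar χ) {u : P} (hu : IsUnip d P u) : χ u = 1 := by
  obtain ⟨F, hF, hd⟩ := hχ.exists_differentiableAt
  have h1 := ((hd 1 (by simp)).continuousAt.tendsto).comp (hu.tendsto hP)
  have h2 : F 1 = 1 := by
    have := hF 1
    simpa [toMat] using this
  have hAP : A ∈ lieAlg P := hP.mem_lieAlg hA (d.isUpper_of_commute (Commute.refl A))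
  rw [h2] at h1
  apply Units.ext
  refine tendsto_nhds_unique (tendsto_const_nhds.congr fun t => ?_) h1
  have := hF (⟨expGL (Complex.log t • A), mem_lieAlg_iff.1 hAP _⟩ * u *
    (⟨expGL (Complex.log t • A), mem_lieAlg_iff.1 hAP _⟩ : P)⁻¹)
  rw [map_mul, map_mul, map_inv, mul_comm (χ _) (χ u), mul_assoc (χ u), mul_inv_cancel, mul_one] at this
  exact this.symm

theorem IsUnip.det_compress (hP : d.IsParabolicPair R.G P) {Q : Mat n} (hQ : Q * Q = Q)
    (hAQ : Commute A Q) {u : GL (Fin n) ℂ} (hu : IsUnip d P u)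
    (hf : (u : Mat n) * Q = Q * (u : Mat n) * Q) : (compress Q (u : Mat n)).det = 1 := by
  have h1 := ((contDiff_det 0).continuous.tendsto _).comp
    (((continuous_compress Q).tendsto _).comp (hu.tendsto hP))
  rw [compress_one hQ, Matrix.det_one] at h1
  have hc : ∀ s : ℂ, NormedSpace.exp (s • A) * Q = Q * NormedSpace.exp (s • A) * Q := fun s => by
    rw [← ((hAQ.smul_left s).exp_left).eq, mul_assoc, hQ]
  refine tendsto_nhds_unique (tendsto_const_nhds.congr fun t => ?_) h1
  have h3 : NormedSpace.exp (Complex.log t • A) * NormedSpace.exp (-(Complex.log t • A)) = 1 :=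
    (expGL _).val_inv
  have hm := hc (-Complex.log t)
  rw [neg_smul] at hm
  simp only [Function.comp]
  rw [compress_mul hQ hm, compress_mul hQ hf, Matrix.det_mul, Matrix.det_mul, mul_right_comm,
    ← Matrix.det_mul, ← compress_mul hQ hm, h3, compress_one hQ, Matrix.det_one, one_mul]

/-- $Q$ intertwines $w$ with $Qw$, and $1-Q$ intertwines $0$ with $Qw$; both relations pass to
exponentials and are added. -/
theorem compress_exp {Q w : Mat n} (hQ : Q * Q = Q) (h : Commute Q w) :
    compress Q (NormedSpace.exp w) = NormedSpace.exp (Q * w) := by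
  have h1 : SemiconjBy Q w (Q * w) := by
    show Q * w = Q * w * Q
    rw [mul_assoc, ← h.eq, ← mul_assoc, hQ]
  have h2 : SemiconjBy (1 - Q) 0 (Q * w) := by
    show (1 - Q) * 0 = Q * w * (1 - Q)
    rw [mul_zero, mul_sub, mul_one, mul_assoc, ← h.eq, ← mul_assoc, hQ, sub_self]
  have h3 : Q * NormedSpace.exp w = NormedSpace.exp (Q * w) * Q := h1.exp_right.eq
  have h4 : (1 - Q) * NormedSpace.exp (0 : Mat n) = NormedSpace.exp (Q * w) * (1 - Q) :=
    h2.exp_right.eq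
  rw [NormedSpace.exp_zero, mul_one] at h4
  rw [compress, h3, mul_assoc, hQ, h4, ← mul_add]
  simp

theorem UDiag.det_exp {w : Mat n} (e : UDiag w) : (NormedSpace.exp w).det = Complex.exp w.trace := by
  have h1 := e.exp_smul 1
  rw [one_smul] at h1
  rw [← e.det_loc, h1, e.loc_fn, Matrix.det_diagonal, ← e.trace_loc w, e.loc_self,
    Matrix.trace_diagonal, Complex.exp_sum]
  simp

theorem norm_det_compress_exp {Q w : Mat n} (hQ : Q * Q = Q) (hQs : Qᴴ = Q) (hw : wᴴ = w)
    (h : Commute Q w) : ‖(compress Q (NormedSpace.exp w)).det‖ = Real.exp (Q * w).trace.re := by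
  obtain ⟨e⟩ := exists_uDiag (A := Q * w) (by rw [Matrix.conjTranspose_mul, hQs, hw, h.eq])
  rw [compress_exp hQ h, e.det_exp, Complex.norm_exp]

/-- The absolute value of an anti-dominant character of a parabolic subgroup, expressed by the
determinants of the action on a flag. -/
structure FlagData (R : ReductiveGroup n) (P : MatGroup n) (χ : P →* ℂˣ) where
  m : ℕ
  Q : Fin m → Mat n
  c : Fin m → ℝ
  idem : ∀ k, Q k * Q k = Q k
  herm : ∀ k, (Q k)ᴴ = Q k
  sign : ∀ k, 0 ≤ c k ∨ Q k = 1
  flag : ∀ k, ∀ p ∈ P, (p : Mat n) * Q k = Q k * (p : Mat n) * Q k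
  log_norm : ∀ p : P, Real.log ‖((χ p : ℂˣ) : ℂ)‖ =
    -∑ k, c k * Real.log ‖(compress (Q k) (toMat p)).det‖
  commute : ∀ Y ∈ lieAlg R.T, ∀ k, Commute (Q k) Y
  pairing_eq : ∀ Y ∈ lieAlg R.T, pairing Y χ = -∑ k, c k * (Q k * Y).trace.re
  iwasawa : ∀ g ∈ R.G, ∃ p ∈ P, (g : Mat n)ᴴ * (g : Mat n) = (p : Mat n)ᴴ * (p : Mat n)
  torus_le : R.T ≤ P

/-- Write $p=lu$ with $l$ in the Levi subgroup. The factor $u$ contributes nothing to either side.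
For $l$ the polar decomposition reduces to $e^w$ with $w$ hermitian in the Levi algebra, where
$\log|\chi(e^w)|=\mathrm{tr}(Zw)$ and $Z=a-\sum_k c_kQ_k$ with spectral projections $Q_k$. -/
theorem exists_flagData (hP : IsParabolic R P) {χ : P →* ℂˣ} (hχ : IsAlgChar χ)
    (hanti : IsAntidominant R χ) : Nonempty (FlagData R P χ) := by
  obtain ⟨A, hAT, d, hd⟩ := hP.exists_uDiag
  have hA : A ∈ lieAlg R.G := lieAlg_mono R.maximalTorus.1 hAT
  obtain ⟨Z, hZ⟩ := exists_dualElement hd hχ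
  obtain ⟨e⟩ := exists_uDiag hZ.herm
  obtain ⟨m, τ, c, a, hc, hsum⟩ := e.exists_eq_sum_proj
  have hTlevi : ∀ Y ∈ lieAlg R.T, Y ∈ leviLie R A := fun Y hY =>
    ⟨lieAlg_mono R.maximalTorus.1 hY, R.maximalTorus.2.1.commute_lieAlg_lieAlg hAT hY⟩
  -- The scalar part $a$ of $Z$ is entered as the coefficient $-a$ of the trivial projection; it may
  -- have either sign, which the alternative $Q_k=1$ in `sign` permits.
  set Q : Fin (m + 1) → Mat n := Fin.cons 1 fun k => e.proj (τ k) with hQdef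
  set b : Fin (m + 1) → ℝ := Fin.cons (-a) c with hbdef
  have hidem : ∀ k, Q k * Q k = Q k := Fin.cases (by simp [hQdef]) fun k => by
    simpa [hQdef] using e.proj_mul_self (τ k)
  have hherm : ∀ k, (Q k)ᴴ = Q k := Fin.cases (by simp [hQdef]) fun k => by
    simpa [hQdef] using e.proj_conjTranspose (τ k)
  have hcomm : ∀ k Y, Commute Z Y → Commute (Q k) Y := fun k Y hY => by
    refine Fin.cases ?_ (fun k => ?_) k
    · simp [hQdef]
    · simpa [hQdef, UDiag.proj] using e.commute_fn_of_commute hY _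
  have hZsum : ∀ Y, (Z * Y).trace.re = -∑ k, b k * (Q k * Y).trace.re := by
    intro Y
    rw [Fin.sum_univ_succ]
    have h1 : Z * Y = (a : ℂ) • Y - ∑ k, (c k : ℂ) • (e.proj (τ k) * Y) := by
      conv_lhs => rw [hsum]
      rw [sub_mul, Finset.sum_mul, Matrix.smul_mul, one_mul]
      simp only [Matrix.smul_mul]
    rw [h1, Matrix.trace_sub, Matrix.trace_sum]
    simp [hQdef, hbdef, Complex.re_sum]
    ring
  have hAQ : ∀ k, Commute A (Q k) := fun k =>
    (hcomm k A (hZ.commute_leviLie (hTlevi A hAT))).symm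
  have hlevG : ∀ k, ∀ g ∈ R.G, Commute A (g : Mat n) → Commute (Q k) (g : Mat n) :=
    fun k g hg hgc => hcomm k _ (hZ.comm g hg hgc)
  -- The only use of anti-dominance: since the nilradical does not raise eigenvalues of $Z$, it
  -- preserves the spectral subspaces $\{Z\le\tau\}$, and `flag_of_unip` passes this on to unipotent
  -- elements.
  have hflagU : ∀ k u, IsUnip d P u → (u : Mat n) * Q k = Q k * (u : Mat n) * Q k := by
    intro k u hu
    have := flag_of_unip (Q := Q k) hA hd (hidem k) (hAQ k) (fun Y hY hYu => by
      refine Fin.cases ?_ (fun k => ?_) k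
      · simp [hQdef]
      · simpa [hQdef] using e.mul_proj_of_loc (τ k) fun i j hij =>
          hZ.loc_eq_zero hAT hd hanti e hY hYu hij) (hu.inv hd)
    rwa [inv_inv] at this
  have hflagL : ∀ k, ∀ g ∈ R.G, Commute A (g : Mat n) → (g : Mat n) * Q k = Q k * (g : Mat n) * Q k :=
    fun k g hg hgc => by rw [(hlevG k g hg hgc).eq, mul_assoc, hidem]
  have hlogL : ∀ l : P, Commute A (toMat l) → Real.log ‖((χ l : ℂˣ) : ℂ)‖ =
      -∑ k, b k * Real.log ‖(compress (Q k) (toMat l)).det‖ := by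
    intro l hl
    have hlG : (l : GL (Fin n) ℂ) ∈ R.G := ((hd _).1 l.2).1
    obtain ⟨y, hy, hye⟩ := exists_exp_eq_conjTranspose_mul_self (l : GL (Fin n) ℂ)
    obtain ⟨f⟩ := exists_uDiag hy
    have hyG : y ∈ lieAlg R.G := by
      refine R.zariskiClosed.mem_lieAlg_of_exp hy ?_
      obtain ⟨l', hl', hle⟩ := R.selfAdjoint _ hlG
      have : expGL y = l' * (l : GL (Fin n) ℂ) := Units.ext (by
        rw [expGL_coe, hye, Units.val_mul, hle])
      rw [this]; exact R.G.mul_mem hl' hlG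
    have hlc : Commute A (toMat l)ᴴ := by
      have := congrArg Matrix.conjTranspose hl.eq
      rw [Matrix.conjTranspose_mul, Matrix.conjTranspose_mul, d.conjTranspose_self] at this
      exact this.symm
    have hyA : Commute A y :=
      (f.commute_of_commute_exp (by rw [hye]; exact (hlc.mul_right hl).symm)).symm
    have hyl : y ∈ leviLie R A := ⟨hyG, hyA⟩
    -- From $e^y=l^*l$ the element $le^{-w}$ with $w=y/2$ is unitary; it still lies in the Levi
    -- subgroup, so it affects neither $|\chi|$ nor the moduli of the determinants.
    set w : Mat n := (1 / 2 : ℂ) • y with hw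
    have hwl : w ∈ leviLie R A := (leviLie R A).smul_mem _ hyl
    have hws : wᴴ = w := by rw [hw, Matrix.conjTranspose_smul, hy]; norm_num
    have hwP := mem_lieAlg_of_leviLie hd hwl
    set q : P := expIn hwP 1 with hq
    have hqe : toMat q = NormedSpace.exp w := by
      show NormedSpace.exp ((1 : ℂ) • w) = _; rw [one_smul]
    set k₀ : P := l * q⁻¹ with hk₀
    have hlk : l = k₀ * q := by rw [hk₀]; group
    have hqi : toMat q⁻¹ = NormedSpace.exp (-w) := by
      show ((expGL ((1 : ℂ) • w))⁻¹ : GL (Fin n) ℂ).1 = _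
      rw [one_smul]; rfl
    have hkm : toMat k₀ = toMat l * NormedSpace.exp (-w) := by rw [← hqi]; simp [toMat, hk₀]
    have hkA : Commute A (toMat k₀) := by
      rw [hkm]; exact hl.mul_right (hwl.2.neg_right.exp_right)
    have hku : (toMat k₀)ᴴ * toMat k₀ = 1 := by
      have e1 : NormedSpace.exp y = NormedSpace.exp w * NormedSpace.exp w := by
        rw [← Matrix.exp_add_of_commute w w (Commute.refl w), hw, ← add_smul]; norm_num
      have e2 : NormedSpace.exp (-w) * NormedSpace.exp w = 1 := (expGL w).inv_val
      have e3 : NormedSpace.exp w * NormedSpace.exp (-w) = 1 := (expGL w).val_inv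
      rw [hkm, Matrix.conjTranspose_mul, ← Matrix.exp_conjTranspose, Matrix.conjTranspose_neg, hws]
      calc _ = NormedSpace.exp (-w) * ((toMat l)ᴴ * toMat l) * NormedSpace.exp (-w) := by
            simp only [mul_assoc]
        _ = 1 := by
            rw [show (toMat l)ᴴ * toMat l = _ from hye.symm, e1, ← mul_assoc, e2, one_mul, e3]
    have hχk := hχ.norm_eq_one_of_unitary hku
    have hχl : ((χ l : ℂˣ) : ℂ) = ((χ k₀ : ℂˣ) : ℂ) * Complex.exp (Z * w).trace := by
      rw [hlk, map_mul, Units.val_mul, hZ.exp w hwl q hqe]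
    rw [hχl, norm_mul, hχk, one_mul, Complex.norm_exp, Real.log_exp, hZsum]
    congr 1
    refine Finset.sum_congr rfl fun k _ => ?_
    congr 1
    have hQw : Commute (Q k) w := hcomm k _ (hZ.commute_leviLie hwl)
    have e1 : toMat l = toMat k₀ * NormedSpace.exp w := by
      rw [← hqe]; conv_lhs => rw [hlk]
      simp [toMat]
    have e2 : (compress (Q k) (toMat k₀))ᴴ * compress (Q k) (toMat k₀) = 1 := by
      rw [← compress_conjTranspose_mul_self (hherm k) (hidem k), hku, compress_one (hidem k)]
      exact hflagL k _ ((hd _).1 k₀.2).1 hkA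
    rw [e1, compress_mul (hidem k), Matrix.det_mul, norm_mul, norm_det_of_unitary e2, one_mul,
      norm_det_compress_exp (hidem k) (hherm k) hws hQw, Real.log_exp]
    have e3 : Q k * NormedSpace.exp w = NormedSpace.exp w * Q k := hQw.exp_right.eq
    rw [e3, mul_assoc, hidem]
  refine ⟨⟨m + 1, Q, b, hidem, hherm, ?_, ?_, ?_, ?_, ?_, ?_, ?_⟩⟩
  · exact Fin.cases (Or.inr (by simp [hQdef])) fun k => Or.inl (by simpa [hbdef] using hc k)
  · intro k p hp
    obtain ⟨l, hl, u, hlc, hu, rfl⟩ := exists_levi_unip hA hd hp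
    have h1 := hflagU k u hu
    have h2 := hflagL k l hl hlc
    rw [Units.val_mul]
    calc _ = (l : Mat n) * Q k * ((u : Mat n) * Q k) := by
          rw [mul_assoc, h1]; simp only [mul_assoc]; rw [← mul_assoc (Q k) (Q k), hidem]
      _ = Q k * (l : Mat n) * (Q k * (u : Mat n) * Q k) := by
          rw [h2, h1]; simp only [mul_assoc]; rw [← mul_assoc (Q k) (Q k), hidem]
      _ = _ := by rw [← h1]; simp only [mul_assoc]
  · intro p
    obtain ⟨l, hl, u, hlc, hu, hp⟩ := exists_levi_unip hA hd p.2
    have hlP := mem_of_commute hd hl hlc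
    have e : p = ⟨l, hlP⟩ * ⟨u, hu.1⟩ := Subtype.ext hp
    have h1 : χ ⟨u, hu.1⟩ = 1 := IsUnip.apply_eq_one hA hd hχ (u := ⟨u, hu.1⟩) hu
    rw [e, map_mul, h1, mul_one, hlogL ⟨l, hlP⟩ hlc]
    congr 1
    refine Finset.sum_congr rfl fun k _ => ?_
    have e2 : toMat ((⟨l, hlP⟩ : P) * ⟨u, hu.1⟩) = (l : Mat n) * (u : Mat n) := rfl
    rw [e2, compress_mul (hidem k) (hflagU k u hu), Matrix.det_mul,
      hu.det_compress hd (hidem k) (hAQ k) (hflagU k u hu), mul_one]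
    rfl
  · intro Y hY k
    exact hcomm k Y (hZ.commute_leviLie (hTlevi Y hY))
  · intro Y hY
    rw [Merohoric.pairing_eq, hZ.pair Y (hTlevi Y hY), hZsum]
  · intro g hg
    exact exists_parabolic_conjTranspose_mul_self R.zariskiClosed R.selfAdjoint hA hd hg
  · intro t ht
    exact mem_of_commute hd (R.maximalTorus.1 ht) (R.maximalTorus.2.1.commute_lieAlg hAT ht)

end FlagData

/-! ### Wirtinger calculus and the Laplacian. -/

section Wirtinger

open Complex (I)

variable {E F : Type*} [NormedAddCommGroup E] [NormedSpace ℂ E] [NormedAddCommGroup F]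
  [NormedSpace ℂ F] {𝔸 : Type*} [NormedRing 𝔸] [NormedAlgebra ℂ 𝔸]

/-- `∂f/∂z` for vector valued functions. -/
def dz (f : ℂ → E) (z : ℂ) : E := (1 / 2 : ℂ) • (fderiv ℝ f z 1 - I • fderiv ℝ f z I)

/-- `∂f/∂z̄` for vector valued functions. -/
def dzbar (f : ℂ → E) (z : ℂ) : E := (1 / 2 : ℂ) • (fderiv ℝ f z 1 + I • fderiv ℝ f z I)

theorem dZ_eq_dz : dZ = dz (E := ℂ) := by
  funext f z; simp only [dZ, dz, smul_eq_mul]; ring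

theorem dZbar_eq_dzbar : dZbar = dzbar (E := ℂ) := by
  funext f z; simp only [dZbar, dzbar, smul_eq_mul]; ring

theorem fderiv_eq_dz_add_dzbar (f : ℂ → E) (z w : ℂ) :
    fderiv ℝ f z w = w • dz f z + (starRingEnd ℂ) w • dzbar f z := by
  have h1 : w = w.re • (1 : ℂ) + w.im • I := by simp
  have h2 : (starRingEnd ℂ) w = w.re - w.im * I := by
    apply Complex.ext <;> simp
  have h3 : w = w.re + w.im * I := (Complex.re_add_im w).symm
  have e1 : ∀ (x : ℝ) (v : E), x • v = (x : ℂ) • v := fun x v => (Complex.coe_smul x v).symm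
  have key : ∀ (a b : ℂ) (x y : E), a • x + b • y =
      (a + b * I) • (1 / 2 : ℂ) • (x - I • y) + (a - b * I) • (1 / 2 : ℂ) • (x + I • y) := by
    intro a b x y
    match_scalars
    · ring
    · linear_combination b * Complex.I_mul_I
  have h4 : fderiv ℝ f z w = (w.re : ℂ) • fderiv ℝ f z 1 + (w.im : ℂ) • fderiv ℝ f z I := by
    conv_lhs => rw [h1, map_add, map_smul, map_smul]
    rw [e1, e1]
  rw [h4, key, h2, ← h3, dz, dzbar]

theorem dz_congr {f g : ℂ → E} {z : ℂ} (h : f =ᶠ[𝓝 z] g) : dz f z = dz g z := by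
  simp only [dz, h.fderiv_eq]

theorem dzbar_congr {f g : ℂ → E} {z : ℂ} (h : f =ᶠ[𝓝 z] g) : dzbar f z = dzbar g z := by
  simp only [dzbar, h.fderiv_eq]

theorem dz_add {f g : ℂ → E} {z : ℂ} (hf : DifferentiableAt ℝ f z) (hg : DifferentiableAt ℝ g z) :
    dz (fun w => f w + g w) z = dz f z + dz g z := by
  simp only [dz, fderiv_fun_add hf hg, add_apply]; module

theorem dzbar_add {f g : ℂ → E} {z : ℂ} (hf : DifferentiableAt ℝ f z)
    (hg : DifferentiableAt ℝ g z) : dzbar (fun w => f w + g w) z = dzbar f z + dzbar g z := by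
  simp only [dzbar, fderiv_fun_add hf hg, add_apply]; module

theorem dz_mul {f g : ℂ → 𝔸} {z : ℂ} (hf : DifferentiableAt ℝ f z) (hg : DifferentiableAt ℝ g z) :
    dz (fun w => f w * g w) z = dz f z * g z + f z * dz g z := by
  simp only [dz, fderiv_fun_mul' hf hg]
  simp [smul_sub, mul_sub, sub_mul]
  abel

theorem dzbar_mul {f g : ℂ → 𝔸} {z : ℂ} (hf : DifferentiableAt ℝ f z)
    (hg : DifferentiableAt ℝ g z) :
    dzbar (fun w => f w * g w) z = dzbar f z * g z + f z * dzbar g z := by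
  simp only [dzbar, fderiv_fun_mul' hf hg]
  simp [smul_add, mul_add, add_mul]
  abel

theorem dz_clm (L : E →L[ℂ] F) {f : ℂ → E} {z : ℂ} (hf : DifferentiableAt ℝ f z) :
    dz (fun w => L (f w)) z = L (dz f z) := by
  have h : fderiv ℝ (fun w => L (f w)) z = (L.restrictScalars ℝ).comp (fderiv ℝ f z) :=
    ((L.restrictScalars ℝ).hasFDerivAt.comp z hf.hasFDerivAt).fderiv
  simp [dz, h]

theorem dzbar_clm (L : E →L[ℂ] F) {f : ℂ → E} {z : ℂ} (hf : DifferentiableAt ℝ f z) :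
    dzbar (fun w => L (f w)) z = L (dzbar f z) := by
  have h : fderiv ℝ (fun w => L (f w)) z = (L.restrictScalars ℝ).comp (fderiv ℝ f z) :=
    ((L.restrictScalars ℝ).hasFDerivAt.comp z hf.hasFDerivAt).fderiv
  simp [dzbar, h]

theorem dz_comp_left {Φ : E → F} {f : ℂ → E} {z : ℂ} (hΦ : DifferentiableAt ℂ Φ (f z))
    (hf : DifferentiableAt ℝ f z) : dz (fun w => Φ (f w)) z = fderiv ℂ Φ (f z) (dz f z) := by
  have h : fderiv ℝ (fun w => Φ (f w)) z =
      ((fderiv ℂ Φ (f z)).restrictScalars ℝ).comp (fderiv ℝ f z) :=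
    ((hΦ.hasFDerivAt.restrictScalars ℝ).comp z hf.hasFDerivAt).fderiv
  simp [dz, h]

/-- Conjugate linear maps interchange the two derivatives. -/
theorem dzbar_conj (L : E →L⋆[ℂ] F) {f : ℂ → E} {z : ℂ} (hf : DifferentiableAt ℝ f z) :
    dzbar (fun w => L (f w)) z = L (dz f z) := by
  let L' : E →L[ℝ] F :=
    { toFun := L, map_add' := map_add L, cont := L.cont,
      map_smul' := fun c x => by
        have := L.map_smulₛₗ (c : ℂ) x
        simpa using this }
  have h : fderiv ℝ (fun w => L (f w)) z = L'.comp (fderiv ℝ f z) :=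
    (L'.hasFDerivAt.comp z hf.hasFDerivAt).fderiv
  have h2 : ∀ v, fderiv ℝ (fun w => L (f w)) z v = L (fderiv ℝ f z v) := fun v => by rw [h]; rfl
  simp only [dzbar, dz, h2, map_sub, L.map_smulₛₗ]
  simp [map_ofNat]

theorem dz_conj (L : E →L⋆[ℂ] F) {f : ℂ → E} {z : ℂ} (hf : DifferentiableAt ℝ f z) :
    dz (fun w => L (f w)) z = L (dzbar f z) := by
  let L' : E →L[ℝ] F :=
    { toFun := L, map_add' := map_add L, cont := L.cont,
      map_smul' := fun c x => by
        have := L.map_smulₛₗ (c : ℂ) x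
        simpa using this }
  have h : fderiv ℝ (fun w => L (f w)) z = L'.comp (fderiv ℝ f z) :=
    (L'.hasFDerivAt.comp z hf.hasFDerivAt).fderiv
  have h2 : ∀ v, fderiv ℝ (fun w => L (f w)) z v = L (fderiv ℝ f z v) := fun v => by rw [h]; rfl
  simp only [dzbar, dz, h2, map_add, L.map_smulₛₗ]
  simp [sub_eq_add_neg, map_ofNat]

theorem dzbar_of_differentiableAt {f : ℂ → E} {z : ℂ} (hf : DifferentiableAt ℂ f z) :
    dzbar f z = 0 := by
  have h : fderiv ℝ f z = (fderiv ℂ f z).restrictScalars ℝ := hf.fderiv_restrictScalars ℝ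
  have h2 : fderiv ℂ f z I = I • fderiv ℂ f z 1 := by rw [← map_smul, smul_eq_mul, mul_one]
  simp [dzbar, h, h2, smul_smul]

theorem dz_of_differentiableAt {f : ℂ → E} {z : ℂ} (hf : DifferentiableAt ℂ f z) :
    dz f z = deriv f z := by
  have h : fderiv ℝ f z = (fderiv ℂ f z).restrictScalars ℝ := hf.fderiv_restrictScalars ℝ
  have h2 : fderiv ℂ f z I = I • fderiv ℂ f z 1 := by rw [← map_smul, smul_eq_mul, mul_one]
  simp only [dz, h, ContinuousLinearMap.coe_restrictScalars', h2, smul_smul, Complex.I_mul_I,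
    fderiv_apply_one_eq_deriv]
  module

theorem dz_comp {f : ℂ → E} {φ : ℂ → ℂ} {z : ℂ} (hf : DifferentiableAt ℝ f (φ z))
    (hφ : DifferentiableAt ℂ φ z) : dz (fun w => f (φ w)) z = deriv φ z • dz f (φ z) := by
  have h1 : fderiv ℝ φ z = (fderiv ℂ φ z).restrictScalars ℝ := hφ.fderiv_restrictScalars ℝ
  have h : fderiv ℝ (fun w => f (φ w)) z = (fderiv ℝ f (φ z)).comp (fderiv ℝ φ z) :=
    (hf.hasFDerivAt.comp z (hφ.restrictScalars ℝ).hasFDerivAt).fderiv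
  have h2 : fderiv ℂ φ z I = I * deriv φ z := by
    rw [← fderiv_apply_one_eq_deriv, ← smul_eq_mul, ← map_smul, smul_eq_mul, mul_one]
  have hI := Complex.I_mul_I
  rw [dz, h, h1]
  simp only [ContinuousLinearMap.comp_apply, ContinuousLinearMap.coe_restrictScalars', h2,
    fderiv_apply_one_eq_deriv]
  rw [fderiv_eq_dz_add_dzbar f (φ z) (deriv φ z), fderiv_eq_dz_add_dzbar f (φ z) (I * deriv φ z)]
  simp only [map_mul, Complex.conj_I, smul_add, smul_smul, smul_sub]
  match_scalars
  · linear_combination (-1 / 2 : ℂ) * deriv φ z * hI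
  · linear_combination (1 / 2 : ℂ) * (starRingEnd ℂ) (deriv φ z) * hI

theorem dzbar_comp {f : ℂ → E} {φ : ℂ → ℂ} {z : ℂ} (hf : DifferentiableAt ℝ f (φ z))
    (hφ : DifferentiableAt ℂ φ z) :
    dzbar (fun w => f (φ w)) z = (starRingEnd ℂ) (deriv φ z) • dzbar f (φ z) := by
  have h1 : fderiv ℝ φ z = (fderiv ℂ φ z).restrictScalars ℝ := hφ.fderiv_restrictScalars ℝ
  have h : fderiv ℝ (fun w => f (φ w)) z = (fderiv ℝ f (φ z)).comp (fderiv ℝ φ z) :=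
    (hf.hasFDerivAt.comp z (hφ.restrictScalars ℝ).hasFDerivAt).fderiv
  have h2 : fderiv ℂ φ z I = I * deriv φ z := by
    rw [← fderiv_apply_one_eq_deriv, ← smul_eq_mul, ← map_smul, smul_eq_mul, mul_one]
  have hI := Complex.I_mul_I
  rw [dzbar, h, h1]
  simp only [ContinuousLinearMap.comp_apply, ContinuousLinearMap.coe_restrictScalars', h2,
    fderiv_apply_one_eq_deriv]
  rw [fderiv_eq_dz_add_dzbar f (φ z) (deriv φ z), fderiv_eq_dz_add_dzbar f (φ z) (I * deriv φ z)]
  simp only [map_mul, Complex.conj_I, smul_add, smul_smul]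
  match_scalars
  · linear_combination (1 / 2 : ℂ) * deriv φ z * hI
  · linear_combination (-1 / 2 : ℂ) * (starRingEnd ℂ) (deriv φ z) * hI

theorem contDiffAt_dz {f : ℂ → E} {z : ℂ} {m k : WithTop ℕ∞} (hf : ContDiffAt ℝ k f z)
    (h : m + 1 ≤ k) : ContDiffAt ℝ m (dz f) z := by
  have h1 := hf.fderiv_right h
  have h2 : ∀ v : ℂ, ContDiffAt ℝ m (fun w => fderiv ℝ f w v) z := fun v =>
    h1.clm_apply contDiffAt_const
  exact ((h2 1).sub ((h2 I).const_smul I)).const_smul (1 / 2 : ℂ)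

/-- `∂²u/∂z∂z̄`, a quarter of the Laplacian. -/
def lapl (u : ℂ → ℝ) (z : ℂ) : ℝ :=
  (fderiv ℝ (fun w => fderiv ℝ u w 1) z 1 + fderiv ℝ (fun w => fderiv ℝ u w I) z I) / 4

theorem lapl_congr {u v : ℂ → ℝ} {z : ℂ} (h : u =ᶠ[𝓝 z] v) : lapl u z = lapl v z := by
  have h1 : ∀ c : ℂ, (fun w => fderiv ℝ u w c) =ᶠ[𝓝 z] fun w => fderiv ℝ v w c := fun c => by
    filter_upwards [h.eventuallyEq_nhds] with w hw
    rw [hw.fderiv_eq]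
  simp only [lapl, (h1 _).fderiv_eq]

theorem ContDiffAt.differentiableAt_fderiv_apply {u : ℂ → ℝ} {z : ℂ} (hu : ContDiffAt ℝ 2 u z)
    (v : ℂ) : DifferentiableAt ℝ (fun w => fderiv ℝ u w v) z :=
  ((hu.fderiv_right (m := 1) (by norm_num)).clm_apply contDiffAt_const).differentiableAt (by norm_num)

theorem dzbar_dz_ofReal {u : ℂ → ℝ} {z : ℂ} (hu : ContDiffAt ℝ 2 u z) :
    dzbar (dz fun w => (u w : ℂ)) z = lapl u z := by
  have hd : ∀ᶠ w in 𝓝 z, DifferentiableAt ℝ u w := by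
    filter_upwards [hu.eventually (by simp)] with w hw using hw.differentiableAt (by norm_num)
  have hof : ∀ {f : ℂ → ℝ} {w : ℂ}, DifferentiableAt ℝ f w → ∀ v,
      fderiv ℝ (fun w => (f w : ℂ)) w v = (fderiv ℝ f w v : ℂ) := fun {f w} hw v => by
    have h : fderiv ℝ (fun w => (f w : ℂ)) w = Complex.ofRealCLM.comp (fderiv ℝ f w) :=
      (Complex.ofRealCLM.hasFDerivAt.comp w hw.hasFDerivAt).fderiv
    rw [h]; rfl
  have h1 : (dz fun w => (u w : ℂ)) =ᶠ[𝓝 z]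
      fun w => (1 / 2 : ℂ) • (((fderiv ℝ u w 1 : ℝ) : ℂ) - I • ((fderiv ℝ u w I : ℝ) : ℂ)) := by
    filter_upwards [hd] with w hw
    simp only [dz, hof hw]
  rw [dzbar_congr h1]
  have hD := fun v => ContDiffAt.differentiableAt_fderiv_apply hu v
  have hDc : ∀ v, DifferentiableAt ℝ (fun w => ((fderiv ℝ u w v : ℝ) : ℂ)) z := fun v =>
    (Complex.ofRealCLM.hasFDerivAt.comp z (hD v).hasFDerivAt).differentiableAt
  have hsym := hu.isSymmSndFDerivAt (by simp)
  have hs : ∀ v w : ℂ, fderiv ℝ (fun y => fderiv ℝ u y v) z w = fderiv ℝ (fderiv ℝ u) z w v := by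
    intro v w
    have hc : DifferentiableAt ℝ (fderiv ℝ u) z :=
      (hu.fderiv_right (m := 1) (by norm_num)).differentiableAt (by norm_num)
    rw [fderiv_clm_apply hc (differentiableAt_const v)]
    simp
  -- Symmetry of the second derivative removes the mixed terms of $\partial_{\bar z}\partial_z u$.
  have hs2 : fderiv ℝ (fun y => fderiv ℝ u y 1) z I = fderiv ℝ (fun y => fderiv ℝ u y I) z 1 := by
    rw [hs, hs]; exact hsym.eq I 1
  have h3 : ∀ v, fderiv ℝ (fun w => (1 / 2 : ℂ) • (((fderiv ℝ u w 1 : ℝ) : ℂ) -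
      I • ((fderiv ℝ u w I : ℝ) : ℂ))) z v = (1 / 2 : ℂ) •
        (((fderiv ℝ (fun w => fderiv ℝ u w 1) z v : ℝ) : ℂ) -
          I • ((fderiv ℝ (fun w => fderiv ℝ u w I) z v : ℝ) : ℂ)) := by
    intro v
    have hh := ((hDc 1).hasFDerivAt.fun_sub ((hDc I).hasFDerivAt.fun_const_smul I)).fun_const_smul
      (1 / 2 : ℂ)
    rw [hh.fderiv]
    simp only [smul_apply, sub_apply, hof (hD _)]
  simp only [dzbar, h3, hs2, lapl]
  simp only [smul_eq_mul]
  push_cast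
  linear_combination (-1 / 4 : ℂ) * (fderiv ℝ (fun w => fderiv ℝ u w I) z I : ℂ) * Complex.I_mul_I

/-- $\partial_z$ brings out $\varphi'$, which is holomorphic and passes through $\partial_{\bar z}$,
and $\partial_{\bar z}$ brings out $\overline{\varphi'}$. Hence the Laplacian transforms as a
density. -/
theorem lapl_comp {u : ℂ → ℝ} {φ : ℂ → ℂ} {z : ℂ} (hu : ContDiffAt ℝ 2 u (φ z))
    (hφ : ∀ᶠ w in 𝓝 z, DifferentiableAt ℂ φ w) :
    lapl (fun w => u (φ w)) z = ‖deriv φ z‖ ^ 2 * lapl u (φ z) := by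
  have hφa : AnalyticAt ℂ φ z := Complex.analyticAt_iff_eventually_differentiableAt.2 hφ
  have hφc : ContDiffAt ℝ 2 φ z := hφa.contDiffAt.restrict_scalars ℝ
  have huc : ContDiffAt ℝ 2 (fun w => (u w : ℂ)) (φ z) := Complex.ofRealCLM.contDiff.contDiffAt.comp _ hu
  have hcomp : ContDiffAt ℝ 2 (fun w => u (φ w)) z := hu.comp z hφc
  have h1 : (dz fun w => ((u (φ w) : ℝ) : ℂ)) =ᶠ[𝓝 z]
      fun w => deriv φ w * dz (fun w => (u w : ℂ)) (φ w) := by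
    filter_upwards [hφ, hφc.continuousAt.eventually (huc.eventually (by simp))] with w hw hw2
    exact dz_comp (f := fun w => (u w : ℂ)) (hw2.differentiableAt (by norm_num)) hw
  have hdd : DifferentiableAt ℂ (deriv φ) z := hφa.deriv.differentiableAt
  have hdz : DifferentiableAt ℝ (dz fun w => (u w : ℂ)) (φ z) :=
    (contDiffAt_dz (m := 1) huc (by norm_num)).differentiableAt (by norm_num)
  have h2 : DifferentiableAt ℝ (fun w => dz (fun w => (u w : ℂ)) (φ w)) z :=
    hdz.comp z (hφc.differentiableAt (by norm_num))
  have h3 := dzbar_dz_ofReal hcomp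
  rw [dzbar_congr h1, dzbar_mul (hdd.restrictScalars ℝ) h2, dzbar_of_differentiableAt hdd, zero_mul,
    zero_add, dzbar_comp hdz hφ.self_of_nhds, dzbar_dz_ofReal hu, smul_eq_mul, ← mul_assoc,
    Complex.mul_conj'] at h3
  exact_mod_cast h3.symm

theorem lapl_add {u v : ℂ → ℝ} {z : ℂ} (hu : ContDiffAt ℝ 2 u z) (hv : ContDiffAt ℝ 2 v z) :
    lapl (fun w => u w + v w) z = lapl u z + lapl v z := by
  have h1 : ∀ c : ℂ, (fun w => fderiv ℝ (fun w => u w + v w) w c) =ᶠ[𝓝 z]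
      fun w => fderiv ℝ u w c + fderiv ℝ v w c := fun c => by
    filter_upwards [hu.eventually (by simp), hv.eventually (by simp)] with w h1 h2
    rw [fderiv_fun_add (h1.differentiableAt (by norm_num)) (h2.differentiableAt (by norm_num))]; rfl
  simp only [lapl, (h1 _).fderiv_eq, fderiv_fun_add (ContDiffAt.differentiableAt_fderiv_apply hu _)
    (ContDiffAt.differentiableAt_fderiv_apply hv _), add_apply]
  ring

theorem lapl_const_mul {u : ℂ → ℝ} {z : ℂ} (c : ℝ) (hu : ContDiffAt ℝ 2 u z) :
    lapl (fun w => c * u w) z = c * lapl u z := by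
  have h1 : ∀ v : ℂ, (fun w => fderiv ℝ (fun w => c * u w) w v) =ᶠ[𝓝 z]
      fun w => c * fderiv ℝ u w v := fun v => by
    filter_upwards [hu.eventually (by simp)] with w h1
    rw [fderiv_const_mul (h1.differentiableAt (by norm_num))]; rfl
  simp only [lapl, (h1 _).fderiv_eq, fderiv_const_mul (ContDiffAt.differentiableAt_fderiv_apply hu _),
    smul_apply, smul_eq_mul]
  ring

/-- Where $f$ is positive, $\log|f|$ agrees with the holomorphic logarithm of $f$, and the chain
rule gives $f^{-1}\partial f$. The form with a norm suits determinants of positive matrices, which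
are complex-valued. -/
theorem dz_ofReal_log {f : ℂ → ℂ} {z : ℂ} (hf : ContDiffAt ℝ 2 f z) (hpos : ∀ᶠ w in 𝓝 z, ∃ r : ℝ, 0 < r ∧ f w = r) :
    (dz fun w => ((Real.log ‖f w‖ : ℝ) : ℂ)) =ᶠ[𝓝 z] fun w => (f w)⁻¹ * dz f w := by
  filter_upwards [hf.eventually (by simp), hpos.eventually_nhds] with w hw hp
  have h1 : (fun w => ((Real.log ‖f w‖ : ℝ) : ℂ)) =ᶠ[𝓝 w] fun w => Complex.log (f w) := by
    filter_upwards [hp] with y hy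
    obtain ⟨r, hr, hfr⟩ := hy
    rw [hfr, ← Complex.ofReal_log hr.le, Complex.norm_real, Real.norm_of_nonneg hr.le]
  obtain ⟨r, hr, hfr⟩ := hp.self_of_nhds
  have hs : f w ∈ Complex.slitPlane := by rw [hfr]; exact Or.inl (by simpa using hr)
  have hfd := hw.differentiableAt (by norm_num)
  rw [dz_congr h1]
  have h2 : HasFDerivAt (fun w => Complex.log (f w)) ((f w)⁻¹ • fderiv ℝ f w) w :=
    ((Complex.hasDerivAt_log hs).hasFDerivAt.restrictScalars ℝ).comp w hfd.hasFDerivAt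
      |>.congr_fderiv (by ext v; simp [mul_comm])
  simp only [dz, h2.fderiv, smul_apply, smul_eq_mul]
  ring

/-- The logarithm of the absolute value of a holomorphic function is harmonic. -/
theorem lapl_log_norm {g : ℂ → ℂ} {z : ℂ} (hg : ∀ᶠ w in 𝓝 z, DifferentiableAt ℂ g w)
    (h0 : g z ≠ 0) : lapl (fun w => Real.log (‖g w‖ ^ 2)) z = 0 := by
  have hga : AnalyticAt ℂ g z := Complex.analyticAt_iff_eventually_differentiableAt.2 hg
  have hgc : ContDiffAt ℝ 2 g z := hga.contDiffAt.restrict_scalars ℝ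
  have hne : ∀ᶠ w in 𝓝 z, g w ≠ 0 := hga.continuousAt.eventually_ne h0
  have hcc : ContDiffAt ℝ 2 (fun w => (starRingEnd ℂ) (g w)) z :=
    (Complex.conjCLE.contDiff).contDiffAt.comp z hgc
  set f : ℂ → ℂ := fun w => (starRingEnd ℂ) (g w) * g w with hf
  have hfc : ContDiffAt ℝ 2 f z := hcc.mul hgc
  have hfr : ∀ w, f w = ((‖g w‖ ^ 2 : ℝ) : ℂ) := fun w => by
    simp [hf, Complex.conj_mul']
  have h1 := dz_ofReal_log hfc (by
    filter_upwards [hne] with w hw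
    exact ⟨_, by positivity, hfr w⟩)
  have hfn : ∀ w, ‖f w‖ = ‖g w‖ ^ 2 := fun w => by
    rw [hfr, Complex.norm_real, Real.norm_of_nonneg (by positivity)]
  -- For $f=\bar gg$ and $\partial\bar g=0$ one gets $\partial\log|g|^2=g'/g$, a holomorphic
  -- function.
  have h2 : (fun w => (f w)⁻¹ * dz f w) =ᶠ[𝓝 z] fun w => (g w)⁻¹ * deriv g w := by
    filter_upwards [hne, hg, hgc.eventually (by simp)] with w hw hgw hgcw
    have hgd := hgcw.differentiableAt (show (2 : WithTop ℕ∞) ≠ 0 by norm_num)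
    have e1 : dz (fun w => (starRingEnd ℂ) (g w)) w = 0 := by
      have := dz_conj (starL ℂ : ℂ ≃L⋆[ℂ] ℂ).toContinuousLinearMap hgd
      rw [dzbar_of_differentiableAt hgw, map_zero] at this
      exact this
    have e2 : DifferentiableAt ℝ (fun w => (starRingEnd ℂ) (g w)) w :=
      Complex.conjCLE.differentiableAt.comp w hgd
    simp only [hf]
    rw [dz_mul e2 hgd, e1, zero_mul, zero_add,
      dz_of_differentiableAt hgw]
    have : (starRingEnd ℂ) (g w) ≠ 0 := (map_ne_zero _).2 hw
    field_simp
  simp only [hfn] at h1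
  have hlog : ContDiffAt ℝ 2 (fun w => Real.log (‖g w‖ ^ 2)) z := by
    refine ContDiffAt.log ?_ (by positivity)
    exact hgc.norm_sq ℝ
  have h3 := dzbar_dz_ofReal hlog
  rw [dzbar_congr (h1.trans h2), dzbar_of_differentiableAt] at h3
  · exact_mod_cast h3.symm
  · exact (hga.differentiableAt.inv h0).mul hga.deriv.differentiableAt

end Wirtinger

/-! ### The Chern–Weil inequality for determinants of subbundles. -/

section ChernWeil

open scoped ComplexOrder

variable {n : ℕ}

/-- The compression of $g^*g$ is the Gram matrix of the rows $gQ$ and $1-Q$ together; a common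
kernel vector is killed by $Q$ and by $1-Q$. -/
theorem posDef_compress {Q : Mat n} (hQs : Qᴴ = Q) (hQ : Q * Q = Q) (g : GL (Fin n) ℂ) :
    (compress Q ((g : Mat n)ᴴ * (g : Mat n))).PosDef := by
  have e : compress Q ((g : Mat n)ᴴ * (g : Mat n)) =
      (Matrix.fromRows ((g : Mat n) * Q) (1 - Q))ᴴ * Matrix.fromRows ((g : Mat n) * Q) (1 - Q) := by
    rw [Matrix.conjTranspose_fromRows_eq_fromCols_conjTranspose, Matrix.fromCols_mul_fromRows,
      Matrix.conjTranspose_mul, Matrix.conjTranspose_sub, hQs, Matrix.conjTranspose_one, compress]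
    have : (1 - Q) * (1 - Q) = 1 - Q := by noncomm_ring [hQ]
    rw [this]; simp only [mul_assoc]
  rw [e]
  refine Matrix.PosDef.conjTranspose_mul_self _ ?_
  rw [← Matrix.coe_mulVecLin, ← LinearMap.ker_eq_bot, LinearMap.ker_eq_bot']
  intro v hv
  rw [Matrix.mulVecLin_apply, Matrix.fromRows_mulVec] at hv
  have h1 : ((g : Mat n) * Q).mulVec v = 0 := by
    funext i; exact congrFun hv (Sum.inl i)
  have h2 : (1 - Q).mulVec v = 0 := by
    funext i; exact congrFun hv (Sum.inr i)
  have h3 : Q.mulVec v = 0 := by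
    have := congrArg (((g⁻¹ : GL (Fin n) ℂ) : Mat n).mulVec) h1
    rw [Matrix.mulVec_mulVec, ← mul_assoc, ← Units.val_mul, inv_mul_cancel, Units.val_one,
      one_mul, Matrix.mulVec_zero] at this
    exact this
  rwa [Matrix.sub_mulVec, Matrix.one_mulVec, h3, sub_zero] at h2

theorem exists_det_compress_eq {Q : Mat n} (hQs : Qᴴ = Q) (hQ : Q * Q = Q) (g : GL (Fin n) ℂ) :
    ∃ r : ℝ, 0 < r ∧ (compress Q ((g : Mat n)ᴴ * (g : Mat n))).det = r := by
  have h := (posDef_compress hQs hQ g).det_pos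
  rw [Complex.pos_iff] at h
  exact ⟨_, h.1, Complex.ext rfl (by simpa using h.2.symm)⟩

/-- Jacobi's formula, read off from the expansion $\det(M+sV)=\det
M\,(1+s\,\mathrm{tr}(M^{-1}V)+O(s^2))$. -/
theorem fderiv_det {M : Mat n} (hM : IsUnit M) (V : Mat n) :
    fderiv ℂ (fun M : Mat n => M.det) M V = M.det * (M⁻¹ * V).trace := by
  have hd : DifferentiableAt ℂ (fun M : Mat n => M.det) M :=
    (contDiff_det 1).contDiffAt.differentiableAt (by norm_num)
  have h1 : HasDerivAt (fun s : ℂ => M + s • V) V 0 := by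
    exact (((hasDerivAt_id (0 : ℂ)).smul_const V).const_add M).congr_deriv (by simp)
  have h2 : HasDerivAt (fun s : ℂ => (M + s • V).det) (fderiv ℂ (fun M : Mat n => M.det) M V) 0 := by
    have hd' : HasFDerivAt (fun M : Mat n => M.det) (fderiv ℂ (fun M : Mat n => M.det) M)
        (M + (0 : ℂ) • V) := by simpa using hd.hasFDerivAt
    exact hd'.comp_hasDerivAt 0 h1
  have h3 : ∀ s : ℂ, (M + s • V).det = M.det * (1 + (M⁻¹ * V).trace * s +
      (Matrix.det (1 + (Polynomial.X : Polynomial ℂ) • (M⁻¹ * V).map Polynomial.C)).divX.divX.eval s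
        * s ^ 2) := by
    intro s
    rw [← Matrix.det_one_add_smul, ← Matrix.det_mul, mul_add, mul_one, Matrix.mul_smul, ← mul_assoc,
      Matrix.mul_nonsing_inv _ ((Matrix.isUnit_iff_isUnit_det _).1 hM), one_mul]
  have h4 : HasDerivAt (fun s : ℂ => (M + s • V).det) (M.det * (M⁻¹ * V).trace) 0 := by
    simp only [h3]
    have h5 := (Polynomial.hasDerivAt (Matrix.det (1 + (Polynomial.X : Polynomial ℂ) •
      (M⁻¹ * V).map Polynomial.C)).divX.divX (0 : ℂ)).mul ((hasDerivAt_id (0 : ℂ)).pow 2)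
    have h6 := ((((hasDerivAt_id (0 : ℂ)).const_mul (M⁻¹ * V).trace).const_add 1).add h5).const_mul
      M.det
    refine HasDerivAt.congr_deriv h6 ?_
    simp
  exact h2.unique h4

theorem dz_det {W : ℂ → Mat n} {z : ℂ} (hW : DifferentiableAt ℝ W z) (hu : IsUnit (W z)) :
    dz (fun w => (W w).det) z = (W z).det * ((W z)⁻¹ * dz W z).trace := by
  have hd : DifferentiableAt ℂ (fun M : Mat n => M.det) (W z) :=
    (contDiff_det 1).contDiffAt.differentiableAt (by norm_num)
  exact (dz_comp_left hd hW).trans (fderiv_det hu _)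

theorem contDiffAt_inv {W : ℂ → Mat n} {z : ℂ} {m : WithTop ℕ∞} (hW : ContDiffAt ℝ m W z)
    (hu : IsUnit (W z)) : ContDiffAt ℝ m (fun w => (W w)⁻¹) z := by
  obtain ⟨v, hv⟩ := hu
  have h1 : ContDiffAt ℝ m Ring.inverse (W z) := by rw [← hv]; exact contDiffAt_ringInverse ℝ v
  have h2 : (fun w => (W w)⁻¹) = fun w => Ring.inverse (W w) := by
    funext w; exact Matrix.nonsing_inv_eq_ringInverse _
  rw [h2]
  exact h1.comp z hW

theorem eventually_isUnit {W : ℂ → Mat n} {z : ℂ} (hW : ContinuousAt W z) (hu : IsUnit (W z)) :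
    ∀ᶠ w in 𝓝 z, IsUnit (W w) :=
  hW.eventually (Units.isOpen.mem_nhds hu)

theorem dzbar_inv {W : ℂ → Mat n} {z : ℂ} (hW : ContDiffAt ℝ 1 W z) (hu : IsUnit (W z)) :
    dzbar (fun w => (W w)⁻¹) z = -((W z)⁻¹ * dzbar W z * (W z)⁻¹) := by
  have hWd := hW.differentiableAt (by norm_num)
  have h1 := dzbar_mul ((contDiffAt_inv hW hu).differentiableAt (by norm_num)) hWd
  have h2 : (fun w => (W w)⁻¹ * W w) =ᶠ[𝓝 z] fun _ => 1 := by
    filter_upwards [eventually_isUnit hW.continuousAt hu] with w hw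
    exact Matrix.nonsing_inv_mul _ ((Matrix.isUnit_iff_isUnit_det _).1 hw)
  rw [dzbar_congr h2, dzbar_of_differentiableAt (differentiableAt_const _)] at h1
  have h3 := congrArg (· * (W z)⁻¹) h1.symm
  simp only [add_mul, zero_mul, mul_assoc, Matrix.mul_nonsing_inv _
    ((Matrix.isUnit_iff_isUnit_det _).1 hu), mul_one] at h3
  rw [mul_assoc]
  exact eq_neg_of_add_eq_zero_left h3

theorem curvature_eq {H : ℂ → Mat n} {z : ℂ} (hH : ContDiffAt ℝ 2 H z) (hu : IsUnit (H z)) :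
    curvature H z = (H z)⁻¹ * dzbar (dz H) z - (H z)⁻¹ * dzbar H z * (H z)⁻¹ * dz H z := by
  have h1 : ∀ᶠ w in 𝓝 z, (Matrix.of fun k l => dZ (fun v => H v k l) w) = dz H w := by
    filter_upwards [hH.eventually (by simp)] with w hw
    ext k l
    rw [dZ_eq_dz]
    exact dz_clm (entryCLM k l) (hw.differentiableAt (by norm_num))
  have hdz : ContDiffAt ℝ 1 (dz H) z := contDiffAt_dz hH (by norm_num)
  have hinv : ContDiffAt ℝ 1 (fun w => (H w)⁻¹) z := contDiffAt_inv (hH.of_le (by norm_num)) hu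
  have h2 : curvature H z = dzbar (fun w => (H w)⁻¹ * dz H w) z := by
    ext i j
    rw [curvature, Matrix.of_apply, dZbar_eq_dzbar]
    refine Eq.trans (dzbar_congr ?_) (dzbar_clm (entryCLM i j)
      ((hinv.mul hdz).differentiableAt (by norm_num)))
    filter_upwards [h1] with w hw
    rw [hw]; rfl
  rw [h2, dzbar_mul (hinv.differentiableAt (by norm_num)) (hdz.differentiableAt (by norm_num)),
    dzbar_inv (hH.of_le (by norm_num)) hu]
  simp only [neg_mul]
  abel

theorem dzbar_conjTranspose {H : ℂ → Mat n} {z : ℂ} (hH : DifferentiableAt ℝ H z) :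
    dzbar (fun w => (H w)ᴴ) z = (dz H z)ᴴ := by
  let L : Mat n →L⋆[ℂ] Mat n :=
    { toFun := fun M => Mᴴ, map_add' := Matrix.conjTranspose_add,
      map_smul' := fun c M => Matrix.conjTranspose_smul c M, cont := by fun_prop }
  exact dzbar_conj L hH

theorem dz_conjTranspose {H : ℂ → Mat n} {z : ℂ} (hH : DifferentiableAt ℝ H z) :
    dz (fun w => (H w)ᴴ) z = (dzbar H z)ᴴ := by
  let L : Mat n →L⋆[ℂ] Mat n :=
    { toFun := fun M => Mᴴ, map_add' := Matrix.conjTranspose_add,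
      map_smul' := fun c M => Matrix.conjTranspose_smul c M, cont := by fun_prop }
  exact dz_conj L hH

theorem norm_trace_mul_le (M N : Mat n) :
    ‖(M * N).trace‖ ≤ Real.sqrt (frob M) * Real.sqrt (frob N) := by
  have h1 : (M * N).trace = ∑ p : Fin n × Fin n, M p.1 p.2 * N p.2 p.1 := by
    rw [Fintype.sum_prod_type]
    simp [Matrix.trace, Matrix.mul_apply]
  have h2 : frob M = ∑ p : Fin n × Fin n, ‖M p.1 p.2‖ ^ 2 := by
    rw [Fintype.sum_prod_type]; rfl
  have h3 : frob N = ∑ p : Fin n × Fin n, ‖N p.2 p.1‖ ^ 2 := by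
    rw [Fintype.sum_prod_type, Finset.sum_comm]; rfl
  rw [h1, h2, h3]
  refine (norm_sum_le _ _).trans (le_trans (le_of_eq ?_)
    (Real.sum_mul_le_sqrt_mul_sqrt _ (fun p : Fin n × Fin n => ‖M p.1 p.2‖) fun p => ‖N p.2 p.1‖))
  simp

/-- The pointwise norm of a curvature coefficient `F` with respect to the metric `H`. -/
def hermNorm (H F : Mat n) : ℝ := Real.sqrt (F * (H⁻¹ * Fᴴ * H)).trace.re

theorem hermNorm_eq (g : GL (Fin n) ℂ) (F : Mat n) : hermNorm ((g : Mat n)ᴴ * (g : Mat n)) F =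
    Real.sqrt (frob ((g : Mat n) * F * ((g⁻¹ : GL (Fin n) ℂ) : Mat n))) := by
  have hgi : (g : Mat n)⁻¹ = ((g⁻¹ : GL (Fin n) ℂ) : Mat n) := (Matrix.coe_units_inv g).symm
  have hinv : ((g : Mat n)ᴴ * (g : Mat n))⁻¹ =
      ((g⁻¹ : GL (Fin n) ℂ) : Mat n) * ((g⁻¹ : GL (Fin n) ℂ) : Mat n)ᴴ := by
    rw [Matrix.mul_inv_rev, hgi, ← Matrix.conjTranspose_nonsing_inv, hgi]
  have h : (frob ((g : Mat n) * F * ((g⁻¹ : GL (Fin n) ℂ) : Mat n)) : ℂ) =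
      (F * (((g : Mat n)ᴴ * (g : Mat n))⁻¹ * Fᴴ * ((g : Mat n)ᴴ * (g : Mat n)))).trace := by
    rw [frob_eq_trace, hinv, Matrix.conjTranspose_mul, Matrix.conjTranspose_mul,
      Matrix.trace_mul_comm]
    rw [show F * (((g⁻¹ : GL (Fin n) ℂ) : Mat n) * ((g⁻¹ : GL (Fin n) ℂ) : Mat n)ᴴ * Fᴴ *
      ((g : Mat n)ᴴ * (g : Mat n))) = (F * ((g⁻¹ : GL (Fin n) ℂ) : Mat n) *
      (((g⁻¹ : GL (Fin n) ℂ) : Mat n)ᴴ * (Fᴴ * (g : Mat n)ᴴ))) * (g : Mat n) by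
        simp only [mul_assoc], Matrix.trace_mul_comm _ (g : Mat n)]
    simp only [mul_assoc]
  rw [hermNorm, ← h, Complex.ofReal_re]

/-- The algebraic core of the Chern–Weil formula for the determinant of a flag. -/
theorem trace_compress_identity {Q : Mat n} (hQs : Qᴴ = Q) (hQ : Q * Q = Q) (g : GL (Fin n) ℂ)
    (F : Mat n) : ∃ Rm T : Mat n,
      let H := (g : Mat n)ᴴ * (g : Mat n)
      (compress Q H)⁻¹ * Q = Rm ∧ Q * (compress Q H)⁻¹ = Rm ∧ H⁻¹ = Rm + T ∧ (Q = 1 → T = 0) ∧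
      (∀ B : Mat n, ∃ r : ℝ, 0 ≤ r ∧ (Rm * Bᴴ * T * B).trace = r) ∧
      ‖(Rm * H * F).trace‖ ≤ Real.sqrt (frob Q) * hermNorm H F := by
  set H : Mat n := (g : Mat n)ᴴ * (g : Mat n) with hH
  set W := compress Q H with hW
  have hWu : IsUnit W.det := (Matrix.isUnit_iff_isUnit_det _).1 (posDef_compress hQs hQ g).isUnit
  have hHs : Hᴴ = H := by simp [hH]
  have hHu : IsUnit H.det := by
    rw [hH, Matrix.det_mul, Matrix.det_conjTranspose]
    have := (Matrix.isUnit_iff_isUnit_det _).1 g.isUnit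
    exact this.star.mul this
  have hWs : Wᴴ = W := by rw [hW, compress_conjTranspose hQs, hHs]
  have hWQ : W * Q = Q * H * Q := by
    rw [hW, compress, add_mul, sub_mul, one_mul, hQ, sub_self, add_zero, mul_assoc _ Q Q, hQ]
  have hQW : Q * W = Q * H * Q := by
    rw [hW, compress, mul_add, mul_sub, mul_one, hQ, sub_self, add_zero, ← mul_assoc, ← mul_assoc, hQ]
  have hc : W⁻¹ * Q = Q * W⁻¹ := by
    calc W⁻¹ * Q = W⁻¹ * (Q * W) * W⁻¹ := by
          rw [mul_assoc, mul_assoc, Matrix.mul_nonsing_inv _ hWu, mul_one]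
      _ = _ := by rw [hQW, ← hWQ, ← mul_assoc, Matrix.nonsing_inv_mul _ hWu, one_mul]
  -- `Rm` is the inverse of $QHQ$ on the range of $Q$, extended by zero: `Rm * H` is the
  -- $H$-orthogonal projection onto that range. The complement `T`, with $H^{-1}=Rm+T$, satisfies
  -- $THT=T$.
  obtain ⟨Rm, hRm⟩ : ∃ Rm, Rm = W⁻¹ * Q := ⟨_, rfl⟩
  rw [← hRm] at hc
  have hRs : Rmᴴ = Rm := by
    conv_lhs => rw [hRm, Matrix.conjTranspose_mul, hQs, Matrix.conjTranspose_nonsing_inv, hWs, ← hc]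
  have hRHR : Rm * H * Rm = Rm := by
    calc Rm * H * Rm = W⁻¹ * Q * H * (Q * W⁻¹) := by rw [← hc, hRm]
      _ = W⁻¹ * (Q * H * Q) * W⁻¹ := by simp only [mul_assoc]
      _ = Rm := by
          rw [← hWQ, ← mul_assoc, Matrix.nonsing_inv_mul _ hWu, one_mul, ← hc]
  set T := H⁻¹ - Rm with hT
  have hHis : (H⁻¹)ᴴ = H⁻¹ := by rw [Matrix.conjTranspose_nonsing_inv, hHs]
  have hTs : Tᴴ = T := by rw [hT, Matrix.conjTranspose_sub, hRs, hHis]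
  have hTHT : T * H * T = T := by
    rw [hT, sub_mul, sub_mul, mul_sub, mul_sub, Matrix.nonsing_inv_mul _ hHu, hRHR, one_mul, one_mul,
      mul_assoc Rm H, Matrix.mul_nonsing_inv _ hHu, mul_one]
    abel
  have hgi : ((g⁻¹ : GL (Fin n) ℂ) : Mat n) * (g : Mat n) = 1 := by
    rw [← Units.val_mul, inv_mul_cancel, Units.val_one]
  refine ⟨Rm, T, hRm.symm, hc.symm, by rw [hT]; abel, ?_, ?_, ?_⟩
  · intro h
    rw [hT, hRm, hW, h]; simp [compress]
  · intro B
    -- The trace is a squared norm, that of the second fundamental form of the subbundle when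
    -- $B=\partial H$.
    refine ⟨frob ((g : Mat n) * T * B * ((g : Mat n) * Rm)ᴴ), frob_nonneg _, ?_⟩
    rw [frob_eq_trace]
    simp only [Matrix.conjTranspose_mul, Matrix.conjTranspose_conjTranspose, hRs, hTs]
    have e1 : (g : Mat n) * Rm * (Bᴴ * (T * (g : Mat n)ᴴ)) *
        ((g : Mat n) * T * B * (Rm * (g : Mat n)ᴴ)) =
        (g : Mat n) * (Rm * Bᴴ * (T * H * T) * B * Rm * (g : Mat n)ᴴ) := by
      rw [hH]; simp only [mul_assoc]
    rw [e1, hTHT, Matrix.trace_mul_comm (g : Mat n)]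
    have e2 : Rm * Bᴴ * T * B * Rm * (g : Mat n)ᴴ * (g : Mat n) = (Rm * Bᴴ * T * B) * (Rm * H) := by
      rw [hH]; simp only [mul_assoc]
    rw [e2, Matrix.trace_mul_comm _ (Rm * H)]
    have e3 : Rm * H * (Rm * Bᴴ * T * B) = (Rm * H * Rm) * Bᴴ * T * B := by simp only [mul_assoc]
    rw [e3, hRHR]
  · rw [hH, hermNorm_eq, ← hH]
    -- In the orthonormal frame given by $g$ the projection becomes an orthogonal one of the same
    -- trace, hence the same Frobenius norm, as $Q$. The estimate is Cauchy–Schwarz.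
    set Pr : Mat n := (g : Mat n) * Rm * (g : Mat n)ᴴ with hPr
    have hPrs : Prᴴ = Pr := by simp [hPr, hRs, mul_assoc]
    have hPrPr : Pr * Pr = Pr := by
      have : Pr * Pr = (g : Mat n) * (Rm * H * Rm) * (g : Mat n)ᴴ := by
        rw [hPr, hH]; simp only [mul_assoc]
      rw [this, hRHR]
    have h1 : (Rm * H * F).trace =
        (Pr * ((g : Mat n) * F * ((g⁻¹ : GL (Fin n) ℂ) : Mat n))).trace := by
      have : Pr * ((g : Mat n) * F * ((g⁻¹ : GL (Fin n) ℂ) : Mat n)) =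
          (g : Mat n) * (Rm * H * F * ((g⁻¹ : GL (Fin n) ℂ) : Mat n)) := by
        rw [hPr, hH]; simp only [mul_assoc]
      rw [this, Matrix.trace_mul_comm (g : Mat n), mul_assoc _ _ (g : Mat n), hgi, mul_one]
    have h2 : frob Pr = frob Q := by
      have e1 : ((frob Pr : ℝ) : ℂ) = ((frob Q : ℝ) : ℂ) := by
        have e2 : Rm = Q * Rm := by rw [hc, ← mul_assoc, hQ]
        rw [frob_eq_trace, frob_eq_trace, hPrs, hQs, hPrPr, hQ, hPr, mul_assoc,
          Matrix.trace_mul_comm (g : Mat n), mul_assoc, ← hH, e2, mul_assoc,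
          Matrix.trace_mul_comm Q, hRm, mul_assoc, mul_assoc, ← mul_assoc Q H Q, ← hWQ, ← mul_assoc,
          Matrix.nonsing_inv_mul _ hWu, one_mul]
      exact_mod_cast e1
    rw [h1, ← h2]
    exact norm_trace_mul_le _ _

/-- The Chern–Weil inequality for the determinant of a flag. -/
theorem lapl_log_det_compress {Q : Mat n} (hQs : Qᴴ = Q) (hQ : Q * Q = Q) {H : ℂ → Mat n} {z : ℂ}
    (hH : ContDiffAt ℝ 2 H z)
    (hg : ∀ᶠ w in 𝓝 z, ∃ g : GL (Fin n) ℂ, H w = (g : Mat n)ᴴ * (g : Mat n)) :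
    ContDiffAt ℝ 2 (fun w => Real.log ‖(compress Q (H w)).det‖) z ∧
    -(Real.sqrt (frob Q) * hermNorm (H z) (curvature H z)) ≤
      lapl (fun w => Real.log ‖(compress Q (H w)).det‖) z ∧
    (Q = 1 → lapl (fun w => Real.log ‖(compress Q (H w)).det‖) z ≤
      Real.sqrt (frob Q) * hermNorm (H z) (curvature H z)) := by
  have hW : ContDiffAt ℝ 2 (fun w => compress Q (H w)) z :=
    ((contDiffAt_const.mul hH).mul contDiffAt_const).add contDiffAt_const
  have hdet : ContDiffAt ℝ 2 (fun w => (compress Q (H w)).det) z :=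
    ((contDiff_det (n := n) 2).contDiffAt.restrict_scalars ℝ).comp z hW
  have hpos : ∀ᶠ w in 𝓝 z, ∃ r : ℝ, 0 < r ∧ (compress Q (H w)).det = r := by
    filter_upwards [hg] with w hw
    obtain ⟨g, hg⟩ := hw
    rw [hg]; exact exists_det_compress_eq hQs hQ g
  have hWu : ∀ᶠ w in 𝓝 z, IsUnit (compress Q (H w)) := by
    filter_upwards [hg] with w hw
    obtain ⟨g, hg⟩ := hw
    rw [hg]; exact (posDef_compress hQs hQ g).isUnit
  have hne : (compress Q (H z)).det ≠ 0 :=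
    ((Matrix.isUnit_iff_isUnit_det _).1 hWu.self_of_nhds).ne_zero
  have hsm : ContDiffAt ℝ 2 (fun w => Real.log ‖(compress Q (H w)).det‖) z :=
    (hdet.norm ℝ hne).log (by simpa using hne)
  refine ⟨hsm, ?_⟩
  obtain ⟨g, hgz⟩ := hg.self_of_nhds
  obtain ⟨Rm, T, h1, h2, h3, h4, h5, h6⟩ := trace_compress_identity hQs hQ g (curvature H z)
  rw [← hgz] at h1 h2 h3 h6
  have hHu : IsUnit (H z) := by
    rw [Matrix.isUnit_iff_isUnit_det, hgz, Matrix.det_mul, Matrix.det_conjTranspose]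
    have := (Matrix.isUnit_iff_isUnit_det _).1 g.isUnit
    exact this.star.mul this
  have hHd : ∀ᶠ w in 𝓝 z, DifferentiableAt ℝ H w := by
    filter_upwards [hH.eventually (by simp)] with w hw using hw.differentiableAt (by norm_num)
  have hdH : ContDiffAt ℝ 1 (dz H) z := contDiffAt_dz hH (by norm_num)
  -- the first derivative
  have hdW : ∀ᶠ w in 𝓝 z, dz (fun w => compress Q (H w)) w = Q * dz H w * Q := by
    filter_upwards [hHd] with w hw
    have hc : ∀ M : Mat n, dz (fun _ => M) w = 0 := fun M => by
      rw [dz_of_differentiableAt (differentiableAt_const _), deriv_const]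
    have hQH : DifferentiableAt ℝ (fun w => Q * H w) w := (differentiableAt_const _).fun_mul hw
    simp only [compress]
    rw [dz_add (hQH.fun_mul (differentiableAt_const _)) (differentiableAt_const _),
      dz_mul hQH (differentiableAt_const _), dz_mul (differentiableAt_const _) hw, hc, hc]
    simp
  have hcb : ∀ M : Mat n, dzbar (fun _ => M) z = 0 := fun M =>
    dzbar_of_differentiableAt (differentiableAt_const _)
  have hQm : ∀ {K : ℂ → Mat n}, DifferentiableAt ℝ K z →
      dzbar (fun w => Q * K w * Q) z = Q * dzbar K z * Q := fun {K} hK => by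
    rw [dzbar_mul ((differentiableAt_const _).fun_mul hK) (differentiableAt_const _),
      dzbar_mul (differentiableAt_const _) hK, hcb]
    simp
  have hdWb : dzbar (fun w => compress Q (H w)) z = Q * dzbar H z * Q := by
    simp only [compress]
    rw [dzbar_add (((differentiableAt_const _).fun_mul hHd.self_of_nhds).fun_mul
      (differentiableAt_const _)) (differentiableAt_const _), hQm hHd.self_of_nhds, hcb, add_zero]
  let tr : Mat n →L[ℂ] ℂ := (Matrix.traceLinearMap (Fin n) ℂ ℂ).toContinuousLinearMap
  have hfirst : (dz fun w => ((Real.log ‖(compress Q (H w)).det‖ : ℝ) : ℂ)) =ᶠ[𝓝 z]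
      fun w => tr ((compress Q (H w))⁻¹ * (Q * dz H w * Q)) := by
    filter_upwards [dz_ofReal_log hdet hpos, hdW, hWu, hW.eventually (by simp)] with w e1 e2 e3 e4
    rw [e1, dz_det (e4.differentiableAt (by norm_num)) e3, e2, inv_mul_cancel_left₀]
    · rfl
    · exact ((Matrix.isUnit_iff_isUnit_det _).1 e3).ne_zero
  have hinv := contDiffAt_inv (hW.of_le (show (1 : WithTop ℕ∞) ≤ 2 by norm_num)) hWu.self_of_nhds
  have hSd : DifferentiableAt ℝ (fun w => (Q * dz H w * Q)) z :=
    ((differentiableAt_const _).fun_mul (hdH.differentiableAt (by norm_num))).fun_mul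
      (differentiableAt_const _)
  have hid := hinv.differentiableAt (by norm_num)
  have hkey := dzbar_dz_ofReal hsm
  have htr := dzbar_clm tr (hid.fun_mul hSd)
  rw [dzbar_mul hid hSd, dzbar_inv (hW.of_le (by norm_num)) hWu.self_of_nhds, hdWb,
    hQm (hdH.differentiableAt (by norm_num))] at htr
  replace hkey := htr.symm.trans ((dzbar_congr hfirst).symm.trans hkey)
  have hconj : dzbar H z = (dz H z)ᴴ := by
    rw [← dzbar_conjTranspose hHd.self_of_nhds]
    refine dzbar_congr ?_
    filter_upwards [hg] with w hw
    obtain ⟨g, hg⟩ := hw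
    rw [hg]; simp
  obtain ⟨r, hr, hrt⟩ := h5 (dz H z)
  -- The Laplacian is the curvature traced over the subbundle plus the squared second fundamental
  -- form $r\ge0$. This gives the lower bound; for $Q=1$ the form vanishes and the bound is
  -- two-sided.
  have hformula : ((lapl (fun w => Real.log ‖(compress Q (H w)).det‖) z : ℝ) : ℂ) =
      (Rm * H z * curvature H z).trace + r := by
    rw [← hkey, ← hrt, curvature_eq hH hHu]
    have hHH := Matrix.mul_nonsing_inv _ ((Matrix.isUnit_iff_isUnit_det _).1 hHu)
    set W := compress Q (H z)
    set B := dz H z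
    set B2 := dzbar (dz H) z
    have hT : T = (H z)⁻¹ - Rm := by rw [h3]; abel
    show (-(W⁻¹ * (Q * dzbar H z * Q) * W⁻¹) * (Q * B * Q) + W⁻¹ * (Q * B2 * Q)).trace = _
    rw [hconj, hT]
    have e1 : W⁻¹ * (Q * Bᴴ * Q) * W⁻¹ * (Q * B * Q) = (Rm * Bᴴ) * ((Q * W⁻¹) * Q) * B * Q := by
      rw [← h1]; simp only [mul_assoc]
    have e2 : Q * W⁻¹ * Q = Rm := by rw [mul_assoc, h1, ← h2, ← mul_assoc, hQ]
    have e3 : Q * Rm = Rm := by rw [← h2, ← mul_assoc, hQ]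
    have e4 : ((Rm * Bᴴ) * Rm * B * Q).trace = (Rm * Bᴴ * Rm * B).trace := by
      rw [Matrix.trace_mul_comm]; simp only [← mul_assoc]; rw [e3]
    have e5 : (W⁻¹ * (Q * B2 * Q)).trace = (Rm * B2).trace := by
      rw [← mul_assoc, ← mul_assoc, h1, Matrix.trace_mul_comm, ← mul_assoc, e3]
    have e6 : Rm * H z * ((H z)⁻¹ * B2 - (H z)⁻¹ * Bᴴ * (H z)⁻¹ * B) =
        Rm * B2 - Rm * Bᴴ * (H z)⁻¹ * B := by
      rw [mul_sub, mul_assoc Rm, ← mul_assoc (H z), hHH, one_mul]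
      congr 1
      simp only [mul_assoc]
      rw [← mul_assoc (H z) (H z)⁻¹, hHH, one_mul]
    rw [e6, Matrix.trace_add, neg_mul, Matrix.trace_neg, e1, e2, e4, e5, Matrix.trace_sub, mul_sub,
      sub_mul, Matrix.trace_sub]
    ring
  have hre := congrArg Complex.re hformula
  rw [Complex.ofReal_re, Complex.add_re, Complex.ofReal_re] at hre
  have hle := (Complex.abs_re_le_norm _).trans h6
  rw [abs_le] at hle
  refine ⟨by linarith, fun hQ1 => ?_⟩
  have hr0 : r = 0 := by
    rw [h4 hQ1] at hrt
    simp only [mul_zero, zero_mul, Matrix.trace_zero] at hrt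
    exact_mod_cast hrt.symm
  linarith

theorem curvature_conj_aux {g H B C D B2 g' : Mat n} (hg : IsUnit g) (hH : IsUnit H) :
    (gᴴ * H * g)⁻¹ * (D * (B * g + H * g') + gᴴ * (B2 * g + B * 0 + (C * g' + H * 0))) -
      (gᴴ * H * g)⁻¹ * ((D * H + gᴴ * C) * g + gᴴ * H * 0) * (gᴴ * H * g)⁻¹ *
        (gᴴ * (B * g + H * g')) = g⁻¹ * (H⁻¹ * B2 - H⁻¹ * C * H⁻¹ * B) * g := by
  have hg' := (Matrix.isUnit_iff_isUnit_det _).1 hg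
  have hsu : IsUnit (gᴴ).det := by rw [Matrix.det_conjTranspose]; exact hg'.star
  have hH1 := Matrix.nonsing_inv_mul _ ((Matrix.isUnit_iff_isUnit_det _).1 hH)
  have hH2 := Matrix.mul_nonsing_inv _ ((Matrix.isUnit_iff_isUnit_det _).1 hH)
  have hg1 := Matrix.mul_nonsing_inv _ hg'
  have hs1 := Matrix.nonsing_inv_mul _ hsu
  have c1 : ∀ M : Mat n, (gᴴ)⁻¹ * (gᴴ * M) = M := fun M => by rw [← mul_assoc, hs1, one_mul]
  have c2 : ∀ M : Mat n, H⁻¹ * (H * M) = M := fun M => by rw [← mul_assoc, hH1, one_mul]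
  have c4 : ∀ M : Mat n, H * (H⁻¹ * M) = M := fun M => by rw [← mul_assoc, hH2, one_mul]
  have c3 : ∀ M : Mat n, g * (g⁻¹ * M) = M := fun M => by rw [← mul_assoc, hg1, one_mul]
  simp only [Matrix.mul_inv_rev, mul_add, add_mul, mul_sub, sub_mul, mul_assoc, c1, c2, c3, c4,
    mul_zero, add_zero]
  abel

/-- The curvature in another holomorphic frame. -/
theorem curvature_conj {H : ℂ → Mat n} {g : ℂ → Mat n} {z : ℂ} (hH : ContDiffAt ℝ 2 H z)
    (hu : IsUnit (H z)) (hg : ∀ᶠ w in 𝓝 z, DifferentiableAt ℂ g w) (hgu : IsUnit (g z)) :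
    curvature (fun w => (g w)ᴴ * H w * g w) z = (g z)⁻¹ * curvature H z * g z := by
  have hga : AnalyticAt ℂ g z := Complex.analyticAt_iff_eventually_differentiableAt.2 hg
  have hgc : ContDiffAt ℝ 2 g z := hga.contDiffAt.restrict_scalars ℝ
  have hgd : DifferentiableAt ℝ g z := hgc.differentiableAt (by norm_num)
  have hL : ContDiff ℝ 2 fun M : Mat n => Mᴴ := by
    let L : Mat n →L[ℝ] Mat n :=
      { toFun := fun M => Mᴴ, map_add' := Matrix.conjTranspose_add,
        map_smul' := fun c M => by simp, cont := by fun_prop }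
    exact L.contDiff
  have hgs : ContDiffAt ℝ 2 (fun w => (g w)ᴴ) z := hL.contDiffAt.comp z hgc
  have hK : ContDiffAt ℝ 2 (fun w => (g w)ᴴ * H w * g w) z := (hgs.mul hH).mul hgc
  have hu' : IsUnit ((g z)ᴴ * H z * g z) := by
    refine (IsUnit.mul ?_ hu).mul hgu
    rw [Matrix.isUnit_iff_isUnit_det, Matrix.det_conjTranspose]
    exact ((Matrix.isUnit_iff_isUnit_det _).1 hgu).star
  have hHd := hH.differentiableAt (show (2 : WithTop ℕ∞) ≠ 0 by norm_num)
  have hdH : DifferentiableAt ℝ (dz H) z :=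
    (contDiffAt_dz (m := 1) hH (by norm_num)).differentiableAt (by norm_num)
  have hdz : dz (fun w => (g w)ᴴ * H w * g w) =ᶠ[𝓝 z]
      fun w => (g w)ᴴ * (dz H w * g w + H w * dz g w) := by
    filter_upwards [hg, hgs.eventually (by simp), hH.eventually (by simp)] with w h1 h2 h3
    have h2d := h2.differentiableAt (show (2 : WithTop ℕ∞) ≠ 0 by norm_num)
    have h3d := h3.differentiableAt (show (2 : WithTop ℕ∞) ≠ 0 by norm_num)
    have e0 : dz (fun w => (g w)ᴴ) w = 0 := by
      rw [dz_conjTranspose (h1.restrictScalars ℝ), dzbar_of_differentiableAt h1,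
        Matrix.conjTranspose_zero]
    rw [dz_mul (h2d.fun_mul h3d) (h1.restrictScalars ℝ), dz_mul h2d h3d, e0]
    simp only [zero_mul, zero_add, mul_add, mul_assoc]
  have hd' : DifferentiableAt ℂ (deriv g) z := hga.deriv.differentiableAt
  have hd'r : DifferentiableAt ℝ (dz g) z :=
    (contDiffAt_dz (m := 1) hgc (by norm_num)).differentiableAt (by norm_num)
  have e1 : dzbar g z = 0 := dzbar_of_differentiableAt hg.self_of_nhds
  have e2 : dzbar (dz g) z = 0 := by
    refine (dzbar_congr ?_).trans (dzbar_of_differentiableAt hd')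
    filter_upwards [hg] with w hw using dz_of_differentiableAt hw
  have e3 := dzbar_conjTranspose hgd
  have hgsd := hgs.differentiableAt (show (2 : WithTop ℕ∞) ≠ 0 by norm_num)
  rw [curvature_eq hK hu', curvature_eq hH hu, hdz.self_of_nhds, dzbar_congr hdz,
    dzbar_mul hgsd ((hdH.fun_mul hgd).fun_add (hHd.fun_mul hd'r)),
    dzbar_add (hdH.fun_mul hgd) (hHd.fun_mul hd'r), dzbar_mul hdH hgd, dzbar_mul hHd hd'r,
    dzbar_mul (hgsd.fun_mul hHd) hgd, dzbar_mul hgsd hHd, e1, e2, e3]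
  exact curvature_conj_aux hgu hu

end ChernWeil

/-! ### The metric induced on the line bundle of a character. -/

section CharMetric

variable {n : ℕ} {R : ReductiveGroup n} {P : MatGroup n} {χ : P →* ℂˣ}

theorem contDiffAt_sum_mul {ι : Type*} {s : Finset ι} {c : ι → ℝ} {f : ι → ℂ → ℝ} {z : ℂ}
    (hf : ∀ k, ContDiffAt ℝ 2 (f k) z) : ContDiffAt ℝ 2 (fun w => ∑ k ∈ s, c k * f k w) z :=
  ContDiffAt.sum fun k _ => contDiffAt_const.mul (hf k)

theorem lapl_const (c : ℝ) (z : ℂ) : lapl (fun _ => c) z = 0 := by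
  simp [lapl]

theorem lapl_sum_mul {ι : Type*} {s : Finset ι} {c : ι → ℝ} {f : ι → ℂ → ℝ} {z : ℂ}
    (hf : ∀ k, ContDiffAt ℝ 2 (f k) z) :
    lapl (fun w => ∑ k ∈ s, c k * f k w) z = ∑ k ∈ s, c k * lapl (f k) z := by
  classical
  induction s using Finset.induction_on with
  | empty => simpa using lapl_const 0 z
  | insert k s hk ih =>
    simp only [Finset.sum_insert hk]
    rw [lapl_add (contDiffAt_const.mul (hf k)) (contDiffAt_sum_mul hf), lapl_const_mul _ (hf k), ih]

/-- The logarithm of the metric induced on the line bundle of a character. -/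
def FlagData.logMetric (D : FlagData R P χ) (H : Mat n) : ℝ :=
  ∑ k, -D.c k * Real.log ‖(compress (D.Q k) H).det‖

theorem FlagData.logMetric_conjTranspose_mul_self (D : FlagData R P χ) (p : P) :
    D.logMetric ((toMat p)ᴴ * toMat p) = Real.log (‖((χ p : ℂˣ) : ℂ)‖ ^ 2) := by
  rw [Real.log_pow, D.log_norm p, logMetric, mul_neg, Finset.mul_sum, ← Finset.sum_neg_distrib]
  refine Finset.sum_congr rfl fun k _ => ?_
  rw [compress_conjTranspose_mul_self (D.herm k) (D.idem k) (M := toMat p) (D.flag k p p.2), Matrix.det_mul,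
    Matrix.det_conjTranspose, norm_mul, norm_star, ← sq, Real.log_pow]
  push_cast; ring

theorem norm_sq_units_pos (a : ℂˣ) : 0 < ‖(a : ℂ)‖ ^ 2 := by
  have := norm_pos_iff.2 a.ne_zero
  positivity

/-- `charMetric` chooses some $q$ with $q^*q$ equal to the given matrix. The choice is harmless:
`logMetric` depends on the matrix alone and determines $|\chi(q)|$. -/
theorem FlagData.charMetric_conjTranspose_mul_self (D : FlagData R P χ) (p : P) :
    charMetric χ ((toMat p)ᴴ * toMat p) = ‖((χ p : ℂˣ) : ℂ)‖ ^ 2 := by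
  have h : ∃ q : P, (toMat p)ᴴ * toMat p = (toMat q)ᴴ * toMat q := ⟨p, rfl⟩
  rw [charMetric, dif_pos h]
  have h1 := D.logMetric_conjTranspose_mul_self p
  rw [h.choose_spec, D.logMetric_conjTranspose_mul_self] at h1
  refine Real.log_injOn_pos ?_ ?_ h1
  · exact Set.mem_Ioi.2 (norm_sq_units_pos _)
  · exact Set.mem_Ioi.2 (norm_sq_units_pos _)

theorem FlagData.exists_char (D : FlagData R P χ) {g : GL (Fin n) ℂ} (hg : g ∈ R.G) :
    ∃ p : P, (g : Mat n)ᴴ * (g : Mat n) = (toMat p)ᴴ * toMat p := by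
  obtain ⟨p, hp, h⟩ := D.iwasawa g hg
  exact ⟨⟨p, hp⟩, h⟩

theorem FlagData.charMetric_pos (D : FlagData R P χ) {g : GL (Fin n) ℂ} (hg : g ∈ R.G) :
    0 < charMetric χ ((g : Mat n)ᴴ * (g : Mat n)) := by
  obtain ⟨p, hp⟩ := D.exists_char hg
  rw [hp, D.charMetric_conjTranspose_mul_self]
  exact norm_sq_units_pos _

theorem FlagData.log_charMetric (D : FlagData R P χ) {g : GL (Fin n) ℂ} (hg : g ∈ R.G) :
    Real.log (charMetric χ ((g : Mat n)ᴴ * (g : Mat n))) =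
      D.logMetric ((g : Mat n)ᴴ * (g : Mat n)) := by
  obtain ⟨p, hp⟩ := D.exists_char hg
  rw [hp, D.charMetric_conjTranspose_mul_self, D.logMetric_conjTranspose_mul_self]

/-- The metric of a character in another frame of the reduced bundle. -/
theorem FlagData.charMetric_conj (D : FlagData R P χ) {g : GL (Fin n) ℂ} (hg : g ∈ R.G) (p : P) :
    charMetric χ ((toMat p)ᴴ * ((g : Mat n)ᴴ * (g : Mat n)) * toMat p) =
      ‖((χ p : ℂˣ) : ℂ)‖ ^ 2 * charMetric χ ((g : Mat n)ᴴ * (g : Mat n)) := by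
  obtain ⟨q, hq⟩ := D.exists_char hg
  have e : (toMat p)ᴴ * ((g : Mat n)ᴴ * (g : Mat n)) * toMat p = (toMat (q * p))ᴴ * toMat (q * p) := by
    rw [hq]; simp [toMat, mul_assoc]
  rw [e, hq, D.charMetric_conjTranspose_mul_self, D.charMetric_conjTranspose_mul_self, map_mul,
    Units.val_mul, norm_mul]
  ring

/-- The constant in the Chern–Weil inequality. -/
def FlagData.bound (D : FlagData R P χ) : ℝ := ∑ k, |D.c k| * Real.sqrt (frob (D.Q k))

/-- The curvature of the line bundle of an anti-dominant character is bounded on one side by the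
norm of the curvature of the principal bundle. -/
theorem FlagData.lapl_logMetric (D : FlagData R P χ) {H : ℂ → Mat n} {z : ℂ}
    (hH : ContDiffAt ℝ 2 H z)
    (hg : ∀ᶠ w in 𝓝 z, ∃ g : GL (Fin n) ℂ, H w = (g : Mat n)ᴴ * (g : Mat n)) :
    ContDiffAt ℝ 2 (fun w => D.logMetric (H w)) z ∧
    lapl (fun w => D.logMetric (H w)) z ≤ D.bound * hermNorm (H z) (curvature H z) := by
  have h := fun k => lapl_log_det_compress (D.herm k) (D.idem k) hH hg
  have hc := fun k => (h k).1
  refine ⟨contDiffAt_sum_mul hc, ?_⟩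
  simp only [logMetric]
  rw [lapl_sum_mul hc, bound, Finset.sum_mul]
  refine Finset.sum_le_sum fun k _ => ?_
  obtain ⟨-, h2, h3⟩ := h k
  -- Coefficients $c_k\ge0$ need only the lower bound for the Laplacian of the determinant. When
  -- $Q_k=1$ the sign of $c_k$ is free, but there the bound is two-sided.
  rcases D.sign k with hk | hk
  · rw [abs_of_nonneg hk]
    nlinarith
  · have h4 := h3 hk
    set x := Real.sqrt (frob (D.Q k)) * hermNorm (H z) (curvature H z) with hx
    have : -D.c k * lapl (fun w => Real.log ‖(compress (D.Q k) (H w)).det‖) z ≤ |D.c k| * x := by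
      refine (le_abs_self _).trans ?_
      rw [abs_mul, abs_neg]
      exact mul_le_mul_of_nonneg_left (abs_le.2 ⟨h2, h4⟩) (abs_nonneg _)
    rw [hx, ← mul_assoc] at this
    exact this

end CharMetric

/-! ### Green's identity in the plane. -/

section PlaneGreen

open MeasureTheory Filter

theorem continuousOn_lapl {V : Set ℂ} (hV : IsOpen V) {u : ℂ → ℝ} (hu : ContDiffOn ℝ 2 u V) :
    ContinuousOn (lapl u) V := by
  have h1 : ∀ c : ℂ, ContinuousOn (fun z => fderiv ℝ (fun w => fderiv ℝ u w c) z c) V := fun c => by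
    have h2 : ContDiffOn ℝ 1 (fun w => fderiv ℝ u w c) V :=
      (hu.fderiv_of_isOpen hV (by norm_num)).clm_apply contDiffOn_const
    exact (h2.continuousOn_fderiv_of_isOpen hV (by norm_num)).clm_apply continuousOn_const
  exact ((h1 1).add (h1 Complex.I)).div_const 4

theorem lapl_eq_zero_of_notMem_tsupport {f : ℂ → ℝ} {z : ℂ} (hz : z ∉ tsupport f) :
    lapl f z = 0 := by
  rw [lapl_congr (notMem_tsupport_iff_eventuallyEq.1 hz)]
  exact lapl_const 0 z

theorem tsupport_lapl_subset (f : ℂ → ℝ) : tsupport (lapl f) ⊆ tsupport f := by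
  refine closure_minimal (fun z hz => ?_) (isClosed_tsupport f)
  by_contra h
  exact hz (lapl_eq_zero_of_notMem_tsupport h)

theorem continuous_mul_of_tsupport_subset {V : Set ℂ} (hV : IsOpen V) {f h : ℂ → ℝ}
    (hf : Continuous f) (hs : tsupport f ⊆ V) (hh : ContinuousOn h V) :
    Continuous fun z => f z * h z := by
  rw [continuous_iff_continuousAt]
  intro z
  by_cases hz : z ∈ V
  · exact hf.continuousAt.mul (hh.continuousAt (hV.mem_nhds hz))
  · have h1 : (fun z => f z * h z) =ᶠ[𝓝 z] fun _ => 0 := by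
      filter_upwards [notMem_tsupport_iff_eventuallyEq.1 fun h => hz (hs h)] with w hw
      rw [hw]; simp
    exact (continuousAt_const (y := (0 : ℝ))).congr h1.symm

theorem integrable_mul_of_tsupport_subset {V : Set ℂ} (hV : IsOpen V) {f h : ℂ → ℝ}
    (hf : Continuous f) (hc : HasCompactSupport f) (hs : tsupport f ⊆ V) (hh : ContinuousOn h V) :
    Integrable fun z => f z * h z :=
  (continuous_mul_of_tsupport_subset hV hf hs hh).integrable_of_hasCompactSupport hc.mul_right

/-- Green's identity in the plane. -/
theorem integral_mul_lapl {V : Set ℂ} (hV : IsOpen V) {f u : ℂ → ℝ} (hf : ContDiff ℝ 2 f)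
    (hc : HasCompactSupport f) (hs : tsupport f ⊆ V) (hu : ContDiffOn ℝ 2 u V) :
    ∫ z, f z * lapl u z = ∫ z, u z * lapl f z := by
  have hdf : ∀ c : ℂ, ContDiff ℝ 1 fun w => fderiv ℝ f w c := fun c =>
    (hf.fderiv_right (m := 1) (by norm_num)).clm_apply contDiff_const
  have hdu : ∀ c : ℂ, ContDiffOn ℝ 1 (fun w => fderiv ℝ u w c) V := fun c =>
    (hu.fderiv_of_isOpen hV (by norm_num)).clm_apply contDiffOn_const
  have hddf : ∀ c : ℂ, Continuous fun z => fderiv ℝ (fun w => fderiv ℝ f w c) z c := fun c =>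
    ((hdf c).continuous_fderiv (by norm_num)).clm_apply continuous_const
  have hddu : ∀ c : ℂ, ContinuousOn (fun z => fderiv ℝ (fun w => fderiv ℝ u w c) z c) V := fun c =>
    ((hdu c).continuousOn_fderiv_of_isOpen hV (by norm_num)).clm_apply continuousOn_const
  have hsub : ∀ (F : ℂ → ℝ) (c : ℂ), tsupport (fun w => fderiv ℝ F w c) ⊆ tsupport F := by
    intro F c
    refine closure_minimal (fun z hz => ?_) (isClosed_tsupport F)
    by_contra h
    refine hz ?_
    simp only [(notMem_tsupport_iff_eventuallyEq.1 h).fderiv_eq]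
    simp
  have hcs : ∀ F : ℂ → ℝ, tsupport F ⊆ tsupport f → HasCompactSupport F := fun F h =>
    hc.of_isClosed_subset (isClosed_tsupport F) h
  -- Two integrations by parts in the direction $c$; regularity of $u$ is needed only on $V$, which
  -- contains the support of $f$ and of its derivatives.
  have key : ∀ c : ℂ, ∫ z, f z * fderiv ℝ (fun w => fderiv ℝ u w c) z c =
      ∫ z, fderiv ℝ (fun w => fderiv ℝ f w c) z c * u z := by
    intro c
    have hs1 := hsub f c
    have hs2 := (hsub (fun w => fderiv ℝ f w c) c).trans hs1
    have i1 := integrable_mul_of_tsupport_subset hV hf.continuous hc hs (hddu c)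
    have i2 := integrable_mul_of_tsupport_subset hV (hdf c).continuous (hcs _ hs1) (hs1.trans hs)
      (hdu c).continuousOn
    have i3 := integrable_mul_of_tsupport_subset hV hf.continuous hc hs (hdu c).continuousOn
    have i4 := integrable_mul_of_tsupport_subset hV (hddf c) (hcs _ hs2) (hs2.trans hs)
      hu.continuousOn
    have i5 := integrable_mul_of_tsupport_subset hV (hdf c).continuous (hcs _ hs1) (hs1.trans hs)
      hu.continuousOn
    have hline : ∀ {F : ℂ → ℝ} {z : ℂ}, DifferentiableAt ℝ F z →
        HasLineDerivAt ℝ F (fderiv ℝ F z c) z c := fun hF => hF.hasFDerivAt.hasLineDerivAt c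
    have e1 := integral_bilinear_hasLineDerivAt_right_eq_neg_left_of_integrable
      (μ := volume) (B := ContinuousLinearMap.mul ℝ ℝ) (v := c) (f := f)
      (f' := fun z => fderiv ℝ f z c) (g := fun w => fderiv ℝ u w c)
      (g' := fun z => fderiv ℝ (fun w => fderiv ℝ u w c) z c) i2 i1 i3
      (fun z _ => hline (hf.differentiable (by norm_num) z))
      (fun z hz => hline (((hdu c).differentiableOn (by norm_num)).differentiableAt
        (hV.mem_nhds (hs hz))))
    have e2 := integral_bilinear_hasLineDerivAt_right_eq_neg_left_of_integrable
      (μ := volume) (B := ContinuousLinearMap.mul ℝ ℝ) (v := c) (f := fun w => fderiv ℝ f w c)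
      (f' := fun z => fderiv ℝ (fun w => fderiv ℝ f w c) z c) (g := u)
      (g' := fun z => fderiv ℝ u z c) i4 i2 i5
      (fun z _ => hline ((hdf c).differentiable (by norm_num) z))
      (fun z hz => hline ((hu.differentiableOn (by norm_num)).differentiableAt
        (hV.mem_nhds (hs (hs1 hz)))))
    simp only [ContinuousLinearMap.mul_apply'] at e1 e2
    rw [e1, e2, neg_neg]
  have hint : ∀ c : ℂ, Integrable (fun z => f z * fderiv ℝ (fun w => fderiv ℝ u w c) z c) ∧
      Integrable (fun z => fderiv ℝ (fun w => fderiv ℝ f w c) z c * u z) := fun c =>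
    ⟨integrable_mul_of_tsupport_subset hV hf.continuous hc hs (hddu c),
      integrable_mul_of_tsupport_subset hV (hddf c)
        (hcs _ ((hsub (fun w => fderiv ℝ f w c) c).trans (hsub f c)))
        (((hsub (fun w => fderiv ℝ f w c) c).trans (hsub f c)).trans hs) hu.continuousOn⟩
  have e3 : (fun z => f z * lapl u z) = fun z => (1 / 4 : ℝ) *
      (f z * fderiv ℝ (fun w => fderiv ℝ u w 1) z 1 +
        f z * fderiv ℝ (fun w => fderiv ℝ u w Complex.I) z Complex.I) := by
    funext z; simp only [lapl]; ring
  have e4 : (fun z => u z * lapl f z) = fun z => (1 / 4 : ℝ) *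
      (fderiv ℝ (fun w => fderiv ℝ f w 1) z 1 * u z +
        fderiv ℝ (fun w => fderiv ℝ f w Complex.I) z Complex.I * u z) := by
    funext z; simp only [lapl]; ring
  rw [e3, e4, integral_const_mul, integral_const_mul, integral_add (hint 1).1 (hint _).1,
    integral_add (hint 1).2 (hint _).2, key, key]

/-! #### Logarithmic cut-off functions -/

/-- The profile of the cut-off functions. -/
def profile (s : ℝ) : ℝ := Real.smoothTransition (2 + s)

theorem contDiff_profile (m : ℕ∞) : ContDiff ℝ m profile :=
  Real.smoothTransition.contDiff.comp (contDiff_const.add contDiff_id)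

theorem profile_of_le {s : ℝ} (h : s ≤ -2) : profile s = 0 :=
  Real.smoothTransition.zero_of_nonpos (by linarith)

theorem profile_of_ge {s : ℝ} (h : -1 ≤ s) : profile s = 1 :=
  Real.smoothTransition.one_of_one_le (by linarith)

theorem deriv_profile_of_lt {s : ℝ} (h : s < -2) : deriv profile s = 0 := by
  have : profile =ᶠ[𝓝 s] fun _ => 0 := by
    filter_upwards [Iio_mem_nhds h] with t ht using profile_of_le (le_of_lt ht)
  rw [this.deriv_eq, deriv_const]

theorem deriv_profile_of_gt {s : ℝ} (h : -1 < s) : deriv profile s = 0 := by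
  have : profile =ᶠ[𝓝 s] fun _ => 1 := by
    filter_upwards [Ioi_mem_nhds h] with t ht using profile_of_ge (le_of_lt ht)
  rw [this.deriv_eq, deriv_const]

theorem deriv2_profile_of_lt {s : ℝ} (h : s < -2) : deriv (deriv profile) s = 0 := by
  have : deriv profile =ᶠ[𝓝 s] fun _ => 0 := by
    filter_upwards [Iio_mem_nhds h] with t ht using deriv_profile_of_lt ht
  rw [this.deriv_eq, deriv_const]

theorem deriv2_profile_of_gt {s : ℝ} (h : -1 < s) : deriv (deriv profile) s = 0 := by
  have : deriv profile =ᶠ[𝓝 s] fun _ => 0 := by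
    filter_upwards [Ioi_mem_nhds h] with t ht using deriv_profile_of_gt ht
  rw [this.deriv_eq, deriv_const]

theorem contDiff_deriv_profile : ContDiff ℝ 1 (deriv profile) :=
  ((contDiff_profile 2).of_le (show (1 : WithTop ℕ∞) + 1 ≤ 2 by norm_num)).deriv'

theorem exists_bound_deriv2_profile : ∃ M, 0 ≤ M ∧ ∀ s, |deriv (deriv profile) s| ≤ M := by
  have hc : Continuous (deriv (deriv profile)) := contDiff_deriv_profile.continuous_deriv (by norm_num)
  obtain ⟨M, hM⟩ := isCompact_Icc.exists_bound_of_continuousOn (s := Set.Icc (-2 : ℝ) (-1)) hc.continuousOn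
  refine ⟨max M 0, le_max_right _ _, fun s => ?_⟩
  rcases lt_or_ge s (-2) with h | h
  · rw [deriv2_profile_of_lt h]; simp
  · rcases lt_or_ge (-1) s with h' | h'
    · rw [deriv2_profile_of_gt h']; simp
    · exact (hM s ⟨h, h'⟩).trans (le_max_left _ _)

/-- Cut-off functions that vanish near `p` and are `1` off a small disc. -/
def cutoff (n : ℕ) (p z : ℂ) : ℝ := if z = p then 0 else profile (Real.log ‖z - p‖ / n)

theorem cutoff_nonneg (n : ℕ) (p z : ℂ) : 0 ≤ cutoff n p z := by
  unfold cutoff; split_ifs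
  · exact le_rfl
  · exact Real.smoothTransition.nonneg _

theorem cutoff_le_one (n : ℕ) (p z : ℂ) : cutoff n p z ≤ 1 := by
  unfold cutoff; split_ifs
  · exact zero_le_one
  · exact Real.smoothTransition.le_one _

/-- The transition from $0$ to $1$ takes place between the radii $e^{-2n}$ and $e^{-n}$. The value
at the centre has to be prescribed in `cutoff`, since `Real.log 0 = 0` would give $1$ there. -/
theorem cutoff_eventually_eq_zero {n : ℕ} (hn : 0 < n) (p : ℂ) : cutoff n p =ᶠ[𝓝 p] fun _ => 0 := by
  have hn' : (0 : ℝ) < n := by exact_mod_cast hn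
  filter_upwards [Metric.ball_mem_nhds p (Real.exp_pos (-2 * n))] with z hz
  unfold cutoff; split_ifs with h
  · rfl
  · refine profile_of_le ?_
    rw [div_le_iff₀ hn']
    rw [mem_ball_iff_norm] at hz
    have := Real.log_le_log (norm_pos_iff.2 (sub_ne_zero.2 h)) hz.le
    rwa [Real.log_exp] at this

theorem cutoff_of_le {n : ℕ} (hn : 0 < n) {p z : ℂ} (hz : Real.exp (-n) ≤ ‖z - p‖) :
    cutoff n p z = 1 := by
  have hn' : (0 : ℝ) < n := by exact_mod_cast hn
  have hp : 0 < ‖z - p‖ := (Real.exp_pos _).trans_le hz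
  rw [cutoff, if_neg (sub_ne_zero.1 (norm_pos_iff.1 hp))]
  refine profile_of_ge ?_
  rw [le_div_iff₀ hn']
  have := Real.log_le_log (Real.exp_pos _) hz
  rw [Real.log_exp] at this
  linarith

theorem cutoff_congr_of_ne (n : ℕ) {p z : ℂ} (hz : z ≠ p) :
    cutoff n p =ᶠ[𝓝 z] fun w => profile (Real.log ‖w - p‖ / n) := by
  filter_upwards [isOpen_ne.mem_nhds hz] with w hw
  rw [cutoff, if_neg hw]

theorem contDiff_cutoff {n : ℕ} (hn : 0 < n) (p : ℂ) : ContDiff ℝ 2 (cutoff n p) := by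
  rw [contDiff_iff_contDiffAt]
  intro z
  by_cases hz : z = p
  · rw [hz]; exact contDiffAt_const.congr_of_eventuallyEq (cutoff_eventually_eq_zero hn p)
  · refine ContDiffAt.congr_of_eventuallyEq ?_ (cutoff_congr_of_ne n hz)
    have h1 : ContDiffAt ℝ 2 (fun w : ℂ => Real.log ‖w - p‖ / n) z :=
      (((contDiffAt_id.sub contDiffAt_const).norm ℝ (sub_ne_zero.2 hz)).log
        (norm_ne_zero_iff.2 (sub_ne_zero.2 hz))).div_const _
    exact ((contDiff_profile 2).contDiffAt).comp z h1

theorem lapl_comp_re {h : ℝ → ℝ} (hh : ContDiff ℝ 2 h) (w : ℂ) :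
    lapl (fun w => h w.re) w = deriv (deriv h) w.re / 4 := by
  have h0 : ∀ {k : ℝ → ℝ} (w : ℂ), DifferentiableAt ℝ k w.re → ∀ c : ℂ,
      fderiv ℝ (fun w : ℂ => k w.re) w c = deriv k w.re * c.re := fun {k} w hk c => by
    have := (hk.hasDerivAt.hasFDerivAt.comp w Complex.reCLM.hasFDerivAt).fderiv
    have e : fderiv ℝ (fun w : ℂ => k w.re) w = _ := this
    rw [e]; simp [mul_comm]
  have hd := hh.differentiable (by norm_num)
  have hd2 : Differentiable ℝ (deriv h) :=
    ((hh.of_le (show (1 : WithTop ℕ∞) + 1 ≤ 2 by norm_num)).deriv').differentiable (by norm_num)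
  have h1 : ∀ c : ℂ, (fun w => fderiv ℝ (fun w : ℂ => h w.re) w c) = fun w => c.re * deriv h w.re :=
    fun c => by funext w; rw [h0 w (hd _)]; ring
  have h2 : ∀ c : ℂ, fderiv ℝ (fun w : ℂ => c.re * deriv h w.re) w c =
      c.re * (deriv (deriv h) w.re * c.re) := fun c => by
    have hdd : DifferentiableAt ℝ (fun w : ℂ => deriv h w.re) w :=
      (hd2 _).comp w Complex.reCLM.differentiableAt
    rw [fderiv_const_mul hdd, smul_apply, h0 w (hd2 _), smul_eq_mul]
  simp only [lapl, h1, h2]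
  simp

/-- The Laplacian of the cut-off functions as a function of the radius. -/
def cutoffLapl (n : ℕ) (r : ℝ) : ℝ := deriv (deriv profile) (Real.log r / n) / (4 * r ^ 2 * n ^ 2)

/-- In the coordinate $\log((w-p)/(z-p))$ the cut-off depends on the real part only, so its
Laplacian is a second derivative times the conformal factor $|z-p|^{-2}$. Division by $z-p$ puts the
base point at $1$, away from the branch cut. -/
theorem lapl_cutoff {n : ℕ} (hn : 0 < n) (p z : ℂ) : lapl (cutoff n p) z = cutoffLapl n ‖z - p‖ := by
  have hn' : (n : ℝ) ≠ 0 := by exact_mod_cast hn.ne'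
  by_cases hz : z = p
  · rw [hz, lapl_congr (cutoff_eventually_eq_zero hn p), lapl_const]
    simp [cutoffLapl]
  · have hzp : z - p ≠ 0 := sub_ne_zero.2 hz
    set φ : ℂ → ℂ := fun w => Complex.log ((w - p) / (z - p)) with hφ
    set h : ℝ → ℝ := fun s => profile ((s + Real.log ‖z - p‖) / n) with hh
    have hhc : ContDiff ℝ 2 h :=
      (contDiff_profile 2).comp ((contDiff_id.add contDiff_const).div_const _)
    have hd : ∀ w, (w - p) / (z - p) ∈ Complex.slitPlane → HasDerivAt φ (1 / (z - p) / ((w - p) / (z - p))) w :=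
      fun w hw => (((hasDerivAt_id w).sub_const p).div_const (z - p)).clog hw
    have hz1 : (z - p) / (z - p) ∈ Complex.slitPlane := by
      rw [div_self hzp]; exact Complex.one_mem_slitPlane
    have hev : ∀ᶠ w in 𝓝 z, (w - p) / (z - p) ∈ Complex.slitPlane := by
      have hcont : ContinuousAt (fun w => (w - p) / (z - p)) z := by fun_prop
      exact hcont.eventually (Complex.isOpen_slitPlane.mem_nhds hz1)
    have e1 : cutoff n p =ᶠ[𝓝 z] fun w => h (φ w).re := by
      filter_upwards [cutoff_congr_of_ne n hz, isOpen_ne.mem_nhds hz] with w hw hwp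
      have hwp' : w - p ≠ 0 := sub_ne_zero.2 hwp
      rw [hw, hh, hφ]
      simp only [Complex.log_re, norm_div]
      rw [Real.log_div (norm_ne_zero_iff.2 hwp') (norm_ne_zero_iff.2 hzp), sub_add_cancel]
    have hhc' : ContDiffAt ℝ 2 (fun w : ℂ => h w.re) (φ z) :=
      hhc.contDiffAt.comp (φ z) Complex.reCLM.contDiff.contDiffAt
    rw [lapl_congr e1, lapl_comp (u := fun w => h w.re) hhc' (by
      filter_upwards [hev] with w hw using (hd w hw).differentiableAt), lapl_comp_re hhc,
      (hd z hz1).deriv]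
    have e2 : (φ z).re = 0 := by simp [hφ]
    have e3 : deriv h = fun s => deriv profile ((s + Real.log ‖z - p‖) / n) / n := by
      funext s
      have h1 : HasDerivAt (fun s : ℝ => (s + Real.log ‖z - p‖) / n) (1 / n) s :=
        ((hasDerivAt_id s).add_const _).div_const _
      have h2 := (((contDiff_profile 2).differentiable (by norm_num) _).hasDerivAt (x := (s + Real.log ‖z - p‖) / n)).comp s h1
      rw [show h = profile ∘ fun s : ℝ => (s + Real.log ‖z - p‖) / n from rfl, h2.deriv]; ring
    have e4 : deriv (deriv h) 0 = deriv (deriv profile) (Real.log ‖z - p‖ / n) / n ^ 2 := by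
      rw [e3]
      have h1 : HasDerivAt (fun s : ℝ => (s + Real.log ‖z - p‖) / n) (1 / n) 0 :=
        ((hasDerivAt_id (0 : ℝ)).add_const _).div_const _
      have h2 := ((((contDiff_deriv_profile.differentiable (by norm_num) _).hasDerivAt
        (x := ((0 : ℝ) + Real.log ‖z - p‖) / n)).comp 0 h1).div_const (n : ℝ))
      have h3 : deriv (fun s => deriv profile ((s + Real.log ‖z - p‖) / n) / n) 0 = _ := h2.deriv
      rw [h3, zero_add]; field_simp
    rw [e2, e4, cutoffLapl, div_self hzp, div_one, norm_div, norm_one]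
    field_simp

theorem cutoffLapl_of_lt {n : ℕ} (hn : 0 < n) {r : ℝ} (hr : 0 < r) (h : r < Real.exp (-2 * n)) :
    cutoffLapl n r = 0 := by
  have hn' : (0 : ℝ) < n := by exact_mod_cast hn
  rw [cutoffLapl, deriv2_profile_of_lt, zero_div]
  rw [div_lt_iff₀ hn']
  have := Real.log_lt_log hr h
  rwa [Real.log_exp] at this

theorem cutoffLapl_of_gt {n : ℕ} (hn : 0 < n) {r : ℝ} (h : Real.exp (-n) < r) :
    cutoffLapl n r = 0 := by
  have hn' : (0 : ℝ) < n := by exact_mod_cast hn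
  rw [cutoffLapl, deriv2_profile_of_gt, zero_div]
  rw [lt_div_iff₀ hn']
  have := Real.log_lt_log (Real.exp_pos _) h
  rw [Real.log_exp] at this
  linarith

end PlaneGreen

/-! ### Logarithmic singularities: Green's identity at a puncture. -/

section Puncture

open MeasureTheory Filter

theorem integral_radial (f : ℝ → ℝ) (p : ℂ) :
    ∫ z : ℂ, f ‖z - p‖ = 2 * Real.pi * ∫ r in Set.Ioi (0 : ℝ), r * f r := by
  have h1 := integral_sub_right_eq_self (μ := (volume : Measure ℂ)) (fun z => f ‖z‖) p
  rw [h1, integral_fun_norm_addHaar (volume : Measure ℂ) f, Complex.finrank_real_complex,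
    Measure.real, Complex.volume_ball]
  simp [mul_assoc]

/-- The lower limit $e^{-3n}$, below the support, leaves room for the strict inequalities under
which the derivatives of the profile are known to vanish. -/
theorem integral_Ioi_eq_interval {n : ℕ} (hn : 0 < n) {f : ℝ → ℝ}
    (h0 : ∀ r, 0 < r → r < Real.exp (-2 * n) → f r = 0) (h1 : ∀ r, Real.exp (-n) < r → f r = 0) :
    ∫ r in Set.Ioi (0 : ℝ), r * f r = ∫ r in (Real.exp (-3 * n))..1, r * f r := by
  have hn' : (0 : ℝ) < n := by exact_mod_cast hn
  have hle : Real.exp (-3 * n) ≤ 1 := Real.exp_le_one_iff.2 (by linarith)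
  rw [intervalIntegral.integral_of_le hle]
  refine setIntegral_eq_of_subset_of_forall_sdiff_eq_zero measurableSet_Ioi
    (fun r hr => (Real.exp_pos _).trans hr.1) fun r hr => ?_
  have hr0 : (0 : ℝ) < r := hr.1
  rcases le_or_gt r (Real.exp (-3 * n)) with h | h
  · rw [h0 r hr0 (h.trans_lt (Real.exp_lt_exp.2 (by linarith))), mul_zero]
  · have h2 : 1 < r := by
      by_contra h2
      exact hr.2 ⟨h, not_lt.1 h2⟩
    rw [h1 r ((by rw [← Real.exp_zero]; exact Real.exp_lt_exp.2 (by linarith) : Real.exp (-(n:ℝ)) < 1).trans h2), mul_zero]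

theorem continuousOn_cutoffLapl (n : ℕ) : ContinuousOn (cutoffLapl n) (Set.Ioi 0) := by
  intro r hr
  have hr0 : (0 : ℝ) < r := hr
  have hc : Continuous (deriv (deriv profile)) := contDiff_deriv_profile.continuous_deriv (by norm_num)
  refine ContinuousAt.continuousWithinAt ?_
  by_cases hn : n = 0
  · have : cutoffLapl n = fun _ => 0 := by funext x; simp [cutoffLapl, hn]
    rw [this]; exact continuousAt_const
  · refine ContinuousAt.div ?_ (by fun_prop) (by positivity)
    exact hc.continuousAt.comp ((Real.continuousAt_log hr0.ne').div_const _)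

/-- With $s=\log r/n$ and profile $\psi$, the radial integrand has the primitive
$\frac14(s\psi'(s)-\psi(s))$. Its values are $-\frac14$ at $r=1$ and $0$ at $r=e^{-3n}$; the factor
$2\pi$ then gives a result independent of $n$. -/
theorem integral_log_mul_cutoffLapl {n : ℕ} (hn : 0 < n) (p : ℂ) :
    ∫ z : ℂ, Real.log ‖z - p‖ * cutoffLapl n ‖z - p‖ = -(Real.pi / 2) := by
  have hn' : (0 : ℝ) < n := by exact_mod_cast hn
  have hle : Real.exp (-3 * n) ≤ 1 := Real.exp_le_one_iff.2 (by linarith)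
  have hpos : ∀ r ∈ Set.uIcc (Real.exp (-3 * n)) 1, 0 < r := fun r hr => by
    rw [Set.uIcc_of_le hle] at hr; exact (Real.exp_pos _).trans_le hr.1
  rw [integral_radial (fun r => Real.log r * cutoffLapl n r), integral_Ioi_eq_interval hn
    (fun r hr h => by simp [cutoffLapl_of_lt hn hr h]) (fun r h => by simp [cutoffLapl_of_gt hn h])]
  set G : ℝ → ℝ := fun r => (1 / 4 : ℝ) * (Real.log r / n * deriv profile (Real.log r / n) -
    profile (Real.log r / n)) with hG
  have hderiv : ∀ r ∈ Set.uIcc (Real.exp (-3 * n)) 1,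
      HasDerivAt G (r * (Real.log r * cutoffLapl n r)) r := by
    intro r hr
    have hr0 := hpos r hr
    have h1 : HasDerivAt (fun r => Real.log r / n) (r⁻¹ / n) r :=
      (Real.hasDerivAt_log hr0.ne').div_const _
    have h2 := (((contDiff_profile 2).differentiable (by norm_num) _).hasDerivAt
      (x := Real.log r / n)).comp r h1
    have h3 := ((contDiff_deriv_profile.differentiable (by norm_num) _).hasDerivAt
      (x := Real.log r / n)).comp r h1
    refine (((h1.fun_mul h3).fun_sub h2).const_mul (1 / 4 : ℝ)).congr_deriv ?_
    simp only [Function.comp, cutoffLapl]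
    field_simp
    ring
  have hcont : ContinuousOn (fun r => r * (Real.log r * cutoffLapl n r))
      (Set.uIcc (Real.exp (-3 * n)) 1) := by
    refine continuousOn_id.mul (ContinuousOn.mul ?_ ?_)
    · exact Real.continuousOn_log.mono fun r hr => (hpos r hr).ne'
    · exact (continuousOn_cutoffLapl n).mono fun r hr => hpos r hr
  rw [intervalIntegral.integral_eq_sub_of_hasDerivAt hderiv hcont.intervalIntegrable]
  have e1 : G 1 = -(1 / 4) := by
    simp only [hG, Real.log_one, zero_div, zero_mul, zero_sub]
    rw [profile_of_ge (by norm_num)]; norm_num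
  have e2 : G (Real.exp (-3 * n)) = 0 := by
    have : -3 * (n : ℝ) / n = -3 := by field_simp
    simp only [hG, Real.log_exp, this]
    rw [profile_of_le (by norm_num), deriv_profile_of_lt (by norm_num)]; norm_num
  rw [e1, e2]; ring

/-- On the interval of integration $|\log r|\le3n$, while the Laplacian is at most $M/(4r^2n^2)$ and
$\int dr/r=3n$: the powers of $n$ cancel. This uniform bound is what makes an error $o(\log|z|)$
negligible. -/
theorem exists_integral_abs_log_mul_cutoffLapl_le : ∃ C : ℝ, 0 ≤ C ∧ ∀ n : ℕ, 0 < n → ∀ p : ℂ,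
    ∫ z : ℂ, |Real.log ‖z - p‖ * cutoffLapl n ‖z - p‖| ≤ C := by
  obtain ⟨M, hM0, hM⟩ := exists_bound_deriv2_profile
  refine ⟨2 * Real.pi * (9 / 4 * M), by positivity, fun n hn p => ?_⟩
  have hn' : (0 : ℝ) < n := by exact_mod_cast hn
  have hle : Real.exp (-3 * n) ≤ 1 := Real.exp_le_one_iff.2 (by linarith)
  have hpos : ∀ r ∈ Set.uIcc (Real.exp (-3 * n)) 1, 0 < r := fun r hr => by
    rw [Set.uIcc_of_le hle] at hr; exact (Real.exp_pos _).trans_le hr.1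
  rw [integral_radial (fun r => |Real.log r * cutoffLapl n r|), integral_Ioi_eq_interval hn
    (fun r hr h => by simp [cutoffLapl_of_lt hn hr h]) (fun r h => by simp [cutoffLapl_of_gt hn h])]
  refine mul_le_mul_of_nonneg_left ?_ (by positivity)
  have hcont : ContinuousOn (fun r => r * |Real.log r * cutoffLapl n r|)
      (Set.uIcc (Real.exp (-3 * n)) 1) := by
    refine continuousOn_id.mul (ContinuousOn.abs (ContinuousOn.mul ?_ ?_))
    · exact Real.continuousOn_log.mono fun r hr => (hpos r hr).ne'
    · exact (continuousOn_cutoffLapl n).mono fun r hr => hpos r hr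
  have hcont2 : ContinuousOn (fun r : ℝ => 3 / 4 * M / n * r⁻¹) (Set.uIcc (Real.exp (-3 * n)) 1) :=
    continuousOn_const.mul (continuousOn_inv₀.mono fun r hr => (hpos r hr).ne')
  have hint : ∫ r in (Real.exp (-3 * n))..1, 3 / 4 * M / n * r⁻¹ = 9 / 4 * M := by
    rw [intervalIntegral.integral_const_mul, integral_inv_of_pos (Real.exp_pos _) one_pos, one_div,
      ← Real.exp_neg, Real.log_exp]
    field_simp; ring
  rw [← hint]
  refine intervalIntegral.integral_mono_on hle hcont.intervalIntegrable hcont2.intervalIntegrable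
    fun r hr => ?_
  have hr0 : 0 < r := (Real.exp_pos _).trans_le hr.1
  have hlog : |Real.log r| ≤ 3 * n := by
    rw [abs_le]
    have h1 := Real.log_le_log (Real.exp_pos _) hr.1
    rw [Real.log_exp] at h1
    have h2 := Real.log_nonpos hr0.le hr.2
    constructor <;> linarith
  have h3 : |cutoffLapl n r| ≤ M / (4 * r ^ 2 * n ^ 2) := by
    rw [cutoffLapl, abs_div, abs_of_pos (show 0 < 4 * r ^ 2 * (n : ℝ) ^ 2 by positivity)]
    gcongr
    exact hM _
  rw [abs_mul]
  calc r * (|Real.log r| * |cutoffLapl n r|) ≤ r * (3 * n * (M / (4 * r ^ 2 * n ^ 2))) := by gcongr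
    _ = 3 / 4 * M / n * r⁻¹ := by field_simp

theorem tsupport_lapl_cutoff_subset {n : ℕ} (hn : 0 < n) (p : ℂ) :
    tsupport (lapl (cutoff n p)) ⊆ {p}ᶜ ∩ Metric.closedBall p (Real.exp (-n)) := by
  have h1 : tsupport (lapl (cutoff n p)) ⊆ Metric.closedBall p (Real.exp (-n)) ∩
      (Metric.ball p (Real.exp (-2 * n)))ᶜ := by
    refine closure_minimal (fun z hz => ⟨?_, ?_⟩)
      (Metric.isClosed_closedBall.inter Metric.isOpen_ball.isClosed_compl)
    · by_contra h
      rw [mem_closedBall_iff_norm, not_le] at h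
      exact hz (by rw [lapl_cutoff hn, cutoffLapl_of_gt hn h])
    · intro h
      rw [mem_ball_iff_norm] at h
      refine hz ?_
      rw [lapl_cutoff hn]
      rcases eq_or_ne z p with rfl | hne
      · simp [cutoffLapl]
      · exact cutoffLapl_of_lt hn (norm_pos_iff.2 (sub_ne_zero.2 hne)) h
  intro z hz
  refine ⟨?_, (h1 hz).1⟩
  rintro rfl
  exact (h1 hz).2 (Metric.mem_ball_self (Real.exp_pos _))

/-- Fatou's lemma: bounded integrals of nonnegative functions pass to the limit. -/
theorem integrable_of_tendsto_of_bounded {α : Type*} [MeasurableSpace α] {μ : Measure α}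
    {G : ℕ → α → ℝ} {f : α → ℝ} (hGf : ∀ᵐ x ∂μ, Tendsto (fun n => G n x) atTop (𝓝 (f x)))
    (hG : ∀ n, Integrable (G n) μ) (h0 : ∀ n, 0 ≤ᵐ[μ] G n) {C : ℝ}
    (hC : ∀ᶠ n in atTop, ∫ x, G n x ∂μ ≤ C) : Integrable f μ := by
  refine ⟨aestronglyMeasurable_of_tendsto_ae _ (fun n => (hG n).1) hGf, ?_⟩
  have h1 : ∫⁻ x, ‖f x‖ₑ ∂μ ≤ liminf (fun n => ∫⁻ x, ‖G n x‖ₑ ∂μ) atTop := by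
    refine le_trans (le_of_eq (lintegral_congr_ae ?_))
      (lintegral_liminf_le' fun n => (hG n).1.aemeasurable.enorm)
    filter_upwards [hGf] with x hx using hx.enorm.liminf_eq.symm
  refine lt_of_le_of_lt h1 (lt_of_le_of_lt ?_ (ENNReal.ofReal_lt_top (r := C)))
  refine liminf_le_of_frequently_le' (Eventually.frequently ?_)
  filter_upwards [hC] with n hn
  have h2 : ∫⁻ x, ‖G n x‖ₑ ∂μ = ∫⁻ x, ENNReal.ofReal (G n x) ∂μ := by
    refine lintegral_congr_ae ?_
    filter_upwards [h0 n] with x hx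
    exact Real.enorm_eq_ofReal hx
  rw [h2, ← ofReal_integral_eq_lintegral_ofReal (hG n) (h0 n)]
  exact ENNReal.ofReal_le_ofReal hn

/-- Green's identity on a punctured neighbourhood, for a function with logarithmic growth whose
Laplacian is bounded above by an integrable function. -/
theorem integral_mul_lapl_puncture {V : Set ℂ} (hV : IsOpen V) {p : ℂ} {f u g : ℂ → ℝ} {α : ℝ}
    (hf : ContDiff ℝ 2 f) (hc : HasCompactSupport f) (hs : tsupport f ⊆ V) (hf0 : ∀ z, 0 ≤ f z)
    (hf1 : f =ᶠ[𝓝 p] fun _ => 1) (hu : ContDiffOn ℝ 2 u (V \ {p}))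
    (hα : (fun z => u z - α * Real.log ‖z - p‖) =o[𝓝[≠] p] fun z => Real.log ‖z - p‖)
    (hg : Integrable fun z => f z * g z) (hle : ∀ z ∈ V \ {p}, lapl u z ≤ g z) :
    Integrable (fun z => f z * lapl u z) ∧ Integrable (fun z => u z * lapl f z) ∧
      ∫ z, f z * lapl u z = (∫ z, u z * lapl f z) - Real.pi / 2 * α := by
  have hVp : IsOpen (V \ {p}) := hV.sdiff isClosed_singleton
  have hpV : p ∈ V := hs (subset_tsupport f (by
    rw [Function.mem_support, hf1.self_of_nhds]; exact one_ne_zero))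
  have hlf : tsupport (lapl f) ⊆ V \ {p} := fun z hz => ⟨hs (tsupport_lapl_subset f hz), by
    rintro rfl
    refine (notMem_tsupport_iff_eventuallyEq.2 ?_) hz
    filter_upwards [hf1.eventuallyEq_nhds] with w hw
    rw [lapl_congr hw, lapl_const]; rfl⟩
  have hlfc : Continuous (lapl f) := by
    rw [← continuousOn_univ]
    exact continuousOn_lapl isOpen_univ hf.contDiffOn
  have hulf : Integrable fun z => u z * lapl f z := by
    have := integrable_mul_of_tsupport_subset hVp hlfc
      (hc.of_isClosed_subset (isClosed_tsupport _) (tsupport_lapl_subset f)) hlf hu.continuousOn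
    simpa only [mul_comm] using this
  obtain ⟨r, hr, hball⟩ : ∃ r > 0, ∀ z, ‖z - p‖ ≤ r → z ∈ V ∧ f =ᶠ[𝓝 z] fun _ => 1 := by
    obtain ⟨r, hr, h⟩ := Metric.eventually_nhds_iff.1 ((hV.eventually_mem hpV).and
      hf1.eventuallyEq_nhds)
    refine ⟨r / 2, by positivity, fun z hz => h ?_⟩
    rw [dist_eq_norm]; linarith
  -- eventually the cut-off is supported in the small disc
  have hsmall : ∀ δ > 0, ∀ᶠ n : ℕ in atTop, 0 < n ∧ Real.exp (-n) < δ := by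
    intro δ hδ
    have h1 : Tendsto (fun n : ℕ => Real.exp (-n)) atTop (𝓝 0) :=
      Real.tendsto_exp_neg_atTop_nhds_zero.comp tendsto_natCast_atTop_atTop
    filter_upwards [eventually_gt_atTop 0, h1.eventually (gt_mem_nhds hδ)] with n h2 h3 using ⟨h2, h3⟩
  have hcs : ∀ {n : ℕ}, 0 < n → tsupport (fun z => f z * cutoff n p z) ⊆ V \ {p} := fun {n} hn z hz =>
    ⟨hs (tsupport_mul_subset_left hz), by
      rintro rfl
      refine (notMem_tsupport_iff_eventuallyEq.2 ?_) (tsupport_mul_subset_right hz)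
      exact cutoff_eventually_eq_zero hn _⟩
  have hlc : ∀ {n : ℕ}, 0 < n → Continuous (lapl (cutoff n p)) := fun {n} hn => by
    rw [← continuousOn_univ]
    exact continuousOn_lapl isOpen_univ (contDiff_cutoff hn p).contDiffOn
  have hlcc : ∀ {n : ℕ}, 0 < n → HasCompactSupport (lapl (cutoff n p)) := fun {n} hn =>
    (isCompact_closedBall p (Real.exp (-n))).of_isClosed_subset (isClosed_tsupport _)
      ((tsupport_lapl_cutoff_subset hn p).trans Set.inter_subset_right)
  have hlcV : ∀ {n : ℕ}, 0 < n → Real.exp (-n) < r → tsupport (lapl (cutoff n p)) ⊆ V \ {p} :=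
    fun {n} hn hnr z hz => by
      obtain ⟨h1, h2⟩ := tsupport_lapl_cutoff_subset hn p hz
      rw [mem_closedBall_iff_norm] at h2
      exact ⟨(hball z (h2.trans hnr.le)).1, h1⟩
  have hulc : ∀ {n : ℕ}, 0 < n → Real.exp (-n) < r →
      Integrable fun z => u z * lapl (cutoff n p) z := fun {n} hn hnr => by
    have := integrable_mul_of_tsupport_subset hVp (hlc hn) (hlcc hn) (hlcV hn hnr) hu.continuousOn
    simpa only [mul_comm] using this
  -- The cut-off varies only where $f=1$, and $f$ varies only where the cut-off is $1$, so the
  -- Laplacian of the product is the sum of the two Laplacians, without a mixed term.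
  have hgreen : ∀ {n : ℕ}, 0 < n → Real.exp (-n) < r →
      Integrable (fun z => f z * cutoff n p z * lapl u z) ∧
      ∫ z, f z * cutoff n p z * lapl u z =
        (∫ z, u z * lapl f z) + ∫ z, u z * lapl (cutoff n p) z := by
    intro n hn hnr
    have hfc : ContDiff ℝ 2 fun z => f z * cutoff n p z := hf.mul (contDiff_cutoff hn p)
    refine ⟨integrable_mul_of_tsupport_subset hVp hfc.continuous hc.mul_right (hcs hn)
      (continuousOn_lapl hVp hu), ?_⟩
    rw [integral_mul_lapl hVp hfc hc.mul_right (hcs hn) hu, ← integral_add hulf (hulc hn hnr)]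
    refine integral_congr_ae (Eventually.of_forall fun z => ?_)
    show u z * lapl (fun z => f z * cutoff n p z) z = u z * lapl f z + u z * lapl (cutoff n p) z
    rw [← mul_add]
    congr 1
    rcases le_or_gt ‖z - p‖ r with hz | hz
    · have h1 := (hball z hz).2
      have h2 : (fun z => f z * cutoff n p z) =ᶠ[𝓝 z] cutoff n p := by
        filter_upwards [h1] with w hw
        rw [hw, one_mul]
      rw [lapl_congr h2, lapl_congr h1, lapl_const, zero_add]
    · have h1 : cutoff n p =ᶠ[𝓝 z] fun _ => 1 := by
        have : ∀ᶠ w in 𝓝 z, r < ‖w - p‖ :=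
          (by fun_prop : ContinuousAt (fun w => ‖w - p‖) z).eventually (lt_mem_nhds hz)
        filter_upwards [this] with w hw
        exact cutoff_of_le hn (hnr.le.trans hw.le)
      have h2 : (fun z => f z * cutoff n p z) =ᶠ[𝓝 z] f := by
        filter_upwards [h1] with w hw
        rw [hw, mul_one]
      rw [lapl_congr h2, lapl_congr h1, lapl_const, add_zero]
  -- the contribution of the puncture
  have hlim : Tendsto (fun n : ℕ => ∫ z, u z * lapl (cutoff n p) z) atTop
      (𝓝 (-(Real.pi / 2 * α))) := by
    obtain ⟨C, hC0, hC⟩ := exists_integral_abs_log_mul_cutoffLapl_le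
    rw [Metric.tendsto_atTop']
    intro ε hε
    -- $C$ bounds the integrals of $|\log|z-p||$ times the absolute Laplacian of the cut-off, so an
    -- error at most $\varepsilon/(C+1)$ times $|\log|z-p||$ contributes less than $\varepsilon$.
    have hδ : 0 < ε / (C + 1) := by positivity
    have h1 := hα.def hδ
    rw [eventually_nhdsWithin_iff, Metric.eventually_nhds_iff] at h1
    obtain ⟨s, hs0, hs1⟩ := h1
    obtain ⟨N, hN⟩ := eventually_atTop.1 (hsmall (min r s) (lt_min hr hs0))
    refine ⟨N, fun n hn => ?_⟩
    obtain ⟨hn0, hns⟩ := hN n hn.le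
    have hnr := hns.trans_le (min_le_left _ _)
    have hlogc : ContinuousOn (fun z : ℂ => Real.log ‖z - p‖) (V \ {p}) := by
      refine ContinuousOn.log (by fun_prop) fun z hz => norm_ne_zero_iff.2 (sub_ne_zero.2 hz.2)
    have i1 : Integrable fun z : ℂ => Real.log ‖z - p‖ * lapl (cutoff n p) z := by
      have := integrable_mul_of_tsupport_subset hVp (hlc hn0) (hlcc hn0) (hlcV hn0 hnr) hlogc
      simpa only [mul_comm] using this
    have e1 : ∫ z, Real.log ‖z - p‖ * lapl (cutoff n p) z = -(Real.pi / 2) := by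
      simp only [lapl_cutoff hn0]; exact integral_log_mul_cutoffLapl hn0 p
    have e2 : (∫ z, u z * lapl (cutoff n p) z) - -(Real.pi / 2 * α) =
        ∫ z, (u z * lapl (cutoff n p) z - α * (Real.log ‖z - p‖ * lapl (cutoff n p) z)) := by
      rw [integral_sub (hulc hn0 hnr) (i1.const_mul α), integral_const_mul, e1]; ring
    rw [dist_eq_norm, e2]
    have e3 : ∫ z, |Real.log ‖z - p‖ * lapl (cutoff n p) z| ≤ C := by
      simp only [lapl_cutoff hn0]; exact hC n hn0 p
    calc _ ≤ ∫ z, ε / (C + 1) * |Real.log ‖z - p‖ * lapl (cutoff n p) z| := by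
          refine norm_integral_le_of_norm_le (i1.abs.const_mul _) (Eventually.of_forall fun z => ?_)
          by_cases hz : z ∈ tsupport (lapl (cutoff n p))
          · obtain ⟨h2, h3⟩ := tsupport_lapl_cutoff_subset hn0 p hz
            rw [mem_closedBall_iff_norm] at h3
            have h4 := hs1 (y := z) (by
              rw [dist_eq_norm]; exact h3.trans_lt (hns.trans_le (min_le_right _ _))) h2
            have e4 : u z * lapl (cutoff n p) z - α * (Real.log ‖z - p‖ * lapl (cutoff n p) z) =
                (u z - α * Real.log ‖z - p‖) * lapl (cutoff n p) z := by ring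
            rw [e4, norm_mul, abs_mul, ← mul_assoc]
            exact mul_le_mul_of_nonneg_right h4 (norm_nonneg _)
          · rw [image_eq_zero_of_notMem_tsupport hz]; simp
      _ = ε / (C + 1) * ∫ z, |Real.log ‖z - p‖ * lapl (cutoff n p) z| := integral_const_mul _ _
      _ ≤ ε / (C + 1) * C := mul_le_mul_of_nonneg_left e3 hδ.le
      _ < ε := by
          rw [div_mul_eq_mul_div, div_lt_iff₀ (by positivity)]
          nlinarith
  have hpt : ∀ z, z ≠ p → ∀ᶠ n : ℕ in atTop, cutoff n p z = 1 := fun z hz => by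
    filter_upwards [hsmall ‖z - p‖ (norm_pos_iff.2 (sub_ne_zero.2 hz))] with n hn
    exact cutoff_of_le hn.1 hn.2.le
  have hne : ∀ᵐ z : ℂ, z ≠ p := by
    rw [ae_iff]; simp
  obtain ⟨N, hN⟩ := eventually_atTop.1 (hsmall r hr)
  have hmeas : ∀ n, 0 < n → AEStronglyMeasurable (cutoff n p) (volume : Measure ℂ) := fun n hn =>
    (contDiff_cutoff hn p).continuous.aestronglyMeasurable
  have hfg : ∀ n, 0 < n → Integrable fun z => cutoff n p z * (f z * g z) := fun n hn =>
    hg.bdd_mul (c := 1) (hmeas n hn) (Eventually.of_forall fun z => by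
      rw [Real.norm_of_nonneg (cutoff_nonneg n p z)]; exact cutoff_le_one n p z)
  have hgint : ∀ n, 0 < n → |∫ z, cutoff n p z * (f z * g z)| ≤ ∫ z, |f z * g z| := fun n hn => by
    rw [← Real.norm_eq_abs]
    refine norm_integral_le_of_norm_le hg.abs (Eventually.of_forall fun z => ?_)
    rw [norm_mul, Real.norm_of_nonneg (cutoff_nonneg n p z)]
    exact mul_le_of_le_one_left (norm_nonneg _) (cutoff_le_one n p z)
  have hlimb : ∀ᶠ n in atTop, -(Real.pi / 2 * α) - 1 < ∫ z, u z * lapl (cutoff n p) z :=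
    hlim.eventually (lt_mem_nhds (by linarith))
  -- The difference $g-\Delta u$ is nonnegative, so its cut-off integrals are integrals of
  -- nonnegative functions. Green's identity and the limit of the puncture term bound them, and
  -- Fatou's lemma gives integrability without any lower bound on $\Delta u$.
  have hkey : Integrable fun z => f z * g z - f z * lapl u z := by
    refine integrable_of_tendsto_of_bounded
      (G := fun n z => cutoff (n + N) p z * (f z * g z) - f z * cutoff (n + N) p z * lapl u z)
      (C := (∫ z, |f z * g z|) - (∫ z, u z * lapl f z) + Real.pi / 2 * α + 1) ?_ ?_ ?_ ?_
    · filter_upwards [hne] with z hz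
      refine tendsto_const_nhds.congr' ?_
      filter_upwards [(tendsto_add_atTop_nat N).eventually (hpt z hz)] with n hn
      rw [hn]; ring
    · intro n
      obtain ⟨h1, h2⟩ := hN (n + N) (by omega)
      exact (hfg _ h1).sub (hgreen h1 h2).1
    · intro n
      filter_upwards [hne] with z hz
      have : cutoff (n + N) p z * (f z * g z) - f z * cutoff (n + N) p z * lapl u z =
          cutoff (n + N) p z * (f z * (g z - lapl u z)) := by ring
      simp only [this, Pi.zero_apply]
      refine mul_nonneg (cutoff_nonneg _ _ _) ?_
      by_cases hzV : z ∈ V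
      · exact mul_nonneg (hf0 z) (sub_nonneg.2 (hle z ⟨hzV, hz⟩))
      · rw [image_eq_zero_of_notMem_tsupport fun h => hzV (hs h), zero_mul]
    · filter_upwards [(tendsto_add_atTop_nat N).eventually hlimb] with n hn
      obtain ⟨h1, h2⟩ := hN (n + N) (by omega)
      rw [integral_sub (hfg _ h1) (hgreen h1 h2).1, (hgreen h1 h2).2]
      have := (le_abs_self _).trans (hgint _ h1)
      linarith
  have hint : Integrable fun z => f z * lapl u z := by
    refine (hg.sub hkey).congr (Eventually.of_forall fun z => ?_)
    exact sub_sub_cancel _ _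
  refine ⟨hint, hulf, ?_⟩
  -- Once $f\Delta u$ is integrable, dominated convergence identifies the limit of the left side of
  -- the truncated identity.
  have hl1 : Tendsto (fun n : ℕ => ∫ z, f z * cutoff (n + N) p z * lapl u z) atTop
      (𝓝 (∫ z, f z * lapl u z)) := by
    refine tendsto_integral_of_dominated_convergence (fun z => |f z * lapl u z|) (fun n => ?_)
      hint.abs (fun n => Eventually.of_forall fun z => ?_) ?_
    · obtain ⟨h1, h2⟩ := hN (n + N) (by omega)
      exact (hgreen h1 h2).1.1
    · have e : f z * cutoff (n + N) p z * lapl u z = cutoff (n + N) p z * (f z * lapl u z) := by ring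
      rw [e, norm_mul, Real.norm_of_nonneg (cutoff_nonneg _ p z)]
      exact mul_le_of_le_one_left (norm_nonneg _) (cutoff_le_one _ p z)
    · filter_upwards [hne] with z hz
      refine tendsto_const_nhds.congr' ?_
      filter_upwards [(tendsto_add_atTop_nat N).eventually (hpt z hz)] with n hn
      rw [hn]; ring
  have hl2 : Tendsto (fun n : ℕ => ∫ z, f z * cutoff (n + N) p z * lapl u z) atTop
      (𝓝 ((∫ z, u z * lapl f z) + -(Real.pi / 2 * α))) := by
    refine ((hlim.comp (tendsto_add_atTop_nat N)).const_add _).congr fun n => ?_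
    obtain ⟨h1, h2⟩ := hN (n + N) (by omega)
    exact (hgreen h1 h2).2.symm
  rw [tendsto_nhds_unique hl1 hl2, sub_eq_add_neg]

end Puncture

/-! ### Densities on the surface and their integrals in charts. -/

section Charts

set_option linter.unusedSectionVars false

open MeasureTheory Filter

variable {X : Type u} [TopologicalSpace X] [ChartedSpace ℂ X] [IsManifold 𝓘(ℂ) ω X]

/-- The change of coordinates from the chart at `a` to the chart at `b`. -/
def trans (a b : X) (z : ℂ) : ℂ := chartAt ℂ b ((chartAt ℂ a).symm z)

theorem contDiffAt_trans {a b y : X} (ha : y ∈ (chartAt ℂ a).source)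
    (hb : y ∈ (chartAt ℂ b).source) : ContDiffAt ℂ ω (trans a b) (chartAt ℂ a y) := by
  have h1 : ContMDiffAt 𝓘(ℂ) 𝓘(ℂ) ω (chartAt ℂ a).symm (chartAt ℂ a y) :=
    (contMDiffOn_chart_symm (I := 𝓘(ℂ)) (n := ω) (x := a)).contMDiffAt
      ((chartAt ℂ a).open_target.mem_nhds ((chartAt ℂ a).map_source ha))
  have h2 : ContMDiffAt 𝓘(ℂ) 𝓘(ℂ) ω (chartAt ℂ b) ((chartAt ℂ a).symm (chartAt ℂ a y)) := by
    rw [(chartAt ℂ a).left_inv ha]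
    exact (contMDiffOn_chart (I := 𝓘(ℂ)) (n := ω) (x := b)).contMDiffAt
      ((chartAt ℂ b).open_source.mem_nhds hb)
  exact (h2.comp _ h1).contDiffAt

theorem eventually_mem_source {a b y : X} (ha : y ∈ (chartAt ℂ a).source)
    (hb : y ∈ (chartAt ℂ b).source) : ∀ᶠ w in 𝓝 (chartAt ℂ a y), w ∈ (chartAt ℂ a).target ∧
      (chartAt ℂ a).symm w ∈ (chartAt ℂ b).source := by
  refine ((chartAt ℂ a).open_target.eventually_mem ((chartAt ℂ a).map_source ha)).and ?_
  have h := (chartAt ℂ a).continuousAt_symm ((chartAt ℂ a).map_source ha)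
  rw [ContinuousAt, (chartAt ℂ a).left_inv ha] at h
  exact h.eventually ((chartAt ℂ b).open_source.eventually_mem hb)

theorem eventually_differentiableAt_trans {a b y : X} (ha : y ∈ (chartAt ℂ a).source)
    (hb : y ∈ (chartAt ℂ b).source) :
    ∀ᶠ w in 𝓝 (chartAt ℂ a y), DifferentiableAt ℂ (trans a b) w := by
  filter_upwards [eventually_mem_source ha hb] with w hw
  have := contDiffAt_trans ((chartAt ℂ a).map_target hw.1) hw.2
  rw [(chartAt ℂ a).right_inv hw.1] at this
  exact this.differentiableAt (by simp)

theorem comp_symm_eventuallyEq {α : Type*} (u : X → α) {a b y : X} (ha : y ∈ (chartAt ℂ a).source)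
    (hb : y ∈ (chartAt ℂ b).source) : (fun w => u ((chartAt ℂ a).symm w)) =ᶠ[𝓝 (chartAt ℂ a y)]
      fun w => (fun v => u ((chartAt ℂ b).symm v)) (trans a b w) := by
  filter_upwards [eventually_mem_source ha hb] with w hw
  simp only [trans]
  rw [(chartAt ℂ b).left_inv hw.2]

theorem trans_apply {a b y : X} (ha : y ∈ (chartAt ℂ a).source) :
    trans a b (chartAt ℂ a y) = chartAt ℂ b y := by
  simp only [trans]
  rw [(chartAt ℂ a).left_inv ha]

theorem isManifold_real : IsManifold 𝓘(ℝ, ℂ) ∞ X := by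
  refine isManifold_of_contDiffOn _ _ _ fun e e' he he' => ?_
  have h := HasGroupoid.compatible (G := contDiffGroupoid ω 𝓘(ℂ)) he he'
  have h2 := (contMDiffOn_of_mem_contDiffGroupoid h).contDiffOn
  have h3 := (h2.restrict_scalars ℝ).of_le (m := ∞) le_top
  simpa using h3

theorem contDiffAt_comp_symm {E : Type*} [NormedAddCommGroup E] [NormedSpace ℝ E] {k : ℕ∞}
    {f : X → E} {a y : X} (hf : ContMDiffAt 𝓘(ℝ, ℂ) 𝓘(ℝ, E) k f y)
    (ha : y ∈ (chartAt ℂ a).source) :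
    ContDiffAt ℝ k (fun w => f ((chartAt ℂ a).symm w)) (chartAt ℂ a y) := by
  have := isManifold_real (X := X)
  have h1 : ContMDiffAt 𝓘(ℝ, ℂ) 𝓘(ℝ, ℂ) ∞ (chartAt ℂ a).symm (chartAt ℂ a y) :=
    (contMDiffOn_chart_symm (I := 𝓘(ℝ, ℂ)) (n := ∞) (x := a)).contMDiffAt
      ((chartAt ℂ a).open_target.mem_nhds ((chartAt ℂ a).map_source ha))
  have h2 : ContMDiffAt 𝓘(ℝ, ℂ) 𝓘(ℝ, E) k f ((chartAt ℂ a).symm (chartAt ℂ a y)) := by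
    rwa [(chartAt ℂ a).left_inv ha]
  exact (h2.comp _ (h1.of_le (by exact_mod_cast le_top))).contDiffAt

theorem differentiableAt_comp_symm {f : X → ℂ} {a y : X} (hf : MDifferentiableAt 𝓘(ℂ) 𝓘(ℂ) f y)
    (ha : y ∈ (chartAt ℂ a).source) :
    DifferentiableAt ℂ (fun w => f ((chartAt ℂ a).symm w)) (chartAt ℂ a y) := by
  have h1 : MDifferentiableAt 𝓘(ℂ) 𝓘(ℂ) (chartAt ℂ a).symm (chartAt ℂ a y) :=
    ((contMDiffOn_chart_symm (I := 𝓘(ℂ)) (n := ω) (x := a)).contMDiffAt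
      ((chartAt ℂ a).open_target.mem_nhds ((chartAt ℂ a).map_source ha))).mdifferentiableAt (by simp)
  have h2 : MDifferentiableAt 𝓘(ℂ) 𝓘(ℂ) f ((chartAt ℂ a).symm (chartAt ℂ a y)) := by
    rwa [(chartAt ℂ a).left_inv ha]
  exact (h2.comp _ h1).differentiableAt

/-- The Laplacian (divided by `4`) of `u` in the chart at `a`. -/
def lapDens (u : X → ℝ) (a y : X) : ℝ :=
  lapl (fun w => u ((chartAt ℂ a).symm w)) (chartAt ℂ a y)

/-- `u` is `C²` at `y` in the chart at `a`. -/
def SmoothIn (u : X → ℝ) (a y : X) : Prop :=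
  ContDiffAt ℝ 2 (fun w => u ((chartAt ℂ a).symm w)) (chartAt ℂ a y)

theorem lapDens_trans {u : X → ℝ} {a b y : X} (ha : y ∈ (chartAt ℂ a).source)
    (hb : y ∈ (chartAt ℂ b).source) (hu : SmoothIn u b y) :
    lapDens u a y = ‖deriv (trans a b) (chartAt ℂ a y)‖ ^ 2 * lapDens u b y := by
  rw [lapDens, lapl_congr (comp_symm_eventuallyEq u ha hb),
    lapl_comp (u := fun v => u ((chartAt ℂ b).symm v)) (by rwa [trans_apply ha])
      (eventually_differentiableAt_trans ha hb), trans_apply ha]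
  rfl

/-- The coefficients `F a y` form a density off `D`. -/
def IsDensityOff (D : Finset X) (F : X → X → ℝ) : Prop :=
  ∀ a b y, y ∉ D → y ∈ (chartAt ℂ a).source → y ∈ (chartAt ℂ b).source →
    F a y = ‖deriv (trans a b) (chartAt ℂ a y)‖ ^ 2 * F b y

theorem isDensityOff_lapDens {D : Finset X} {u : X → ℝ}
    (hu : ∀ a y, y ∉ D → y ∈ (chartAt ℂ a).source → SmoothIn u a y) :
    IsDensityOff D (lapDens u) := fun _ b y hy ha hb => lapDens_trans ha hb (hu b y hy hb)

theorem IsDensityOff.mul {D : Finset X} {F : X → X → ℝ} (hF : IsDensityOff D F) (ρ : X → ℝ) :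
    IsDensityOff D fun a y => ρ y * F a y := fun a b y hy ha hb => by
  simp only [hF a b y hy ha hb]; ring

theorem IsDensityOff.mono {D D' : Finset X} (h : D ⊆ D') {F : X → X → ℝ} (hF : IsDensityOff D F) :
    IsDensityOff D' F := fun a b y hy => hF a b y fun hy' => hy (h hy')

theorem injOn_trans (a b : X) : Set.InjOn (trans a b)
    {z | z ∈ (chartAt ℂ a).target ∧ (chartAt ℂ a).symm z ∈ (chartAt ℂ b).source} := by
  intro z hz w hw h
  exact (chartAt ℂ a).symm.injOn hz.1 hw.1 ((chartAt ℂ b).injOn hz.2 hw.2 h)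

theorem abs_det_mul (c : ℂ) :
    |((ContinuousLinearMap.toSpanSingleton ℂ c).restrictScalars ℝ : ℂ →L[ℝ] ℂ).det| = ‖c‖ ^ 2 := by
  have h : (((ContinuousLinearMap.toSpanSingleton ℂ c).restrictScalars ℝ : ℂ →L[ℝ] ℂ) : ℂ →ₗ[ℝ] ℂ) =
      LinearMap.mulLeft ℝ c := by
    ext; simp [mul_comm]
  rw [ContinuousLinearMap.det, h]
  have h2 : LinearMap.det (LinearMap.mulLeft ℝ c) = Complex.normSq c := Algebra.norm_complex_apply c
  rw [h2, Complex.normSq_eq_norm_sq, abs_of_nonneg (by positivity)]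

variable [CompactSpace X] [Nonempty X]

/-- The points of the `k`-th piece. -/
def cell (k : ℕ) : Set X :=
  {y | y ∈ (chartAt ℂ (atlasPt X k)).source ∧ ∀ l < k, y ∉ (chartAt ℂ (atlasPt X l)).source}

theorem exists_mem_cell (y : X) : ∃ k < atlasSize X, y ∈ cell (X := X) k := by
  classical
  have h : ∃ k, k < atlasSize X ∧ y ∈ (chartAt ℂ (atlasPt X k)).source := by
    obtain ⟨k, hk⟩ := (exists_finite_atlas X).choose_spec.choose_spec y
    exact ⟨k, hk⟩
  refine ⟨Nat.find h, (Nat.find_spec h).1, (Nat.find_spec h).2, fun l hl hy => ?_⟩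
  exact Nat.find_min h hl ⟨hl.trans (Nat.find_spec h).1, hy⟩

theorem mem_piece_iff {k : ℕ} {z : ℂ} : z ∈ piece X k ↔
    z ∈ (chartAt ℂ (atlasPt X k)).target ∧ (chartAt ℂ (atlasPt X k)).symm z ∈ cell (X := X) k :=
  ⟨fun h => ⟨h.1, (chartAt ℂ _).map_target h.1, h.2⟩, fun h => ⟨h.1, h.2.2⟩⟩

theorem isOpen_target_inter (a : X) {O : Set X} (hO : IsOpen O) :
    IsOpen {z | z ∈ (chartAt ℂ a).target ∧ (chartAt ℂ a).symm z ∈ O} :=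
  (chartAt ℂ a).symm.isOpen_inter_preimage hO

theorem measurableSet_target_cell (a : X) (k : ℕ) :
    MeasurableSet {z | z ∈ (chartAt ℂ a).target ∧ (chartAt ℂ a).symm z ∈ cell (X := X) k} := by
  have h : {z | z ∈ (chartAt ℂ a).target ∧ (chartAt ℂ a).symm z ∈ cell (X := X) k} =
      {z | z ∈ (chartAt ℂ a).target ∧
        (chartAt ℂ a).symm z ∈ (chartAt ℂ (atlasPt X k)).source} \
      {z | z ∈ (chartAt ℂ a).target ∧ (chartAt ℂ a).symm z ∈
        ⋃ l ∈ Finset.range k, (chartAt ℂ (atlasPt X l)).source} := by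
    ext z
    simp only [cell, Set.mem_ofPred_eq, Set.mem_sdiff, Set.mem_iUnion, Finset.mem_range,
      exists_prop, not_and, not_exists]
    tauto
  rw [h]
  exact (isOpen_target_inter a (chartAt ℂ _).open_source).measurableSet.diff
    (isOpen_target_inter a (isOpen_biUnion fun l _ => (chartAt ℂ _).open_source)).measurableSet

theorem measurableSet_piece (k : ℕ) : MeasurableSet (piece X k) := by
  convert measurableSet_target_cell (atlasPt X k) k using 1
  ext z; exact mem_piece_iff

theorem finite_target_mem (a : X) (D : Finset X) :
    {z | z ∈ (chartAt ℂ a).target ∧ (chartAt ℂ a).symm z ∈ D}.Finite := by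
  refine Set.Finite.of_finite_image (f := (chartAt ℂ a).symm) (D.finite_toSet.subset ?_)
    ((chartAt ℂ a).symm.injOn.mono fun z hz => hz.1)
  rintro _ ⟨z, hz, rfl⟩
  exact hz.2

theorem ae_symm_notMem (a : X) (D : Finset X) :
    ∀ᵐ z : ℂ, z ∈ (chartAt ℂ a).target → (chartAt ℂ a).symm z ∉ D := by
  filter_upwards [compl_mem_ae_iff.2 ((finite_target_mem a D).measure_zero volume)] with z hz h1 h2
  exact hz ⟨h1, h2⟩

/-- The integral over `X` of a density. -/
def surfInt (F : X → X → ℝ) : ℝ :=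
  ∑ k ∈ Finset.range (atlasSize X),
    ∫ z in piece X k, F (atlasPt X k) ((chartAt ℂ (atlasPt X k)).symm z)

section Chart

variable [T2Space X]

/-- Change of variables on one piece of the partition: the factor $|\varphi'|^2$ of a density is the
real Jacobian of the holomorphic transition map. Points of $D$, where the density law may fail, form
a null set. -/
theorem cell_density {D : Finset X} {F : X → X → ℝ} (hF : IsDensityOff D F) (b : X)
    (h0 : ∀ a y, y ∉ D → y ∈ (chartAt ℂ a).source → y ∉ (chartAt ℂ b).source → F a y = 0) (k : ℕ) :
    (IntegrableOn (fun z => F (atlasPt X k) ((chartAt ℂ (atlasPt X k)).symm z)) (piece X k) ↔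
      IntegrableOn (fun z => F b ((chartAt ℂ b).symm z))
        {z | z ∈ (chartAt ℂ b).target ∧ (chartAt ℂ b).symm z ∈ cell (X := X) k}) ∧
    ∫ z in piece X k, F (atlasPt X k) ((chartAt ℂ (atlasPt X k)).symm z) =
      ∫ z in {z | z ∈ (chartAt ℂ b).target ∧ (chartAt ℂ b).symm z ∈ cell (X := X) k},
        F b ((chartAt ℂ b).symm z) := by
  set a := atlasPt X k with ha
  set S : Set ℂ := {z | z ∈ piece X k ∧ (chartAt ℂ a).symm z ∈ (chartAt ℂ b).source \ (D : Set X)}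
    with hS
  set T : Set ℂ := {z | z ∈ (chartAt ℂ b).target ∧ (chartAt ℂ b).symm z ∈ cell (X := X) k} with hT
  have hSP : S ⊆ piece X k := fun z hz => hz.1
  have hSm : MeasurableSet S := by
    have : S = piece X k ∩ {z | z ∈ (chartAt ℂ a).target ∧
        (chartAt ℂ a).symm z ∈ (chartAt ℂ b).source \ (D : Set X)} := by
      ext z
      constructor
      · intro h
        exact ⟨h.1, h.1.1, h.2⟩
      · intro h
        exact ⟨h.1, h.2.2⟩
    rw [this]
    exact (measurableSet_piece k).inter (isOpen_target_inter a
      ((chartAt ℂ b).open_source.sdiff D.finite_toSet.isClosed)).measurableSet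
  have hfun : ∀ z ∈ S, F a ((chartAt ℂ a).symm z) =
      |((ContinuousLinearMap.toSpanSingleton ℂ (deriv (trans a b) z)).restrictScalars ℝ :
        ℂ →L[ℝ] ℂ).det| • F b ((chartAt ℂ b).symm (trans a b z)) := by
    intro z hz
    have h1 := (chartAt ℂ a).map_target hz.1.1
    rw [hF a b _ hz.2.2 h1 hz.2.1, (chartAt ℂ a).right_inv hz.1.1, abs_det_mul, trans,
      (chartAt ℂ b).left_inv hz.2.1, smul_eq_mul]
  have hder : ∀ z ∈ S, HasFDerivWithinAt (trans a b)
      ((ContinuousLinearMap.toSpanSingleton ℂ (deriv (trans a b) z)).restrictScalars ℝ) S z := by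
    intro z hz
    have h1 := (contDiffAt_trans ((chartAt ℂ a).map_target hz.1.1) hz.2.1).differentiableAt (by simp)
    rw [(chartAt ℂ a).right_inv hz.1.1] at h1
    exact (h1.hasDerivAt.hasFDerivAt.restrictScalars ℝ).hasFDerivWithinAt
  have hinj : Set.InjOn (trans a b) S := by
    refine (injOn_trans a b).mono fun z hz => ?_
    exact ⟨hz.1.1, hz.2.1⟩
  have himg : trans a b '' S =ᵐ[volume] T := by
    have hsub : trans a b '' S = T \ {z | z ∈ (chartAt ℂ b).target ∧ (chartAt ℂ b).symm z ∈ D} := by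
      ext w
      constructor
      · rintro ⟨z, hz, rfl⟩
        have e : (chartAt ℂ b).symm (trans a b z) = (chartAt ℂ a).symm z :=
          (chartAt ℂ b).left_inv hz.2.1
        constructor
        · refine ⟨(chartAt ℂ b).map_source hz.2.1, ?_⟩
          rw [e]; exact (mem_piece_iff.1 hz.1).2
        · intro h
          have := h.2
          rw [e] at this
          exact hz.2.2 this
      · rintro ⟨⟨h1, h2⟩, h3⟩
        have e := (chartAt ℂ a).left_inv h2.1
        have hw : (chartAt ℂ a).symm (trans b a w) = (chartAt ℂ b).symm w := e
        refine ⟨trans b a w, ⟨mem_piece_iff.2 ⟨(chartAt ℂ a).map_source h2.1, ?_⟩, ?_⟩, ?_⟩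
        · change (chartAt ℂ a).symm (trans b a w) ∈ _
          rw [hw]; exact h2
        · rw [hw]
          exact ⟨(chartAt ℂ b).map_target h1, fun h => h3 ⟨h1, h⟩⟩
        · change chartAt ℂ b ((chartAt ℂ a).symm (trans b a w)) = w
          rw [hw, (chartAt ℂ b).right_inv h1]
    rw [hsub]
    exact sdiff_null_ae_eq_self ((finite_target_mem b D).measure_zero volume)
  have hzero : ∀ᵐ z : ℂ, z ∈ piece X k → z ∉ S → F a ((chartAt ℂ a).symm z) = 0 := by
    filter_upwards [ae_symm_notMem a D] with z hz hzP hzS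
    exact h0 a _ (hz hzP.1) ((chartAt ℂ a).map_target hzP.1) fun h => hzS ⟨hzP, h, hz hzP.1⟩
  have hI := integrableOn_image_iff_integrableOn_abs_det_fderiv_smul (μ := volume) hSm hder hinj
    (fun z => F b ((chartAt ℂ b).symm z))
  have hE := integral_image_eq_integral_abs_det_fderiv_smul (μ := volume) hSm hder hinj
    (fun z => F b ((chartAt ℂ b).symm z))
  rw [integrableOn_congr_set_ae himg] at hI
  rw [setIntegral_congr_set himg] at hE
  rw [hI, hE, ← setIntegral_congr_fun hSm hfun, ← integrableOn_congr_fun hfun hSm]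
  have hz' : ∀ᵐ z : ℂ, z ∈ (piece X k \ S : Set ℂ) → F a ((chartAt ℂ a).symm z) = 0 :=
    hzero.mono fun z h hz => h hz.1 hz.2
  exact ⟨⟨fun h => h.mono_set hSP,
      fun h => h.of_ae_sdiff_eq_zero (measurableSet_piece k).nullMeasurableSet hz'⟩,
    setIntegral_eq_of_subset_of_ae_sdiff_eq_zero (measurableSet_piece k).nullMeasurableSet hSP hz'⟩

theorem target_eq_biUnion (b : X) : (chartAt ℂ b).target = ⋃ k ∈ Finset.range (atlasSize X),
    {z | z ∈ (chartAt ℂ b).target ∧ (chartAt ℂ b).symm z ∈ cell (X := X) k} := by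
  ext z
  simp only [Set.mem_iUnion, Finset.mem_range, exists_prop]
  constructor
  · intro hz
    obtain ⟨k, hk, h⟩ := exists_mem_cell ((chartAt ℂ b).symm z)
    exact ⟨k, hk, hz, h⟩
  · rintro ⟨k, -, h⟩
    exact h.1

theorem cell_disjoint {k l : ℕ} (h : k ≠ l) {y : X} (hk : y ∈ cell (X := X) k) :
    y ∉ cell (X := X) l := by
  intro hl
  rcases lt_or_gt_of_ne h with h | h
  · exact hl.2 k h hk.1
  · exact hk.2 l h hl.1

theorem densityIntegrable_iff {D : Finset X} {F : X → X → ℝ} (hF : IsDensityOff D F) (b : X)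
    (h0 : ∀ a y, y ∉ D → y ∈ (chartAt ℂ a).source → y ∉ (chartAt ℂ b).source → F a y = 0) : DensityIntegrable F ↔
      IntegrableOn (fun z => F b ((chartAt ℂ b).symm z)) (chartAt ℂ b).target := by
  rw [target_eq_biUnion b, integrableOn_finset_iUnion]
  simp only [Finset.mem_range]
  exact forall₂_congr fun k _ => (cell_density hF b h0 k).1

theorem surfInt_eq {D : Finset X} {F : X → X → ℝ} (hF : IsDensityOff D F) (b : X)
    (h0 : ∀ a y, y ∉ D → y ∈ (chartAt ℂ a).source → y ∉ (chartAt ℂ b).source → F a y = 0) (hI : DensityIntegrable F) :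
    surfInt F = ∫ z in (chartAt ℂ b).target, F b ((chartAt ℂ b).symm z) := by
  have h := (densityIntegrable_iff hF b h0).1 hI
  rw [target_eq_biUnion b, integrableOn_finset_iUnion] at h
  rw [target_eq_biUnion b, integral_biUnion_finset _ (fun k _ => measurableSet_target_cell b k) ?_ h]
  · exact Finset.sum_congr rfl fun k _ => (cell_density hF b h0 k).2
  · intro k _ l _ hkl
    exact Set.disjoint_left.2 fun z hz hz' => cell_disjoint hkl hz.2 hz'.2

theorem surfInt_congr {D : Finset X} {F G : X → X → ℝ} (h : ∀ a y, y ∉ D →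
    y ∈ (chartAt ℂ a).source → F a y = G a y) : surfInt F = surfInt G := by
  refine Finset.sum_congr rfl fun k _ => setIntegral_congr_ae (measurableSet_piece k) ?_
  filter_upwards [ae_symm_notMem (atlasPt X k) D] with z hz hzP
  exact h _ _ (hz hzP.1) ((chartAt ℂ _).map_target hzP.1)

theorem DensityIntegrable.congr {D : Finset X} {F G : X → X → ℝ} (hF : DensityIntegrable F)
    (h : ∀ a y, y ∉ D → y ∈ (chartAt ℂ a).source → F a y = G a y) : DensityIntegrable G := by
  refine fun k hk => (hF k hk).congr_fun_ae ?_
  rw [Filter.EventuallyEq, ae_restrict_iff' (measurableSet_piece k)]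
  filter_upwards [ae_symm_notMem (atlasPt X k) D] with z hz hzP
  exact h _ _ (hz hzP.1) ((chartAt ℂ _).map_target hzP.1)

theorem surfInt_sum {ι : Type*} (s : Finset ι) {F : ι → X → X → ℝ}
    (hF : ∀ i ∈ s, DensityIntegrable (F i)) :
    surfInt (fun a y => ∑ i ∈ s, F i a y) = ∑ i ∈ s, surfInt (F i) := by
  simp only [surfInt]
  rw [Finset.sum_comm]
  refine Finset.sum_congr rfl fun k hk => ?_
  exact integral_finsetSum _ fun i hi => hF i hi k (Finset.mem_range.1 hk)

theorem DensityIntegrable.sum {ι : Type*} (s : Finset ι) {F : ι → X → X → ℝ}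
    (hF : ∀ i ∈ s, DensityIntegrable (F i)) : DensityIntegrable fun a y => ∑ i ∈ s, F i a y :=
  fun k hk => integrable_finsetSum _ fun i hi => hF i hi k hk

theorem DensityIntegrable.add {F G : X → X → ℝ} (hF : DensityIntegrable F)
    (hG : DensityIntegrable G) : DensityIntegrable fun a y => F a y + G a y :=
  fun k hk => (hF k hk).add (hG k hk)

theorem DensityIntegrable.const_mul {F : X → X → ℝ} (hF : DensityIntegrable F) (c : ℝ) :
    DensityIntegrable fun a y => c * F a y :=
  fun k hk => (hF k hk).const_mul c

theorem DensityIntegrable.abs {F : X → X → ℝ} (hF : DensityIntegrable F) :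
    DensityIntegrable fun a y => |F a y| :=
  fun k hk => (hF k hk).abs

theorem DensityIntegrable.mul_continuous {F : X → X → ℝ} (hF : DensityIntegrable F) {ρ : X → ℝ}
    (hρ : Continuous ρ) : DensityIntegrable fun a y => ρ y * F a y := by
  intro k hk
  obtain ⟨C, hC⟩ := isCompact_univ.exists_bound_of_continuousOn hρ.continuousOn
  refine (hF k hk).bdd_mul (c := C) ?_ (Eventually.of_forall fun z => hC _ (Set.mem_univ _))
  refine ContinuousOn.aestronglyMeasurable ?_ (measurableSet_piece k)
  exact hρ.comp_continuousOn ((chartAt ℂ _).continuousOn_symm.mono fun z hz => hz.1)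

theorem surfInt_add {F G : X → X → ℝ} (hF : DensityIntegrable F) (hG : DensityIntegrable G) :
    surfInt (fun a y => F a y + G a y) = surfInt F + surfInt G := by
  simp only [surfInt]
  rw [← Finset.sum_add_distrib]
  exact Finset.sum_congr rfl fun k hk => integral_add (hF k (Finset.mem_range.1 hk))
    (hG k (Finset.mem_range.1 hk))

end Chart
end Charts

/-! ### Green's identity on the compact surface with punctures. -/

section SurfaceGreen

set_option linter.unusedSectionVars false

open MeasureTheory Filter

variable {X : Type u} [TopologicalSpace X] [ChartedSpace ℂ X] [IsManifold 𝓘(ℂ) ω X]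

/-- A function on `X` in the chart at `b`, extended by zero. -/
def chartFun (b : X) (ρ : X → ℝ) : ℂ → ℝ :=
  (chartAt ℂ b).target.indicator fun z => ρ ((chartAt ℂ b).symm z)

theorem chartFun_of_mem {b : X} (ρ : X → ℝ) {z : ℂ} (hz : z ∈ (chartAt ℂ b).target) :
    chartFun b ρ z = ρ ((chartAt ℂ b).symm z) := Set.indicator_of_mem hz _

theorem chartFun_eventuallyEq {b : X} (ρ : X → ℝ) {z : ℂ} (hz : z ∈ (chartAt ℂ b).target) :
    chartFun b ρ =ᶠ[𝓝 z] fun w => ρ ((chartAt ℂ b).symm w) := by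
  filter_upwards [(chartAt ℂ b).open_target.mem_nhds hz] with w hw using chartFun_of_mem ρ hw

theorem smoothIn_of_contMDiff {ρ : X → ℝ} (hρ : ContMDiff 𝓘(ℝ, ℂ) 𝓘(ℝ) ∞ ρ) {a y : X}
    (ha : y ∈ (chartAt ℂ a).source) : SmoothIn ρ a y :=
  (contDiffAt_comp_symm (k := ⊤) hρ.contMDiffAt ha).of_le (WithTop.coe_le_coe.2 (le_top : (2 : ℕ∞) ≤ ⊤))

theorem lapDens_eq_zero {ρ : X → ℝ} {a y : X} (ha : y ∈ (chartAt ℂ a).source)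
    (hy : y ∉ tsupport ρ) : lapDens ρ a y = 0 := by
  have h := (chartAt ℂ a).continuousAt_symm ((chartAt ℂ a).map_source ha)
  rw [ContinuousAt, (chartAt ℂ a).left_inv ha] at h
  have h2 : (fun w => ρ ((chartAt ℂ a).symm w)) =ᶠ[𝓝 (chartAt ℂ a y)] fun _ => 0 :=
    h.eventually (notMem_tsupport_iff_eventuallyEq.1 hy)
  rw [lapDens, lapl_congr h2, lapl_const]

theorem lapl_eq_lapDens (u : X → ℝ) {b : X} {z : ℂ} (hz : z ∈ (chartAt ℂ b).target) :
    lapl (fun w => u ((chartAt ℂ b).symm w)) z = lapDens u b ((chartAt ℂ b).symm z) := by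
  rw [lapDens, (chartAt ℂ b).right_inv hz]

variable [T2Space X] [CompactSpace X] [Nonempty X]

theorem tsupport_chartFun_subset {b : X} {ρ : X → ℝ} (hs : tsupport ρ ⊆ (chartAt ℂ b).source) :
    tsupport (chartFun b ρ) ⊆ chartAt ℂ b '' tsupport ρ := by
  have hK : IsCompact (chartAt ℂ b '' tsupport ρ) :=
    (isClosed_tsupport ρ).isCompact.image_of_continuousOn ((chartAt ℂ b).continuousOn.mono hs)
  refine closure_minimal (fun z hz => ?_) hK.isClosed
  have hzt : z ∈ (chartAt ℂ b).target := by
    by_contra h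
    exact hz (Set.indicator_of_notMem h _)
  rw [Function.mem_support, chartFun_of_mem ρ hzt] at hz
  exact ⟨_, subset_tsupport ρ hz, (chartAt ℂ b).right_inv hzt⟩

theorem hasCompactSupport_chartFun {b : X} {ρ : X → ℝ} (hs : tsupport ρ ⊆ (chartAt ℂ b).source) :
    HasCompactSupport (chartFun b ρ) :=
  ((isClosed_tsupport ρ).isCompact.image_of_continuousOn
    ((chartAt ℂ b).continuousOn.mono hs)).of_isClosed_subset (isClosed_tsupport _)
      (tsupport_chartFun_subset hs)

theorem contDiff_chartFun {b : X} {ρ : X → ℝ} (hρ : ContMDiff 𝓘(ℝ, ℂ) 𝓘(ℝ) ∞ ρ)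
    (hs : tsupport ρ ⊆ (chartAt ℂ b).source) : ContDiff ℝ 2 (chartFun b ρ) := by
  rw [contDiff_iff_contDiffAt]
  intro z
  by_cases hz : z ∈ tsupport (chartFun b ρ)
  · obtain ⟨y, hy, rfl⟩ := tsupport_chartFun_subset hs hz
    exact ContDiffAt.congr_of_eventuallyEq (smoothIn_of_contMDiff hρ (hs hy))
      (chartFun_eventuallyEq ρ ((chartAt ℂ b).map_source (hs hy)))
  · exact contDiffAt_const.congr_of_eventuallyEq (notMem_tsupport_iff_eventuallyEq.1 hz)

theorem integrable_indicator_target {b : X} {f : ℂ → ℝ} :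
    Integrable ((chartAt ℂ b).target.indicator f) ↔ IntegrableOn f (chartAt ℂ b).target :=
  integrable_indicator_iff (chartAt ℂ b).open_target.measurableSet

theorem integral_indicator_target {b : X} {f : ℂ → ℝ} :
    ∫ z, (chartAt ℂ b).target.indicator f z = ∫ z in (chartAt ℂ b).target, f z :=
  integral_indicator (chartAt ℂ b).open_target.measurableSet

/-- Green's identity for a cut-off function supported in one chart, which contains at most one
puncture. -/
theorem surfInt_mul_lapDens {D : Finset X} {u : X → ℝ} {α : X → ℝ} {g : X → X → ℝ}
    (hu : ∀ a y, y ∉ D → y ∈ (chartAt ℂ a).source → SmoothIn u a y)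
    (hα : ∀ x ∈ D, (fun y => u y - α x * Real.log ‖coord x y‖) =o[𝓝[≠] x]
      fun y => Real.log ‖coord x y‖)
    (hg : IsDensityOff D g) (hgI : DensityIntegrable g)
    (hle : ∀ a y, y ∉ D → y ∈ (chartAt ℂ a).source → lapDens u a y ≤ g a y)
    {b : X} {O : Set X} (hO : IsOpen O) (hOb : O ⊆ (chartAt ℂ b).source)
    (hOD : ∀ y ∈ O, y ∈ D → y = b) {ρ : X → ℝ} (hρ : ContMDiff 𝓘(ℝ, ℂ) 𝓘(ℝ) ∞ ρ)
    (hρO : tsupport ρ ⊆ O) (hρ0 : ∀ y, 0 ≤ ρ y) (hρ1 : b ∈ D → ρ =ᶠ[𝓝 b] fun _ => 1) :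
    DensityIntegrable (fun a y => ρ y * lapDens u a y) ∧
    DensityIntegrable (fun a y => u y * lapDens ρ a y) ∧
    surfInt (fun a y => ρ y * lapDens u a y) = surfInt (fun a y => u y * lapDens ρ a y) -
      Real.pi / 2 * (open Classical in if b ∈ D then α b else 0) := by
  have hs := hρO.trans hOb
  have hρ' : ∀ y, y ∉ (chartAt ℂ b).source → y ∉ tsupport ρ := fun y hy h => hy (hs h)
  have d1 : IsDensityOff D (fun a y => ρ y * lapDens u a y) := (isDensityOff_lapDens hu).mul ρ
  have d2 : IsDensityOff D (fun a y => u y * lapDens ρ a y) :=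
    (isDensityOff_lapDens fun _ _ _ ha => smoothIn_of_contMDiff hρ ha).mul u
  have d3 : IsDensityOff D (fun a y => ρ y * g a y) := hg.mul ρ
  have z1 : ∀ a y, y ∉ D → y ∈ (chartAt ℂ a).source → y ∉ (chartAt ℂ b).source →
      ρ y * lapDens u a y = 0 := fun a y _ _ hy => by
    rw [image_eq_zero_of_notMem_tsupport (hρ' y hy), zero_mul]
  have z2 : ∀ a y, y ∉ D → y ∈ (chartAt ℂ a).source → y ∉ (chartAt ℂ b).source →
      u y * lapDens ρ a y = 0 := fun a y _ ha hy => by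
    rw [lapDens_eq_zero ha (hρ' y hy), mul_zero]
  have z3 : ∀ a y, y ∉ D → y ∈ (chartAt ℂ a).source → y ∉ (chartAt ℂ b).source →
      ρ y * g a y = 0 := fun a y _ _ hy => by
    rw [image_eq_zero_of_notMem_tsupport (hρ' y hy), zero_mul]
  have hgI' := (densityIntegrable_iff d3 b z3).1 (hgI.mul_continuous hρ.continuous)
  set f := chartFun b ρ with hf
  set U : ℂ → ℝ := fun w => u ((chartAt ℂ b).symm w) with hU
  set V : Set ℂ := {z | z ∈ (chartAt ℂ b).target ∧ (chartAt ℂ b).symm z ∈ O} with hV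
  have e1 : (fun z => f z * lapl U z) = (chartAt ℂ b).target.indicator
      fun z => ρ ((chartAt ℂ b).symm z) * lapDens u b ((chartAt ℂ b).symm z) := by
    funext z
    by_cases hz : z ∈ (chartAt ℂ b).target
    · rw [Set.indicator_of_mem hz, hf, chartFun_of_mem ρ hz, lapl_eq_lapDens u hz]
    · rw [Set.indicator_of_notMem hz, hf, chartFun, Set.indicator_of_notMem hz, zero_mul]
  have e2 : (fun z => U z * lapl f z) = (chartAt ℂ b).target.indicator
      fun z => u ((chartAt ℂ b).symm z) * lapDens ρ b ((chartAt ℂ b).symm z) := by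
    funext z
    by_cases hz : z ∈ (chartAt ℂ b).target
    · rw [Set.indicator_of_mem hz, lapl_congr (chartFun_eventuallyEq ρ hz), lapl_eq_lapDens ρ hz]
    · rw [Set.indicator_of_notMem hz, lapl_eq_zero_of_notMem_tsupport, mul_zero]
      intro h
      obtain ⟨y, hy, rfl⟩ := tsupport_chartFun_subset hs h
      exact hz ((chartAt ℂ b).map_source (hs hy))
  have e3 : (fun z => f z * g b ((chartAt ℂ b).symm z)) = (chartAt ℂ b).target.indicator
      fun z => ρ ((chartAt ℂ b).symm z) * g b ((chartAt ℂ b).symm z) := by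
    funext z
    by_cases hz : z ∈ (chartAt ℂ b).target
    · rw [Set.indicator_of_mem hz, hf, chartFun_of_mem ρ hz]
    · rw [Set.indicator_of_notMem hz, hf, chartFun, Set.indicator_of_notMem hz, zero_mul]
  have hVo : IsOpen V := isOpen_target_inter b hO
  have hfV : tsupport f ⊆ V := fun z hz => by
    obtain ⟨y, hy, rfl⟩ := tsupport_chartFun_subset hs hz
    refine ⟨(chartAt ℂ b).map_source (hs hy), ?_⟩
    rw [(chartAt ℂ b).left_inv (hs hy)]
    exact hρO hy
  have hf2 := contDiff_chartFun hρ hs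
  have hfc := hasCompactSupport_chartFun hs
  have hUat : ∀ z ∈ V, (chartAt ℂ b).symm z ∉ D → ContDiffAt ℝ 2 U z := fun z hz hzD => by
    have := hu b _ hzD ((chartAt ℂ b).map_target hz.1)
    rwa [SmoothIn, (chartAt ℂ b).right_inv hz.1] at this
  have key : Integrable (fun z => f z * lapl U z) ∧ Integrable (fun z => U z * lapl f z) ∧
      ∫ z, f z * lapl U z = (∫ z, U z * lapl f z) -
        Real.pi / 2 * (open Classical in if b ∈ D then α b else 0) := by
    by_cases hb : b ∈ D
    · rw [if_pos hb]
      have hbt := mem_chart_target ℂ b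
      have hsymm : Tendsto (chartAt ℂ b).symm (𝓝 (chartAt ℂ b b)) (𝓝 b) := by
        have := (chartAt ℂ b).continuousAt_symm hbt
        rwa [ContinuousAt, (chartAt ℂ b).left_inv (mem_chart_source ℂ b)] at this
      have hne : ∀ z ∈ V \ {chartAt ℂ b b}, (chartAt ℂ b).symm z ∉ D := fun z hz hzD => by
        have h := hOD _ hz.1.2 hzD
        refine hz.2 ?_
        exact ((chartAt ℂ b).right_inv hz.1.1).symm.trans (congrArg (chartAt ℂ b) h)
      refine integral_mul_lapl_puncture hVo hf2 hfc hfV (g := fun z => g b ((chartAt ℂ b).symm z))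
        (fun z => Set.indicator_nonneg (fun z _ => hρ0 _) z) ?_
        (fun z hz => (hUat z hz.1 (hne z hz)).contDiffWithinAt) ?_ ?_ ?_
      · filter_upwards [chartFun_eventuallyEq ρ hbt, hsymm.eventually (hρ1 hb)] with z h1 h2
        rw [hf, h1, h2]
      · have ht : Tendsto (chartAt ℂ b).symm (𝓝[≠] (chartAt ℂ b b)) (𝓝[≠] b) := by
          refine tendsto_nhdsWithin_iff.2 ⟨hsymm.mono_left nhdsWithin_le_nhds, ?_⟩
          filter_upwards [nhdsWithin_le_nhds ((chartAt ℂ b).open_target.mem_nhds hbt),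
            self_mem_nhdsWithin] with z hz hzne h
          refine hzne ?_
          exact ((chartAt ℂ b).right_inv hz).symm.trans (congrArg (chartAt ℂ b) h)
        have hev : ∀ᶠ z in 𝓝[≠] (chartAt ℂ b b),
            coord b ((chartAt ℂ b).symm z) = z - chartAt ℂ b b := by
          filter_upwards [nhdsWithin_le_nhds ((chartAt ℂ b).open_target.mem_nhds hbt)] with z hz
          rw [coord, (chartAt ℂ b).right_inv hz]
        refine ((hα b hb).comp_tendsto ht).congr' ?_ ?_
        · filter_upwards [hev] with z hz
          simp only [Function.comp, hz, hU]
        · filter_upwards [hev] with z hz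
          simp only [Function.comp, hz]
      · rw [e3, integrable_indicator_target]; exact hgI'
      · intro z hz
        rw [hU, lapl_eq_lapDens u hz.1.1]
        exact hle b _ (hne z hz) ((chartAt ℂ b).map_target hz.1.1)
    · rw [if_neg hb, mul_zero, sub_zero]
      have hUV : ContDiffOn ℝ 2 U V := fun z hz => (hUat z hz fun h => hb
        (by have := hOD _ hz.2 h; rwa [← this])).contDiffWithinAt
      refine ⟨integrable_mul_of_tsupport_subset hVo hf2.continuous hfc hfV
        (continuousOn_lapl hVo hUV), ?_, integral_mul_lapl hVo hf2 hfc hfV hUV⟩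
      have hlc : Continuous (lapl f) := by
        rw [← continuousOn_univ]
        exact continuousOn_lapl isOpen_univ hf2.contDiffOn
      have := integrable_mul_of_tsupport_subset hVo hlc
        (hfc.of_isClosed_subset (isClosed_tsupport _) (tsupport_lapl_subset f))
        ((tsupport_lapl_subset f).trans hfV) hUV.continuousOn
      simpa only [mul_comm] using this
  rw [e1, e2, integrable_indicator_target, integrable_indicator_target,
    integral_indicator_target, integral_indicator_target] at key
  have i1 := (densityIntegrable_iff d1 b z1).2 key.1
  have i2 := (densityIntegrable_iff d2 b z2).2 key.2.1
  exact ⟨i1, i2, by rw [surfInt_eq d1 b z1 i1, surfInt_eq d2 b z2 i2, key.2.2]⟩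

/-- A finite smooth partition of unity adapted to the punctures. -/
theorem exists_partition (D : Finset X) : ∃ (t : Finset X) (ρ : X → X → ℝ),
    (∀ b, ContMDiff 𝓘(ℝ, ℂ) 𝓘(ℝ) ∞ (ρ b)) ∧ (∀ b ∈ t, ∀ y, 0 ≤ ρ b y) ∧
    (∀ b ∈ t, ∃ O : Set X, IsOpen O ∧ O ⊆ (chartAt ℂ b).source ∧ (∀ y ∈ O, y ∈ D → y = b) ∧
      tsupport (ρ b) ⊆ O) ∧
    (∀ y, ∑ b ∈ t, ρ b y = 1) ∧ (∀ b ∈ t, b ∈ D → ρ b =ᶠ[𝓝 b] fun _ => 1) ∧ D ⊆ t := by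
  classical
  -- Removing from each chart domain all punctures except its centre leaves at most one puncture in
  -- each member. Every puncture then must itself be the centre of a member.
  set O : X → Set X := fun b => (chartAt ℂ b).source \ ((D.erase b : Finset X) : Set X) with hO
  have hOo : ∀ b, IsOpen (O b) := fun b =>
    (chartAt ℂ b).open_source.sdiff (Finset.finite_toSet _).isClosed
  have hOD : ∀ b, ∀ y ∈ O b, y ∈ D → y = b := fun b y hy hyD => by
    by_contra h
    exact hy.2 (Finset.mem_coe.2 (Finset.mem_erase.2 ⟨h, hyD⟩))
  obtain ⟨t, ht⟩ := isCompact_univ.elim_finite_subcover O hOo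
    (fun x _ => Set.mem_iUnion.2 ⟨x, mem_chart_source ℂ x, by simp⟩)
  have := isManifold_real (X := X)
  obtain ⟨ρ, hρ⟩ := SmoothPartitionOfUnity.exists_isSubordinate 𝓘(ℝ, ℂ) (s := Set.univ)
    isClosed_univ (fun b : t => O b) (fun b => hOo b) (by
      intro y hy
      obtain ⟨b, hb, hy'⟩ := Set.mem_iUnion₂.1 (ht hy)
      exact Set.mem_iUnion.2 ⟨⟨b, hb⟩, hy'⟩)
  have hsum : ∀ y, ∑ b : t, ρ b y = 1 := fun y =>
    ρ.sum_finsupport' y (Set.mem_univ y) (Finset.subset_univ _)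
  refine ⟨t, fun b => if h : b ∈ t then ρ ⟨b, h⟩ else 0, fun b => ?_, fun b hb y => ?_,
    fun b hb => ⟨O b, hOo b, Set.sdiff_subset, hOD b, ?_⟩, fun y => ?_, fun b hb hbD => ?_,
    fun x hx => ?_⟩
  · by_cases hb : b ∈ t
    · simp only [dif_pos hb]
      exact (ρ ⟨b, hb⟩).contMDiff
    · simp only [dif_neg hb]
      exact contMDiff_const
  · simp only [dif_pos hb]
    exact ρ.nonneg _ _
  · simp only [dif_pos hb]
    exact hρ ⟨b, hb⟩
  · rw [← hsum y, ← Finset.sum_coe_sort t]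
    refine Finset.sum_congr rfl fun b _ => ?_
    simp
  -- Near a puncture $b$ all other functions of the partition vanish, because their supports avoid
  -- $b$; hence the one belonging to $b$ equals $1$ there.
  · simp only [dif_pos hb]
    have h0 : ∀ c : t, c ≠ ⟨b, hb⟩ → ∀ᶠ y in 𝓝 b, ρ c y = 0 := fun c hc => by
      refine notMem_tsupport_iff_eventuallyEq.1 fun h => hc ?_
      exact Subtype.ext (hOD c b (hρ c h) hbD).symm
    have h1 : ∀ᶠ y in 𝓝 b, ∀ c : t, c ≠ ⟨b, hb⟩ → ρ c y = 0 := by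
      rw [eventually_all]
      intro c
      by_cases hc : c = ⟨b, hb⟩
      · exact Eventually.of_forall fun y h => absurd hc h
      · exact (h0 c hc).mono fun y hy _ => hy
    filter_upwards [h1] with y hy
    rw [← hsum y, Finset.sum_eq_single ⟨b, hb⟩ (fun c _ hc => hy c hc) (by simp)]
  · obtain ⟨b, hb, hy⟩ := Set.mem_iUnion₂.1 (ht (Set.mem_univ x))
    rwa [hOD b x hy hx]

/-- The total Laplacian of a function with logarithmic singularities at the punctures. -/
theorem surfInt_lapDens {D : Finset X} {u : X → ℝ} {α : X → ℝ} {g : X → X → ℝ}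
    (hu : ∀ a y, y ∉ D → y ∈ (chartAt ℂ a).source → SmoothIn u a y)
    (hα : ∀ x ∈ D, (fun y => u y - α x * Real.log ‖coord x y‖) =o[𝓝[≠] x]
      fun y => Real.log ‖coord x y‖)
    (hg : IsDensityOff D g) (hgI : DensityIntegrable g)
    (hle : ∀ a y, y ∉ D → y ∈ (chartAt ℂ a).source → lapDens u a y ≤ g a y) :
    DensityIntegrable (lapDens u) ∧ surfInt (lapDens u) = -(Real.pi / 2) * ∑ x ∈ D, α x := by
  classical
  obtain ⟨t, ρ, hρ, hρ0, hρO, hsum, hρ1, hDt⟩ := exists_partition D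
  have key := fun b (hb : b ∈ t) => (hρO b hb).elim fun O hO => surfInt_mul_lapDens hu hα hg hgI hle
    hO.1 hO.2.1 hO.2.2.1 (hρ b) hO.2.2.2 (hρ0 b hb) (hρ1 b hb)
  have e1 : ∀ a y, ∑ b ∈ t, ρ b y * lapDens u a y = lapDens u a y := fun a y => by
    rw [← Finset.sum_mul, hsum, one_mul]
  have i1 := DensityIntegrable.sum t fun b hb => (key b hb).1
  have s1 := surfInt_sum t fun b hb => (key b hb).1
  have s2 := surfInt_sum t fun b hb => (key b hb).2.1
  simp only [e1] at i1 s1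
  refine ⟨i1, ?_⟩
  -- The Laplacians of the partition functions add up to the Laplacian of $1$, so after summation
  -- only the puncture terms remain.
  have e2 : surfInt (fun a y => ∑ b ∈ t, u y * lapDens (ρ b) a y) = 0 := by
    rw [surfInt_congr (D := D) (G := fun _ _ => 0)]
    · simp [surfInt]
    · intro a y _ ha
      rw [← Finset.mul_sum]
      have h1 : ∑ b ∈ t, lapDens (ρ b) a y =
          lapl (fun w => ∑ b ∈ t, 1 * ρ b ((chartAt ℂ a).symm w)) (chartAt ℂ a y) := by
        rw [lapl_sum_mul (c := fun _ => 1) (f := fun b w => ρ b ((chartAt ℂ a).symm w)) fun b => smoothIn_of_contMDiff (hρ b) ha]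
        simp only [one_mul]
        rfl
      rw [h1]
      simp only [one_mul, hsum, lapl_const, mul_zero]
  change surfInt (lapDens u) = _ at s1
  rw [s1, Finset.sum_congr rfl fun b hb => (key b hb).2.2, Finset.sum_sub_distrib, ← s2, e2,
    ← Finset.mul_sum, Finset.sum_ite_mem, Finset.inter_eq_right.2 hDt]
  ring

end SurfaceGreen

/-! ### Degrees of line bundles with smooth and with singular metrics. -/

section ChernDegree

set_option linter.unusedSectionVars false

open MeasureTheory Filter

variable {X : Type u} [TopologicalSpace X] [ChartedSpace ℂ X] [IsManifold 𝓘(ℂ) ω X]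

theorem lapl_sub {u v : ℂ → ℝ} {z : ℂ} (hu : ContDiffAt ℝ 2 u z) (hv : ContDiffAt ℝ 2 v z) :
    lapl (fun w => u w - v w) z = lapl u z - lapl v z := by
  have h := lapl_add hu (contDiffAt_const.mul hv : ContDiffAt ℝ 2 (fun w => (-1 : ℝ) * v w) z)
  rw [lapl_const_mul _ hv] at h
  have e : (fun w => u w - v w) = fun w => u w + -1 * v w := by funext w; ring
  rw [e, h]; ring

theorem tendsto_symm_chart {a y : X} (ha : y ∈ (chartAt ℂ a).source) :
    Tendsto (chartAt ℂ a).symm (𝓝 (chartAt ℂ a y)) (𝓝 y) := by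
  have h := (chartAt ℂ a).continuousAt_symm ((chartAt ℂ a).map_source ha)
  rwa [ContinuousAt, (chartAt ℂ a).left_inv ha] at h

theorem eventually_differentiableAt_comp_symm {f : X → ℂ} {O : Set X} (hO : IsOpen O)
    (hf : MDifferentiableOn 𝓘(ℂ) 𝓘(ℂ) f O) {a y : X} (hy : y ∈ O)
    (ha : y ∈ (chartAt ℂ a).source) : ∀ᶠ w in 𝓝 (chartAt ℂ a y),
      DifferentiableAt ℂ (fun w => f ((chartAt ℂ a).symm w)) w := by
  filter_upwards [(tendsto_symm_chart ha).eventually (hO.eventually_mem hy),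
    (chartAt ℂ a).open_target.eventually_mem ((chartAt ℂ a).map_source ha)] with w h1 h2
  have := differentiableAt_comp_symm ((hf _ h1).mdifferentiableAt (hO.mem_nhds h1))
    ((chartAt ℂ a).map_target h2)
  rwa [(chartAt ℂ a).right_inv h2] at this

theorem lapDens_congr {u v : X → ℝ} {a y : X} (ha : y ∈ (chartAt ℂ a).source) (h : u =ᶠ[𝓝 y] v) :
    lapDens u a y = lapDens v a y :=
  lapl_congr ((tendsto_symm_chart ha).eventually h)

theorem SmoothIn.congr {u v : X → ℝ} {a y : X} (ha : y ∈ (chartAt ℂ a).source)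
    (hu : SmoothIn u a y) (h : v =ᶠ[𝓝 y] u) : SmoothIn v a y :=
  ContDiffAt.congr_of_eventuallyEq hu ((tendsto_symm_chart ha).eventually h)

/-- `m i` are the squared norms of frames over `U i` of a holomorphic line bundle off `D`. -/
structure IsMetricOff {ι : Type u} (D : Finset X) (U : ι → Opens X) (m : ι → X → ℝ) : Prop where
  smooth : ∀ i a y, y ∈ U i → y ∉ D → y ∈ (chartAt ℂ a).source →
    SmoothIn (fun v => Real.log (m i v)) a y
  pos : ∀ i y, y ∈ U i → y ∉ D → 0 < m i y
  trans : ∀ i j a y, y ∈ U i → y ∈ U j → y ∉ D → y ∈ (chartAt ℂ a).source → ∃ g : X → ℂ,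
    (∀ᶠ w in 𝓝 (chartAt ℂ a y), DifferentiableAt ℂ (fun w => g ((chartAt ℂ a).symm w)) w) ∧
      g y ≠ 0 ∧ ∀ᶠ v in 𝓝 y, m j v = ‖g v‖ ^ 2 * m i v

/-- The curvature density of a hermitian line bundle. -/
def chernDens {ι : Type u} (U : ι → Opens X) (m : ι → X → ℝ) (a y : X) : ℝ :=
  open Classical in
  if h : ∃ i, y ∈ U i then lapDens (fun v => Real.log (m h.choose v)) a y else 0

variable {ι : Type u} {D : Finset X} {U : ι → Opens X} {m : ι → X → ℝ}

theorem eventually_mem_off {O : Opens X} {y : X} [T2Space X] (hy : y ∈ O) (hyD : y ∉ D) :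
    ∀ᶠ v in 𝓝 y, v ∈ O ∧ v ∉ D :=
  (O.isOpen.eventually_mem hy).and
    (D.finite_toSet.isClosed.isOpen_compl.eventually_mem (by simpa using hyD))

variable [T2Space X]

/-- Two frames differ by a nowhere vanishing holomorphic function $g$ and $\log|g|^2$ is harmonic,
so the curvature is independent of the frame and the choice made in `chernDens` is immaterial. -/
theorem IsMetricOff.lapDens_eq (h : IsMetricOff D U m) {i j : ι} {a y : X} (hi : y ∈ U i)
    (hj : y ∈ U j) (hy : y ∉ D) (ha : y ∈ (chartAt ℂ a).source) :
    lapDens (fun v => Real.log (m j v)) a y = lapDens (fun v => Real.log (m i v)) a y := by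
  obtain ⟨g, hhol, hg0, hm⟩ := h.trans i j a y hi hj hy ha
  have hgc : ∀ᶠ v in 𝓝 y, g v ≠ 0 := by
    have h1 := ((chartAt ℂ a).continuousAt ha).eventually
      (hhol.self_of_nhds.continuousAt.eventually_ne (by rwa [(chartAt ℂ a).left_inv ha]))
    filter_upwards [h1, (chartAt ℂ a).open_source.mem_nhds ha] with v h1 h2
    rwa [(chartAt ℂ a).left_inv h2] at h1
  have e : (fun v => Real.log (m j v)) =ᶠ[𝓝 y]
      fun v => Real.log (‖g v‖ ^ 2) + Real.log (m i v) := by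
    filter_upwards [hm, eventually_mem_off hi hy, hgc] with v h1 h2 h3
    rw [h1, Real.log_mul (by have := norm_ne_zero_iff.2 h3; positivity) (h.pos i v h2.1 h2.2).ne']
  have hne : g ((chartAt ℂ a).symm (chartAt ℂ a y)) ≠ 0 := by rwa [(chartAt ℂ a).left_inv ha]
  have hc : ContDiffAt ℝ 2 (fun w => g ((chartAt ℂ a).symm w)) (chartAt ℂ a y) :=
    ((Complex.analyticAt_iff_eventually_differentiableAt.2 hhol).contDiffAt).restrict_scalars ℝ
  rw [lapDens_congr ha e]
  refine (lapl_add ?_ (h.smooth i a y hi hy ha)).trans ?_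
  · exact (hc.norm_sq ℝ).log (by have := norm_ne_zero_iff.2 hne; positivity)
  · rw [lapl_log_norm hhol hne, zero_add]; rfl

theorem IsMetricOff.chernDens_eq (h : IsMetricOff D U m) {i : ι} {a y : X} (hi : y ∈ U i)
    (hy : y ∉ D) (ha : y ∈ (chartAt ℂ a).source) :
    chernDens U m a y = lapDens (fun v => Real.log (m i v)) a y := by
  have hex : ∃ i, y ∈ U i := ⟨i, hi⟩
  rw [chernDens, dif_pos hex]
  exact h.lapDens_eq hi hex.choose_spec hy ha

theorem IsMetricOff.chernCoeff_eq (h : IsMetricOff D U m) {a y : X}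
    (hy : y ∉ D) (ha : y ∈ (chartAt ℂ a).source) : chernCoeff U m a y = chernDens U m a y := by
  rw [chernCoeff, chernDens]
  split_ifs with hex
  · rw [dZbar_eq_dzbar, dZ_eq_dz]
    exact dzbar_dz_ofReal (h.smooth _ a y hex.choose_spec hy ha)
  · simp

theorem IsMetricOff.isDensityOff (h : IsMetricOff D U m) : IsDensityOff D (chernDens U m) := by
  intro a b y hy ha hb
  by_cases hex : ∃ i, y ∈ U i
  · obtain ⟨i, hi⟩ := hex
    rw [h.chernDens_eq hi hy ha, h.chernDens_eq hi hy hb,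
      lapDens_trans ha hb (h.smooth i b y hi hy hb)]
  · simp only [chernDens, dif_neg hex, mul_zero]

variable [CompactSpace X] [Nonempty X]

/-- The form $d\bar z\wedge dz=2i\,dx\wedge dy$ and the prefactor $i/2\pi$ together give $-1/\pi$.
-/
theorem IsMetricOff.chernDegree_eq (h : IsMetricOff D U m) :
    chernDegree U m = -(1 / Real.pi) * surfInt (chernDens U m) := by
  have h1 : integral11 (chernCoeff U m) = 2 * Complex.I * (surfInt (chernDens U m) : ℂ) := by
    simp only [integral11, surfInt, Complex.ofReal_sum, Finset.mul_sum]
    refine Finset.sum_congr rfl fun k _ => ?_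
    rw [← integral_complex_ofReal, ← integral_const_mul]
    refine setIntegral_congr_ae (measurableSet_piece k) ?_
    filter_upwards [ae_symm_notMem (atlasPt X k) D] with z hz hzP
    rw [h.chernCoeff_eq (hz hzP.1) ((chartAt ℂ _).map_target hzP.1)]
  rw [chernDegree, h1]
  have h2 : Complex.I / (2 * Real.pi) * (2 * Complex.I * (surfInt (chernDens U m) : ℂ)) =
      ((-(1 / Real.pi) * surfInt (chernDens U m) : ℝ) : ℂ) := by
    push_cast
    field_simp
    rw [Complex.I_sq]
    ring
  rw [h2, Complex.ofReal_re]

/-- A density with continuous coefficients is integrable. -/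
theorem densityIntegrable_of_continuousOn {F : X → X → ℝ} (hF : IsDensityOff D F)
    (hc : ∀ b, ContinuousOn (fun z => F b ((chartAt ℂ b).symm z)) (chartAt ℂ b).target) :
    DensityIntegrable F := by
  obtain ⟨t, ρ, hρ, -, hρO, hsum, -, -⟩ := exists_partition D
  have h1 : DensityIntegrable fun a y => ∑ b ∈ t, ρ b y * F a y := by
    refine DensityIntegrable.sum t fun b hb => ?_
    obtain ⟨O, -, hOb, -, hO⟩ := hρO b hb
    have hs := hO.trans hOb
    refine (densityIntegrable_iff (hF.mul (ρ b)) b fun a y _ _ hy => ?_).2 ?_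
    · rw [image_eq_zero_of_notMem_tsupport fun h => hy (hs h), zero_mul]
    · have h2 := integrable_mul_of_tsupport_subset (chartAt ℂ b).open_target
        (contDiff_chartFun (hρ b) hs).continuous (hasCompactSupport_chartFun hs)
        ((tsupport_chartFun_subset hs).trans (by
          rintro _ ⟨y, hy, rfl⟩
          exact (chartAt ℂ b).map_source (hs hy))) (hc b)
      refine h2.integrableOn.congr_fun (fun z hz => ?_) (chartAt ℂ b).open_target.measurableSet
      simp only [chartFun_of_mem (ρ b) hz]
  refine h1.congr (D := ∅) fun a y _ _ => ?_
  rw [← Finset.sum_mul, hsum, one_mul]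

theorem IsMetricOff.densityIntegrable (h : IsMetricOff ∅ U m) (hcov : ∀ y, ∃ i, y ∈ U i) :
    DensityIntegrable (chernDens U m) := by
  refine densityIntegrable_of_continuousOn h.isDensityOff fun b z hz => ?_
  obtain ⟨i, hi⟩ := hcov ((chartAt ℂ b).symm z)
  have hzb := (chartAt ℂ b).map_target hz
  have hc : ContinuousOn (lapl fun w => Real.log (m i ((chartAt ℂ b).symm w)))
      {w | w ∈ (chartAt ℂ b).target ∧ (chartAt ℂ b).symm w ∈ (U i : Set X)} := by
    refine continuousOn_lapl (isOpen_target_inter b (U i).isOpen) fun w hw => ?_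
    have := h.smooth i b _ hw.2 (by simp) ((chartAt ℂ b).map_target hw.1)
    rw [SmoothIn, (chartAt ℂ b).right_inv hw.1] at this
    exact this.contDiffWithinAt
  have hO := (isOpen_target_inter b (U i).isOpen).mem_nhds (⟨hz, hi⟩ :
    z ∈ {w | w ∈ (chartAt ℂ b).target ∧ (chartAt ℂ b).symm w ∈ (U i : Set X)})
  refine ((hc.continuousAt hO).congr ?_).continuousWithinAt
  filter_upwards [hO] with w hw
  rw [h.chernDens_eq hw.2 (by simp) ((chartAt ℂ b).map_target hw.1),
    lapl_eq_lapDens (fun v => Real.log (m i v)) hw.1]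

/-- Comparison of the degrees of a singular and a smooth hermitian metric on a line bundle. -/
theorem chernDegree_eq_add {ι' : Type u} {U' : ι' → Opens X} {m' : ι' → X → ℝ}
    (h : IsMetricOff D U m) (h' : IsMetricOff ∅ U' m') (hcov : ∀ y, ∃ i, y ∈ U' i) (r : ι' → ι)
    (hr : ∀ i y, y ∈ U' i → y ∉ D → y ∈ U (r i)) {u : X → ℝ} {α : X → ℝ}
    (hu : ∀ i y, y ∈ U' i → y ∉ D → u y = Real.log (m (r i) y) - Real.log (m' i y))
    (hα : ∀ x ∈ D, (fun y => u y - α x * Real.log ‖coord x y‖) =o[𝓝[≠] x]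
      fun y => Real.log ‖coord x y‖)
    {G : X → X → ℝ} (hG : IsDensityOff D G) (hGI : DensityIntegrable G)
    (hle : ∀ i a y, y ∈ U i → y ∉ D → y ∈ (chartAt ℂ a).source →
      lapDens (fun v => Real.log (m i v)) a y ≤ G a y) :
    chernDegree U m = chernDegree U' m' + (1 / 2) * ∑ x ∈ D, α x := by
  have hue : ∀ i y, y ∈ U' i → y ∉ D →
      u =ᶠ[𝓝 y] fun v => Real.log (m (r i) v) - Real.log (m' i v) := fun i y hi hy => by
    filter_upwards [eventually_mem_off hi hy] with v hv using hu i v hv.1 hv.2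
  have hlap : ∀ a y, y ∉ D → y ∈ (chartAt ℂ a).source →
      SmoothIn u a y ∧ lapDens u a y = chernDens U m a y - chernDens U' m' a y := by
    intro a y hy ha
    obtain ⟨i, hi⟩ := hcov y
    have s1 := h.smooth (r i) a y (hr i y hi hy) hy ha
    have s2 := h'.smooth i a y hi (by simp) ha
    have s3 : SmoothIn (fun v => Real.log (m (r i) v) - Real.log (m' i v)) a y := ContDiffAt.sub s1 s2
    refine ⟨s3.congr ha (hue i y hi hy), ?_⟩
    rw [lapDens_congr ha (hue i y hi hy), h.chernDens_eq (hr i y hi hy) hy ha,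
      h'.chernDens_eq hi (by simp) ha]
    exact lapl_sub s1 s2
  have hF' := h'.isDensityOff.mono (Finset.empty_subset D)
  have hFI' := h'.densityIntegrable hcov
  -- The Laplacian of $u$ is the difference of the two curvatures. The singular one is bounded above
  -- by $G$; the smooth one is integrable, so its absolute value may be added to the bound.
  have hgd : IsDensityOff D fun a y => G a y + |chernDens U' m' a y| := fun a b y hy ha hb => by
    simp only [hG a b y hy ha hb, hF' a b y hy ha hb, abs_mul, abs_pow, abs_norm]; ring
  obtain ⟨i1, s1⟩ := surfInt_lapDens (fun a y hy ha => (hlap a y hy ha).1) hα hgd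
    (hGI.add hFI'.abs) (fun a y hy ha => by
      obtain ⟨i, hi⟩ := hcov y
      have h1 := hle (r i) a y (hr i y hi hy) hy ha
      rw [← h.chernDens_eq (hr i y hi hy) hy ha] at h1
      rw [(hlap a y hy ha).2]
      have := neg_abs_le (chernDens U' m' a y)
      linarith)
  have e : surfInt (chernDens U m) = surfInt (lapDens u) + surfInt (chernDens U' m') := by
    rw [← surfInt_add i1 hFI']
    refine surfInt_congr (D := D) fun a y hy ha => ?_
    rw [(hlap a y hy ha).2]; ring
  rw [h.chernDegree_eq, h'.chernDegree_eq, e, s1]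
  field_simp
  ring

end ChernDegree

/-! ### Existence of smooth hermitian metrics on line bundles. -/

section SmoothMetric

set_option linter.unusedSectionVars false

variable {X : Type u} [TopologicalSpace X] [ChartedSpace ℂ X] [IsManifold 𝓘(ℂ) ω X]

theorem contMDiffAt_of_mdifferentiableOn {f : X → ℂ} {O : Set X} (hO : IsOpen O)
    (hf : MDifferentiableOn 𝓘(ℂ) 𝓘(ℂ) f O) {y : X} (hy : y ∈ O) :
    ContMDiffAt 𝓘(ℝ, ℂ) 𝓘(ℝ, ℂ) ∞ f y := by
  have := isManifold_real (X := X)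
  have ha := mem_chart_source ℂ y
  have hhol := eventually_differentiableAt_comp_symm hO hf hy ha
  have hc : ContDiffAt ℝ ∞ (fun w => f ((chartAt ℂ y).symm w)) (chartAt ℂ y y) :=
    ((Complex.analyticAt_iff_eventually_differentiableAt.2 hhol).contDiffAt).restrict_scalars ℝ
  have h2 : ContMDiffAt 𝓘(ℝ, ℂ) 𝓘(ℝ, ℂ) ∞ (chartAt ℂ y) y :=
    (contMDiffOn_chart (I := 𝓘(ℝ, ℂ)) (n := ∞) (x := y)).contMDiffAt
      ((chartAt ℂ y).open_source.mem_nhds ha)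
  refine (hc.contMDiffAt.comp y h2).congr_of_eventuallyEq ?_
  filter_upwards [(chartAt ℂ y).open_source.mem_nhds ha] with v hv
  simp only [Function.comp]
  rw [(chartAt ℂ y).left_inv hv]

theorem LineBundle.IsSmoothMetric.isMetricOff [T2Space X] {L : LineBundle X} {m : L.ι → X → ℝ}
    (h : L.IsSmoothMetric m) : IsMetricOff ∅ L.U m where
  smooth i a y hi _ ha := by
    have h1 := contDiffAt_comp_symm (k := ⊤) ((h.1 i).contMDiffAt ((L.U i).isOpen.mem_nhds hi)) ha
    refine (h1.of_le (WithTop.coe_le_coe.2 (le_top : (2 : ℕ∞) ≤ ⊤))).log ?_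
    rw [(chartAt ℂ a).left_inv ha]
    exact (h.2.1 i y hi).ne'
  pos i y hi _ := h.2.1 i y hi
  trans i j a y hi hj _ ha := by
    have hO : IsOpen (L.U i ∩ L.U j : Set X) := (L.U i).isOpen.inter (L.U j).isOpen
    refine ⟨L.g i j, ?_, L.ne_zero i j y hi hj, ?_⟩
    · exact eventually_differentiableAt_comp_symm hO (L.hol i j) ⟨hi, hj⟩ ha
    · filter_upwards [hO.mem_nhds ⟨hi, hj⟩] with v hv using h.2.2 i j v hv.1 hv.2

/-- The metrics in which the frame $e_k$ has norm one are $|g_{ki}|^2$ in the frame $e_i$; a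
partition of unity averages them, and the cocycle condition gives the transformation law. -/
theorem LineBundle.exists_isSmoothMetric [T2Space X] [CompactSpace X] (L : LineBundle X) :
    ∃ m, L.IsSmoothMetric m := by
  have := isManifold_real (X := X)
  obtain ⟨t, ht⟩ := isCompact_univ.elim_finite_subcover (fun i => (L.U i : Set X))
    (fun i => (L.U i).isOpen) (fun y _ => Set.mem_iUnion.2 (L.cover y))
  obtain ⟨ρ, hρ⟩ := SmoothPartitionOfUnity.exists_isSubordinate 𝓘(ℝ, ℂ) (s := Set.univ)
    isClosed_univ (fun i : t => (L.U i : Set X)) (fun i => (L.U i).isOpen) (by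
      intro y hy
      obtain ⟨b, hb, hy'⟩ := Set.mem_iUnion₂.1 (ht hy)
      exact Set.mem_iUnion.2 ⟨⟨b, hb⟩, hy'⟩)
  have hout : ∀ (k : t) y, y ∉ L.U k → ρ k y = 0 := fun k y hy =>
    image_eq_zero_of_notMem_tsupport fun h => hy (hρ k h)
  refine ⟨fun i y => ∑ k : t, ρ k y * ‖L.g k i y‖ ^ 2, fun i y hy => ?_, fun i y hy => ?_,
    fun i j y hi hj => ?_⟩
  · refine ContMDiffAt.contMDiffWithinAt ?_
    refine ContMDiffAt.sum fun k _ => ?_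
    by_cases hk : y ∈ tsupport (ρ k)
    · have hO : IsOpen (L.U k ∩ L.U i : Set X) := (L.U k).isOpen.inter (L.U i).isOpen
      have h1 := contMDiffAt_of_mdifferentiableOn hO (L.hol k i) ⟨hρ k hk, hy⟩
      have h2 : ContMDiffAt 𝓘(ℝ, ℂ) 𝓘(ℝ) ∞ (fun y => ‖L.g k i y‖ ^ 2) y :=
        ((contDiff_norm_sq ℝ).contDiffAt.contMDiffAt).comp y h1
      exact (ρ k).contMDiff.contMDiffAt.mul h2
    · refine (contMDiffAt_const (c := (0 : ℝ))).congr_of_eventuallyEq ?_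
      filter_upwards [notMem_tsupport_iff_eventuallyEq.1 hk] with v hv
      rw [hv]; simp
  · obtain ⟨k, hk⟩ := ρ.exists_pos_of_mem (Set.mem_univ y)
    refine Finset.sum_pos' (fun k _ => mul_nonneg (ρ.nonneg k y) (by positivity))
      ⟨k, Finset.mem_univ _, mul_pos hk ?_⟩
    have hky : y ∈ L.U k := by
      by_contra h
      exact hk.ne' (hout k y h)
    have := norm_ne_zero_iff.2 (L.ne_zero k i y hky hy)
    positivity
  · rw [Finset.mul_sum]
    refine Finset.sum_congr rfl fun k _ => ?_
    by_cases hk : y ∈ L.U k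
    · rw [← L.cocycle k i j y hk hi hj, norm_mul]; ring
    · rw [hout k y hk]; ring

end SmoothMetric

/-! ### The norm of the curvature under changes of frame and coordinate. -/

section CurvatureChart

variable {n : ℕ}

/-- A matrix as a continuous linear function of its entries. -/
def ofCLM (𝕜 : Type*) [NontriviallyNormedField 𝕜] [CompleteSpace 𝕜] [NormedAlgebra 𝕜 ℂ] :
    (Fin n → Fin n → ℂ) →L[𝕜] Mat n where
  toFun := Matrix.of
  map_add' _ _ := rfl
  map_smul' _ _ := rfl
  cont := continuous_id

theorem differentiableAt_matrix {f : ℂ → Mat n} {z : ℂ}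
    (h : ∀ i j, DifferentiableAt ℂ (fun w => f w i j) z) : DifferentiableAt ℂ f z :=
  (ofCLM ℂ).differentiableAt.comp z
    (differentiableAt_pi.2 fun i => differentiableAt_pi.2 fun j => h i j)

theorem contDiffAt_matrix {f : ℂ → Mat n} {z : ℂ} {k : WithTop ℕ∞}
    (h : ∀ i j, ContDiffAt ℝ k (fun w => f w i j) z) : ContDiffAt ℝ k f z :=
  (ofCLM ℝ).contDiff.contDiffAt.comp z
    (contDiffAt_pi.2 fun i => contDiffAt_pi.2 fun j => h i j)

theorem curvature_congr {H H' : ℂ → Mat n} {z : ℂ} (h : H =ᶠ[𝓝 z] H') :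
    curvature H z = curvature H' z := by
  ext i j
  simp only [curvature, Matrix.of_apply, dZbar_eq_dzbar]
  refine dzbar_congr ?_
  filter_upwards [h.eventuallyEq_nhds] with w hw
  have e : ∀ k l, dZ (fun v => H v k l) w = dZ (fun v => H' v k l) w := fun k l => by
    rw [dZ_eq_dz]
    exact dz_congr (hw.mono fun v hv => congrFun (congrFun hv k) l)
  simp only [e, hw.self_of_nhds]

theorem curvature_comp {H : ℂ → Mat n} {φ : ℂ → ℂ} {z : ℂ} (hH : ContDiffAt ℝ 2 H (φ z))
    (hu : IsUnit (H (φ z))) (hφ : ∀ᶠ w in 𝓝 z, DifferentiableAt ℂ φ w) :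
    curvature (fun w => H (φ w)) z = ((‖deriv φ z‖ ^ 2 : ℝ) : ℂ) • curvature H (φ z) := by
  have hφa : AnalyticAt ℂ φ z := Complex.analyticAt_iff_eventually_differentiableAt.2 hφ
  have hφc : ContDiffAt ℝ 2 φ z := hφa.contDiffAt.restrict_scalars ℝ
  have hφd := hφ.self_of_nhds
  have hHd : DifferentiableAt ℝ H (φ z) := hH.differentiableAt (by norm_num)
  have hdz : ContDiffAt ℝ 1 (dz H) (φ z) := contDiffAt_dz hH (by norm_num)
  have hdzd : DifferentiableAt ℝ (dz H) (φ z) := hdz.differentiableAt (by norm_num)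
  have hev : (dz fun w => H (φ w)) =ᶠ[𝓝 z]
      fun w => algebraMap ℂ (Mat n) (deriv φ w) * dz H (φ w) := by
    filter_upwards [hφ, hφd.continuousAt.eventually (hH.eventually (by simp))] with w h1 h2
    rw [dz_comp (h2.differentiableAt (by norm_num)) h1, Algebra.smul_def]
  have hal : DifferentiableAt ℂ (fun w => algebraMap ℂ (Mat n) (deriv φ w)) z := by
    have h1 : DifferentiableAt ℂ (fun w => deriv φ w • (1 : Mat n)) z :=
      hφa.deriv.differentiableAt.smul_const _
    simpa only [Algebra.algebraMap_eq_smul_one] using h1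
  have h2 : dzbar (dz fun w => H (φ w)) z =
      (deriv φ z * (starRingEnd ℂ) (deriv φ z)) • dzbar (dz H) (φ z) := by
    have hcomp : DifferentiableAt ℝ (fun w => dz H (φ w)) z :=
      hdzd.comp z (hφd.restrictScalars ℝ)
    rw [dzbar_congr hev, dzbar_mul (hal.restrictScalars ℝ) hcomp, dzbar_of_differentiableAt hal,
      dzbar_comp hdzd hφd, zero_mul, zero_add, Algebra.algebraMap_eq_smul_one, smul_mul_smul_comm,
      one_mul]
  have hHc : ContDiffAt ℝ 2 (fun w => H (φ w)) z := hH.comp z hφc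
  rw [curvature_eq hHc hu, curvature_eq hH hu, h2, dz_comp hHd hφd, dzbar_comp hHd hφd]
  have e : ((‖deriv φ z‖ ^ 2 : ℝ) : ℂ) = deriv φ z * (starRingEnd ℂ) (deriv φ z) := by
    rw [Complex.mul_conj, Complex.normSq_eq_norm_sq]
  rw [e]
  simp only [Matrix.mul_smul, Matrix.smul_mul, smul_sub, smul_smul]

theorem hermNorm_smul (H F : Mat n) {c : ℝ} (hc : 0 ≤ c) :
    hermNorm H ((c : ℂ) • F) = c * hermNorm H F := by
  rw [hermNorm, hermNorm, Matrix.conjTranspose_smul]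
  have e : (((c : ℂ) • F) * (H⁻¹ * (star (c : ℂ) • Fᴴ) * H)).trace.re =
      c ^ 2 * (F * (H⁻¹ * Fᴴ * H)).trace.re := by
    have h1 : star (c : ℂ) = c := Complex.conj_ofReal c
    rw [h1]
    simp only [Matrix.mul_smul, Matrix.smul_mul, smul_smul, Matrix.trace_smul, smul_eq_mul]
    rw [← Complex.ofReal_mul, Complex.re_ofReal_mul, sq]
  rw [e, Real.sqrt_mul (by positivity), Real.sqrt_sq hc]

theorem hermNorm_conj (k g : GL (Fin n) ℂ) (F : Mat n) :
    hermNorm ((g : Mat n)ᴴ * ((k : Mat n)ᴴ * (k : Mat n)) * (g : Mat n))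
      ((g : Mat n)⁻¹ * F * (g : Mat n)) = hermNorm ((k : Mat n)ᴴ * (k : Mat n)) F := by
  have e : (g : Mat n)ᴴ * ((k : Mat n)ᴴ * (k : Mat n)) * (g : Mat n) =
      ((k * g : GL (Fin n) ℂ) : Mat n)ᴴ * ((k * g : GL (Fin n) ℂ) : Mat n) := by
    simp [mul_assoc]
  have hg : (g : Mat n) * (g : Mat n)⁻¹ = 1 := by
    rw [← Matrix.coe_units_inv]; simp
  rw [e, hermNorm_eq, hermNorm_eq, mul_inv_rev, Units.val_mul, Units.val_mul, Matrix.coe_units_inv g]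
  congr 2
  calc _ = (k : Mat n) * ((g : Mat n) * (g : Mat n)⁻¹) * F * ((g : Mat n) * (g : Mat n)⁻¹) *
        ((k⁻¹ : GL (Fin n) ℂ) : Mat n) := by simp only [mul_assoc]
    _ = _ := by rw [hg, mul_one, mul_one]

/-- The norm of the curvature of `H` at `z`. -/
def curvNormAt (H : ℂ → Mat n) (z : ℂ) : ℝ := hermNorm (H z) (curvature H z)

theorem curvNormAt_congr {H H' : ℂ → Mat n} {z : ℂ} (h : H =ᶠ[𝓝 z] H') :
    curvNormAt H z = curvNormAt H' z := by
  rw [curvNormAt, curvNormAt, curvature_congr h, h.self_of_nhds]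

theorem curvNormAt_conj {H g : ℂ → Mat n} {z : ℂ} (hH : ContDiffAt ℝ 2 H z) {k γ : GL (Fin n) ℂ}
    (hk : H z = (k : Mat n)ᴴ * (k : Mat n)) (hg : ∀ᶠ w in 𝓝 z, DifferentiableAt ℂ g w)
    (hγ : g z = γ) : curvNormAt (fun w => (g w)ᴴ * H w * g w) z = curvNormAt H z := by
  have hu : IsUnit (H z) := by
    rw [hk]
    exact k.isUnit.star.mul k.isUnit
  rw [curvNormAt, curvature_conj hH hu hg (by rw [hγ]; exact γ.isUnit), curvNormAt, hk, hγ]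
  exact hermNorm_conj k γ _

theorem curvNormAt_comp {H : ℂ → Mat n} {φ : ℂ → ℂ} {z : ℂ} (hH : ContDiffAt ℝ 2 H (φ z))
    {k : GL (Fin n) ℂ} (hk : H (φ z) = (k : Mat n)ᴴ * (k : Mat n))
    (hφ : ∀ᶠ w in 𝓝 z, DifferentiableAt ℂ φ w) :
    curvNormAt (fun w => H (φ w)) z = ‖deriv φ z‖ ^ 2 * curvNormAt H (φ z) := by
  have hu : IsUnit (H (φ z)) := by
    rw [hk]
    exact k.isUnit.star.mul k.isUnit
  rw [curvNormAt, curvature_comp hH hu hφ, hermNorm_smul _ _ (by positivity)]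
  rfl

end CurvatureChart

/-! ### Curvature of a metrized bundle and the metrics induced by characters. -/

section MetricBundle

set_option linter.unusedSectionVars false

open Filter

variable {X : Type u} [TopologicalSpace X] [ChartedSpace ℂ X] [IsManifold 𝓘(ℂ) ω X] [T2Space X]
  [CompactSpace X] [Nonempty X] {n : ℕ} {S : Setup X n}

/-- The metric in the chart at `a` in a local frame. -/
def MetrizedBundle.gram (B : MetrizedBundle S) (s : ∀ y, B.E.Fib y) (a : X) (w : ℂ) : Mat n :=
  B.h _ (s ((chartAt ℂ a).symm w))

variable {B : MetrizedBundle S}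

theorem HolOn.eventually_differentiableAt {G : MatGroup n} {O : Set X} (hO : IsOpen O) {g : X → G}
    (hg : HolOn O g) {a y : X} (hy : y ∈ O) (ha : y ∈ (chartAt ℂ a).source) :
    ∀ᶠ w in 𝓝 (chartAt ℂ a y),
      DifferentiableAt ℂ (fun w => toMat (g ((chartAt ℂ a).symm w))) w := by
  have h : ∀ᶠ w in 𝓝 (chartAt ℂ a y), ∀ i j,
      DifferentiableAt ℂ (fun w => toMat (g ((chartAt ℂ a).symm w)) i j) w :=
    eventually_all.2 fun i => eventually_all.2 fun j =>
      eventually_differentiableAt_comp_symm hO (hg i j) hy ha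
  exact h.mono fun w hw => differentiableAt_matrix hw

theorem MetrizedBundle.contDiffAt_gram {U : Opens X} {s : ∀ y, B.E.Fib y}
    (hs : B.E.IsSection U s) {a y : X} (hy : y ∈ U) (ha : y ∈ (chartAt ℂ a).source) :
    ContDiffAt ℝ 2 (B.gram s a) (chartAt ℂ a y) :=
  contDiffAt_matrix fun i j => (contDiffAt_comp_symm (k := ⊤)
    ((B.h_smooth U s hs i j).contMDiffAt (U.isOpen.mem_nhds hy)) ha).of_le
      (WithTop.coe_le_coe.2 (le_top : (2 : ℕ∞) ≤ ⊤))

theorem MetrizedBundle.eventually_mem {U : Opens X} {a y : X} (hy : y ∈ U) (hyD : y ∉ S.D)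
    (ha : y ∈ (chartAt ℂ a).source) : ∀ᶠ w in 𝓝 (chartAt ℂ a y), (chartAt ℂ a).symm w ∈ U ∧
      (chartAt ℂ a).symm w ∉ S.D :=
  (tendsto_symm_chart ha).eventually (eventually_mem_off hy hyD)

theorem MetrizedBundle.gram_eq (B : MetrizedBundle S) (s : ∀ y, B.E.Fib y) {a : X} {w : ℂ}
    (hw : (chartAt ℂ a).symm w ∉ S.D) : ∃ k : S.G, B.gram s a w = (toMat k)ᴴ * toMat k :=
  B.h_reduction _ hw _

theorem MetrizedBundle.h_ratio (B : MetrizedBundle S) {y : X} (hy : y ∉ S.D) (e e' : B.E.Fib y) :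
    B.h y e' = (toMat (B.E.ratio e e'))ᴴ * B.h y e * toMat (B.E.ratio e e') := by
  rw [← B.h_act y hy, B.E.act_ratio]

theorem MetrizedBundle.holOn_ratio {U V : Opens X} {s t : ∀ y, B.E.Fib y}
    (hs : B.E.IsSection U s) (ht : B.E.IsSection V t) :
    HolOn ((U ⊓ V : Opens X) : Set X) fun y => B.E.ratio (s y) (t y) :=
  (B.E.change (B.E.mono hs inf_le_left) t).1 (B.E.mono ht inf_le_right)

/-- A holomorphic change of frame conjugates the curvature, and the $h$-norm is invariant under
this. Hence the section chosen in `curvNorm` does not matter. -/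
theorem MetrizedBundle.curvNormAt_gram_congr {U V : Opens X} {s t : ∀ y, B.E.Fib y}
    (hs : B.E.IsSection U s) (ht : B.E.IsSection V t) {a y : X} (hy : y ∈ U) (hy' : y ∈ V)
    (hyD : y ∉ S.D) (ha : y ∈ (chartAt ℂ a).source) :
    curvNormAt (B.gram t a) (chartAt ℂ a y) = curvNormAt (B.gram s a) (chartAt ℂ a y) := by
  have hO : y ∈ U ⊓ V := ⟨hy, hy'⟩
  have hyD' : (chartAt ℂ a).symm (chartAt ℂ a y) ∉ S.D := by rwa [(chartAt ℂ a).left_inv ha]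
  obtain ⟨g, hg⟩ : ∃ g : ℂ → S.G, g = fun w => B.E.ratio (s ((chartAt ℂ a).symm w))
      (t ((chartAt ℂ a).symm w)) := ⟨_, rfl⟩
  have hgd : ∀ᶠ w in 𝓝 (chartAt ℂ a y), DifferentiableAt ℂ (fun w => toMat (g w)) w := by
    rw [hg]
    exact HolOn.eventually_differentiableAt (U ⊓ V).isOpen (MetrizedBundle.holOn_ratio hs ht) hO ha
  have hgram : B.gram t a =ᶠ[𝓝 (chartAt ℂ a y)]
      fun w => (toMat (g w))ᴴ * B.gram s a w * toMat (g w) := by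
    rw [hg]
    filter_upwards [MetrizedBundle.eventually_mem hO hyD ha] with w hw
    exact B.h_ratio hw.2 _ _
  obtain ⟨k, hk⟩ := B.gram_eq s hyD'
  exact (curvNormAt_congr hgram).trans (curvNormAt_conj (MetrizedBundle.contDiffAt_gram hs hy ha)
    (k := k) (γ := g (chartAt ℂ a y)) hk hgd rfl)

theorem MetrizedBundle.curvNorm_eq {U : Opens X} {s : ∀ y, B.E.Fib y}
    (hs : B.E.IsSection U s) {a y : X} (hy : y ∈ U) (hyD : y ∉ S.D)
    (ha : y ∈ (chartAt ℂ a).source) :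
    curvNorm B.E B.h a y = curvNormAt (B.gram s a) (chartAt ℂ a y) := by
  have hex : ∃ us : Opens X × (∀ y, B.E.Fib y), y ∈ us.1 ∧ B.E.IsSection us.1 us.2 :=
    ⟨(U, s), hy, hs⟩
  have h1 : curvNorm B.E B.h a y = curvNormAt (B.gram hex.choose.2 a) (chartAt ℂ a y) := by
    rw [curvNorm, dif_pos hex]; rfl
  rw [h1]
  exact MetrizedBundle.curvNormAt_gram_congr hs hex.choose_spec.2 hy hex.choose_spec.1 hyD ha

/-- The curvature coefficient is multiplied by $|\varphi'|^2$ under a change of coordinate, and the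
norm on endomorphisms does not involve the coordinate. -/
theorem MetrizedBundle.isDensityOff_curvNorm (B : MetrizedBundle S) :
    IsDensityOff S.D (curvNorm B.E B.h) := by
  intro a b y hyD ha hb
  obtain ⟨U, s, hy, hs⟩ := B.E.exists_section y hyD
  have hyD' : (chartAt ℂ b).symm (chartAt ℂ b y) ∉ S.D := by rwa [(chartAt ℂ b).left_inv hb]
  obtain ⟨k, hk⟩ := B.gram_eq s hyD'
  have hc := MetrizedBundle.contDiffAt_gram hs hy hb
  rw [← trans_apply ha] at hk hc
  have e : B.gram s a =ᶠ[𝓝 (chartAt ℂ a y)] fun w => B.gram s b (trans a b w) :=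
    comp_symm_eventuallyEq (fun v => B.h v (s v)) ha hb
  rw [MetrizedBundle.curvNorm_eq hs hy hyD ha, MetrizedBundle.curvNorm_eq hs hy hyD hb,
    curvNormAt_congr e, curvNormAt_comp hc hk (eventually_differentiableAt_trans ha hb),
    trans_apply ha]

variable {P : MatGroup n} {χ : P →* ℂˣ}

theorem MetrizedBundle.log_charMetric (F : FlagData S.R P χ) {y : X} (hy : y ∉ S.D)
    (e : B.E.Fib y) : Real.log (charMetric χ (B.h y e)) = F.logMetric (B.h y e) := by
  obtain ⟨k, hk⟩ := B.h_reduction y hy e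
  rw [hk]
  exact F.log_charMetric k.2

theorem MetrizedBundle.smoothIn_log_charMetric (F : FlagData S.R P χ) {U : Opens X}
    {s : ∀ y, B.E.Fib y} (hs : B.E.IsSection U s) {a y : X} (hy : y ∈ U) (hyD : y ∉ S.D)
    (ha : y ∈ (chartAt ℂ a).source) :
    SmoothIn (fun v => Real.log (charMetric χ (B.h v (s v)))) a y ∧
    lapDens (fun v => Real.log (charMetric χ (B.h v (s v)))) a y ≤
      F.bound * curvNorm B.E B.h a y := by
  have e : (fun w => (fun v => Real.log (charMetric χ (B.h v (s v)))) ((chartAt ℂ a).symm w))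
      =ᶠ[𝓝 (chartAt ℂ a y)] fun w => F.logMetric (B.gram s a w) := by
    filter_upwards [MetrizedBundle.eventually_mem hy hyD ha] with w hw
    exact MetrizedBundle.log_charMetric F hw.2 _
  have h := F.lapl_logMetric (MetrizedBundle.contDiffAt_gram hs hy ha) (by
    filter_upwards [MetrizedBundle.eventually_mem hy hyD ha] with w hw
    obtain ⟨k, hk⟩ := B.gram_eq s hw.2
    exact ⟨k, hk⟩)
  refine ⟨ContDiffAt.congr_of_eventuallyEq h.1 e, ?_⟩
  rw [lapDens, lapl_congr e, MetrizedBundle.curvNorm_eq hs hy hyD ha]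
  exact h.2

/-- The ratio of two sections of a reduction, as an element of `P`. -/
theorem MetrizedBundle.isMetricOff (F : FlagData S.R P χ) (hχ : IsAlgChar χ)
    (σ : Reduction B.E S.D P) : IsMetricOff S.D (fun s : σ.Sec => s.1.1)
      fun s y => charMetric χ (B.h y (s.1.2 y)) where
  smooth s a y hy hyD ha := (MetrizedBundle.smoothIn_log_charMetric F s.2.1 hy hyD ha).1
  pos s y _ hyD := by
    obtain ⟨k, hk⟩ := B.h_reduction y hyD (s.1.2 y)
    rw [hk]
    exact F.charMetric_pos k.2
  trans s t a y hs ht hyD ha := by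
    -- The transition function of the line bundle is $\chi$ of the $P$-valued ratio. It is
    -- holomorphic because it is also the composition of the holomorphic $G$-valued ratio with a
    -- rational extension of $\chi$.
    obtain ⟨Φ, hΦ, hΦd⟩ := hχ.exists_differentiableAt
    have hO : y ∈ s.1.1 ⊓ t.1.1 := ⟨hs, ht⟩
    have hval : ∀ v, v ∈ s.1.1 ⊓ t.1.1 → v ∉ S.D → Φ (toMat (B.E.ratio (s.1.2 v) (t.1.2 v))) =
        ((χ (σ.transition s t v) : ℂˣ) : ℂ) := fun v hv hvD => by
      rw [← hΦ]
      exact congrArg (fun g : GL (Fin n) ℂ => Φ (g : Mat n))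
        (σ.transition_coe s t hv.1 hv.2 hvD).symm
    refine ⟨fun v => Φ (toMat (B.E.ratio (s.1.2 v) (t.1.2 v))), ?_, ?_, ?_⟩
    · filter_upwards [HolOn.eventually_differentiableAt (s.1.1 ⊓ t.1.1).isOpen
        (MetrizedBundle.holOn_ratio s.2.1 t.2.1) hO ha] with w hw
      refine DifferentiableAt.comp (g := Φ) w (hΦd _ ?_) hw
      exact ((Matrix.isUnit_iff_isUnit_det _).1 (B.E.ratio _ _ : GL (Fin n) ℂ).isUnit).ne_zero
    · exact (hval y hO hyD).trans_ne (Units.ne_zero _)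
    · filter_upwards [eventually_mem_off hO hyD] with v hv
      obtain ⟨k, hk⟩ := B.h_reduction v hv.2 (s.1.2 v)
      rw [hval v hv.1 hv.2, B.h_ratio hv.2 (s.1.2 v) (t.1.2 v), hk]
      have e : toMat (B.E.ratio (s.1.2 v) (t.1.2 v)) = toMat (σ.transition s t v) :=
        congrArg (fun g : GL (Fin n) ℂ => (g : Mat n)) (σ.transition_coe s t hv.1.1 hv.1.2 hv.2).symm
      rw [e]
      exact F.charMetric_conj k.2 _

end MetricBundle

/-! ### Growth of characters in terms of matrix norms. -/

section Growth

variable {n : ℕ}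

theorem norm_entry_le (M : Mat n) (i j : Fin n) : ‖M i j‖ ≤ ‖M‖ := by
  rw [Matrix.linfty_opNorm_def, ← coe_nnnorm, NNReal.coe_le_coe]
  exact (Finset.single_le_sum (f := fun j => ‖M i j‖₊) (fun _ _ => zero_le) (Finset.mem_univ j)).trans
    (Finset.le_sup (f := fun i => ∑ j, ‖M i j‖₊) (Finset.mem_univ i))

theorem norm_le_of_entry {M : Mat n} {C : ℝ} (hC : 0 ≤ C) (h : ∀ i j, ‖M i j‖ ≤ C) :
    ‖M‖ ≤ n * C := by
  lift C to NNReal using hC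
  rw [Matrix.linfty_opNorm_def]
  have : (Finset.univ.sup fun i => ∑ j, ‖M i j‖₊) ≤ n * C := by
    refine Finset.sup_le fun i _ => (Finset.sum_le_card_nsmul _ _ C fun j _ => ?_).trans (by simp)
    exact_mod_cast h i j
  exact_mod_cast this

theorem norm_exp_le (M : Mat n) : ‖NormedSpace.exp M‖ ≤ (‖(1 : Mat n)‖ + 1) * Real.exp ‖M‖ := by
  have h1 : HasSum (fun k : ℕ => (‖(1 : Mat n)‖ + 1) * (((k.factorial : ℝ))⁻¹ * ‖M‖ ^ k))
      ((‖(1 : Mat n)‖ + 1) * Real.exp ‖M‖) := by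
    have h2 := (NormedSpace.exp_series_hasSum_exp' (𝕂 := ℝ) ‖M‖).mul_left (‖(1 : Mat n)‖ + 1)
    rw [← Real.exp_eq_exp_ℝ] at h2
    simpa using h2
  rw [NormedSpace.exp_eq_tsum ℂ]
  refine tsum_of_norm_bounded h1 fun k => ?_
  have h3 : ‖M ^ k‖ ≤ (‖(1 : Mat n)‖ + 1) * ‖M‖ ^ k := by
    rcases Nat.eq_zero_or_pos k with rfl | hk
    · simp
    · exact (norm_pow_le' M hk).trans (le_mul_of_one_le_left (by positivity) (by simp))
  rw [norm_smul, norm_inv, Complex.norm_natCast]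
  calc _ ≤ ((k.factorial : ℝ))⁻¹ * ((‖(1 : Mat n)‖ + 1) * ‖M‖ ^ k) := by gcongr
    _ = _ := by ring

theorem norm_sq_le_conjTranspose_mul_self (M : Mat n) : ‖M‖ ^ 2 ≤ n ^ 2 * (n * ‖Mᴴ * M‖) := by
  have h1 : frob M ≤ n * ‖Mᴴ * M‖ := by
    have h2 := congrArg Norm.norm (frob_eq_trace M)
    rw [Complex.norm_real, Real.norm_of_nonneg (frob_nonneg M)] at h2
    rw [h2, Matrix.trace]
    refine (norm_sum_le _ _).trans ((Finset.sum_le_card_nsmul _ _ ‖Mᴴ * M‖ fun i _ => ?_).trans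
      (by simp))
    exact norm_entry_le _ i i
  have h3 : ‖M‖ ≤ n * Real.sqrt (n * ‖Mᴴ * M‖) := by
    refine norm_le_of_entry (Real.sqrt_nonneg _) fun i j => ?_
    refine Real.le_sqrt_of_sq_le ?_
    exact (norm_sq_le_frob M i j).trans h1
  calc ‖M‖ ^ 2 ≤ (n * Real.sqrt (n * ‖Mᴴ * M‖)) ^ 2 := by gcongr
    _ = _ := by rw [mul_pow, Real.sq_sqrt (by positivity)]

theorem exists_norm_le_conjTranspose_mul_self (n : ℕ) : ∃ K : ℝ, 1 ≤ K ∧ ∀ M : Mat n,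
    ‖M‖ ≤ K * (1 + ‖Mᴴ * M‖) := by
  refine ⟨n ^ 2 * n + 1, by simp; positivity, fun M => ?_⟩
  have h := norm_sq_le_conjTranspose_mul_self M
  have h1 : 0 ≤ ‖Mᴴ * M‖ := norm_nonneg _
  have h2 : (0 : ℝ) ≤ (n : ℝ) ^ 2 * n := by positivity
  nlinarith [sq_nonneg (‖M‖ - 1), mul_nonneg h2 h1]

theorem exists_norm_det_compress_le (Q : Mat n) : ∃ A : ℝ, 1 ≤ A ∧ ∀ M : Mat n,
    ‖(compress Q M).det‖ ≤ A * (1 + ‖M‖) ^ n := by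
  set K : ℝ := ‖Q‖ * ‖Q‖ + ‖1 - Q‖ with hK
  refine ⟨n.factorial * K ^ n + 1, by simp; positivity, fun M => ?_⟩
  have h1 : ∀ i j, ‖compress Q M i j‖ ≤ K * (1 + ‖M‖) := fun i j => by
    refine (norm_entry_le _ i j).trans ?_
    rw [compress]
    calc ‖Q * M * Q + (1 - Q)‖ ≤ ‖Q‖ * ‖M‖ * ‖Q‖ + ‖1 - Q‖ := by
          refine (norm_add_le _ _).trans (add_le_add ?_ le_rfl)
          exact (norm_mul_le _ _).trans (mul_le_mul_of_nonneg_right (norm_mul_le _ _) (norm_nonneg _))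
      _ ≤ K * (1 + ‖M‖) := by
          rw [hK]
          nlinarith [norm_nonneg M, norm_nonneg (1 - Q), mul_nonneg (norm_nonneg Q) (norm_nonneg Q)]
  have h2 := Matrix.det_le (abv := NormedField.toAbsoluteValue ℂ) (A := compress Q M) h1
  simp only [Fintype.card_fin, nsmul_eq_mul] at h2
  change ‖(compress Q M).det‖ ≤ _ at h2
  have h3 : (0 : ℝ) ≤ (1 + ‖M‖) ^ n := by positivity
  calc _ ≤ _ := h2
    _ = n.factorial * K ^ n * (1 + ‖M‖) ^ n := by rw [mul_pow]; ring
    _ ≤ _ := by nlinarith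

variable {R : ReductiveGroup n} {P : MatGroup n} {χ : P →* ℂˣ}

theorem toMat_mul_inv (p : P) : toMat p * toMat p⁻¹ = 1 := by
  simp [toMat]

/-- The determinants on the flag are polynomial in the entries, which bounds their logarithms from
above; the determinants for $p$ and $p^{-1}$ multiply to $1$, which gives the bound from below.
Logarithmic growth in the norm is what turns $e^{o(\log|z|)}$ into $o(\log|z|)$. -/
theorem FlagData.exists_log_norm_le (F : FlagData R P χ) : ∃ A B : ℝ, 0 ≤ A ∧ 0 ≤ B ∧ ∀ p : P,
    |Real.log ‖((χ p : ℂˣ) : ℂ)‖| ≤ A + B * Real.log (1 + ‖toMat p‖ + ‖toMat p⁻¹‖) := by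
  choose a ha1 ha using fun k => exists_norm_det_compress_le (F.Q k)
  have ha0 : ∀ k, 0 ≤ Real.log (a k) := fun k => Real.log_nonneg (ha1 k)
  refine ⟨∑ k, |F.c k| * Real.log (a k), ∑ k, |F.c k| * n,
    Finset.sum_nonneg fun k _ => mul_nonneg (abs_nonneg _) (ha0 k), by positivity, fun p => ?_⟩
  set L := Real.log (1 + ‖toMat p‖ + ‖toMat p⁻¹‖)
  have hup : ∀ k (q : P), 0 < ‖(compress (F.Q k) (toMat q)).det‖ →
      1 + ‖toMat q‖ ≤ 1 + ‖toMat p‖ + ‖toMat p⁻¹‖ →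
      Real.log ‖(compress (F.Q k) (toMat q)).det‖ ≤ Real.log (a k) + n * L := by
    intro k q h0 hq
    have hpos : 0 < a k := one_pos.trans_le (ha1 k)
    refine (Real.log_le_log h0 (ha k _)).trans ?_
    rw [Real.log_mul hpos.ne' (by positivity), Real.log_pow]
    have := Real.log_le_log (by positivity) hq
    gcongr
  have hk : ∀ k, |Real.log ‖(compress (F.Q k) (toMat p)).det‖| ≤ Real.log (a k) + n * L := by
    intro k
    have h1 : (compress (F.Q k) (toMat p)).det * (compress (F.Q k) (toMat p⁻¹)).det = 1 := by
      rw [← Matrix.det_mul, ← compress_mul (N := toMat p⁻¹) (F.idem k) (F.flag k _ (p⁻¹).2), toMat_mul_inv,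
        compress_one (F.idem k), Matrix.det_one]
    have h2 := congrArg Norm.norm h1
    rw [norm_mul, norm_one] at h2
    have p1 : 0 < ‖(compress (F.Q k) (toMat p)).det‖ :=
      norm_pos_iff.2 (left_ne_zero_of_mul_eq_one h1)
    have p2 : 0 < ‖(compress (F.Q k) (toMat p⁻¹)).det‖ :=
      norm_pos_iff.2 (right_ne_zero_of_mul_eq_one h1)
    have h3 := congrArg Real.log h2
    rw [Real.log_mul p1.ne' p2.ne', Real.log_one] at h3
    have u1 := hup k p p1 (by have := norm_nonneg (toMat p⁻¹); linarith)
    have u2 := hup k p⁻¹ p2 (by have := norm_nonneg (toMat p); linarith)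
    rw [abs_le]
    constructor <;> linarith
  rw [F.log_norm p, abs_neg, Finset.sum_mul, ← Finset.sum_add_distrib]
  refine (Finset.abs_sum_le_sum_abs _ _).trans (Finset.sum_le_sum fun k _ => ?_)
  rw [abs_mul, mul_assoc, ← mul_add]
  exact mul_le_mul_of_nonneg_left (hk k) (abs_nonneg _)

theorem FlagData.log_norm_exp (F : FlagData R P χ) {θ : Mat n} (hθ : θ ∈ lieAlg R.T)
    (hs : θᴴ = θ) (r : ℝ) {t : P} (ht : toMat t = NormedSpace.exp (r • θ)) :
    Real.log ‖((χ t : ℂˣ) : ℂ)‖ = r * pairing θ χ := by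
  rw [F.log_norm t, F.pairing_eq θ hθ, mul_neg, Finset.mul_sum]
  congr 1
  refine Finset.sum_congr rfl fun k _ => ?_
  rw [ht, norm_det_compress_exp (F.idem k) (F.herm k) (by rw [Matrix.conjTranspose_smul, hs]; simp)
    ((F.commute θ hθ k).smul_right r), Real.log_exp, Matrix.mul_smul, Matrix.trace_smul,
    Complex.real_smul, Complex.re_ofReal_mul]
  ring

/-- The size of the metric of a character in terms of the size of the hermitian matrix. -/
theorem FlagData.exists_logMetric_le (F : FlagData R P χ) : ∃ A B : ℝ, 0 ≤ A ∧ 0 ≤ B ∧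
    ∀ θ ∈ lieAlg R.T, θᴴ = θ → ∀ (r : ℝ) (k : GL (Fin n) ℂ) (M N : Mat n), k ∈ R.G →
      (k : Mat n)ᴴ * (k : Mat n) = NormedSpace.exp (r • θ) * M * NormedSpace.exp (r • θ) →
      M * N = 1 → |F.logMetric ((k : Mat n)ᴴ * (k : Mat n)) - 2 * pairing θ χ * r| ≤
        A + B * Real.log (1 + ‖M‖ + ‖N‖) := by
  obtain ⟨A, B, hA, hB, hAB⟩ := F.exists_log_norm_le
  obtain ⟨K, hK1, hK⟩ := exists_norm_le_conjTranspose_mul_self n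
  have hK' : (1 : ℝ) ≤ 1 + K + n * K := by
    have : (0 : ℝ) ≤ n * K := by positivity
    linarith
  refine ⟨2 * A + 2 * B * Real.log (1 + K + n * K), 2 * B, by
    have := Real.log_nonneg hK'; positivity, by positivity, ?_⟩
  intro θ hθ hs r k M N hk hM hMN
  obtain ⟨p, hp⟩ := F.exists_char hk
  obtain ⟨t, htT, ht⟩ := hθ (r : ℂ)
  have ht' : (t : Mat n) = NormedSpace.exp (r • θ) := by
    rw [ht]; congr 1
  set τ : P := ⟨t, F.torus_le htT⟩ with hτ
  have hτE : toMat τ = NormedSpace.exp (r • θ) := ht'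
  have hτh : (toMat τ)ᴴ = toMat τ := by
    rw [hτE, ← Matrix.exp_conjTranspose, Matrix.conjTranspose_smul, hs]; simp
  -- The torus factor $\tau=e^{r\theta}$ is split off: then $q^*q=M$ and $q^{-1}q^{-*}=N$. The
  -- factor $\tau$ contributes exactly $2r\langle\theta,\chi\rangle$, and $q$ is controlled by the
  -- norms of $M$ and $N$.
  set q : P := p * τ⁻¹ with hq
  have hpq : p = q * τ := by simp [hq]
  have hpm : toMat p = toMat q * toMat τ := by rw [hpq]; simp [toMat]
  have hτi : toMat τ⁻¹ * toMat τ = 1 := by simp [toMat]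
  have hτi' : toMat τ * toMat τ⁻¹ = 1 := by simp [toMat]
  have hqM : (toMat q)ᴴ * toMat q = M := by
    have h1 : toMat τ * ((toMat q)ᴴ * toMat q) * toMat τ = toMat τ * M * toMat τ := by
      rw [hτE] at hpm ⊢
      rw [← hM, hp, hpm, Matrix.conjTranspose_mul, ← hτE, hτh]
      simp only [mul_assoc]
    have h2 := congrArg (fun Z => toMat τ⁻¹ * Z * toMat τ⁻¹) h1
    simp only [mul_assoc, hτi', mul_one] at h2
    simpa only [← mul_assoc, hτi, one_mul] using h2
  have hqi : toMat q * toMat q⁻¹ = 1 := toMat_mul_inv q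
  have hqi' : toMat q⁻¹ * toMat q = 1 := by simp [toMat]
  have hqN : toMat q⁻¹ * (toMat q⁻¹)ᴴ = N := by
    have h3 : toMat q⁻¹ * (toMat q⁻¹)ᴴ * M = 1 := by
      rw [← hqM]
      calc _ = toMat q⁻¹ * ((toMat q * toMat q⁻¹)ᴴ * toMat q) := by
            rw [Matrix.conjTranspose_mul]; simp only [mul_assoc]
        _ = 1 := by rw [hqi, Matrix.conjTranspose_one, one_mul, hqi']
    calc _ = toMat q⁻¹ * (toMat q⁻¹)ᴴ * M * N := by rw [mul_assoc _ M N, hMN, mul_one]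
      _ = N := by rw [h3, one_mul]
  have hn1 : ‖toMat q‖ ≤ K * (1 + ‖M‖) := by
    have := hK (toMat q)
    rwa [hqM] at this
  have hn2 : ‖toMat q⁻¹‖ ≤ n * (K * (1 + ‖N‖)) := by
    refine norm_le_of_entry (by positivity) fun i j => ?_
    have h4 := hK (toMat q⁻¹)ᴴ
    rw [Matrix.conjTranspose_conjTranspose, hqN] at h4
    refine le_trans ?_ ((norm_entry_le _ j i).trans h4)
    rw [Matrix.conjTranspose_apply, norm_star]
  have hn3 : 1 + ‖toMat q‖ + ‖toMat q⁻¹‖ ≤ (1 + K + n * K) * (1 + ‖M‖ + ‖N‖) := by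
    have h0 : (0 : ℝ) ≤ n * K := by positivity
    nlinarith [norm_nonneg M, norm_nonneg N, mul_nonneg h0 (norm_nonneg M),
      mul_nonneg h0 (norm_nonneg N), mul_nonneg (zero_le_one.trans hK1) (norm_nonneg N)]
  have hlog := Real.log_le_log (by positivity) hn3
  rw [Real.log_mul (by positivity) (by positivity)] at hlog
  have hχ : ‖((χ p : ℂˣ) : ℂ)‖ = ‖((χ q : ℂˣ) : ℂ)‖ * ‖((χ τ : ℂˣ) : ℂ)‖ := by
    rw [hpq, map_mul, Units.val_mul, norm_mul]
  have hne : ∀ a : P, ‖((χ a : ℂˣ) : ℂ)‖ ≠ 0 := fun a => norm_ne_zero_iff.2 (Units.ne_zero _)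
  rw [hp, F.logMetric_conjTranspose_mul_self, Real.log_pow, hχ, Real.log_mul (hne q) (hne τ),
    F.log_norm_exp hθ hs r hτE]
  have e : ((2 : ℕ) : ℝ) * (Real.log ‖((χ q : ℂˣ) : ℂ)‖ + r * pairing θ χ) -
      2 * pairing θ χ * r = 2 * Real.log ‖((χ q : ℂˣ) : ℂ)‖ := by push_cast; ring
  rw [e, abs_mul, abs_two]
  have h5 := hAB q
  have h6 := mul_le_mul_of_nonneg_left hlog hB
  linarith

end Growth

/-! ### Asymptotics of the induced metric at a puncture. -/

section Asymptotics

set_option linter.unusedSectionVars false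

open Filter

variable {n : ℕ}

theorem norm_conjTranspose_le (M : Mat n) : ‖Mᴴ‖ ≤ n * ‖M‖ :=
  norm_le_of_entry (norm_nonneg _) fun i j => by
    rw [Matrix.conjTranspose_apply, norm_star]
    exact norm_entry_le M j i

theorem exp_mul_exp_neg (M : Mat n) : NormedSpace.exp M * NormedSpace.exp (-M) = 1 := by
  rw [Matrix.exp_neg]
  exact Matrix.mul_nonsing_inv _ ((Matrix.isUnit_iff_isUnit_det _).1 (Matrix.isUnit_exp _))

theorem exp_neg_mul_exp (M : Mat n) : NormedSpace.exp (-M) * NormedSpace.exp M = 1 :=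
  mul_eq_one_comm.1 (exp_mul_exp_neg M)

/-- Conjugation by the real power `|z| ^ θ`. -/
def conjAbs (θ : Mat n) (r : ℝ) (M : Mat n) : Mat n :=
  NormedSpace.exp (r • θ) * M * NormedSpace.exp (-(r • θ))

theorem conjAbs_mul (θ : Mat n) (r : ℝ) (M N : Mat n) :
    conjAbs θ r M * conjAbs θ r N = conjAbs θ r (M * N) := by
  unfold conjAbs
  calc _ = NormedSpace.exp (r • θ) * M * (NormedSpace.exp (-(r • θ)) * NormedSpace.exp (r • θ)) * N *
        NormedSpace.exp (-(r • θ)) := by simp only [mul_assoc]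
    _ = _ := by rw [exp_neg_mul_exp]; simp only [mul_one, mul_assoc]

theorem conjAbs_one (θ : Mat n) (r : ℝ) : conjAbs θ r 1 = 1 := by
  rw [conjAbs, mul_one, exp_mul_exp_neg]

theorem exp_conjAbs (θ : Mat n) (r : ℝ) (M : Mat n) :
    NormedSpace.exp (conjAbs θ r M) = conjAbs θ r (NormedSpace.exp M) := by
  unfold conjAbs
  rw [Matrix.exp_neg]
  exact Matrix.exp_conj _ _ (Matrix.isUnit_exp _)

/-- Conjugation by `|z| ^ θ` differs from conjugation by `z ^ θ` by a bounded factor. -/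
theorem exists_norm_conjAbs_le (θ : Mat n) : ∃ C : ℝ, 0 ≤ C ∧ ∀ (z : ℂ) (M : Mat n),
    ‖conjAbs θ (Real.log ‖z‖) M‖ ≤ C * ‖zpow z θ * M * zpowNeg z θ‖ := by
  set K := (‖(1 : Mat n)‖ + 1) * Real.exp (Real.pi * ‖θ‖) with hK
  have hK0 : 0 ≤ K := by positivity
  refine ⟨K * K, by positivity, fun z M => ?_⟩
  -- Since $\log z=\log|z|+i\arg z$ with $|\arg z|\le\pi$, the powers $z^\theta$ and $|z|^\theta$
  -- differ by the commuting and bounded factor $e^a$.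
  set a : Mat n := ((z.arg : ℂ) * Complex.I) • θ with ha
  have hlog : Complex.log z • θ = Real.log ‖z‖ • θ + a := by
    rw [Complex.log, ha, add_smul]; rfl
  have hcomm : Commute (Real.log ‖z‖ • θ) a :=
    ((Commute.refl θ).smul_left _).smul_right _
  have e1 : zpow z θ = NormedSpace.exp a * NormedSpace.exp (Real.log ‖z‖ • θ) := by
    rw [zpow, hlog, add_comm, Matrix.exp_add_of_commute _ _ hcomm.symm]
  have e2 : zpowNeg z θ = NormedSpace.exp (-(Real.log ‖z‖ • θ)) * NormedSpace.exp (-a) := by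
    rw [zpowNeg, hlog, neg_add, Matrix.exp_add_of_commute _ _ (hcomm.neg_left.neg_right)]
  have ha1 : ‖a‖ ≤ Real.pi * ‖θ‖ := by
    rw [ha, norm_smul, norm_mul, Complex.norm_I, mul_one, Complex.norm_real]
    exact mul_le_mul_of_nonneg_right (Complex.abs_arg_le_pi z) (norm_nonneg _)
  have b1 : ‖NormedSpace.exp a‖ ≤ K := (norm_exp_le a).trans (by rw [hK]; gcongr)
  have b2 : ‖NormedSpace.exp (-a)‖ ≤ K := (norm_exp_le (-a)).trans (by rw [hK, norm_neg]; gcongr)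
  have e3 : conjAbs θ (Real.log ‖z‖) M =
      NormedSpace.exp (-a) * (zpow z θ * M * zpowNeg z θ) * NormedSpace.exp a := by
    rw [e1, e2, conjAbs]
    calc _ = 1 * NormedSpace.exp (Real.log ‖z‖ • θ) * M * NormedSpace.exp (-(Real.log ‖z‖ • θ)) * 1 := by
          rw [one_mul, mul_one]
      _ = _ := by
          nth_rewrite 1 [← exp_neg_mul_exp a]
          rw [← exp_neg_mul_exp a]
          simp only [mul_assoc]
  rw [e3]
  calc _ ≤ ‖NormedSpace.exp (-a)‖ * ‖zpow z θ * M * zpowNeg z θ‖ * ‖NormedSpace.exp a‖ :=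
        (norm_mul_le _ _).trans (mul_le_mul_of_nonneg_right (norm_mul_le _ _) (norm_nonneg _))
    _ ≤ K * ‖zpow z θ * M * zpowNeg z θ‖ * K := by gcongr
    _ = _ := by ring

variable {X : Type u} [TopologicalSpace X] [ChartedSpace ℂ X]

theorem tendsto_coord (x : X) : Tendsto (coord x) (𝓝[≠] x) (𝓝[≠] 0) := by
  refine tendsto_nhdsWithin_iff.2 ⟨?_, ?_⟩
  · have h := ((chartAt ℂ x).continuousAt (mem_chart_source ℂ x)).tendsto
    have h2 := (h.sub_const (chartAt ℂ x x)).mono_left (nhdsWithin_le_nhds (s := {x}ᶜ))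
    rwa [sub_self] at h2
  · filter_upwards [nhdsWithin_le_nhds ((chartAt ℂ x).open_source.mem_nhds (mem_chart_source ℂ x)),
      self_mem_nhdsWithin] with y hy hne h
    exact hne ((chartAt ℂ x).injOn hy (mem_chart_source ℂ x) (sub_eq_zero.1 h))

theorem tendsto_log_coord (x : X) : Tendsto (fun y => Real.log ‖coord x y‖) (𝓝[≠] x) atBot :=
  tendsto_log_norm_nhdsNE.comp (tendsto_coord x)

theorem BddNear.exists_norm_conjAbs_le {x : X} {θ : Mat n} {M : X → Mat n}
    (h : BddNear x (conjZ x θ M)) :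
    ∃ C : ℝ, 0 ≤ C ∧ ∀ᶠ y in 𝓝[≠] x, ‖conjAbs θ (Real.log ‖coord x y‖) (M y)‖ ≤ C := by
  obtain ⟨C, hC⟩ := h
  obtain ⟨K, hK0, hK⟩ := Merohoric.exists_norm_conjAbs_le θ
  refine ⟨K * (n * |C|), by positivity, ?_⟩
  filter_upwards [hC] with y hy
  refine (hK _ _).trans (mul_le_mul_of_nonneg_left ?_ hK0)
  exact norm_le_of_entry (abs_nonneg C) fun i j => (hy i j).trans (le_abs_self C)

variable [T2Space X] [CompactSpace X] [Nonempty X] {S : Setup X n} {B : MetrizedBundle S}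
  {P : MatGroup n} {χ : P →* ℂˣ}

/-- Asymptotics at a puncture of the metric induced by a `θ`-adapted metric. -/
theorem MetrizedBundle.logMetric_isLittleO (F : FlagData S.R P χ) {x : X} (hx : x ∈ S.D)
    {g : X → S.G} (hg : IsParahoricAt x (S.θ x) g) :
    (fun y => F.logMetric (B.h y (B.E.act (B.frame x y) (g y))) -
      2 * pairing (S.θ x) χ * Real.log ‖coord x y‖) =o[𝓝[≠] x]
        fun y => Real.log ‖coord x y‖ := by
  obtain ⟨hs, hθ⟩ := span_cochar S.R.maximalTorus.2.1 S.R.torus_selfAdjoint (S.isWeight x hx).1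
  obtain ⟨A, b, hA, hb, hAb⟩ := F.exists_logMetric_le
  obtain ⟨c, hc1, hc2⟩ := B.adapted x hx
  obtain ⟨C1, hC1, hw1⟩ := hg.1.exists_norm_conjAbs_le
  obtain ⟨C2, hC2, hw2⟩ := hg.2.exists_norm_conjAbs_le
  set θ := S.θ x
  set r : X → ℝ := fun y => Real.log ‖coord x y‖ with hr
  set c' : X → Mat n := fun y => conjAbs θ (r y) (c y) with hc'
  set K := (‖(1 : Mat n)‖ + 1) with hK
  set C3 := 1 + n * C1 * K * C1 + C2 * K * (n * C2) with hC3
  have hC31 : 1 ≤ C3 := by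
    have h1 : 0 ≤ n * C1 * K * C1 := by positivity
    have h2 : 0 ≤ C2 * K * (n * C2) := by positivity
    linarith
  have hr0 : Tendsto r (𝓝[≠] x) atBot := tendsto_log_coord x
  have hrn : Tendsto (fun y => ‖r y‖) (𝓝[≠] x) atTop := tendsto_abs_atBot_atTop.comp hr0
  have hc'o : c' =o[𝓝[≠] x] r := by
    rw [Asymptotics.isLittleO_iff]
    intro ε hε
    have h1 : ∀ᶠ y in 𝓝[≠] x, ∀ i j, ‖c' y i j‖ ≤ ε / (n + 1) * ‖r y‖ :=
      eventually_all.2 fun i => eventually_all.2 fun j =>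
        (Asymptotics.isLittleO_iff.1 (hc2 i j)) (by positivity)
    filter_upwards [h1] with y hy
    refine (norm_le_of_entry (by positivity) hy).trans ?_
    have h2 : (n : ℝ) * (ε / (n + 1)) ≤ ε := by
      rw [mul_div_assoc', div_le_iff₀ (by positivity)]
      nlinarith
    calc (n : ℝ) * (ε / (n + 1) * ‖r y‖) = n * (ε / (n + 1)) * ‖r y‖ := by ring
      _ ≤ ε * ‖r y‖ := mul_le_mul_of_nonneg_right h2 (norm_nonneg _)
  -- With $w$, $w^{-1}$ bounded and $c'=\mathrm{Ad}(|z|^\theta)c$, the deviation from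
  -- $2\langle\theta,\chi\rangle\log|z|$ is at most a constant plus a multiple of $\|c'\|$, and
  -- $\|c'\|=o(\log|z|)$.
  have hbound : ∀ᶠ y in 𝓝[≠] x, ‖F.logMetric (B.h y (B.E.act (B.frame x y) (g y))) -
      2 * pairing θ χ * r y‖ ≤ 1 * ‖(A + b * Real.log C3) + b * ‖c' y‖‖ := by
    filter_upwards [hc1, hw1, hw2, eventually_not_mem S.D x] with y hy h1 h2 hyD
    obtain ⟨k, hk⟩ := B.h_reduction y hyD (B.E.act (B.frame x y) (g y))
    have hact := B.h_act y hyD (B.frame x y) (g y)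
    rw [hk, hy.2] at hact
    set E := NormedSpace.exp (r y • θ) with hE
    set w := conjAbs θ (r y) (toMat (g y)) with hw
    set w' := conjAbs θ (r y) (toMat (g y)⁻¹) with hw'
    have hEE : NormedSpace.exp ((2 * Real.log ‖coord x y‖) • θ) = E * E := by
      rw [two_mul, add_smul, Matrix.exp_add_of_commute _ _ (Commute.refl _)]
    have hEh : Eᴴ = E := by
      rw [hE, ← Matrix.exp_conjTranspose, Matrix.conjTranspose_smul, hs]; simp
    have hww : w * w' = 1 := by
      rw [hw, hw', conjAbs_mul, ← conjAbs_one θ (r y)]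
      congr 1
      simp [toMat]
    have hwE : w * E = E * toMat (g y) := by
      rw [hw, conjAbs, mul_assoc, exp_neg_mul_exp, mul_one]
    have hecE : NormedSpace.exp (c' y) * E = E * NormedSpace.exp (c y) := by
      rw [hc']
      simp only
      rw [exp_conjAbs, conjAbs, mul_assoc, exp_neg_mul_exp, mul_one]
    -- Both powers $E=|z|^\theta$ are moved to the outside. This conjugates $g$ into the bounded
    -- matrix $w$ and $e^c$ into $e^{c'}$, which is the shape required by
    -- `FlagData.exists_logMetric_le`.
    have hM : (toMat k)ᴴ * toMat k = E * (wᴴ * NormedSpace.exp (c' y) * w) * E := by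
      have hEw : E * wᴴ = (toMat (g y))ᴴ * E := by
        have := congrArg Matrix.conjTranspose hwE
        rwa [Matrix.conjTranspose_mul, Matrix.conjTranspose_mul, hEh] at this
      calc (toMat k)ᴴ * toMat k = (toMat (g y))ᴴ * E * (E * NormedSpace.exp (c y)) * toMat (g y) := by
            refine hact.trans ?_
            rw [hEE]; simp only [mul_assoc]
        _ = E * wᴴ * (NormedSpace.exp (c' y) * E) * toMat (g y) := by rw [hEw, hecE]
        _ = E * wᴴ * NormedSpace.exp (c' y) * (w * E) := by rw [hwE]; simp only [mul_assoc]
        _ = _ := by simp only [mul_assoc]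
    have hMN : wᴴ * NormedSpace.exp (c' y) * w * (w' * NormedSpace.exp (-c' y) * w'ᴴ) = 1 := by
      calc _ = wᴴ * NormedSpace.exp (c' y) * (w * w') * NormedSpace.exp (-c' y) * w'ᴴ := by
            simp only [mul_assoc]
        _ = wᴴ * (NormedSpace.exp (c' y) * NormedSpace.exp (-c' y)) * w'ᴴ := by
            rw [hww, mul_one]; simp only [mul_assoc]
        _ = (w' * w)ᴴ := by rw [exp_mul_exp_neg, mul_one, Matrix.conjTranspose_mul]
        _ = 1 := by rw [mul_eq_one_comm.1 hww, Matrix.conjTranspose_one]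
    have hmain := hAb θ hθ hs (r y) k _ _ k.2 hM hMN
    have n1 : ‖wᴴ * NormedSpace.exp (c' y) * w‖ ≤ n * C1 * K * C1 * Real.exp ‖c' y‖ := by
      calc _ ≤ ‖wᴴ‖ * ‖NormedSpace.exp (c' y)‖ * ‖w‖ :=
            (norm_mul_le _ _).trans (mul_le_mul_of_nonneg_right (norm_mul_le _ _) (norm_nonneg _))
        _ ≤ (n * C1) * (K * Real.exp ‖c' y‖) * C1 := by
            have := (norm_conjTranspose_le w).trans (mul_le_mul_of_nonneg_left h1 (Nat.cast_nonneg n))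
            have := norm_exp_le (c' y)
            gcongr
        _ = _ := by ring
    have n2 : ‖w' * NormedSpace.exp (-c' y) * w'ᴴ‖ ≤ C2 * K * (n * C2) * Real.exp ‖c' y‖ := by
      calc _ ≤ ‖w'‖ * ‖NormedSpace.exp (-c' y)‖ * ‖w'ᴴ‖ :=
            (norm_mul_le _ _).trans (mul_le_mul_of_nonneg_right (norm_mul_le _ _) (norm_nonneg _))
        _ ≤ C2 * (K * Real.exp ‖c' y‖) * (n * C2) := by
            have := (norm_conjTranspose_le w').trans (mul_le_mul_of_nonneg_left h2 (Nat.cast_nonneg n))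
            have h3 := norm_exp_le (-c' y)
            rw [norm_neg] at h3
            gcongr
        _ = _ := by ring
    have n3 : 1 + ‖wᴴ * NormedSpace.exp (c' y) * w‖ + ‖w' * NormedSpace.exp (-c' y) * w'ᴴ‖ ≤
        C3 * Real.exp ‖c' y‖ := by
      have := Real.one_le_exp (norm_nonneg (c' y))
      rw [hC3]
      linarith
    have n4 := Real.log_le_log (by positivity) n3
    rw [Real.log_mul (by positivity) (Real.exp_pos _).ne', Real.log_exp] at n4
    rw [one_mul, hk]
    refine hmain.trans (le_trans ?_ (le_abs_self _))
    have := mul_le_mul_of_nonneg_left n4 hb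
    linarith
  refine (Asymptotics.IsBigO.of_bound 1 hbound).trans_isLittleO ?_
  exact ((Asymptotics.isLittleO_const_left).2 (Or.inr hrn)).add (hc'o.norm_left.const_mul_left b)

end Asymptotics

/-! ### Extension of characters over the punctures. -/

section Extension

set_option linter.unusedSectionVars false

open Filter

/-- The upper bound makes the singularity removable, and the lower bound $|\psi|\ge e^{-C}$ keeps
the limit away from $0$. -/
theorem exists_nonzero_extension {ψ : ℂ → ℂ} {c : ℂ} {C : ℝ}
    (hd : ∀ᶠ z in 𝓝[≠] c, DifferentiableAt ℂ ψ z)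
    (hb : ∀ᶠ z in 𝓝[≠] c, ψ z ≠ 0 ∧ |Real.log ‖ψ z‖| ≤ C) :
    ∃ L : ℂ, L ≠ 0 ∧ DifferentiableAt ℂ (Function.update ψ c L) c := by
  have hexp : ∀ᶠ z in 𝓝[≠] c, Real.exp (-C) ≤ ‖ψ z‖ ∧ ‖ψ z‖ ≤ Real.exp C := by
    filter_upwards [hb] with z hz
    have h0 := norm_pos_iff.2 hz.1
    obtain ⟨h1, h2⟩ := abs_le.1 hz.2
    exact ⟨(Real.le_log_iff_exp_le h0).1 h1, (Real.log_le_iff_le_exp h0).1 h2⟩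
  have ht := Complex.tendsto_limUnder_of_differentiable_on_punctured_nhds_of_bounded_under hd
    ⟨Real.exp C + ‖ψ c‖, by
      rw [eventually_map]
      filter_upwards [hexp] with z hz
      exact (norm_sub_le _ _).trans (add_le_add_left hz.2 _)⟩
  refine ⟨limUnder (𝓝[≠] c) ψ, ?_, ?_⟩
  · have := ge_of_tendsto ht.norm (hexp.mono fun z hz => hz.1)
    exact norm_pos_iff.1 ((Real.exp_pos _).trans_le this)
  · have h1 := hd.and hexp
    rw [eventually_nhdsWithin_iff] at h1
    refine (Complex.differentiableOn_update_limUnder_of_bddAbove h1 (fun z hz => ?_) ?_).differentiableAt h1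
    · exact (hz.1 hz.2).1.differentiableWithinAt
    · refine ⟨Real.exp C, ?_⟩
      rintro _ ⟨z, hz, rfl⟩
      exact (hz.1 hz.2).2.2

variable {X : Type u} [TopologicalSpace X] [ChartedSpace ℂ X] [IsManifold 𝓘(ℂ) ω X]

theorem mdifferentiableAt_of_chart {f : X → ℂ} {y : X}
    (h : DifferentiableAt ℂ (fun w => f ((chartAt ℂ y).symm w)) (chartAt ℂ y y)) :
    MDifferentiableAt 𝓘(ℂ) 𝓘(ℂ) f y := by
  have ha := mem_chart_source ℂ y
  have h2 : MDifferentiableAt 𝓘(ℂ) 𝓘(ℂ) (chartAt ℂ y) y :=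
    ((contMDiffOn_chart (I := 𝓘(ℂ)) (n := ω) (x := y)).contMDiffAt
      ((chartAt ℂ y).open_source.mem_nhds ha)).mdifferentiableAt (by simp)
  refine (h.mdifferentiableAt.comp y h2).congr_of_eventuallyEq ?_
  filter_upwards [(chartAt ℂ y).open_source.mem_nhds ha] with v hv
  simp only [Function.comp]
  rw [(chartAt ℂ y).left_inv hv]

variable [T2Space X] [CompactSpace X] [Nonempty X]

theorem tendsto_symm_chart_ne (x : X) :
    Tendsto (chartAt ℂ x).symm (𝓝[≠] (chartAt ℂ x x)) (𝓝[≠] x) := by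
  refine tendsto_nhdsWithin_iff.2
    ⟨(tendsto_symm_chart (mem_chart_source ℂ x)).mono_left nhdsWithin_le_nhds, ?_⟩
  filter_upwards [nhdsWithin_le_nhds ((chartAt ℂ x).open_target.mem_nhds (mem_chart_target ℂ x)),
    self_mem_nhdsWithin] with z hz hzne h
  exact hzne (((chartAt ℂ x).right_inv hz).symm.trans (congrArg (chartAt ℂ x) h))

variable {n : ℕ} {S : Setup X n} {P : MatGroup n} {χ : P →* ℂˣ}

/-- A character of `P` is bounded above and below on `𝒫_θ` near a puncture. -/
theorem FlagData.exists_log_bound (F : FlagData S.R P χ) {x : X} (hx : x ∈ S.D) {g : X → S.G}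
    (hg : IsParahoricAt x (S.θ x) g) {p : X → P}
    (hp : ∀ᶠ y in 𝓝[≠] x, (g y : GL (Fin n) ℂ) = p y) :
    ∃ C, ∀ᶠ y in 𝓝[≠] x, |Real.log ‖((χ (p y) : ℂˣ) : ℂ)‖| ≤ C := by
  obtain ⟨-, hθ⟩ := span_cochar S.R.maximalTorus.2.1 S.R.torus_selfAdjoint (S.isWeight x hx).1
  obtain ⟨A, b, hA, hb, hAb⟩ := F.exists_log_norm_le
  obtain ⟨C1, hC1⟩ := hg.1
  obtain ⟨C2, hC2⟩ := hg.2
  refine ⟨A + b * Real.log (1 + n * |C1| + n * |C2|), ?_⟩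
  filter_upwards [hC1, hC2, hp] with y h1 h2 hy
  -- The matrix $z^\theta$ is an element $\tau$ of $T\subset P$, so $\tau p\tau^{-1}$ lies in $P$.
  -- It is bounded with its inverse by the parahoric condition, and $\chi$ takes the same value on
  -- it as on $p$.
  obtain ⟨t, htT, ht⟩ := hθ (Complex.log (coord x y))
  obtain ⟨τ, hτ⟩ : ∃ τ : P, (τ : GL (Fin n) ℂ) = t := ⟨⟨t, F.torus_le htT⟩, rfl⟩
  have hτz : toMat τ = zpow (coord x y) (S.θ x) := by rw [toMat, hτ]; exact ht
  have hτi : toMat τ⁻¹ = zpowNeg (coord x y) (S.θ x) := by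
    have h3 : toMat τ * toMat τ⁻¹ = 1 := toMat_mul_inv τ
    calc toMat τ⁻¹ = zpowNeg (coord x y) (S.θ x) * zpow (coord x y) (S.θ x) * toMat τ⁻¹ := by
          rw [zpowNeg_mul_zpow, one_mul]
      _ = zpowNeg (coord x y) (S.θ x) * (toMat τ * toMat τ⁻¹) := by rw [hτz, mul_assoc]
      _ = _ := by rw [h3, mul_one]
  have hgp : toMat (g y) = toMat (p y) := congrArg (fun q : GL (Fin n) ℂ => (q : Mat n)) hy
  have hgp' : toMat (g y)⁻¹ = toMat (p y)⁻¹ :=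
    congrArg (fun q : GL (Fin n) ℂ => ((q⁻¹ : GL (Fin n) ℂ) : Mat n)) hy
  have e1 : toMat (τ * p y * τ⁻¹) = conjZ x (S.θ x) (fun y => toMat (g y)) y := by
    rw [conjZ, hgp, ← hτz, ← hτi]; simp [toMat]
  have e2 : toMat (τ * p y * τ⁻¹)⁻¹ = conjZ x (S.θ x) (fun y => toMat (g y)⁻¹) y := by
    rw [conjZ, hgp', ← hτz, ← hτi]; simp [toMat, mul_assoc]
  have hχ : χ (τ * p y * τ⁻¹) = χ (p y) := by
    rw [map_mul, map_mul, map_inv, mul_comm (χ τ), mul_assoc, mul_inv_cancel, mul_one]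
  have h3 := hAb (τ * p y * τ⁻¹)
  rw [hχ, e1, e2] at h3
  have n1 := norm_le_of_entry (abs_nonneg C1) fun i j => (h1 i j).trans (le_abs_self C1)
  have n2 := norm_le_of_entry (abs_nonneg C2) fun i j => (h2 i j).trans (le_abs_self C2)
  refine h3.trans (add_le_add_right (mul_le_mul_of_nonneg_left ?_ hb) _)
  exact Real.log_le_log (by positivity) (by linarith)

/-- A character of a parabolic subgroup defines a character of `𝒫_θ`. -/
theorem FlagData.exists_regular (F : FlagData S.R P χ) (hχ : IsAlgChar χ) (U : Opens X) (p : X → P)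
    (hp : p ∈ S.parabolicSheaf P U) :
    ∃ f : X → ℂ, MDifferentiableOn 𝓘(ℂ) 𝓘(ℂ) f U ∧ (∀ y ∈ U, f y ≠ 0) ∧
      ∀ y ∈ U, y ∉ S.D → f y = ((χ (p y) : ℂˣ) : ℂ) := by
  classical
  obtain ⟨g, ⟨hgh, hgp⟩, hgeq⟩ := hp
  obtain ⟨Φ, hΦ, hΦd⟩ := hχ.exists_differentiableAt
  have hO : IsOpen ((U : Set X) \ S.D) := U.isOpen.sdiff S.D.finite_toSet.isClosed
  have hval : ∀ v, v ∈ U → v ∉ S.D → ((χ (p v) : ℂˣ) : ℂ) = Φ (toMat (g v)) := fun v hv hvD => by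
    rw [← hΦ]
    exact congrArg (fun q : GL (Fin n) ℂ => Φ (q : Mat n)) (hgeq v hv hvD).symm
  have hoff : ∀ a y, y ∈ U → y ∉ S.D → y ∈ (chartAt ℂ a).source →
      DifferentiableAt ℂ (fun w => ((χ (p ((chartAt ℂ a).symm w)) : ℂˣ) : ℂ)) (chartAt ℂ a y) := by
    intro a y hy hyD ha
    have h1 := (HolOn.eventually_differentiableAt hO hgh ⟨hy, hyD⟩ ha).self_of_nhds
    have h2 : DifferentiableAt ℂ (fun w => Φ (toMat (g ((chartAt ℂ a).symm w)))) (chartAt ℂ a y) :=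
      DifferentiableAt.comp (g := Φ) _ (hΦd _
        ((Matrix.isUnit_iff_isUnit_det _).1 (g _ : GL (Fin n) ℂ).isUnit).ne_zero) h1
    refine h2.congr_of_eventuallyEq ?_
    filter_upwards [(tendsto_symm_chart ha).eventually (hO.eventually_mem ⟨hy, hyD⟩)] with w hw
    exact hval _ hw.1 hw.2
  -- At a puncture the value of $p$ carries no information, so the value of the extension there is
  -- the limit from the punctured disc.
  have hext : ∀ x, x ∈ S.D → x ∈ U → ∃ L : ℂ, L ≠ 0 ∧ DifferentiableAt ℂ (Function.update
      (fun w => ((χ (p ((chartAt ℂ x).symm w)) : ℂˣ) : ℂ)) (chartAt ℂ x x) L) (chartAt ℂ x x) := by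
    intro x hxD hxU
    have hevU : ∀ᶠ y in 𝓝[≠] x, y ∈ U := nhdsWithin_le_nhds (U.isOpen.mem_nhds hxU)
    have hev : ∀ᶠ y in 𝓝[≠] x, y ∈ U ∧ y ∉ S.D := hevU.and (eventually_not_mem S.D x)
    obtain ⟨C, hC⟩ := F.exists_log_bound hxD (hgp x hxD hxU)
      (hev.mono fun y hy => hgeq y hy.1 hy.2)
    refine exists_nonzero_extension (C := C) ?_ ?_
    · filter_upwards [(tendsto_symm_chart_ne x).eventually hev,
        nhdsWithin_le_nhds ((chartAt ℂ x).open_target.mem_nhds (mem_chart_target ℂ x))] with w hw hwt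
      have := hoff x _ hw.1 hw.2 ((chartAt ℂ x).map_target hwt)
      rwa [(chartAt ℂ x).right_inv hwt] at this
    · filter_upwards [(tendsto_symm_chart_ne x).eventually hC] with w hw
      exact ⟨Units.ne_zero _, hw⟩
  choose! L hL hLd using hext
  refine ⟨fun y => if y ∈ S.D then L y else ((χ (p y) : ℂˣ) : ℂ), fun y hy => ?_, fun y hy => ?_,
    fun y _ hyD => if_neg hyD⟩
  · refine MDifferentiableAt.mdifferentiableWithinAt (mdifferentiableAt_of_chart ?_)
    have ha := mem_chart_source ℂ y
    by_cases hyD : y ∈ S.D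
    · refine (hLd y hyD hy).congr_of_eventuallyEq ?_
      have h1 := (tendsto_symm_chart_ne y).eventually (eventually_not_mem S.D y)
      rw [eventually_nhdsWithin_iff] at h1
      filter_upwards [h1] with w hw
      by_cases hwy : w = chartAt ℂ y y
      · rw [hwy, Function.update_self, (chartAt ℂ y).left_inv ha, if_pos hyD]
      · rw [Function.update_of_ne hwy, if_neg (hw hwy)]
    · refine (hoff y y hy hyD ha).congr_of_eventuallyEq ?_
      filter_upwards [(tendsto_symm_chart ha).eventually (hO.eventually_mem ⟨hy, hyD⟩)] with w hw
      exact if_neg hw.2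
  · by_cases hyD : y ∈ S.D
    · simp only [if_pos hyD]
      exact hL y hyD hy
    · simp only [if_neg hyD]
      exact Units.ne_zero _

/-- The character of `𝒫_θ` corresponding to a character of `P`. -/
def FlagData.parahoricChar (F : FlagData S.R P χ) (hχ : IsAlgChar χ) : ParahoricChar S P where
  val _ := χ
  algebraic _ _ := hχ
  regular := F.exists_regular hχ

end Extension

/-! ### Comparison of reductions, degrees and stability conditions. -/

section Comparison

set_option linter.unusedSectionVars false

open Filter

variable {X : Type u} [TopologicalSpace X] [ChartedSpace ℂ X] [IsManifold 𝓘(ℂ) ω X] [T2Space X]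
  [CompactSpace X] [Nonempty X] {n : ℕ} {S : Setup X n} {B : MetrizedBundle S} {P : MatGroup n}
  {χ : P →* ℂˣ}

theorem MetrizedBundle.xi_isSection {U : Opens X} {s : ∀ y, B.E.Fib y} (hs : B.E.IsSection U s) :
    B.Xi.IsSection U s :=
  ⟨B.E.mono hs inf_le_left, fun _ hx hxU => absurd hx (B.E.le hs hxU)⟩

/-- Two reductions of `E` and of its extension with the same `P`-orbits. -/
def SameReduction (σ : Reduction B.E S.D P) (σ' : Reduction B.Xi S.D P) : Prop :=
  ∀ (y : X) (e : B.E.Fib y), e ∈ σ.carrier y ↔ e ∈ σ'.carrier y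

/-- The orbits are unchanged. A lift $g$ witnessing adaptedness at a puncture gives the local
section $e_x\cdot g$ of the extension there. -/
theorem MetrizedBundle.exists_reduction_xi (σ : Reduction B.E S.D P) (hσ : B.IsAdaptedReduction σ) :
    ∃ σ' : Reduction B.Xi S.D P, SameReduction σ σ' := by
  refine ⟨⟨σ.carrier, σ.orbit, fun y _ => ?_⟩, fun y e => Iff.rfl⟩
  by_cases hy : y ∈ S.D
  · obtain ⟨U, g, hyU, hg, hgp, hgc⟩ := hσ y hy
    refine ⟨U ⊓ B.nbhd y, fun v => B.E.act (B.frame y v) (g v), ⟨hyU, B.mem_nbhd y hy⟩, ⟨?_, ?_⟩,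
      fun v hv hvD => hgc v hv.1 hvD⟩
    · have h1 : B.E.IsSection (U ⊓ B.nbhd y ⊓ S.punctured) (B.frame y) :=
        B.E.mono (B.frame_isSection y hy) (inf_le_inf_right _ inf_le_right)
      refine (B.E.change h1 _).2 ?_
      show HolOn _ _
      have e : (fun v => B.E.ratio (B.frame y v) (B.E.act (B.frame y v) (g v))) = g :=
        funext fun v => B.E.ratio_act _ _
      rw [e]
      exact fun i j => (hg i j).mono fun v hv => ⟨hv.1.1, hv.2⟩
    · intro x hx hxU
      obtain rfl := B.nbhd_inter y hy x hxU.2 hx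
      exact hgp.congr (Eventually.of_forall fun v => (B.E.ratio_act _ _).symm)
  · obtain ⟨U, s, hyU, hs, hc⟩ := σ.exists_section y hy
    exact ⟨U, s, hyU, MetrizedBundle.xi_isSection hs, hc⟩

/-- Conversely, the ratio of a local section of the extended reduction to the frame $e_x$ is
parahoric by the definition of $\Xi$, and serves as the lift witnessing adaptedness. -/
theorem MetrizedBundle.exists_reduction (σ' : Reduction B.Xi S.D P) :
    ∃ σ : Reduction B.E S.D P, B.IsAdaptedReduction σ ∧ SameReduction σ σ' := by
  refine ⟨⟨σ'.carrier, σ'.orbit, fun y hy => ?_⟩, fun x hx => ?_, fun y e => Iff.rfl⟩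
  · obtain ⟨U, s, hyU, hs, hc⟩ := σ'.exists_section y trivial
    exact ⟨U ⊓ S.punctured, s, ⟨hyU, hy⟩, hs.1, fun v hv hvD => hc v hv.1 hvD⟩
  · obtain ⟨U, s, hxU, hs, hc⟩ := σ'.exists_section x trivial
    refine ⟨U ⊓ B.nbhd x, fun y => B.E.ratio (B.frame x y) (s y), ⟨hxU, B.mem_nbhd x hx⟩, ?_,
      hs.2 x hx hxU, fun y hy hyD => ?_⟩
    · have h := MetrizedBundle.holOn_ratio (B.frame_isSection x hx) hs.1
      exact fun i j => (h i j).mono fun v hv => ⟨⟨hv.1.2, hv.2⟩, hv.1.1, hv.2⟩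
    · have e : B.E.act (B.frame x y) (B.E.ratio (B.frame x y) (s y)) = s y := B.E.act_ratio _ _
      exact (congrArg (fun e => e ∈ σ'.carrier y) e).mpr (hc y hy.1 hyD)

/-- The restriction to `X_D` of a section of the extended reduction. -/
def SameReduction.restrict {σ : Reduction B.E S.D P} {σ' : Reduction B.Xi S.D P}
    (h : SameReduction σ σ') (s : σ'.Sec) : σ.Sec :=
  ⟨(s.1.1 ⊓ S.punctured, s.1.2), s.2.1.1, fun v hv hvD => (h v _).2 (s.2.2 v hv.1 hvD)⟩

/-- The analytic degree is the parahoric degree. -/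
theorem SameReduction.degAn_eq {σ : Reduction B.E S.D P} {σ' : Reduction B.Xi S.D P}
    (h : SameReduction σ σ') (F : FlagData S.R P χ) (hχ : IsAlgChar χ) {κ : ParahoricChar S P}
    (hκ : κ.Corresponds χ) : B.degAn σ χ = parhDeg σ' κ χ := by
  set L := κ.lineBundle σ' with hL
  have hex := L.exists_isSmoothMetric
  set m' := hex.choose with hm'
  have hm'S : L.IsSmoothMetric m' := hex.choose_spec
  have hdeg : L.deg = chernDegree L.U m' := by rw [LineBundle.deg, dif_pos hex]
  have hsec : ∀ y, ∃ i : σ'.Sec, y ∈ i.1.1 := L.cover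
  choose i0 hi0 using hsec
  -- Both metrics change by $|\chi|^2$ of the same transition function off the punctures, so the
  -- quotient does not depend on the section and $u$ is one function for the whole surface; at the
  -- punctures its values are irrelevant.
  set u : X → ℝ := fun y => Real.log (charMetric χ (B.h y ((i0 y).1.2 y))) -
    Real.log (m' (i0 y) y) with hu
  have hue : ∀ (i : σ'.Sec) y, y ∈ i.1.1 → y ∉ S.D →
      u y = Real.log (charMetric χ (B.h y (i.1.2 y))) - Real.log (m' i y) := by
    intro i y hi hyD
    obtain ⟨k, hk⟩ := B.h_reduction y hyD (i.1.2 y)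
    have h1 : m' (i0 y) y = ‖((χ (σ'.transition i (i0 y) y) : ℂˣ) : ℂ)‖ ^ 2 * m' i y := by
      rw [hm'S.2.2 i (i0 y) y hi (hi0 y), ← hκ y hyD]
      congr 3
      exact (κ.regular _ _ (σ'.transition_mem i (i0 y))).choose_spec.2.2 y ⟨hi, hi0 y⟩ hyD
    have e : toMat (B.E.ratio (i.1.2 y) ((i0 y).1.2 y)) = toMat (σ'.transition i (i0 y) y) :=
      congrArg (fun g : GL (Fin n) ℂ => (g : Mat n)) (σ'.transition_coe i (i0 y) hi (hi0 y) hyD).symm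
    have h2 : charMetric χ (B.h y ((i0 y).1.2 y)) =
        ‖((χ (σ'.transition i (i0 y) y) : ℂˣ) : ℂ)‖ ^ 2 * charMetric χ (B.h y (i.1.2 y)) := by
      rw [B.h_ratio hyD (i.1.2 y) ((i0 y).1.2 y), hk]
      rw [e]
      exact F.charMetric_conj k.2 _
    have p1 := norm_sq_units_pos (χ (σ'.transition i (i0 y) y))
    have p2 : 0 < charMetric χ (B.h y (i.1.2 y)) := by rw [hk]; exact F.charMetric_pos k.2
    have p3 : 0 < m' i y := hm'S.2.1 i y hi
    simp only [hu]
    rw [h1, h2, Real.log_mul p1.ne' p2.ne', Real.log_mul p1.ne' p3.ne']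
    ring
  -- The smooth metric stays bounded near the puncture, so the logarithmic term of $u$ comes from
  -- $h$ alone.
  have hα : ∀ x ∈ S.D, (fun y => u y - 2 * pairing (S.θ x) χ * Real.log ‖coord x y‖) =o[𝓝[≠] x]
      fun y => Real.log ‖coord x y‖ := by
    intro x hx
    have hxi := hi0 x
    have h1 := MetrizedBundle.logMetric_isLittleO (B := B) F hx ((i0 x).2.1.2 x hx hxi)
    have h2 : (fun y => Real.log (m' (i0 x) y)) =o[𝓝[≠] x] fun y => Real.log ‖coord x y‖ := by
      have hc : ContinuousAt (fun y => Real.log (m' (i0 x) y)) x :=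
        (((hm'S.1 (i0 x)).contMDiffAt ((L.U (i0 x)).isOpen.mem_nhds hxi)).continuousAt).log
          (hm'S.2.1 _ x hxi).ne'
      refine ((hc.tendsto.mono_left nhdsWithin_le_nhds).isBigO_one ℝ).trans_isLittleO ?_
      exact (Asymptotics.isLittleO_const_left).2
        (Or.inr (tendsto_abs_atBot_atTop.comp (tendsto_log_coord x)))
    refine (h1.sub h2).congr' ?_ EventuallyEq.rfl
    filter_upwards [nhdsWithin_le_nhds ((i0 x).1.1.isOpen.mem_nhds hxi),
      eventually_not_mem S.D x] with y hy hyD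
    have e : B.E.act (B.frame x y) (B.Xi.ratio (B.frame x y) ((i0 x).1.2 y)) = (i0 x).1.2 y :=
      B.E.act_ratio _ _
    have e3 : Real.log (charMetric χ (B.h y ((i0 x).1.2 y))) = F.logMetric (B.h y ((i0 x).1.2 y)) :=
      MetrizedBundle.log_charMetric (B := B) F hyD _
    rw [hue (i0 x) y hy hyD, e3]
    have e2 := congrArg (fun f => F.logMetric (B.h y f)) e
    refine (congrArg (fun t => t - 2 * pairing (S.θ x) χ * Real.log ‖coord x y‖ -
      Real.log (m' (i0 x) y)) e2).trans ?_
    ring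
  -- The weight enters twice in $\alpha=2\langle\theta,\chi\rangle$, as metrics are squared norms;
  -- the factor $\frac12$ of the comparison formula compensates. The integrable upper bound is the
  -- Chern–Weil bound times $|F_h|_h$.
  have hmain := chernDegree_eq_add (MetrizedBundle.isMetricOff F hχ σ) hm'S.isMetricOff L.cover
    (r := h.restrict) (fun i y hi hyD => ⟨hi, hyD⟩) (u := u)
    (α := fun x => 2 * pairing (S.θ x) χ) hue hα
    (G := fun a y => F.bound * curvNorm B.E B.h a y)
    (fun a b y hyD ha hb => by
      simp only [B.isDensityOff_curvNorm a b y hyD ha hb]; ring)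
    (DensityIntegrable.const_mul B.curvature_L1 F.bound)
    (fun i a y hi hyD ha => (MetrizedBundle.smoothIn_log_charMetric F i.2.1 hi hyD ha).2)
  rw [MetrizedBundle.degAn, parhDeg, hdeg]
  refine hmain.trans ?_
  rw [← Finset.mul_sum]
  ring

theorem exists_notMem_finset (D : Finset X) : ∃ y, y ∉ D := by
  have := neBot_compl_finset D (Classical.arbitrary X)
  obtain ⟨y, hy⟩ := (self_mem_nhdsWithin :
    ((D : Set X)ᶜ) ∈ 𝓝[((D : Set X)ᶜ)] (Classical.arbitrary X)) |> Filter.nonempty_of_mem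
  exact ⟨y, hy⟩

/-- The analytic and the algebraic stability conditions agree. -/
theorem stability_iff {c : ∀ P : MatGroup n, Reduction B.E S.D P → Prop}
    {c' : ∀ P : MatGroup n, Reduction B.Xi S.D P → Prop} {rel : ℝ → Prop}
    (hc : ∀ P σ σ', SameReduction σ σ' → (c P σ ↔ c' P σ')) :
    AnStability B c rel ↔ AlgStability B.Xi c' rel := by
  constructor
  · intro hAn P hP hPG σ' hσ' κ χ hκ hne hanti hcen
    obtain ⟨σ, hσ, hs⟩ := MetrizedBundle.exists_reduction σ'
    obtain ⟨y, hyD, hy⟩ := hne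
    -- A character of $\mathcal P_\theta$ equals $\chi$ at every point off the punctures, so any
    -- such point transfers algebraicity, nontriviality and triviality on the centre.
    have hχ : IsAlgChar χ := hκ y hyD ▸ κ.algebraic y hyD
    obtain ⟨F⟩ := exists_flagData hP hχ hanti
    rw [← hs.degAn_eq F hχ hκ]
    refine hAn P hP hPG σ hσ ((hc P σ σ' hs).2 hσ') χ hχ ?_ hanti fun z hz => ?_
    · rwa [← hκ y hyD]
    · rw [← hκ y hyD]; exact hcen y hyD z hz
  · intro hAlg P hP hPG σ hσ hcσ χ hχ hne hanti hcen
    -- The flag data serve both the comparison of degrees and the construction of the character of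
    -- $\mathcal P_\theta$ that tests algebraic stability.
    obtain ⟨F⟩ := exists_flagData hP hχ hanti
    obtain ⟨σ', hs⟩ := MetrizedBundle.exists_reduction_xi σ hσ
    obtain ⟨y, hy⟩ := exists_notMem_finset S.D
    have hκ : (F.parahoricChar hχ).Corresponds χ := fun _ _ => rfl
    rw [hs.degAn_eq F hχ hκ]
    exact hAlg P hP hPG σ' ((hc P σ σ' hs).1 hcσ) _ χ hκ ⟨y, hy, hne⟩ hanti fun _ _ z hz => hcen z hz

theorem MetrizedHiggs.compatible_iff (F : MetrizedHiggs S) (P : MatGroup n)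
    (σ : Reduction F.B.E S.D P) (σ' : Reduction F.B.Xi S.D P) (h : SameReduction σ σ') :
    F.φ.Compatible σ ↔ F.Xi.φ.Compatible σ' :=
  ⟨fun hφ y hy e he => hφ y hy e ((h y e).2 he), fun hφ y hy e he => hφ y hy e ((h y e).1 he)⟩

theorem MetrizedConnection.compatible_iff (F : MetrizedConnection S) (P : MatGroup n)
    (σ : Reduction F.B.E S.D P) (σ' : Reduction F.B.Xi S.D P) (h : SameReduction σ σ') :
    F.A.Compatible σ ↔ F.Xi.A.Compatible σ' := by
  constructor
  · intro hA s y hy hyD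
    exact hA (h.restrict s) y ⟨hy, hyD⟩ hyD
  · intro hA s y hy hyD
    -- A section of the reduction of $E$ lives over a subset of $X_D$, so as a section of the
    -- extension it has no condition to satisfy at punctures.
    exact hA ⟨s.1, MetrizedBundle.xi_isSection s.2.1, fun v hv hvD => (h v _).1 (s.2.2 v hv hvD)⟩
      y hy hyD

end Comparison

end Merohoric

end

theorem mainTheorem9 {X : Type u} [TopologicalSpace X] [T2Space X] [CompactSpace X]
    [ConnectedSpace X] [ChartedSpace ℂ X] [IsManifold 𝓘(ℂ) ω X] {n : ℕ}
    (S : Merohoric.Setup X n) :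
    (∀ F : Merohoric.MetrizedHiggs S,
      (F.RhStable ↔ F.Xi.RStable) ∧ (F.RhSemistable ↔ F.Xi.RSemistable)) ∧
    (∀ F : Merohoric.MetrizedConnection S,
      (F.RhStable ↔ F.Xi.RStable) ∧ (F.RhSemistable ↔ F.Xi.RSemistable)) := by
  have : Nonempty X := inferInstance
  exact ⟨fun F => ⟨Merohoric.stability_iff F.compatible_iff, Merohoric.stability_iff F.compatible_iff⟩,
    fun F => ⟨Merohoric.stability_iff F.compatible_iff, Merohoric.stability_iff F.compatible_iff⟩⟩
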